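/- Let $Y_2$ be the surface over $\mathbb C$ defined by $X+\frac1X+Y+\frac1Y+Z+\frac1Z-2=0$, with the elliptic fibration $(X,Y,Z)\mapsto Z=s$, and let $E$ be the curve $$V^2+\Bigl(s+\frac1s-2\Bigr)UV=U(U-1)^2$$ over $\mathbb C(s)$. 1. $Y_2$ is irreducible, and $U=-XY$, $V=-Y(XY+1)$, $s=Z$ define an isomorphism between the function field of $E$ and that of $Y_2$, which is the identity on $\mathbb C$; thus $E$ is a Weierstrass model of the generic fibre of the fibration $Z=s$. 2. The point $A=(U,V)=(s,s-1)$ of $E(\mathbb C(s))$ has order exactly $8$. 3. The singular fibres of the corresponding minimal elliptic surface over $\mathbb P^1$ (Kodaira types, as read off minimal Weierstrass equations by Tate's algorithm) are: $I_8$ at $s=0$ and at $s=\infty$, $I_4$ at $s=1$, $I_2$ at $s=-1$, $I_1$ at $s=3+2\sqrt2$ and at $s=3-2\sqrt2$. All other fibres are smooth. 4. This elliptic surface is the elliptic modular surface attached to $\Gamma_1(8)$. That is: let $\Gamma_1(8)\ltimes\mathbb Z^2$ act on $\mathbb H\times\mathbb C$ by $(\tau,z)\mapsto\bigl(\frac{a\tau+b}{c\tau+d},\frac{z+m\tau+n}{c\tau+d}\bigr)$;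 then the part of the surface over the set of all $s\in\mathbb P^1(\mathbb C)$ with smooth fibre is isomorphic, as a complex surface fibred in curves with a zero section, to the quotient of $\mathbb H\times\mathbb C$ by this action, fibred over $\Gamma_1(8)\backslash\mathbb H$ and with zero section $z=0$. 5. The Mordell–Weil group $E(\mathbb C(s))$ is isomorphic to $\mathbb Z/8\mathbb Z$. -/

import Mathlib

open scoped WithZero MatrixGroups UpperHalfPlane Topology

noncomputable section

namespace ModularFibration

/-! ### The surface `Y₂`, its fibration `Z = s`, and the Weierstrass curve over `ℂ(s)` -/

/-- The equation `X + 1/X + Y + 1/Y + Z + 1/Z - 2 = 0`, multiplied by `XYZ`.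
The variables `X, Y, Z` are numbered `0, 1, 2`. -/
def yTwoEquation : MvPolynomial (Fin 3) ℂ :=
  let X : MvPolynomial (Fin 3) ℂ := MvPolynomial.X 0
  let Y : MvPolynomial (Fin 3) ℂ := MvPolynomial.X 1
  let Z : MvPolynomial (Fin 3) ℂ := MvPolynomial.X 2
  X ^ 2 * Y * Z + Y * Z + X * Y ^ 2 * Z + X * Z + X * Y * Z ^ 2 + X * Y - 2 * X * Y * Z

/-- The affine coordinate ring `ℂ[X, Y, Z] / (equation)` of `Y₂`. -/
abbrev YTwoRing : Type := MvPolynomial (Fin 3) ℂ ⧸ Ideal.span {yTwoEquation}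

/-- The field of rational functions of `Y₂`. -/
abbrev YTwoFunctionField : Type := FractionRing YTwoRing

/-- The rational functions `X, Y, Z` (numbered `0, 1, 2`) on `Y₂`. -/
def yTwoCoord (i : Fin 3) : YTwoFunctionField :=
  algebraMap YTwoRing YTwoFunctionField (Ideal.Quotient.mk _ (MvPolynomial.X i))

/-- A complex number, as a constant function on `Y₂`. -/
def yTwoConst (c : ℂ) : YTwoFunctionField :=
  algebraMap YTwoRing YTwoFunctionField (Ideal.Quotient.mk _ (MvPolynomial.C c))

/-- The parameter `s` of `ℂ(s)`. -/
abbrev s : RatFunc ℂ := RatFunc.X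

/-- The Weierstrass curve `V² + (s + 1/s - 2) U V = U (U - 1)²` over `ℂ(s)`, that is,
`V² + a₁ U V = U³ + a₂ U² + a₄ U` with `a₁ = s + 1/s - 2`, `a₂ = -2`, `a₄ = 1`. -/
def E : WeierstrassCurve (RatFunc ℂ) where
  a₁ := s + 1 / s - 2
  a₂ := -2
  a₃ := 0
  a₄ := 1
  a₆ := 0

/-- A rational function of `s`, as a function on the curve `E`. -/
def curveConst (f : RatFunc ℂ) : E.toAffine.FunctionField :=
  algebraMap E.toAffine.CoordinateRing E.toAffine.FunctionField
    (WeierstrassCurve.Affine.CoordinateRing.mk E.toAffine (Polynomial.C (Polynomial.C f)))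

/-- The coordinate function `U` on the curve `E`. -/
def curveU : E.toAffine.FunctionField :=
  algebraMap E.toAffine.CoordinateRing E.toAffine.FunctionField
    (WeierstrassCurve.Affine.CoordinateRing.mk E.toAffine (Polynomial.C Polynomial.X))

/-- The coordinate function `V` on the curve `E`. -/
def curveV : E.toAffine.FunctionField :=
  algebraMap E.toAffine.CoordinateRing E.toAffine.FunctionField
    (WeierstrassCurve.Affine.CoordinateRing.mk E.toAffine Polynomial.X)

/-! ### Singular fibres of the elliptic surface over `ℙ¹` with a given generic fibre -/

/-- The normalised discrete valuation of `ℂ(s)` attached to a point of `ℙ¹(ℂ) = ℂ ∪ {∞}`: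
the order of vanishing at that point, written multiplicatively. -/
def placeValuation : OnePoint ℂ → Valuation (RatFunc ℂ) ℤᵐ⁰
  | some a => IsDedekindDomain.HeightOneSpectrum.valuation (R := Polynomial ℂ) (RatFunc ℂ)
      { asIdeal := Ideal.span {Polynomial.X - Polynomial.C a}
        isPrime := (Ideal.span_singleton_prime (Polynomial.X_sub_C_ne_zero a)).mpr
          (Polynomial.prime_X_sub_C a)
        ne_bot := by
          simpa [Ideal.span_singleton_eq_bot] using Polynomial.X_sub_C_ne_zero a }
  | none => by
      classical exact RatFunc.inftyValuation ℂ

/-- The local ring of `ℙ¹` at a point, as a subring of `ℂ(s)`. -/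
abbrev placeRing (p : OnePoint ℂ) : ValuationSubring (RatFunc ℂ) :=
  (placeValuation p).valuationSubring

theorem placeValuation_isNontrivial (p : OnePoint ℂ) : (placeValuation p).IsNontrivial := by
  cases p with
  | infty => classical exact inferInstanceAs (RatFunc.inftyValuation ℂ).IsNontrivial
  | coe a =>
    refine ⟨?_⟩
    obtain ⟨x, hx⟩ := IsDedekindDomain.HeightOneSpectrum.valuation_exists_uniformizer
      (R := Polynomial ℂ) (RatFunc ℂ)
      { asIdeal := Ideal.span {Polynomial.X - Polynomial.C a}
        isPrime := (Ideal.span_singleton_prime (Polynomial.X_sub_C_ne_zero a)).mpr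
          (Polynomial.prime_X_sub_C a)
        ne_bot := by
          simpa [Ideal.span_singleton_eq_bot] using Polynomial.X_sub_C_ne_zero a }
    refine ⟨x, ?_, ?_⟩
    · show IsDedekindDomain.HeightOneSpectrum.valuation _ _ x ≠ 0
      rw [hx]; simp
    · show IsDedekindDomain.HeightOneSpectrum.valuation _ _ x ≠ 1
      rw [hx, ← WithZero.exp_zero, ne_eq, WithZero.exp_inj]; simp

instance placeRing_isDiscreteValuationRing (p : OnePoint ℂ) :
    IsDiscreteValuationRing (placeRing p) := by
  have := placeValuation_isNontrivial p
  exact (placeValuation p).valuationSubring_isDiscreteValuationRing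

/-- The Kodaira-Néron model over `ℙ¹` of the curve `W` over `ℂ(s)` has a fibre of Kodaira type
`I_n` at `p`, as read off a minimal Weierstrass equation at `p` by Tate's algorithm:
good reduction (a smooth fibre) for `n = 0`, and for `n ≥ 1` multiplicative reduction with
discriminant vanishing to order exactly `n`. -/
def HasFibreTypeI (W : WeierstrassCurve (RatFunc ℂ)) (p : OnePoint ℂ) : ℕ → Prop
  | 0 => ∃ C : WeierstrassCurve.VariableChange (RatFunc ℂ),
      (C • W).HasGoodReduction (placeRing p)
  | n + 1 => ∃ C : WeierstrassCurve.VariableChange (RatFunc ℂ),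
      (C • W).HasMultiplicativeReduction (placeRing p) ∧
        placeValuation p (C • W).Δ = WithZero.exp (-((n : ℤ) + 1))

/-! ### Elliptic modular surfaces -/

/-- The fibre at `s = a` of a Weierstrass curve over `ℂ(s)` whose coefficients are regular
at `a`. -/
def fibre (W : WeierstrassCurve (RatFunc ℂ)) (a : ℂ) : WeierstrassCurve ℂ where
  a₁ := W.a₁.eval (RingHom.id ℂ) a
  a₂ := W.a₂.eval (RingHom.id ℂ) a
  a₃ := W.a₃.eval (RingHom.id ℂ) a
  a₄ := W.a₄.eval (RingHom.id ℂ) a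
  a₆ := W.a₆.eval (RingHom.id ℂ) a

/-- The set of `a ∈ ℂ` at which the coefficients of `W` are regular and the fibre is an
elliptic curve. -/
def smoothLocus (W : WeierstrassCurve (RatFunc ℂ)) : Set ℂ :=
  {a | (∀ f ∈ ({W.a₁, W.a₂, W.a₃, W.a₄, W.a₆} : Set (RatFunc ℂ)), f.denom.eval a ≠ 0) ∧
    (fibre W a).Δ ≠ 0}

/-- The elliptic fibration formed by the plane cubics `fibre W a`, for `a ∈ smoothLocus W`:
a smooth complex surface in `ℂ × ℙ²(ℂ)`, fibred by the first projection. -/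
def smoothPart (W : WeierstrassCurve (RatFunc ℂ)) :
    Set (ℂ × Projectivization ℂ (Fin 3 → ℂ)) :=
  {q | q.1 ∈ smoothLocus W ∧ (fibre W q.1).toProjective.Equation q.2.rep}

/-- The base point `[0 : 1 : 0]`, the point of the zero section in every fibre. -/
def zeroPoint : Projectivization ℂ (Fin 3 → ℂ) :=
  Projectivization.mk ℂ ![0, 1, 0] (fun h => one_ne_zero (congrFun h 1))

/-- A map `ℍ × ℂ → ℂ × ℙ²(ℂ)` is holomorphic: locally it is `q ↦ (g q, [v₀ q : v₁ q : v₂ q])`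
with holomorphic `g` and `v` without common zero of the `vᵢ`. -/
def IsHolomorphic (Φ : ℍ × ℂ → ℂ × Projectivization ℂ (Fin 3 → ℂ)) : Prop :=
  ∀ p : ℍ × ℂ, ∃ (g : ℂ × ℂ → ℂ) (v : ℂ × ℂ → Fin 3 → ℂ), ∀ᶠ q in 𝓝 p,
    DifferentiableAt ℂ g ((q.1 : ℂ), q.2) ∧ DifferentiableAt ℂ v ((q.1 : ℂ), q.2) ∧
      ∃ h : v ((q.1 : ℂ), q.2) ≠ 0, Φ q = (g ((q.1 : ℂ), q.2), Projectivization.mk ℂ _ h)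

/-- The elliptic surface over `ℙ¹` with generic fibre `W` is the elliptic modular surface
attached to the subgroup `Γ` of `SL(2, ℤ)` (torsion free, so in particular without `-1`).

The group `Γ ⋉ ℤ²` acts on `ℍ × ℂ` by
`(τ, z) ↦ ((a τ + b) / (c τ + d), (z + m τ + n) / (c τ + d))`.
The elliptic modular surface is the Kodaira-Néron completion, over the compact modular curve of
`Γ`, of the quotient of `ℍ × ℂ` by this group, fibred over `Γ \ ℍ` in elliptic curves
`ℂ / (ℤ τ + ℤ)`, with `z = 0` as zero section. The definition asks for an isomorphism, respecting
fibrations and zero sections, of this quotient with the part of the elliptic surface of `W` over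
the set of all points of `ℙ¹` where it has good reduction. The isomorphism is given as a map `Φ`
on `ℍ × ℂ`; a bijective holomorphic map between complex manifolds of the same
dimension is biholomorphic. -/
def IsEllipticModularSurface (Γ : Subgroup SL(2, ℤ)) (W : WeierstrassCurve (RatFunc ℂ)) : Prop :=
  (∀ p : OnePoint ℂ, HasFibreTypeI W p 0 ↔ ∃ a ∈ smoothLocus W, p = (a : OnePoint ℂ)) ∧
  ∃ (t : ℍ → ℂ) (Φ : ℍ × ℂ → ℂ × Projectivization ℂ (Fin 3 → ℂ)),
    IsHolomorphic Φ ∧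
    Set.range Φ = smoothPart W ∧
    (∀ τ z, (Φ (τ, z)).1 = t τ) ∧
    (∀ τ, (Φ (τ, 0)).2 = zeroPoint) ∧
    ∀ (τ τ' : ℍ) (z z' : ℂ), Φ (τ', z') = Φ (τ, z) ↔
      ∃ γ ∈ Γ, ∃ m n : ℤ, τ' = γ • τ ∧
        z' = (z + m * (τ : ℂ) + n) / ((γ 1 0 : ℤ) * (τ : ℂ) + (γ 1 1 : ℤ))

end ModularFibration

end

/-!
The fibre of `E` over `s` is the cubic `V² + a₁ U V = U (U - 1)²` with `a₁ = s + 1/s - 2`. It has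
discriminant `a₁² (a₁² - 16)`, and the point `(s, s - 1)` of order eight on it.

The elliptic modular surface is obtained from the odd theta function `theta z τ`, whose zeros are
the points of the lattice `ℤτ + ℤ` (`theta_eq_zero_iff`). Products of two of its values satisfy a
Plücker relation (`theta_plucker`), from which it follows that the theta quotients `cubicVec z τ`
are homogeneous coordinates on the cubic with `a₁ = κ(τ)²`, and that they identify the cubic with
`ℂ / (ℤτ + ℤ)` (`mk_cubicVec_eq_iff`, `exists_uniformisation_eq`). The function `s = hauptmodul τ` is
the coordinate `U` of the point with parameter `1/8`, and `κ² = s + 1/s - 2` (`kappa_sq`). The modular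
law of theta (`theta_smul`) makes the resulting map from `ℍ × ℂ` invariant under `Γ₁(8) ⋉ ℤ²`
(`uniformisation_smul`). Conversely, if two values of `hauptmodul` agree, then the identity of the
fibre lifts locally to the parameters; the derivative of the lifts is an entire doubly periodic
function, hence constant, so the lattices are homothetic (`exists_homothety`). As the homothety
respects the point `(s, s - 1)` with parameter `1/8`, it comes from `Γ₁(8)`
(`exists_gamma1_smul_of_hauptmodul_eq`). Finally the image of `hauptmodul` is open, and it is closed
in the smooth locus because the discriminant tends to `0` or to `∞` at every cusp
(`fibreDisc_smul_bounds`); the smooth locus being connected, the image is all of it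
(`range_hauptmodul`).

For the Mordell-Weil group, a point of `E` over `ℂ(s)` pulls back along `hauptmodul` to a section over
`ℍ`, which lifts to a holomorphic function `f` with the section given by the parameter `f τ`
(`exists_global_lift`). Lifts are unique up to periods `mτ + n`, so that `f` transforms under `Γ₁(8)`
up to periods. The function `Im τ * |f' - Im f / Im τ|²` (`flatNorm`) measures how far `f` is from being
a real combination of `τ` and `1`. It is invariant under `Γ₁(8)`, has no positive local maximum
(`flatNorm_eq_zero_of_isLocalMax`), and tends to zero at the cusps: there `theta (f τ) τ` is not too
small, since the section has polynomial coordinates (`IsLiftOf.exists_exp_le_thetaNorm`), and the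
Borel-Carathéodory inequality converts this into bounds on the derivatives of `f`
(`exists_flatNorm_le`). Hence the flat norm vanishes and `f = aτ + b` with `a`, `b` real. Comparing
`f` with its translates under two parabolic elements of `Γ₁(8)` shows that `a` and `8b` are integers
(`IsLiftOf.exists_eq`), so there are at most eight sections (`exists_injective_zmod`). As `(s, s - 1)`
doubles to `(1, 0)`, which doubles to the point `(0, 0)` of order two, there are exactly eight.

The singular fibres are read off `Δ = a₁² (a₁² - 16)` and `c₄ = Δ + 16`: at the finite zeros of `Δ` the
given equation is minimal, as `c₄` is a unit, and at `0` and `∞` a scaling by the uniformiser makes it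
so. At each of these points the order of `Δ` is not a multiple of twelve, which rules out good
reduction for any other equation (`hasFibreTypeI_E_zero_iff`).

As for the function field, the equation of `Y₂` is a primitive quadratic polynomial in `X` whose
discriminant is not a square, hence irreducible. The functions `-XY` and `Z` on `Y₂` are algebraically
independent (`eq_zero_of_eval₂_eq_zero`), and the coordinate ring of `E` is integral over
`ℂ(s)[U]`; so `U = -XY`, `V = -Y (XY + 1)`, `s = Z` define an embedding of function fields, which is
onto since `Y = V / (U - 1)` and `X = -U / Y`.
-/

namespace ModularFibration

open Complex Filter

/-! ### The odd theta function -/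

/-- The general term `(-1)ⁿ exp(πi (n + 1/2)² τ + 2πi (n + 1/2) z)` of the odd theta series. -/
noncomputable def thetaTerm (n : ℤ) (z τ : ℂ) : ℂ :=
  cexp (Real.pi * I * (n + (n + 1 / 2) ^ 2 * τ + 2 * (n + 1 / 2) * z))

/-- The odd theta function `∑ₙ (-1)ⁿ exp(πi (n + 1/2)² τ + 2πi (n + 1/2) z)`, which vanishes
exactly on the lattice `ℤτ + ℤ`; it is written here as a translate of `jacobiTheta₂`. -/
noncomputable def theta (z τ : ℂ) : ℂ :=
  cexp (Real.pi * I * (τ / 4 + z)) * jacobiTheta₂ (z + 1 / 2 + τ / 2) τ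

theorem thetaTerm_eq (n : ℤ) (z τ : ℂ) : thetaTerm n z τ =
    cexp (Real.pi * I * (τ / 4 + z)) * jacobiTheta₂_term n (z + 1 / 2 + τ / 2) τ := by
  rw [thetaTerm, jacobiTheta₂_term, ← Complex.exp_add]
  congr 1
  ring

theorem hasSum_thetaTerm (z : ℂ) {τ : ℂ} (hτ : 0 < τ.im) :
    HasSum (fun n => thetaTerm n z τ) (theta z τ) := by
  simp_rw [thetaTerm_eq]
  exact (hasSum_jacobiTheta₂_term _ hτ).mul_left _

theorem summable_norm_thetaTerm (z : ℂ) {τ : ℂ} (hτ : 0 < τ.im) :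
    Summable (fun n => ‖thetaTerm n z τ‖) := by
  simp_rw [thetaTerm_eq, norm_mul]
  exact (((summable_jacobiTheta₂_term_iff _ _).mpr hτ).norm).mul_left _

theorem exp_pi_mul_I_int (n : ℤ) : cexp (Real.pi * I * n) = (-1) ^ n := by
  rw [mul_comm, Complex.exp_int_mul, Complex.exp_pi_mul_I]

theorem theta_add_one (z τ : ℂ) : theta (z + 1) τ = -theta z τ := by
  rw [theta, theta, show z + 1 + 1 / 2 + τ / 2 = (z + 1 / 2 + τ / 2) + 1 by ring,
    jacobiTheta₂_add_left, show (Real.pi * I * (τ / 4 + (z + 1)) : ℂ) =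
      Real.pi * I * (τ / 4 + z) + Real.pi * I by ring, Complex.exp_add, Complex.exp_pi_mul_I]
  ring

theorem theta_add_tau (z τ : ℂ) :
    theta (z + τ) τ = -cexp (-(2 * Real.pi * I * z) - Real.pi * I * τ) * theta z τ := by
  rw [theta, theta, show z + τ + 1 / 2 + τ / 2 = (z + 1 / 2 + τ / 2) + τ by ring,
    jacobiTheta₂_add_left', ← mul_assoc, ← mul_assoc, ← Complex.exp_add,
    ← neg_one_mul (cexp _), ← Complex.exp_pi_mul_I, ← Complex.exp_add, ← Complex.exp_add]
  congr 1
  apply Complex.exp_eq_exp_iff_exists_int.mpr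
  exact ⟨-1, by push_cast; ring⟩

theorem theta_neg (z τ : ℂ) : theta (-z) τ = -theta z τ := by
  rw [theta, theta, ← jacobiTheta₂_neg_left, show -(-z + 1 / 2 + τ / 2) = z - 1 / 2 - τ / 2 by ring,
    show z + 1 / 2 + τ / 2 = (z - 1 / 2 - τ / 2 + τ) + 1 by ring, jacobiTheta₂_add_left,
    jacobiTheta₂_add_left', ← mul_assoc, ← Complex.exp_add, ← neg_mul,
    ← neg_one_mul (cexp _), ← Complex.exp_pi_mul_I, ← Complex.exp_add]
  congr 1
  apply Complex.exp_eq_exp_iff_exists_int.mpr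
  exact ⟨-1, by push_cast; ring⟩

@[simp] theorem theta_zero (τ : ℂ) : theta 0 τ = 0 := by
  have := theta_neg 0 τ
  rw [neg_zero] at this
  exact self_eq_neg.mp this

theorem theta_add_int (z τ : ℂ) (n : ℤ) : theta (z + n) τ = (-1) ^ n * theta z τ := by
  induction n using Int.induction_on with
  | zero => simp
  | succ k ih =>
    push_cast at ih ⊢
    rw [← add_assoc, theta_add_one, ih, zpow_add_one₀ (by norm_num)]
    ring
  | pred k ih =>
    push_cast at ih ⊢
    have := theta_add_one (z + (-(k : ℂ) - 1)) τ
    rw [show z + (-(k : ℂ) - 1) + 1 = z + -k by ring, ih] at this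
    rw [zpow_sub_one₀ (by norm_num), eq_comm, ← neg_eq_iff_eq_neg.mpr this]
    norm_num

theorem theta_add_int_mul_tau (z τ : ℂ) (m : ℤ) : theta (z + m * τ) τ =
    (-1) ^ m * cexp (-(2 * Real.pi * I * m * z) - Real.pi * I * m ^ 2 * τ) * theta z τ := by
  induction m using Int.induction_on with
  | zero => simp
  | succ k ih =>
    push_cast at ih ⊢
    rw [show z + (k + 1) * τ = (z + k * τ) + τ by ring, theta_add_tau, ih,
      zpow_add_one₀ (by norm_num), show -(2 * Real.pi * I * (k + 1) * z) -
        Real.pi * I * (k + 1) ^ 2 * τ = (-(2 * Real.pi * I * (z + k * τ)) - Real.pi * I * τ) +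
        (-(2 * Real.pi * I * k * z) - Real.pi * I * k ^ 2 * τ) by ring, Complex.exp_add]
    ring
  | pred k ih =>
    push_cast at ih ⊢
    have := theta_add_tau (z + (-(k : ℂ) - 1) * τ) τ
    rw [show z + (-(k : ℂ) - 1) * τ + τ = z + -k * τ by ring, ih] at this
    have hne := Complex.exp_ne_zero
      (-(2 * Real.pi * I * (z + (-(k : ℂ) - 1) * τ)) - Real.pi * I * τ)
    apply mul_left_cancel₀ (neg_ne_zero.mpr hne)
    rw [← this, zpow_sub_one₀ (by norm_num), show -(2 * Real.pi * I * -k * z) -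
        Real.pi * I * (-k) ^ 2 * τ = (-(2 * Real.pi * I * (z + (-(k : ℂ) - 1) * τ)) -
        Real.pi * I * τ) + (-(2 * Real.pi * I * (-k - 1) * z) - Real.pi * I * (-k - 1) ^ 2 * τ)
        by ring, Complex.exp_add]
    norm_num
    ring

/-- Quasi-periodicity of the theta function under the whole lattice `ℤτ + ℤ`. -/
theorem theta_add_lattice (z τ : ℂ) (m n : ℤ) : theta (z + (m * τ + n)) τ =
    (-1) ^ (m + n) * cexp (-(2 * Real.pi * I * m * z) - Real.pi * I * m ^ 2 * τ) *
      theta z τ := by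
  rw [← add_assoc, theta_add_int, theta_add_int_mul_tau, zpow_add₀ (by norm_num)]
  ring

theorem contDiffAt_jacobiTheta₂ (z : ℂ) {τ : ℂ} (hτ : 0 < τ.im) :
    ContDiffAt ℂ 1 (fun p : ℂ × ℂ => jacobiTheta₂ p.1 p.2) (z, τ) := by
  obtain ⟨T, hT, hτ'⟩ := exists_between hτ
  obtain ⟨S, hz⟩ := exists_gt |im z|
  let V : Set (ℂ × ℂ) := {u | |im u| < S} ×ˢ {v | T < im v}
  have hVo : IsOpen V := by
    refine ((_root_.continuous_abs.comp continuous_im).isOpen_preimage _ isOpen_Iio).prod ?_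
    exact continuous_im.isOpen_preimage _ isOpen_Ioi
  have hVmem : (z, τ) ∈ V := ⟨hz, hτ'⟩
  rw [contDiffAt_one_iff]
  refine ⟨fun p => jacobiTheta₂_fderiv p.1 p.2, V, hVo.mem_nhds hVmem, ?_, fun p hp =>
    hasFDerivAt_jacobiTheta₂ p.1 (hT.trans hp.2)⟩
  let u : ℤ → ℝ := fun n ↦ 3 * Real.pi * |n| ^ 2 * Real.exp (-Real.pi * (T * n ^ 2 - 2 * S * |n|))
  have hu : Summable u := by
    simp_rw [u, mul_assoc (3 * Real.pi)]
    exact (summable_pow_mul_jacobiTheta₂_term_bound S hT 2).mul_left _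
  refine continuousOn_tsum (fun n ↦ ?_) hu (fun n p hp ↦ ?_)
  · apply Continuous.continuousOn
    unfold jacobiTheta₂_term_fderiv
    fun_prop
  · refine (norm_jacobiTheta₂_term_fderiv_le n p.1 p.2).trans ?_
    refine mul_le_mul_of_nonneg_left ?_ (by positivity)
    exact norm_jacobiTheta₂_term_le hT (le_of_lt hp.1) (le_of_lt hp.2) n

/-- The theta function is continuously differentiable in both variables together. -/
theorem contDiffAt_theta (z : ℂ) {τ : ℂ} (hτ : 0 < τ.im) :
    ContDiffAt ℂ 1 (fun p : ℂ × ℂ => theta p.1 p.2) (z, τ) := by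
  have h := contDiffAt_jacobiTheta₂ (z + 1 / 2 + τ / 2) hτ
  have h2 : ContDiffAt ℂ 1 (fun p : ℂ × ℂ => (p.1 + 1 / 2 + p.2 / 2, p.2)) (z, τ) := by
    fun_prop
  have h3 := ContDiffAt.comp (g := fun p : ℂ × ℂ => jacobiTheta₂ p.1 p.2) (z, τ) h h2
  have h4 : ContDiffAt ℂ 1 (fun p : ℂ × ℂ => cexp (Real.pi * I * (p.2 / 4 + p.1))) (z, τ) := by
    fun_prop
  exact h4.mul h3

theorem differentiableAt_theta (z : ℂ) {τ : ℂ} (hτ : 0 < τ.im) :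
    DifferentiableAt ℂ (fun p : ℂ × ℂ => theta p.1 p.2) (z, τ) :=
  (contDiffAt_theta z hτ).differentiableAt one_ne_zero

theorem differentiable_theta {τ : ℂ} (hτ : 0 < τ.im) : Differentiable ℂ (theta · τ) := fun z =>
  (differentiableAt_theta z hτ).comp (f := fun w : ℂ => (w, τ)) z (by fun_prop)

/-! ### The addition formula for theta products -/

/-- The terms of even index in the expansion of a product of two theta functions. -/
noncomputable def evenTerm (k : ℤ) (x τ : ℂ) : ℂ :=
  cexp (Real.pi * I * (2 * k ^ 2 * τ + 4 * k * x))

/-- The terms of odd index in the expansion of a product of two theta functions. -/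
noncomputable def oddTerm (k : ℤ) (x τ : ℂ) : ℂ :=
  cexp (Real.pi * I * (2 * (k + 1 / 2) ^ 2 * τ + 2 * (2 * k + 1) * x))

theorem evenTerm_eq (k : ℤ) (x τ : ℂ) :
    evenTerm k x τ = jacobiTheta₂_term k (2 * x) (2 * τ) := by
  rw [evenTerm, jacobiTheta₂_term]
  congr 1
  ring

theorem oddTerm_eq (k : ℤ) (x τ : ℂ) : oddTerm k x τ =
    cexp (Real.pi * I * (τ / 2 + 2 * x)) * jacobiTheta₂_term k (2 * x + τ) (2 * τ) := by
  rw [oddTerm, jacobiTheta₂_term, ← Complex.exp_add]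
  congr 1
  ring

theorem two_mul_im_pos {τ : ℂ} (hτ : 0 < τ.im) : 0 < (2 * τ).im := by
  simpa using hτ

theorem summable_norm_evenTerm (x : ℂ) {τ : ℂ} (hτ : 0 < τ.im) :
    Summable (fun k => ‖evenTerm k x τ‖) := by
  simp_rw [evenTerm_eq]
  exact ((summable_jacobiTheta₂_term_iff _ _).mpr (two_mul_im_pos hτ)).norm

theorem summable_norm_oddTerm (x : ℂ) {τ : ℂ} (hτ : 0 < τ.im) :
    Summable (fun k => ‖oddTerm k x τ‖) := by
  simp_rw [oddTerm_eq, norm_mul]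
  exact (((summable_jacobiTheta₂_term_iff _ _).mpr (two_mul_im_pos hτ)).norm).mul_left _

/-- Pairs of integers, according to the parity of their sum. -/
noncomputable def parityEquiv : (ℤ × ℤ) ⊕ (ℤ × ℤ) ≃ ℤ × ℤ :=
  Equiv.ofBijective
    (Sum.elim (fun q => (q.1 + q.2, q.1 - q.2)) (fun q => (q.1 + q.2, q.1 - q.2 - 1))) (by
    constructor
    · rintro (⟨a, b⟩ | ⟨a, b⟩) (⟨c, d⟩ | ⟨c, d⟩) h <;>
        simp only [Sum.elim_inl, Sum.elim_inr, Prod.mk.injEq, Sum.inl.injEq, Sum.inr.injEq,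
          reduceCtorEq] at h ⊢ <;> omega
    · rintro ⟨n, m⟩
      rcases Int.even_or_odd' (n + m) with ⟨k, hk | hk⟩
      · exact ⟨Sum.inl (k, n - k), by simp only [Sum.elim_inl, Prod.mk.injEq]; omega⟩
      · exact ⟨Sum.inr (k + 1, n - k - 1), by simp only [Sum.elim_inr, Prod.mk.injEq]; omega⟩)

theorem parityEquiv_inl (q : ℤ × ℤ) : parityEquiv (Sum.inl q) = (q.1 + q.2, q.1 - q.2) := rfl

theorem parityEquiv_inr (q : ℤ × ℤ) : parityEquiv (Sum.inr q) = (q.1 + q.2, q.1 - q.2 - 1) := rfl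

theorem hasSum_mul_of_summable_norm {f g : ℤ → ℂ} (hf : Summable (fun n => ‖f n‖))
    (hg : Summable (fun n => ‖g n‖)) :
    HasSum (fun q : ℤ × ℤ => f q.1 * g q.2) ((∑' k, f k) * ∑' k, g k) :=
  hf.of_norm.hasSum.mul hg.of_norm.hasSum (summable_mul_of_summable_norm (f := f) (g := g) hf hg)

/-- A product of two values of theta is a `2 × 2` determinant; hence such products satisfy the
Plücker relation. -/
theorem theta_mul_theta (x y : ℂ) {τ : ℂ} (hτ : 0 < τ.im) :
    theta (x + y) τ * theta (x - y) τ =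
      (∑' k, oddTerm k x τ) * (∑' k, evenTerm k y τ) -
        (∑' k, evenTerm k x τ) * (∑' k, oddTerm k y τ) := by
  have hO := fun x => summable_norm_oddTerm x hτ
  have hE := fun x => summable_norm_evenTerm x hτ
  have hT := fun x => summable_norm_thetaTerm x hτ
  have h1 := hasSum_mul_of_summable_norm (hO x) (hE y)
  have h2 := hasSum_mul_of_summable_norm (hE x) (hO y)
  have h3 := hasSum_mul_of_summable_norm (hT (x + y)) (hT (x - y))
  rw [(hasSum_thetaTerm _ hτ).tsum_eq, (hasSum_thetaTerm _ hτ).tsum_eq] at h3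
  have hl : HasSum (((fun q : ℤ × ℤ => thetaTerm q.1 (x + y) τ * thetaTerm q.2 (x - y) τ) ∘
      parityEquiv) ∘ Sum.inl) ((∑' k, oddTerm k x τ) * (∑' k, evenTerm k y τ)) := by
    refine h1.congr_fun fun q => ?_
    simp only [Function.comp_apply, parityEquiv_inl, thetaTerm, oddTerm, evenTerm,
      ← Complex.exp_add]
    apply Complex.exp_eq_exp_iff_exists_int.mpr
    exact ⟨q.1, by push_cast; ring⟩
  have hr : HasSum (((fun q : ℤ × ℤ => thetaTerm q.1 (x + y) τ * thetaTerm q.2 (x - y) τ) ∘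
      parityEquiv) ∘ Sum.inr) (-((∑' k, evenTerm k x τ) * (∑' k, oddTerm k y τ))) := by
    refine h2.neg.congr_fun fun q => ?_
    simp only [Function.comp_apply, parityEquiv_inr, thetaTerm, oddTerm, evenTerm,
      ← Complex.exp_add]
    rw [← neg_one_mul (cexp _), ← Complex.exp_pi_mul_I, ← Complex.exp_add]
    apply Complex.exp_eq_exp_iff_exists_int.mpr
    exact ⟨q.1 - 1, by push_cast; ring⟩
  rw [sub_eq_add_neg]
  exact (parityEquiv.hasSum_iff.mpr h3).unique (hl.sum hr)

theorem theta_sub_half (z τ : ℂ) : theta (z - 1 / 2) τ = -theta (z + 1 / 2) τ := by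
  rw [show z + 1 / 2 = (z - 1 / 2) + 1 by ring, theta_add_one, neg_neg]

/-- The three-term relation between theta squares, shifted squares and products. -/
theorem theta_three_term (u w : ℂ) {τ : ℂ} (hτ : 0 < τ.im) :
    theta (u + 1 / 2) τ ^ 2 * theta w τ ^ 2 - theta (w + 1 / 2) τ ^ 2 * theta u τ ^ 2 =
      -(theta (1 / 2) τ ^ 2 * (theta (u - w) τ * theta (u + w) τ)) := by
  have hu := theta_mul_theta u (1 / 2) hτ
  have hw := theta_mul_theta w (1 / 2) hτ
  have hu0 := theta_mul_theta u 0 hτ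
  have hw0 := theta_mul_theta w 0 hτ
  have h0 := theta_mul_theta (1 / 2) 0 hτ
  have huw := theta_mul_theta u w hτ
  rw [theta_sub_half] at hu hw
  rw [add_zero, sub_zero] at hu0 hw0 h0
  have e1 : theta (u + 1 / 2) τ ^ 2 = -(theta (u + 1 / 2) τ * -theta (u + 1 / 2) τ) := by ring
  have e2 : theta (w + 1 / 2) τ ^ 2 = -(theta (w + 1 / 2) τ * -theta (w + 1 / 2) τ) := by ring
  rw [e1, e2, hu, hw, mul_comm (theta (u - w) τ), huw, sq, sq, sq, hu0, hw0, h0]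
  ring

end ModularFibration

namespace ModularFibration

open Complex Filter

/-! ### The modular transformation law of theta -/

/-- The automorphy factor `cτ + d` of an integral matrix. -/
noncomputable def autFactor (γ : SL(2, ℤ)) (τ : ℍ) : ℂ := (γ 1 0 : ℤ) * (τ : ℂ) + (γ 1 1 : ℤ)

theorem autFactor_eq_denom (γ : SL(2, ℤ)) (τ : ℍ) : autFactor γ τ = UpperHalfPlane.denom γ τ := by
  rw [ModularGroup.denom_apply, autFactor]

theorem autFactor_ne_zero (γ : SL(2, ℤ)) (τ : ℍ) : autFactor γ τ ≠ 0 := by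
  rw [autFactor_eq_denom]
  exact UpperHalfPlane.denom_ne_zero _ _

theorem coe_smul_eq (γ : SL(2, ℤ)) (τ : ℍ) :
    ((γ • τ : ℍ) : ℂ) = ((γ 0 0 : ℤ) * (τ : ℂ) + (γ 0 1 : ℤ)) / autFactor γ τ := by
  rw [UpperHalfPlane.specialLinearGroup_apply, autFactor]
  simp

theorem smul_mul_autFactor (γ : SL(2, ℤ)) (τ : ℍ) :
    ((γ • τ : ℍ) : ℂ) * autFactor γ τ = (γ 0 0 : ℤ) * (τ : ℂ) + (γ 0 1 : ℤ) := by
  rw [coe_smul_eq, div_mul_cancel₀ _ (autFactor_ne_zero γ τ)]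

theorem det_eq_one (γ : SL(2, ℤ)) : γ 0 0 * γ 1 1 - γ 0 1 * γ 1 0 = 1 := by
  have := γ.det_coe
  rwa [Matrix.det_fin_two] at this

theorem autFactor_mul (γ δ : SL(2, ℤ)) (τ : ℍ) :
    autFactor (γ * δ) τ = autFactor γ (δ • τ) * autFactor δ τ := by
  have h := smul_mul_autFactor δ τ
  rw [autFactor, autFactor, add_mul, mul_assoc, h, autFactor]
  simp only [Matrix.SpecialLinearGroup.coe_mul, Matrix.mul_apply, Fin.sum_univ_two]
  push_cast
  ring

theorem autFactor_inv (γ : SL(2, ℤ)) (τ : ℍ) :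
    autFactor γ (γ⁻¹ • τ) * autFactor γ⁻¹ τ = 1 := by
  rw [← autFactor_mul, mul_inv_cancel]
  simp [autFactor]

theorem theta_tau_add_one (z : ℂ) {τ : ℂ} (hτ : 0 < τ.im) :
    theta z (τ + 1) = cexp (Real.pi * I / 4) * theta z τ := by
  have h1 : 0 < (τ + 1).im := by simpa using hτ
  refine (hasSum_thetaTerm z h1).unique ?_
  refine ((hasSum_thetaTerm z hτ).mul_left (cexp (Real.pi * I / 4))).congr_fun fun n => ?_
  obtain ⟨k, hk⟩ := Int.even_mul_succ_self n
  have hk' : (n : ℂ) * (n + 1) = k + k := by exact_mod_cast hk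
  rw [thetaTerm, thetaTerm, ← Complex.exp_add]
  apply Complex.exp_eq_exp_iff_exists_int.mpr
  refine ⟨k, ?_⟩
  linear_combination (Real.pi * I : ℂ) * hk'

/-- The transformation of theta under `τ ↦ -1/τ`, with the factor independent of `z` left
unspecified; it comes from Mathlib's functional equation of `jacobiTheta₂`. -/
theorem theta_inversion {τ : ℂ} (hτ : 0 < τ.im) : ∃ C : ℂ, C ≠ 0 ∧ ∀ z : ℂ,
    theta (z / τ) (-1 / τ) = C * cexp (Real.pi * I * z ^ 2 / τ) * theta z τ := by
  have hτ0 : τ ≠ 0 := by rintro rfl; simp at hτ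
  have hs : (-I * τ) ^ (1 / 2 : ℂ) ≠ 0 := by
    rw [Ne, Complex.cpow_eq_zero_iff]
    simp [hτ0]
  refine ⟨-(-I * τ) ^ (1 / 2 : ℂ) * I, by simpa using hs, fun z => ?_⟩
  have h1 := jacobiTheta₂_functional_equation (z + 1 / 2 + τ / 2) τ
  have h2 := jacobiTheta₂_add_left' ((z + 1 / 2 + τ / 2) / τ) (-1 / τ)
  rw [show (z + 1 / 2 + τ / 2) / τ + -1 / τ = z / τ + 1 / 2 + (-1 / τ) / 2 by
    field_simp; ring] at h2
  have hr : (-I * τ) ^ (1 / 2 : ℂ) * (1 / (-I * τ) ^ (1 / 2 : ℂ)) = 1 := mul_one_div_cancel hs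
  have key : cexp (Real.pi * I * (-1 / τ / 4 + z / τ)) *
      cexp (-Real.pi * I * (-1 / τ + 2 * ((z + 1 / 2 + τ / 2) / τ))) =
      -I * (cexp (Real.pi * I * z ^ 2 / τ) * cexp (Real.pi * I * (τ / 4 + z)) *
        cexp (-Real.pi * I * (z + 1 / 2 + τ / 2) ^ 2 / τ)) := by
    rw [show -I = cexp (-(Real.pi / 2 * I)) by
      rw [Complex.exp_neg, Complex.exp_pi_div_two_mul_I, Complex.inv_I], ← Complex.exp_add,
      ← Complex.exp_add, ← Complex.exp_add, ← Complex.exp_add]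
    congr 1
    field_simp
    ring
  rw [theta, h2, theta, h1]
  generalize (-I * τ) ^ (1 / 2 : ℂ) = r at *
  generalize 1 / r = r' at *
  generalize jacobiTheta₂ ((z + 1 / 2 + τ / 2) / τ) (-1 / τ) = J at *
  linear_combination J * key + (cexp (Real.pi * I * z ^ 2 / τ) *
    cexp (Real.pi * I * (τ / 4 + z)) * cexp (-Real.pi * I * (z + 1 / 2 + τ / 2) ^ 2 / τ)) * I * J * hr

/-- The modular transformation law of the theta function. -/
theorem theta_smul (γ : SL(2, ℤ)) : ∀ τ : ℍ, ∃ C : ℂ, C ≠ 0 ∧ ∀ z : ℂ,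
    theta (z / autFactor γ τ) (γ • τ : ℍ) =
      C * cexp (Real.pi * I * (γ 1 0 : ℤ) * z ^ 2 / autFactor γ τ) * theta z τ := by
  have hγ : γ ∈ Subgroup.closure {ModularGroup.S, ModularGroup.T} := by
    rw [SpecialLinearGroup.SL2Z_generators]; trivial
  induction hγ using Subgroup.closure_induction with
  | mem γ hγ =>
    intro τ
    rcases hγ with rfl | rfl
    · obtain ⟨C, hC, h⟩ := theta_inversion τ.im_pos
      refine ⟨C, hC, fun z => ?_⟩
      have e : ((ModularGroup.S • τ : ℍ) : ℂ) = -1 / (τ : ℂ) := by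
        rw [coe_smul_eq, autFactor]; simp [ModularGroup.S]
      rw [e]
      have e2 : autFactor ModularGroup.S τ = τ := by simp [autFactor, ModularGroup.S]
      rw [e2, h z]
      simp [ModularGroup.S]
    · refine ⟨cexp (Real.pi * I / 4), Complex.exp_ne_zero _, fun z => ?_⟩
      have e : ((ModularGroup.T • τ : ℍ) : ℂ) = (τ : ℂ) + 1 := by
        rw [coe_smul_eq, autFactor]; simp [ModularGroup.T]
      have e2 : autFactor ModularGroup.T τ = 1 := by simp [autFactor, ModularGroup.T]
      rw [e, e2, div_one, theta_tau_add_one z τ.im_pos]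
      simp [ModularGroup.T]
  | one =>
    intro τ
    exact ⟨1, one_ne_zero, fun z => by simp [autFactor]⟩
  | mul γ δ _ _ hγ hδ =>
    intro τ
    obtain ⟨C, hC, h⟩ := hγ (δ • τ)
    obtain ⟨D, hD, h'⟩ := hδ τ
    refine ⟨C * D, mul_ne_zero hC hD, fun z => ?_⟩
    have j1 := autFactor_ne_zero γ (δ • τ)
    have j2 := autFactor_ne_zero δ τ
    have hc : ((γ * δ) 1 0 : ℤ) = γ 1 0 * δ 0 0 + γ 1 1 * δ 1 0 := by
      simp [Matrix.SpecialLinearGroup.coe_mul, Matrix.mul_apply, Fin.sum_univ_two]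
    have hdet : (δ 0 0 : ℂ) * δ 1 1 - δ 0 1 * δ 1 0 = 1 := by exact_mod_cast det_eq_one δ
    have hs := smul_mul_autFactor δ τ
    have e1 : autFactor γ (δ • τ) * autFactor δ τ =
        γ 1 0 * (δ 0 0 * τ + δ 0 1) + γ 1 1 * autFactor δ τ := by
      rw [← hs, autFactor]; ring
    have e2 : autFactor δ τ = δ 1 0 * τ + δ 1 1 := rfl
    rw [mul_smul, autFactor_mul, mul_comm (autFactor γ (δ • τ)), ← div_div, h, h', hc]
    have key : cexp (Real.pi * I * (γ 1 0 : ℤ) * (z / autFactor δ τ) ^ 2 / autFactor γ (δ • τ)) *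
        cexp (Real.pi * I * (δ 1 0 : ℤ) * z ^ 2 / autFactor δ τ) =
        cexp (Real.pi * I * ((γ 1 0 * δ 0 0 + γ 1 1 * δ 1 0 : ℤ) : ℂ) * z ^ 2 /
          (autFactor δ τ * autFactor γ (δ • τ))) := by
      rw [← Complex.exp_add]
      congr 1
      push_cast
      field_simp
      have : (γ 1 0 : ℂ) + autFactor δ τ * δ 1 0 * autFactor γ (δ • τ) =
          autFactor δ τ * (γ 1 0 * δ 0 0 + γ 1 1 * δ 1 0) := by
        linear_combination (δ 1 0 : ℂ) * e1 + (-(γ 1 0 : ℂ) * δ 0 0) * e2 - (γ 1 0 : ℂ) * hdet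
      linear_combination (z ^ 2) * this
    rw [← key]
    ring
  | inv γ _ hγ =>
    intro τ
    obtain ⟨C, hC, h⟩ := hγ (γ⁻¹ • τ)
    refine ⟨C⁻¹, inv_ne_zero hC, fun z => ?_⟩
    have hj := autFactor_inv γ τ
    have j2 := autFactor_ne_zero γ⁻¹ τ
    have h1 := h (z / autFactor γ⁻¹ τ)
    rw [div_div, mul_comm (autFactor γ⁻¹ τ), hj, div_one, smul_inv_smul] at h1
    have hc : (γ⁻¹ 1 0 : ℤ) = -γ 1 0 := by
      simp [Matrix.SpecialLinearGroup.coe_inv, Matrix.adjugate_fin_two]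
    rw [h1, hc]
    have key : cexp (Real.pi * I * ((-γ 1 0 : ℤ) : ℂ) * z ^ 2 / autFactor γ⁻¹ τ) *
        cexp (Real.pi * I * (γ 1 0 : ℤ) * (z / autFactor γ⁻¹ τ) ^ 2 / autFactor γ (γ⁻¹ • τ)) = 1 := by
      rw [← Complex.exp_add, Complex.exp_eq_one_iff]
      refine ⟨0, ?_⟩
      rw [eq_div_of_mul_eq j2 hj]
      push_cast
      field_simp
      ring
    have hCC : C⁻¹ * C = 1 := inv_mul_cancel₀ hC
    linear_combination (-(C⁻¹ * C * theta (z / autFactor γ⁻¹ τ) (γ⁻¹ • τ : ℍ))) * key -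
      theta (z / autFactor γ⁻¹ τ) (γ⁻¹ • τ : ℍ) * hCC

/-! ### The zeros of theta -/

/-- This bounds the higher terms of the theta series, written in sines, by the leading one. -/
theorem norm_sin_odd_mul_le (n : ℕ) (w : ℂ) : ‖Complex.sin ((2 * n + 1) * w)‖ ≤
    (2 * n + 1) * Real.exp (2 * n * |w.im|) * ‖Complex.sin w‖ := by
  induction n with
  | zero => simp
  | succ n ih =>
    have h1 : Complex.sin ((2 * (n + 1 : ℕ) + 1) * w) = Complex.sin ((2 * n + 1) * w) +
        2 * Complex.cos ((2 * n + 2) * w) * Complex.sin w := by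
      have e1 := Complex.sin_add ((2 * n + 2) * w) w
      have e2 := Complex.sin_sub ((2 * n + 2) * w) w
      rw [show (2 * (n + 1 : ℕ) + 1) * w = (2 * n + 2) * w + w by push_cast; ring, e1,
        show (2 * n + 1) * w = (2 * n + 2) * w - w by ring, e2]
      ring
    have h2 : ‖Complex.cos ((2 * n + 2) * w)‖ ≤ Real.exp (2 * (n + 1) * |w.im|) := by
      have him : ((2 * n + 2) * w).im = 2 * (n + 1) * w.im := by
        simp [Complex.mul_im]
        left; ring
      have e1 : ‖cexp ((2 * n + 2) * w * I)‖ ≤ Real.exp (2 * (n + 1) * |w.im|) := by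
        rw [Complex.norm_exp, Complex.mul_I_re, him]
        apply Real.exp_le_exp.mpr
        have := neg_le_abs w.im
        nlinarith [(Nat.cast_nonneg n : (0 : ℝ) ≤ n)]
      have e2 : ‖cexp (-((2 * n + 2) * w) * I)‖ ≤ Real.exp (2 * (n + 1) * |w.im|) := by
        rw [Complex.norm_exp, Complex.mul_I_re, Complex.neg_im, him, neg_neg]
        apply Real.exp_le_exp.mpr
        have := le_abs_self w.im
        nlinarith [(Nat.cast_nonneg n : (0 : ℝ) ≤ n)]
      rw [Complex.cos, norm_div, Complex.norm_two]
      have := norm_add_le (cexp ((2 * n + 2) * w * I)) (cexp (-((2 * n + 2) * w) * I))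
      linarith
    have h3 : Real.exp (2 * n * |w.im|) ≤ Real.exp (2 * (n + 1) * |w.im|) := by
      apply Real.exp_le_exp.mpr
      nlinarith [abs_nonneg w.im]
    rw [h1]
    calc _ ≤ (2 * n + 1) * Real.exp (2 * n * |w.im|) * ‖Complex.sin w‖ +
          2 * Real.exp (2 * (n + 1) * |w.im|) * ‖Complex.sin w‖ := by
          refine (norm_add_le _ _).trans (add_le_add ih ?_)
          rw [norm_mul, norm_mul, Complex.norm_two]
          gcongr
      _ ≤ (2 * n + 1) * Real.exp (2 * (n + 1) * |w.im|) * ‖Complex.sin w‖ +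
          2 * Real.exp (2 * (n + 1) * |w.im|) * ‖Complex.sin w‖ := by gcongr
      _ = _ := by push_cast; ring

theorem thetaTerm_add_thetaTerm (n : ℕ) (z τ : ℂ) :
    thetaTerm n z τ + thetaTerm (-(n + 1 : ℤ)) z τ =
      (-1) ^ n * cexp (Real.pi * I * (n + 1 / 2) ^ 2 * τ) *
        (2 * I * Complex.sin ((2 * n + 1) * (Real.pi * z))) := by
  have h1 : thetaTerm n z τ = (-1) ^ n * cexp (Real.pi * I * (n + 1 / 2) ^ 2 * τ) *
      cexp ((2 * n + 1) * (Real.pi * z) * I) := by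
    rw [← zpow_natCast, ← exp_pi_mul_I_int, thetaTerm, ← Complex.exp_add, ← Complex.exp_add]
    congr 1; push_cast; ring
  have h2 : thetaTerm (-(n + 1 : ℤ)) z τ = -((-1) ^ n * cexp (Real.pi * I * (n + 1 / 2) ^ 2 * τ) *
      cexp (-((2 * n + 1) * (Real.pi * z)) * I)) := by
    rw [← zpow_natCast, ← exp_pi_mul_I_int, thetaTerm, ← Complex.exp_add, ← Complex.exp_add,
      ← neg_one_mul (cexp _), ← Complex.exp_pi_mul_I, ← Complex.exp_add]
    apply Complex.exp_eq_exp_iff_exists_int.mpr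
    exact ⟨-n - 1, by push_cast; ring⟩
  have hI : I * I = -1 := Complex.I_mul_I
  rw [h1, h2, Complex.sin]
  linear_combination ((-1) ^ n * cexp (Real.pi * I * (n + 1 / 2) ^ 2 * τ) *
    (cexp ((2 * n + 1) * (Real.pi * z) * I) - cexp (-((2 * n + 1) * (Real.pi * z)) * I))) * hI

theorem norm_exp_pi_mul_I_mul (x : ℝ) (τ : ℂ) :
    ‖cexp (Real.pi * I * x * τ)‖ = Real.exp (-(Real.pi * x * τ.im)) := by
  rw [Complex.norm_exp]
  congr 1
  simp [Complex.mul_re, Complex.mul_im]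

theorem nine_le_exp_pi_mul {y : ℝ} (hy : 3 ≤ 4 * y ^ 2) (hy0 : 0 < y) :
    9 ≤ Real.exp (Real.pi * y) := by
  have h1 : (5 / 2 : ℝ) ≤ Real.pi * y := by nlinarith [Real.pi_gt_three]
  have h2 : Real.exp (1 / 2) ^ 5 = Real.exp (5 / 2) := by
    rw [← Real.exp_nat_mul]; norm_num
  have h3 : (13 / 8 : ℝ) ≤ Real.exp (1 / 2) := by
    have := Real.quadratic_le_exp_of_nonneg (x := 1 / 2) (by norm_num)
    norm_num at this ⊢; linarith
  calc (9 : ℝ) ≤ (13 / 8) ^ 5 := by norm_num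
    _ ≤ Real.exp (1 / 2) ^ 5 := by gcongr
    _ = Real.exp (5 / 2) := h2
    _ ≤ _ := Real.exp_le_exp.mpr h1

/-- High in the upper half plane, on the strip `|Im z| ≤ Im τ / 2`, the theta function is
within a factor of its leading term `2 i exp(πiτ/4) sin(πz)`. -/
theorem norm_theta_sub_le {z τ : ℂ} (hτ : 0 < τ.im) (hτ' : 3 ≤ 4 * τ.im ^ 2)
    (hz : |z.im| ≤ τ.im / 2) :
    ‖theta z τ - cexp (Real.pi * I * (1 / 4 : ℝ) * τ) * (2 * I * Complex.sin (Real.pi * z))‖ ≤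
      Real.exp (-(Real.pi * (1 / 4) * τ.im)) * ‖Complex.sin (Real.pi * z)‖ := by
  have h1 := (hasSum_thetaTerm z hτ).nat_add_neg_add_one
  set A := Real.exp (-(Real.pi * (1 / 4) * τ.im)) with hA
  set S := ‖Complex.sin (Real.pi * z)‖ with hS
  set x := Real.exp (-(Real.pi * τ.im)) with hx
  have hx9 : x ≤ 1 / 9 := by
    rw [hx, Real.exp_neg, ← one_div]
    exact one_div_le_one_div_of_le (by norm_num) (nine_le_exp_pi_mul hτ' hτ)
  have hx0 : 0 < x := Real.exp_pos _
  have hbound : ∀ n : ℕ, ‖thetaTerm n z τ + thetaTerm (-(n + 1 : ℤ)) z τ‖ ≤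
      2 * A * S * (3 * x) ^ n := by
    intro n
    rw [thetaTerm_add_thetaTerm]
    have e1 : ‖cexp (Real.pi * I * (n + 1 / 2) ^ 2 * τ)‖ =
        Real.exp (-(Real.pi * (n + 1 / 2) ^ 2 * τ.im)) := by
      have := norm_exp_pi_mul_I_mul ((n + 1 / 2) ^ 2) τ
      push_cast at this
      exact this
    have e2 := norm_sin_odd_mul_le n (Real.pi * z)
    have him : |(Real.pi * z : ℂ).im| ≤ Real.pi * (τ.im / 2) := by
      rw [Complex.im_ofReal_mul, abs_mul, abs_of_pos Real.pi_pos]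
      gcongr
    have e3 : (2 * n + 1 : ℝ) ≤ 3 ^ n := by
      have := one_add_mul_le_pow (show (-2 : ℝ) ≤ 2 by norm_num) n
      norm_num at this; linarith
    have e4 : Real.exp (-(Real.pi * (n + 1 / 2) ^ 2 * τ.im)) *
        Real.exp (2 * n * |(Real.pi * z : ℂ).im|) ≤ A * x ^ n := by
      rw [hA, hx, ← Real.exp_nat_mul, ← Real.exp_add, ← Real.exp_add]
      apply Real.exp_le_exp.mpr
      have hn : (n : ℝ) ≤ (n : ℝ) ^ 2 := by
        exact_mod_cast Nat.le_self_pow two_ne_zero n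
      have hp : 0 < Real.pi * τ.im := mul_pos Real.pi_pos hτ
      have hn0 : (0 : ℝ) ≤ n := Nat.cast_nonneg n
      nlinarith
    rw [norm_mul, norm_mul, norm_mul, norm_mul, e1, norm_pow, norm_neg, norm_one, one_pow, one_mul,
      Complex.norm_two, Complex.norm_I, mul_one]
    calc _ ≤ Real.exp (-(Real.pi * (n + 1 / 2) ^ 2 * τ.im)) *
          (2 * ((2 * n + 1) * Real.exp (2 * n * |(Real.pi * z : ℂ).im|) * S)) := by gcongr
      _ = 2 * (Real.exp (-(Real.pi * (n + 1 / 2) ^ 2 * τ.im)) *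
        Real.exp (2 * n * |(Real.pi * z : ℂ).im|)) * S * (2 * n + 1) := by ring
      _ ≤ 2 * (A * x ^ n) * S * 3 ^ n := by
        gcongr
      _ = _ := by rw [mul_pow]; ring
  have h3x : 3 * x < 1 := by linarith
  have hgeo := (hasSum_geometric_of_lt_one (by positivity) h3x).mul_left (2 * A * S)
  have h2 := (hasSum_nat_add_iff' 1).mpr h1
  have hgeo' := (hasSum_nat_add_iff' 1).mpr hgeo
  simp only [Finset.range_one, Finset.sum_singleton] at h2 hgeo'
  have h4 := h2.norm_le_of_bounded hgeo' fun n => by exact_mod_cast hbound (n + 1)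
  have e0 := thetaTerm_add_thetaTerm 0 z τ
  have e5 : cexp (Real.pi * I * (1 / 4 : ℝ) * τ) * (2 * I * Complex.sin (Real.pi * z)) =
      thetaTerm (0 : ℕ) z τ + thetaTerm (-((0 : ℕ) + 1 : ℤ)) z τ := by
    rw [e0]
    push_cast
    norm_num
  rw [e5]
  refine h4.trans ?_
  have h6 : (1 - 3 * x)⁻¹ ≤ 3 / 2 := by
    rw [inv_le_comm₀ (by linarith) (by norm_num)]
    linarith
  have hAS : 0 ≤ A * S := by positivity
  nlinarith

end ModularFibration

namespace ModularFibration

open Complex Filter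

/-- The lattice `ℤτ + ℤ` of periods. -/
def periodLattice (τ : ℂ) : AddSubgroup ℂ where
  carrier := {z | ∃ m n : ℤ, z = m * τ + n}
  zero_mem' := ⟨0, 0, by simp⟩
  add_mem' := by
    rintro _ _ ⟨m, n, rfl⟩ ⟨m', n', rfl⟩
    exact ⟨m + m', n + n', by push_cast; ring⟩
  neg_mem' := by
    rintro _ ⟨m, n, rfl⟩
    exact ⟨-m, -n, by push_cast; ring⟩

theorem one_mem_periodLattice (τ : ℂ) : (1 : ℂ) ∈ periodLattice τ := ⟨0, 1, by simp⟩

theorem tau_mem_periodLattice (τ : ℂ) : τ ∈ periodLattice τ := ⟨1, 0, by simp⟩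

theorem lattice_coeff_ext {τ : ℂ} (hτ : 0 < τ.im) {x y x' y' : ℝ}
    (h : (x : ℂ) * τ + y = x' * τ + y') : x = x' ∧ y = y' := by
  have h1 := congrArg Complex.im h
  have h2 := congrArg Complex.re h
  simp only [Complex.add_im, Complex.re_ofReal_mul, Complex.im_ofReal_mul, Complex.ofReal_im,
    add_zero, Complex.add_re, Complex.ofReal_re] at h1 h2
  have h3 := mul_right_cancel₀ hτ.ne' h1
  subst h3
  exact ⟨rfl, by linarith⟩

theorem exists_real_coeff {τ : ℂ} (hτ : 0 < τ.im) (z : ℂ) : ∃ x y : ℝ, z = x * τ + y := by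
  refine ⟨z.im / τ.im, z.re - z.im / τ.im * τ.re, ?_⟩
  apply Complex.ext
  · simp
  · simp [hτ.ne']

/-- A real combination of `τ` and `1` is a period only if the coefficients are integers. -/
theorem coeff_of_mem_periodLattice {τ : ℂ} (hτ : 0 < τ.im) {x y : ℝ}
    (h : (x : ℂ) * τ + y ∈ periodLattice τ) : ∃ m n : ℤ, x = m ∧ y = n := by
  obtain ⟨m, n, h⟩ := h
  obtain ⟨h1, h2⟩ := lattice_coeff_ext hτ (x := x) (y := y) (x' := m) (y' := n) (by exact_mod_cast h)
  exact ⟨m, n, h1, h2⟩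

theorem theta_add_mem_eq_zero_iff {τ l : ℂ} (hl : l ∈ periodLattice τ) (z : ℂ) :
    theta (z + l) τ = 0 ↔ theta z τ = 0 := by
  obtain ⟨m, n, rfl⟩ := hl
  rw [theta_add_lattice, mul_eq_zero, mul_eq_zero]
  have : ((-1 : ℂ) ^ (m + n)) ≠ 0 := zpow_ne_zero _ (by norm_num)
  simp [this, Complex.exp_ne_zero]

/-- Modulo the lattice, every complex number can be moved into the strip `|Im z| ≤ Im τ / 2`. -/
theorem exists_sub_mem_strip {τ : ℂ} (hτ : 0 < τ.im) (z : ℂ) :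
    ∃ m : ℤ, |(z - m * τ).im| ≤ τ.im / 2 := by
  refine ⟨round (z.im / τ.im), ?_⟩
  have h := abs_sub_round (z.im / τ.im)
  have h1 : (z - round (z.im / τ.im) * τ).im = (z.im / τ.im - round (z.im / τ.im)) * τ.im := by
    rw [Complex.sub_im, ← Complex.ofReal_intCast, Complex.im_ofReal_mul]
    field_simp
  rw [h1, abs_mul, abs_of_pos hτ]
  nlinarith

theorem norm_leadingTerm (z τ : ℂ) :
    ‖cexp (Real.pi * I * (1 / 4 : ℝ) * τ) * (2 * I * Complex.sin (Real.pi * z))‖ =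
      2 * (Real.exp (-(Real.pi * (1 / 4) * τ.im)) * ‖Complex.sin (Real.pi * z)‖) := by
  rw [norm_mul, norm_exp_pi_mul_I_mul, norm_mul, norm_mul, Complex.norm_two, Complex.norm_I]
  ring

theorem le_norm_theta {z τ : ℂ} (hτ : 0 < τ.im) (hτ' : 3 ≤ 4 * τ.im ^ 2)
    (hz : |z.im| ≤ τ.im / 2) :
    Real.exp (-(Real.pi * (1 / 4) * τ.im)) * ‖Complex.sin (Real.pi * z)‖ ≤ ‖theta z τ‖ := by
  have h := norm_theta_sub_le hτ hτ' hz
  have h2 := norm_sub_norm_le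
    (cexp (Real.pi * I * (1 / 4 : ℝ) * τ) * (2 * I * Complex.sin (Real.pi * z))) (theta z τ)
  rw [norm_sub_rev, norm_leadingTerm] at h2
  linarith

theorem norm_theta_le {z τ : ℂ} (hτ : 0 < τ.im) (hτ' : 3 ≤ 4 * τ.im ^ 2)
    (hz : |z.im| ≤ τ.im / 2) :
    ‖theta z τ‖ ≤ 3 * (Real.exp (-(Real.pi * (1 / 4) * τ.im)) * ‖Complex.sin (Real.pi * z)‖) := by
  have h := norm_theta_sub_le hτ hτ' hz
  have h2 := norm_sub_norm_le (theta z τ)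
    (cexp (Real.pi * I * (1 / 4 : ℝ) * τ) * (2 * I * Complex.sin (Real.pi * z)))
  rw [norm_leadingTerm] at h2
  linarith

theorem theta_of_mem {τ z : ℂ} (hz : z ∈ periodLattice τ) : theta z τ = 0 := by
  have := (theta_add_mem_eq_zero_iff hz 0).mpr (theta_zero τ)
  rwa [zero_add] at this

theorem mem_of_theta_eq_zero_of_fd {τ z : ℂ} (hτ : 0 < τ.im) (hτ' : 3 ≤ 4 * τ.im ^ 2)
    (hz : theta z τ = 0) : z ∈ periodLattice τ := by
  obtain ⟨m, hm⟩ := exists_sub_mem_strip hτ z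
  have hml : (m : ℂ) * τ ∈ periodLattice τ := ⟨m, 0, by simp⟩
  have h0 : theta (z - m * τ) τ = 0 := by
    rw [← theta_add_mem_eq_zero_iff hml, sub_add_cancel, hz]
  have h1 := le_norm_theta hτ hτ' hm
  rw [h0, norm_zero] at h1
  have h2 : Complex.sin (Real.pi * (z - m * τ)) = 0 := by
    rw [← norm_le_zero_iff]
    have := Real.exp_pos (-(Real.pi * (1 / 4) * τ.im))
    nlinarith
  obtain ⟨n, hn⟩ := Complex.sin_eq_zero_iff.mp h2
  refine ⟨m, n, ?_⟩
  have hpi : (Real.pi : ℂ) ≠ 0 := by exact_mod_cast Real.pi_ne_zero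
  have : z - m * τ = n := mul_left_cancel₀ hpi (by rw [hn]; ring)
  linear_combination this

/-- Multiplication by the automorphy factor maps the lattice of `γ • τ` onto that of `τ`. -/
theorem div_autFactor_mem_iff (γ : SL(2, ℤ)) (τ : ℍ) (z : ℂ) :
    z / autFactor γ τ ∈ periodLattice (γ • τ : ℍ) ↔ z ∈ periodLattice (τ : ℂ) := by
  have hj := autFactor_ne_zero γ τ
  have hs := smul_mul_autFactor γ τ
  have hdet : (γ 0 0 : ℂ) * γ 1 1 - γ 0 1 * γ 1 0 = 1 := by exact_mod_cast det_eq_one γ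
  have hjj : autFactor γ τ = γ 1 0 * τ + γ 1 1 := rfl
  constructor
  · rintro ⟨m, n, h⟩
    rw [div_eq_iff hj, add_mul, mul_assoc, hs, hjj] at h
    exact ⟨m * γ 0 0 + n * γ 1 0, m * γ 0 1 + n * γ 1 1, by push_cast; linear_combination h⟩
  · rintro ⟨m, n, rfl⟩
    refine ⟨m * γ 1 1 - n * γ 1 0, -m * γ 0 1 + n * γ 0 0, ?_⟩
    rw [div_eq_iff hj, add_mul, mul_assoc, hs, hjj]
    push_cast
    linear_combination (-(m : ℂ) * τ - n) * hdet

theorem theta_eq_zero_iff (τ : ℍ) (z : ℂ) : theta z τ = 0 ↔ z ∈ periodLattice (τ : ℂ) := by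
  refine ⟨fun hz => ?_, theta_of_mem⟩
  obtain ⟨γ, hγ⟩ := ModularGroup.exists_smul_mem_fd τ
  obtain ⟨C, hC, h⟩ := theta_smul γ τ
  rw [← div_autFactor_mem_iff γ]
  apply mem_of_theta_eq_zero_of_fd (γ • τ : ℍ).im_pos
    (ModularGroup.three_le_four_mul_im_sq_of_mem_fd hγ)
  rw [h, hz, mul_zero]

theorem theta_ne_zero_iff (τ : ℍ) (z : ℂ) : theta z τ ≠ 0 ↔ z ∉ periodLattice (τ : ℂ) :=
  not_congr (theta_eq_zero_iff τ z)

theorem deriv_theta_zero_ne_zero_of_fd {τ : ℂ} (hτ : 0 < τ.im) (hτ' : 3 ≤ 4 * τ.im ^ 2) :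
    deriv (theta · τ) 0 ≠ 0 := by
  intro h0
  have h1 : HasDerivAt (theta · τ) 0 0 := by
    simpa only [h0] using (differentiable_theta hτ 0).hasDerivAt
  rw [hasDerivAt_iff_isLittleO] at h1
  simp only [theta_zero, sub_zero, smul_zero] at h1
  have h2 : (fun z : ℂ => Complex.sin (Real.pi * z)) =O[𝓝 0] (theta · τ) := by
    apply Asymptotics.IsBigO.of_bound (Real.exp (-(Real.pi * (1 / 4) * τ.im)))⁻¹
    have : ∀ᶠ z : ℂ in 𝓝 0, |z.im| < τ.im / 2 := by
      apply (Complex.continuous_im.abs.tendsto 0).eventually_lt_const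
      simpa using hτ
    filter_upwards [this] with z hz
    rw [inv_mul_eq_div, le_div_iff₀ (Real.exp_pos _), mul_comm]
    exact le_norm_theta hτ hτ' hz.le
  have h3 := h2.trans_isLittleO h1
  have h4 : HasDerivAt (fun z : ℂ => Complex.sin (Real.pi * z)) 0 0 := by
    rw [hasDerivAt_iff_isLittleO]
    simpa using h3
  have h5 : HasDerivAt (fun z : ℂ => Complex.sin (Real.pi * z)) (Real.pi : ℂ) 0 := by
    have := ((hasDerivAt_id (0 : ℂ)).const_mul (Real.pi : ℂ)).csin
    simpa using this
  exact Real.pi_ne_zero (by exact_mod_cast h5.unique h4)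

/-- The zeros of theta are simple. -/
theorem deriv_theta_zero_ne_zero (τ : ℍ) : deriv (theta · τ) 0 ≠ 0 := by
  obtain ⟨γ, hγ⟩ := ModularGroup.exists_smul_mem_fd τ
  obtain ⟨C, hC, h⟩ := theta_smul γ τ
  have h1 := deriv_theta_zero_ne_zero_of_fd (γ • τ : ℍ).im_pos
    (ModularGroup.three_le_four_mul_im_sq_of_mem_fd hγ)
  intro h0
  apply h1
  have h2 : HasDerivAt (theta · τ) 0 0 := by
    simpa only [h0] using (differentiable_theta τ.im_pos 0).hasDerivAt
  have hj := autFactor_ne_zero γ τ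
  have h3 : HasDerivAt (fun w : ℂ => theta w (γ • τ : ℍ)) 0 0 := by
    have e : (fun w : ℂ => theta w (γ • τ : ℍ)) = fun w => C * cexp (Real.pi * I * (γ 1 0 : ℤ) *
        (w * autFactor γ τ) ^ 2 / autFactor γ τ) * theta (w * autFactor γ τ) τ := by
      funext w
      rw [← h, mul_div_cancel_right₀ _ hj]
    rw [e]
    have h4 : HasDerivAt (fun w : ℂ => w * autFactor γ τ) (autFactor γ τ) 0 := by
      simpa using (hasDerivAt_id (0 : ℂ)).mul_const (autFactor γ τ)
    have h5 : HasDerivAt (fun w : ℂ => theta (w * autFactor γ τ) τ) 0 0 := by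
      refine (HasDerivAt.comp (h₂ := (theta · τ)) (h₂' := 0) (0 : ℂ) ?_ h4).congr_deriv
        (zero_mul _)
      simpa only [zero_mul] using h2
    have h6 : DifferentiableAt ℂ (fun w : ℂ => C * cexp (Real.pi * I * (γ 1 0 : ℤ) *
        (w * autFactor γ τ) ^ 2 / autFactor γ τ)) 0 := by fun_prop
    refine (h6.hasDerivAt.mul h5).congr_deriv ?_
    simp
  exact h3.deriv

end ModularFibration

namespace ModularFibration

open Complex Filter

/-! ### Theta parametrisation of the fibres -/

/-- The theta quotient `θ(1/2)² / θ(1/4)²`; its square is the coefficient `s + 1/s - 2`. -/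
noncomputable def kappa (τ : ℂ) : ℂ := theta (1 / 2) τ ^ 2 / theta (1 / 4) τ ^ 2

/-- The Hauptmodul `s = θ(3/8)² / θ(1/8)²`: the value of the coordinate `U` at the point `1/8` of
order `8`. -/
noncomputable def hauptmodul (τ : ℂ) : ℂ := theta (3 / 8) τ ^ 2 / theta (1 / 8) τ ^ 2

/-- Homogeneous coordinates of the point with parameter `z`, as entire functions of `z`. -/
noncomputable def cubicVec (z τ : ℂ) : Fin 3 → ℂ :=
  ![theta (z + 1 / 2) τ ^ 2 * theta z τ,
    kappa τ * theta (z - 1 / 4) τ ^ 2 * theta (z + 1 / 2) τ, theta z τ ^ 3]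

/-- The coordinate `U` of the point with parameter `z`. -/
noncomputable def uCoord (z τ : ℂ) : ℂ := theta (z + 1 / 2) τ ^ 2 / theta z τ ^ 2

/-- The coordinate `V` of the point with parameter `z`. -/
noncomputable def vCoord (z τ : ℂ) : ℂ :=
  kappa τ * theta (z - 1 / 4) τ ^ 2 * theta (z + 1 / 2) τ / theta z τ ^ 3

theorem ofReal_not_mem_periodLattice (τ : ℍ) {y : ℝ} (hy : ∀ n : ℤ, y ≠ n) :
    (y : ℂ) ∉ periodLattice (τ : ℂ) := by
  intro h
  obtain ⟨m, n, -, h2⟩ := coeff_of_mem_periodLattice τ.im_pos (x := 0) (y := y) (by simpa using h)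
  exact hy n h2

theorem ne_intCast_of_mul_eq {y : ℝ} {a b : ℤ} (h : y * b = a) (hab : ¬ b ∣ a) (n : ℤ) : y ≠ n := by
  rintro rfl
  exact hab ⟨n, by rw [mul_comm]; exact_mod_cast h.symm⟩

theorem half_not_mem (τ : ℍ) : (1 / 2 : ℂ) ∉ periodLattice (τ : ℂ) := by
  have := ofReal_not_mem_periodLattice τ
    (ne_intCast_of_mul_eq (y := 1 / 2) (a := 1) (b := 2) (by norm_num) (by decide))
  simpa using this

theorem quarter_not_mem (τ : ℍ) : (1 / 4 : ℂ) ∉ periodLattice (τ : ℂ) := by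
  have := ofReal_not_mem_periodLattice τ
    (ne_intCast_of_mul_eq (y := 1 / 4) (a := 1) (b := 4) (by norm_num) (by decide))
  simpa using this

theorem eighth_not_mem (τ : ℍ) : (1 / 8 : ℂ) ∉ periodLattice (τ : ℂ) := by
  have := ofReal_not_mem_periodLattice τ
    (ne_intCast_of_mul_eq (y := 1 / 8) (a := 1) (b := 8) (by norm_num) (by decide))
  simpa using this

theorem three_eighths_not_mem (τ : ℍ) : (3 / 8 : ℂ) ∉ periodLattice (τ : ℂ) := by
  have := ofReal_not_mem_periodLattice τ
    (ne_intCast_of_mul_eq (y := 3 / 8) (a := 3) (b := 8) (by norm_num) (by decide))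
  simpa using this

theorem theta_half_ne_zero (τ : ℍ) : theta (1 / 2) τ ≠ 0 :=
  (theta_ne_zero_iff τ _).mpr (half_not_mem τ)

theorem theta_quarter_ne_zero (τ : ℍ) : theta (1 / 4) τ ≠ 0 :=
  (theta_ne_zero_iff τ _).mpr (quarter_not_mem τ)

theorem theta_eighth_ne_zero (τ : ℍ) : theta (1 / 8) τ ≠ 0 :=
  (theta_ne_zero_iff τ _).mpr (eighth_not_mem τ)

theorem theta_three_eighths_ne_zero (τ : ℍ) : theta (3 / 8) τ ≠ 0 :=
  (theta_ne_zero_iff τ _).mpr (three_eighths_not_mem τ)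

theorem kappa_ne_zero (τ : ℍ) : kappa τ ≠ 0 :=
  div_ne_zero (pow_ne_zero _ (theta_half_ne_zero τ)) (pow_ne_zero _ (theta_quarter_ne_zero τ))

theorem hauptmodul_ne_zero (τ : ℍ) : hauptmodul τ ≠ 0 :=
  div_ne_zero (pow_ne_zero _ (theta_three_eighths_ne_zero τ))
    (pow_ne_zero _ (theta_eighth_ne_zero τ))

theorem theta_half_sub (z τ : ℂ) : theta (1 / 2 - z) τ = theta (z + 1 / 2) τ := by
  rw [← neg_sub, theta_neg, theta_sub_half, neg_neg]

/-- The identity behind the factor `U - 1` of the cubic: the zeros of `U - 1` are `± 1/4`. -/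
theorem theta_sq_sub_theta_sq (z : ℂ) (τ : ℍ) :
    theta (z + 1 / 2) τ ^ 2 - theta z τ ^ 2 =
      -(kappa τ * (theta (z - 1 / 4) τ * theta (z + 1 / 4) τ)) := by
  have h := theta_three_term z (1 / 4) τ.im_pos
  rw [show (1 / 4 + 1 / 2 : ℂ) = 1 / 2 - (-1 / 4) by norm_num, theta_half_sub,
    show (-1 / 4 + 1 / 2 : ℂ) = 1 / 4 by norm_num] at h
  have h4 := theta_quarter_ne_zero τ
  rw [kappa]
  generalize theta (z + 1 / 2) τ = A at *
  generalize theta (z - 1 / 4) τ = B at *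
  generalize theta (z + 1 / 4) τ = D at *
  field_simp
  linear_combination h

theorem theta_sq_add_quarter (z : ℂ) (τ : ℍ) :
    theta (z + 1 / 4) τ ^ 2 - theta (z - 1 / 4) τ ^ 2 =
      kappa τ * (theta z τ * theta (z + 1 / 2) τ) := by
  have h := theta_sq_sub_theta_sq (z + 1 / 4) τ
  rw [show z + 1 / 4 + 1 / 2 = (z - 1 / 4) + 1 by ring, theta_add_one,
    show z + 1 / 4 - 1 / 4 = z by ring, show z + 1 / 4 + 1 / 4 = z + 1 / 2 by ring] at h
  linear_combination -h

theorem hauptmodul_sub_one (τ : ℍ) :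
    hauptmodul τ - 1 = kappa τ * (theta (3 / 8) τ / theta (1 / 8) τ) := by
  have h := theta_sq_sub_theta_sq (1 / 8) τ
  rw [show (1 / 8 + 1 / 2 : ℂ) = 1 / 2 - (-1 / 8) by norm_num, theta_half_sub,
    show (-1 / 8 + 1 / 2 : ℂ) = 3 / 8 by norm_num,
    show (1 / 8 - 1 / 4 : ℂ) = -(1 / 8) by norm_num, theta_neg,
    show (1 / 8 + 1 / 4 : ℂ) = 3 / 8 by norm_num] at h
  have h8 := theta_eighth_ne_zero τ
  rw [hauptmodul]
  field_simp
  linear_combination h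

/-- The coefficient `a₁` of the fibre over the Hauptmodul is the square of `κ`. -/
theorem kappa_sq (τ : ℍ) : kappa τ ^ 2 = hauptmodul τ + 1 / hauptmodul τ - 2 := by
  have h1 := hauptmodul_sub_one τ
  have h0 := hauptmodul_ne_zero τ
  have h2 : (hauptmodul τ - 1) ^ 2 = kappa τ ^ 2 * hauptmodul τ := by
    rw [h1, hauptmodul]; ring
  field_simp
  linear_combination -h2

/-- The homogeneous cubic equation satisfied by the theta coordinates. -/
theorem cubicVec_equation (z : ℂ) (τ : ℍ) :
    cubicVec z τ 1 ^ 2 * cubicVec z τ 2 +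
        kappa τ ^ 2 * cubicVec z τ 0 * cubicVec z τ 1 * cubicVec z τ 2 =
      cubicVec z τ 0 * (cubicVec z τ 0 - cubicVec z τ 2) ^ 2 := by
  have h1 := theta_sq_sub_theta_sq z τ
  have h2 := theta_sq_add_quarter z τ
  simp only [cubicVec, Matrix.cons_val_zero, Matrix.cons_val_one, Matrix.cons_val]
  have h3 : theta (z + 1 / 2) τ ^ 2 * theta z τ - theta z τ ^ 3 =
      -(kappa τ * theta z τ * (theta (z - 1 / 4) τ * theta (z + 1 / 4) τ)) := by
    linear_combination theta z τ * h1
  rw [h3]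
  linear_combination (-(kappa τ ^ 2 * theta (z - 1 / 4) τ ^ 2 * theta (z + 1 / 2) τ ^ 2 *
    theta z τ ^ 3)) * h2

theorem cubicVec_ne_zero (z : ℂ) (τ : ℍ) : cubicVec z τ ≠ 0 := by
  intro h
  have h2 : theta z τ ^ 3 = 0 := congrFun h 2
  have h1 : kappa τ * theta (z - 1 / 4) τ ^ 2 * theta (z + 1 / 2) τ = 0 := congrFun h 1
  have hz := (theta_eq_zero_iff τ z).mp (eq_zero_of_pow_eq_zero h2)
  rcases mul_eq_zero.mp h1 with h1 | h1
  · rcases mul_eq_zero.mp h1 with h1 | h1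
    · exact kappa_ne_zero τ h1
    · have h3 := (theta_eq_zero_iff τ _).mp (eq_zero_of_pow_eq_zero h1)
      apply quarter_not_mem τ
      have := sub_mem hz h3
      simpa using this
  · have h3 := (theta_eq_zero_iff τ _).mp h1
    apply half_not_mem τ
    have := sub_mem h3 hz
    simpa using this

theorem exp_neg_int_half (m : ℤ) : cexp (-(Real.pi * I * m)) ^ 2 = 1 := by
  rw [← Complex.exp_nat_mul, Complex.exp_eq_one_iff]
  exact ⟨-m, by push_cast; ring⟩

/-- Translation of the parameter by a period only rescales the homogeneous coordinates. -/
theorem cubicVec_add_mem {τ l : ℂ} (hl : l ∈ periodLattice τ) (z : ℂ) :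
    ∃ c : ℂ, c ≠ 0 ∧ cubicVec (z + l) τ = c • cubicVec z τ := by
  obtain ⟨m, n, rfl⟩ := hl
  set K := (-1) ^ (m + n) * cexp (-(2 * Real.pi * I * m * z) - Real.pi * I * m ^ 2 * τ) with hK
  set e := cexp (-(Real.pi * I * m)) with he
  have he2 : e ^ 2 = 1 := exp_neg_int_half m
  have hz : theta (z + (m * τ + n)) τ = K * theta z τ := theta_add_lattice z τ m n
  have hh : theta (z + (m * τ + n) + 1 / 2) τ = K * e * theta (z + 1 / 2) τ := by
    rw [show z + (m * τ + n) + 1 / 2 = z + 1 / 2 + (m * τ + n) by ring, theta_add_lattice, hK, he,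
      mul_assoc _ (cexp _) (cexp _), ← Complex.exp_add]
    congr 3
    ring
  have hq : ∃ f : ℂ, f ^ 2 * e = 1 ∧
      theta (z + (m * τ + n) - 1 / 4) τ = K * f * theta (z - 1 / 4) τ := by
    refine ⟨cexp (Real.pi * I * m / 2), ?_, ?_⟩
    · rw [he, ← Complex.exp_nat_mul, ← Complex.exp_add, Complex.exp_eq_one_iff]
      exact ⟨0, by push_cast; ring⟩
    · rw [show z + (m * τ + n) - 1 / 4 = z - 1 / 4 + (m * τ + n) by ring, theta_add_lattice, hK,
        mul_assoc _ (cexp _) (cexp _), ← Complex.exp_add]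
      congr 3
      ring
  obtain ⟨f, hf, hq⟩ := hq
  refine ⟨K ^ 3, pow_ne_zero _ (mul_ne_zero (zpow_ne_zero _ (by norm_num))
    (Complex.exp_ne_zero _)), ?_⟩
  simp only [cubicVec, hz, hh, hq, Matrix.smul_cons, smul_eq_mul, Matrix.smul_empty]
  congr 1
  · linear_combination (K ^ 3 * theta (z + 1 / 2) τ ^ 2 * theta z τ) * he2
  · congr 1
    · linear_combination (K ^ 3 * kappa τ * theta (z - 1 / 4) τ ^ 2 * theta (z + 1 / 2) τ) * hf
    · congr 1
      ring

theorem uCoord_eq_div {z τ : ℂ} (hz : theta z τ ≠ 0) :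
    uCoord z τ = cubicVec z τ 0 / cubicVec z τ 2 := by
  simp only [uCoord, cubicVec, Matrix.cons_val_zero, Matrix.cons_val]
  field_simp

theorem vCoord_eq_div (z τ : ℂ) : vCoord z τ = cubicVec z τ 1 / cubicVec z τ 2 := rfl

theorem uCoord_add_mem {τ l : ℂ} (hl : l ∈ periodLattice τ) (z : ℂ) :
    uCoord (z + l) τ = uCoord z τ := by
  by_cases hz : theta z τ = 0
  · have h1 := (theta_add_mem_eq_zero_iff hl z).mpr hz
    simp [uCoord, hz, h1]
  · have h1 := mt (theta_add_mem_eq_zero_iff hl z).mp hz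
    obtain ⟨c, hc, h⟩ := cubicVec_add_mem hl z
    rw [uCoord_eq_div hz, uCoord_eq_div h1, h]
    simp [mul_div_mul_left, hc]

theorem vCoord_add_mem {τ l : ℂ} (hl : l ∈ periodLattice τ) (z : ℂ) :
    vCoord (z + l) τ = vCoord z τ := by
  obtain ⟨c, hc, h⟩ := cubicVec_add_mem hl z
  rw [vCoord_eq_div, vCoord_eq_div, h]
  simp [mul_div_mul_left, hc]

theorem uCoord_neg (z τ : ℂ) : uCoord (-z) τ = uCoord z τ := by
  rw [uCoord, uCoord, theta_neg, show -z + 1 / 2 = 1 / 2 - z by ring, theta_half_sub, neg_sq]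

theorem vCoord_neg {z : ℂ} {τ : ℍ} (hz : z ∉ periodLattice (τ : ℂ)) :
    vCoord (-z) τ = -vCoord z τ - kappa τ ^ 2 * uCoord z τ := by
  have h0 := (theta_ne_zero_iff τ z).mpr hz
  have h2 := theta_sq_add_quarter z τ
  rw [vCoord, vCoord, uCoord, theta_neg, show -z + 1 / 2 = 1 / 2 - z by ring, theta_half_sub,
    show -z - 1 / 4 = -(z + 1 / 4) by ring, theta_neg]
  generalize theta (z + 1 / 2) τ = A at *
  generalize theta (z - 1 / 4) τ = B at *
  generalize theta (z + 1 / 4) τ = D at *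
  field_simp
  linear_combination (-(kappa τ * A)) * h2

/-- The affine equation of the fibre. -/
theorem uCoord_vCoord_equation {z : ℂ} {τ : ℍ} (hz : z ∉ periodLattice (τ : ℂ)) :
    vCoord z τ ^ 2 + kappa τ ^ 2 * uCoord z τ * vCoord z τ =
      uCoord z τ * (uCoord z τ - 1) ^ 2 := by
  have h0 := (theta_ne_zero_iff τ z).mpr hz
  have h := cubicVec_equation z τ
  rw [uCoord_eq_div h0, vCoord_eq_div]
  have h2 : cubicVec z τ 2 ≠ 0 := pow_ne_zero 3 h0
  field_simp
  linear_combination h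

theorem uCoord_sub_uCoord {z w : ℂ} {τ : ℍ} (hz : z ∉ periodLattice (τ : ℂ))
    (hw : w ∉ periodLattice (τ : ℂ)) : uCoord z τ - uCoord w τ =
      -(theta (1 / 2) τ ^ 2 * (theta (z - w) τ * theta (z + w) τ)) /
        (theta z τ ^ 2 * theta w τ ^ 2) := by
  have h0 := (theta_ne_zero_iff τ z).mpr hz
  have h1 := (theta_ne_zero_iff τ w).mpr hw
  rw [← theta_three_term z w τ.im_pos, uCoord, uCoord]
  field_simp

theorem uCoord_eq_iff {z w : ℂ} {τ : ℍ} (hz : z ∉ periodLattice (τ : ℂ))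
    (hw : w ∉ periodLattice (τ : ℂ)) : uCoord z τ = uCoord w τ ↔
      z - w ∈ periodLattice (τ : ℂ) ∨ z + w ∈ periodLattice (τ : ℂ) := by
  have h0 := (theta_ne_zero_iff τ z).mpr hz
  have h1 := (theta_ne_zero_iff τ w).mpr hw
  have h2 := theta_half_ne_zero τ
  rw [← sub_eq_zero, uCoord_sub_uCoord hz hw, ← theta_eq_zero_iff, ← theta_eq_zero_iff]
  simp only [neg_div, neg_eq_zero, div_eq_zero_iff, mul_eq_zero, pow_eq_zero_iff, ne_eq,
    OfNat.ofNat_ne_zero, not_false_eq_true, h0, h1, h2, or_false, false_or]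

theorem vCoord_neg_eq_of_two_mul_mem {z : ℂ} {τ : ℂ} (h : 2 * z ∈ periodLattice τ) :
    vCoord (-z) τ = vCoord z τ := by
  rw [← vCoord_add_mem h (-z)]
  congr 1
  ring

theorem tau_half_not_mem (τ : ℍ) : (τ / 2 : ℂ) ∉ periodLattice (τ : ℂ) := by
  intro h
  obtain ⟨m, n, h1, -⟩ := coeff_of_mem_periodLattice τ.im_pos (x := 1 / 2) (y := 0)
    (by convert h using 1; push_cast; ring)
  exact ne_intCast_of_mul_eq (a := 1) (b := 2) (by norm_num) (by decide) m h1

theorem tau_half_add_half_not_mem (τ : ℍ) : (τ / 2 + 1 / 2 : ℂ) ∉ periodLattice (τ : ℂ) := by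
  intro h
  obtain ⟨m, n, h1, -⟩ := coeff_of_mem_periodLattice τ.im_pos (x := 1 / 2) (y := 1 / 2)
    (by convert h using 1; push_cast; ring)
  exact ne_intCast_of_mul_eq (a := 1) (b := 2) (by norm_num) (by decide) m h1

theorem uCoord_ne_zero {z : ℂ} {τ : ℍ} (hz : z ∉ periodLattice (τ : ℂ))
    (hz' : z + 1 / 2 ∉ periodLattice (τ : ℂ)) : uCoord z τ ≠ 0 :=
  div_ne_zero (pow_ne_zero _ ((theta_ne_zero_iff τ _).mpr hz'))
    (pow_ne_zero _ ((theta_ne_zero_iff τ _).mpr hz))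

/-- At a point fixed by the inversion other than the origin and `(0, 0)`, the coordinate `U` is a
root of `4 (U - 1)² + a² U`, where `a` is the coefficient `a₁`. -/
theorem quadratic_of_vCoord_neg {z : ℂ} {τ : ℍ} (hz : z ∉ periodLattice (τ : ℂ))
    (hz' : z + 1 / 2 ∉ periodLattice (τ : ℂ)) (h : vCoord (-z) τ = vCoord z τ) :
    4 * (uCoord z τ - 1) ^ 2 + kappa τ ^ 4 * uCoord z τ = 0 := by
  rw [vCoord_neg hz] at h
  apply mul_left_cancel₀ (uCoord_ne_zero hz hz')
  have h1 := uCoord_vCoord_equation hz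
  linear_combination -4 * h1 -
    (2 * vCoord z τ + kappa τ ^ 2 * uCoord z τ) * h

theorem quadratic_tau_half (τ : ℍ) :
    4 * (uCoord (τ / 2) τ - 1) ^ 2 + kappa τ ^ 4 * uCoord (τ / 2) τ = 0 :=
  quadratic_of_vCoord_neg (tau_half_not_mem τ) (tau_half_add_half_not_mem τ)
    (vCoord_neg_eq_of_two_mul_mem ⟨1, 0, by push_cast; ring⟩)

theorem quadratic_tau_half_add_half (τ : ℍ) :
    4 * (uCoord (τ / 2 + 1 / 2) τ - 1) ^ 2 + kappa τ ^ 4 * uCoord (τ / 2 + 1 / 2) τ = 0 := by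
  refine quadratic_of_vCoord_neg (tau_half_add_half_not_mem τ) ?_
    (vCoord_neg_eq_of_two_mul_mem ⟨1, 1, by push_cast; ring⟩)
  intro h
  apply tau_half_not_mem τ
  have := sub_mem h (one_mem_periodLattice τ)
  convert this using 1
  ring

theorem uCoord_tau_half_ne (τ : ℍ) : uCoord (τ / 2) τ ≠ uCoord (τ / 2 + 1 / 2) τ := by
  rw [Ne, uCoord_eq_iff (tau_half_not_mem τ) (tau_half_add_half_not_mem τ)]
  rintro (h | h)
  · apply half_not_mem τ
    convert neg_mem h using 1
    ring
  · apply half_not_mem τ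
    convert sub_mem h (tau_mem_periodLattice τ) using 1
    ring

/-- The discriminant `a² (a² - 16)` of the fibre is not zero. -/
theorem kappa_discriminant_ne_zero (τ : ℍ) : kappa τ ^ 4 * (kappa τ ^ 4 - 16) ≠ 0 := by
  have h1 := quadratic_tau_half τ
  have h2 := quadratic_tau_half_add_half τ
  have h3 := uCoord_tau_half_ne τ
  have hk := kappa_ne_zero τ
  set x := uCoord (τ / 2) τ
  set y := uCoord (τ / 2 + 1 / 2) τ
  have h4 : 4 * (x + y) = 8 - kappa τ ^ 4 := by
    apply mul_left_cancel₀ (sub_ne_zero.mpr h3)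
    linear_combination h1 - h2
  intro h
  have h5 : kappa τ ^ 4 = 16 := by
    rcases mul_eq_zero.mp h with h | h
    · exact absurd h (pow_ne_zero _ hk)
    · linear_combination h
  rw [h5] at h1 h2 h4
  apply h3
  have hx : (x + 1) ^ 2 = 0 := by linear_combination h1 / 4
  have hy : (y + 1) ^ 2 = 0 := by linear_combination h2 / 4
  have hx' := eq_zero_of_pow_eq_zero hx
  have hy' := eq_zero_of_pow_eq_zero hy
  linear_combination hx' - hy'

/-- Only points of order two are fixed by the inversion. -/
theorem two_mul_mem_of_vCoord_neg {z : ℂ} {τ : ℍ} (hz : z ∉ periodLattice (τ : ℂ))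
    (h : vCoord (-z) τ = vCoord z τ) : 2 * z ∈ periodLattice (τ : ℂ) := by
  by_cases hz' : z + 1 / 2 ∈ periodLattice (τ : ℂ)
  · have h1 := sub_mem (add_mem hz' hz') (one_mem_periodLattice τ)
    convert h1 using 1
    ring
  have h0 := quadratic_of_vCoord_neg hz hz' h
  have h1 := quadratic_tau_half τ
  have h2 := quadratic_tau_half_add_half τ
  have h3 := uCoord_tau_half_ne τ
  have ht := tau_half_not_mem τ
  have ht' := tau_half_add_half_not_mem τ
  have h4 : (uCoord z τ - uCoord (τ / 2) τ) * (uCoord z τ - uCoord (τ / 2 + 1 / 2) τ) = 0 := by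
    apply mul_left_cancel₀ (sub_ne_zero.mpr h3)
    generalize uCoord z τ = u at *
    generalize uCoord (τ / 2) τ = x at *
    generalize uCoord (τ / 2 + 1 / 2) τ = y at *
    linear_combination (x - y) / 4 * h0 + (y - u) / 4 * h1 + (u - x) / 4 * h2
  rcases mul_eq_zero.mp h4 with h4 | h4
  · rcases (uCoord_eq_iff hz ht).mp (sub_eq_zero.mp h4) with h5 | h5
    · convert add_mem (add_mem h5 h5) (tau_mem_periodLattice τ) using 1
      ring
    · convert sub_mem (add_mem h5 h5) (tau_mem_periodLattice τ) using 1
      ring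
  · have hl := add_mem (tau_mem_periodLattice (τ : ℂ)) (one_mem_periodLattice τ)
    rcases (uCoord_eq_iff hz ht').mp (sub_eq_zero.mp h4) with h5 | h5
    · convert add_mem (add_mem h5 h5) hl using 1
      ring
    · convert sub_mem (add_mem h5 h5) hl using 1
      ring

/-- The affine coordinates determine the parameter modulo the lattice. -/
theorem sub_mem_of_coord_eq {z w : ℂ} {τ : ℍ} (hz : z ∉ periodLattice (τ : ℂ))
    (hw : w ∉ periodLattice (τ : ℂ)) (hu : uCoord z τ = uCoord w τ)
    (hv : vCoord z τ = vCoord w τ) : z - w ∈ periodLattice (τ : ℂ) := by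
  rcases (uCoord_eq_iff hz hw).mp hu with h | h
  · exact h
  · have h1 : vCoord (-z) τ = vCoord z τ := by
      rw [hv, ← vCoord_add_mem h (-z)]
      congr 1
      ring
    convert sub_mem (two_mul_mem_of_vCoord_neg hz h1) h using 1
    ring

/-- **Liouville's theorem** for entire doubly periodic functions. -/
theorem eq_const_of_doublyPeriodic {τ : ℂ} (hτ : 0 < τ.im) {f : ℂ → ℂ} (hf : Differentiable ℂ f)
    (h : ∀ l ∈ periodLattice τ, ∀ z, f (z + l) = f z) (z w : ℂ) : f z = f w := by
  refine hf.apply_eq_apply_of_bounded ?_ z w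
  have hc : IsCompact ((fun q : ℝ × ℝ => f (q.1 * τ + q.2)) '' (Set.Icc 0 1 ×ˢ Set.Icc 0 1)) := by
    refine (isCompact_Icc.prod isCompact_Icc).image ?_
    have := hf.continuous
    fun_prop
  refine hc.isBounded.subset ?_
  rintro _ ⟨z, rfl⟩
  obtain ⟨x, y, rfl⟩ := exists_real_coeff hτ z
  refine ⟨(Int.fract x, Int.fract y), ⟨⟨Int.fract_nonneg _, (Int.fract_lt_one _).le⟩,
    ⟨Int.fract_nonneg _, (Int.fract_lt_one _).le⟩⟩, ?_⟩
  have hl : (-⌊x⌋ : ℤ) * τ + (-⌊y⌋ : ℤ) ∈ periodLattice τ := ⟨-⌊x⌋, -⌊y⌋, rfl⟩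
  rw [← h _ hl (x * τ + y)]
  simp only [Int.fract]
  congr 1
  push_cast
  ring

/-- If `U` were not a value of the coordinate, the reciprocal of the coordinate minus `U` would be
an entire elliptic function, hence constant. -/
theorem exists_uCoord_eq (τ : ℍ) (U : ℂ) : ∃ z, z ∉ periodLattice (τ : ℂ) ∧ uCoord z τ = U := by
  have hθ := differentiable_theta τ.im_pos
  by_contra! hne
  set G : ℂ → ℂ := fun z => theta (z + 1 / 2) τ ^ 2 - U * theta z τ ^ 2 with hG
  have hG0 : ∀ z, G z ≠ 0 := by
    intro z h0
    by_cases hz : z ∈ periodLattice (τ : ℂ)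
    · have h1 := (theta_eq_zero_iff τ z).mpr hz
      rw [hG] at h0
      simp only [h1] at h0
      have h2 : theta (z + 1 / 2) τ = 0 := by simpa using h0
      apply half_not_mem τ
      have := sub_mem ((theta_eq_zero_iff τ _).mp h2) hz
      simpa using this
    · apply hne z hz
      have h1 := (theta_ne_zero_iff τ z).mpr hz
      rw [uCoord, div_eq_iff (pow_ne_zero _ h1)]
      exact sub_eq_zero.mp h0
  have hf : Differentiable ℂ fun z => theta z τ ^ 2 / G z := by
    refine Differentiable.div (by fun_prop) ?_ hG0
    have : Differentiable ℂ fun z => theta (z + 1 / 2) τ := hθ.comp (by fun_prop)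
    fun_prop
  have hper : ∀ l ∈ periodLattice (τ : ℂ), ∀ z, theta (z + l) τ ^ 2 / G (z + l) =
      theta z τ ^ 2 / G z := by
    rintro _ ⟨m, n, rfl⟩ z
    have e1 := theta_add_lattice z τ m n
    have e2 := theta_add_lattice (z + 1 / 2) τ m n
    have e3 : (cexp (-(2 * Real.pi * I * m * (z + 1 / 2)) - Real.pi * I * m ^ 2 * τ)) ^ 2 =
        (cexp (-(2 * Real.pi * I * m * z) - Real.pi * I * m ^ 2 * τ)) ^ 2 := by
      rw [← Complex.exp_nat_mul, ← Complex.exp_nat_mul]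
      apply Complex.exp_eq_exp_iff_exists_int.mpr
      exact ⟨-m, by push_cast; ring⟩
    have hK : ((-1) ^ (m + n) *
        cexp (-(2 * Real.pi * I * m * z) - Real.pi * I * m ^ 2 * τ)) ^ 2 ≠ 0 :=
      pow_ne_zero _ (mul_ne_zero (zpow_ne_zero _ (by norm_num)) (Complex.exp_ne_zero _))
    have hGl : G (z + (m * τ + n)) = ((-1) ^ (m + n) *
        cexp (-(2 * Real.pi * I * m * z) - Real.pi * I * m ^ 2 * τ)) ^ 2 * G z := by
      simp only [hG]
      rw [show z + (m * τ + n) + 1 / 2 = z + 1 / 2 + (m * τ + n) by ring, e1, e2]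
      linear_combination (((-1) ^ (m + n)) ^ 2 * theta (z + 1 / 2) τ ^ 2) * e3
    rw [hGl, e1, mul_pow, mul_div_mul_left _ _ hK]
  have h1 := eq_const_of_doublyPeriodic τ.im_pos hf hper (1 / 2) 0
  simp only [theta_zero] at h1
  have h2 : theta (1 / 2) τ ^ 2 / G (1 / 2) ≠ 0 :=
    div_ne_zero (pow_ne_zero _ (theta_half_ne_zero τ)) (hG0 _)
  exact h2 (by rw [h1]; simp)

/-- Every affine point of the fibre is parametrised. -/
theorem exists_coord_eq (τ : ℍ) {U V : ℂ} (h : V ^ 2 + kappa τ ^ 2 * U * V = U * (U - 1) ^ 2) :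
    ∃ z, z ∉ periodLattice (τ : ℂ) ∧ uCoord z τ = U ∧ vCoord z τ = V := by
  obtain ⟨z, hz, rfl⟩ := exists_uCoord_eq τ U
  have h1 := uCoord_vCoord_equation hz
  have h2 : (V - vCoord z τ) * (V + vCoord z τ + kappa τ ^ 2 * uCoord z τ) = 0 := by
    linear_combination h - h1
  rcases mul_eq_zero.mp h2 with h2 | h2
  · exact ⟨z, hz, rfl, (sub_eq_zero.mp h2).symm⟩
  · refine ⟨-z, fun hn => hz (by simpa using neg_mem hn), uCoord_neg z τ, ?_⟩
    rw [vCoord_neg hz]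
    linear_combination -h2

end ModularFibration

namespace ModularFibration

open Complex Filter

/-! ### The smooth locus of the Weierstrass family -/

theorem num_mul_eq_of_mul_eq {f : RatFunc ℂ} {p q : Polynomial ℂ}
    (h : f * algebraMap (Polynomial ℂ) (RatFunc ℂ) q = algebraMap (Polynomial ℂ) (RatFunc ℂ) p) :
    f.num * q = p * f.denom := by
  apply RatFunc.algebraMap_injective
  rw [map_mul, map_mul, ← h]
  have h1 := RatFunc.num_div_denom f
  have h2 : algebraMap (Polynomial ℂ) (RatFunc ℂ) f.denom ≠ 0 :=
    RatFunc.algebraMap_ne_zero f.denom_ne_zero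
  nth_rewrite 2 [← h1]
  field_simp

theorem denom_eval_ne_zero_of_mul_eq {f : RatFunc ℂ} {p q : Polynomial ℂ}
    (h : f * algebraMap (Polynomial ℂ) (RatFunc ℂ) q = algebraMap (Polynomial ℂ) (RatFunc ℂ) p)
    {a : ℂ} (hq : q.eval a ≠ 0) : f.denom.eval a ≠ 0 := by
  have h1 := congrArg (Polynomial.eval a) (num_mul_eq_of_mul_eq h)
  rw [Polynomial.eval_mul, Polynomial.eval_mul] at h1
  intro h0
  rw [h0, mul_zero] at h1
  have hn := (mul_eq_zero.mp h1).resolve_right hq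
  obtain ⟨u, v, huv⟩ := RatFunc.isCoprime_num_denom f
  have h2 := congrArg (Polynomial.eval a) huv
  simp [hn, h0] at h2

theorem eval_eq_of_mul_eq {f : RatFunc ℂ} {p q : Polynomial ℂ}
    (h : f * algebraMap (Polynomial ℂ) (RatFunc ℂ) q = algebraMap (Polynomial ℂ) (RatFunc ℂ) p)
    {a : ℂ} (hq : q.eval a ≠ 0) : f.eval (RingHom.id ℂ) a = p.eval a / q.eval a := by
  have h1 := congrArg (Polynomial.eval a) (num_mul_eq_of_mul_eq h)
  rw [Polynomial.eval_mul, Polynomial.eval_mul] at h1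
  have hd := denom_eval_ne_zero_of_mul_eq h hq
  rw [RatFunc.eval, Polynomial.eval₂_id, Polynomial.eval₂_id, div_eq_div_iff hd hq, h1]

theorem E_a₁_mul : E.a₁ * algebraMap (Polynomial ℂ) (RatFunc ℂ) Polynomial.X =
    algebraMap (Polynomial ℂ) (RatFunc ℂ) ((Polynomial.X - 1) ^ 2) := by
  have h : (RatFunc.X : RatFunc ℂ) ≠ 0 := RatFunc.X_ne_zero
  simp only [E, s, map_pow, map_sub, map_one, RatFunc.algebraMap_X]
  field_simp
  ring

theorem neg_two_eq_C : (-2 : RatFunc ℂ) = RatFunc.C (-2) := by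
  rw [map_neg, map_ofNat]

theorem fibre_E {a : ℂ} (ha : a ≠ 0) : fibre E a = ⟨a + 1 / a - 2, -2, 0, 1, 0⟩ := by
  have h2 : RatFunc.eval (RingHom.id ℂ) a (-2 : RatFunc ℂ) = -2 := by
    rw [neg_two_eq_C, RatFunc.eval_C]
    rfl
  ext
  · change E.a₁.eval (RingHom.id ℂ) a = _
    rw [eval_eq_of_mul_eq E_a₁_mul (by simpa using ha)]
    simp
    field_simp
    ring
  · exact h2
  · exact RatFunc.eval_zero _ _
  · exact RatFunc.eval_one _ _
  · exact RatFunc.eval_zero _ _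

theorem mem_smoothLocus_E_iff (a : ℂ) : a ∈ smoothLocus E ↔ a ≠ 0 ∧
    (a + 1 / a - 2) ^ 2 * ((a + 1 / a - 2) ^ 2 - 16) ≠ 0 := by
  have hΔ : ∀ {a : ℂ}, a ≠ 0 →
      (fibre E a).Δ = (a + 1 / a - 2) ^ 2 * ((a + 1 / a - 2) ^ 2 - 16) := by
    intro a ha
    rw [fibre_E ha]
    simp only [WeierstrassCurve.Δ, WeierstrassCurve.b₂, WeierstrassCurve.b₄, WeierstrassCurve.b₆,
      WeierstrassCurve.b₈]
    ring
  constructor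
  · rintro ⟨h1, h2⟩
    have ha : a ≠ 0 := by
      rintro rfl
      have h3 := h1 E.a₁ (by simp)
      have h4 := congrArg (Polynomial.eval 0) (num_mul_eq_of_mul_eq E_a₁_mul)
      simp at h4
      exact h3 h4.symm
    exact ⟨ha, hΔ ha ▸ h2⟩
  · rintro ⟨ha, h⟩
    refine ⟨?_, (hΔ ha).symm ▸ h⟩
    have key : ∀ c : ℂ, (RatFunc.C c).denom.eval a ≠ 0 := by
      intro c
      apply denom_eval_ne_zero_of_mul_eq (p := Polynomial.C c) (q := 1)
      · simp
      · simp
    intro f hf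
    simp only [Set.mem_insert_iff, Set.mem_singleton_iff] at hf
    rcases hf with rfl | rfl | rfl | rfl | rfl
    · exact denom_eval_ne_zero_of_mul_eq E_a₁_mul (by simpa using ha)
    · change (-2 : RatFunc ℂ).denom.eval a ≠ 0
      rw [neg_two_eq_C]
      exact key (-2)
    · simp [E]
    · simp [E]
    · simp [E]

theorem hauptmodul_mem_smoothLocus (τ : ℍ) : hauptmodul τ ∈ smoothLocus E := by
  rw [mem_smoothLocus_E_iff, ← kappa_sq]
  refine ⟨hauptmodul_ne_zero τ, ?_⟩
  convert kappa_discriminant_ne_zero τ using 1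
  ring

/-! ### The uniformisation -/

/-- The holomorphic map from `ℍ × ℂ` to the elliptic surface. -/
noncomputable def uniformisation (q : ℍ × ℂ) : ℂ × Projectivization ℂ (Fin 3 → ℂ) :=
  (hauptmodul q.1, Projectivization.mk ℂ (cubicVec q.2 q.1) (cubicVec_ne_zero q.2 q.1))

theorem contDiffAt_theta_comp {g : ℂ × ℂ → ℂ} {q : ℂ × ℂ} (hq : 0 < q.1.im)
    (hg : ContDiffAt ℂ 1 g q) : ContDiffAt ℂ 1 (fun p : ℂ × ℂ => theta (g p) p.1) q := by
  have h := contDiffAt_theta (g q) hq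
  exact ContDiffAt.comp (g := fun p : ℂ × ℂ => theta p.1 p.2) (f := fun p : ℂ × ℂ => (g p, p.1))
    q h (hg.prodMk contDiffAt_fst)

theorem contDiffAt_kappa {q : ℂ × ℂ} (hq : 0 < q.1.im) :
    ContDiffAt ℂ 1 (fun p : ℂ × ℂ => kappa p.1) q := by
  have h := theta_quarter_ne_zero ⟨q.1, hq⟩
  have h1 : ContDiffAt ℂ 1 (fun p : ℂ × ℂ => theta (1 / 2) p.1) q :=
    contDiffAt_theta_comp hq contDiffAt_const
  have h2 : ContDiffAt ℂ 1 (fun p : ℂ × ℂ => theta (1 / 4) p.1) q :=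
    contDiffAt_theta_comp hq contDiffAt_const
  exact (h1.pow 2).div (h2.pow 2) (pow_ne_zero 2 h)

theorem contDiffAt_cubicVec_apply (i : Fin 3) {q : ℂ × ℂ} (hq : 0 < q.1.im) :
    ContDiffAt ℂ 1 (fun p : ℂ × ℂ => cubicVec p.2 p.1 i) q := by
  have h0 : ContDiffAt ℂ 1 (fun p : ℂ × ℂ => theta p.2 p.1) q :=
    contDiffAt_theta_comp hq contDiffAt_snd
  have h1 : ContDiffAt ℂ 1 (fun p : ℂ × ℂ => theta (p.2 + 1 / 2) p.1) q :=
    contDiffAt_theta_comp hq (contDiffAt_snd.add contDiffAt_const)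
  have h2 : ContDiffAt ℂ 1 (fun p : ℂ × ℂ => theta (p.2 - 1 / 4) p.1) q :=
    contDiffAt_theta_comp hq (contDiffAt_snd.sub contDiffAt_const)
  fin_cases i
  · exact (h1.pow 2).mul h0
  · exact ((contDiffAt_kappa hq).mul (h2.pow 2)).mul h1
  · exact h0.pow 3

theorem differentiableAt_hauptmodul {τ : ℂ} (hτ : 0 < τ.im) :
    DifferentiableAt ℂ hauptmodul τ := by
  have h := theta_eighth_ne_zero ⟨τ, hτ⟩
  have key : ∀ c : ℂ, DifferentiableAt ℂ (fun σ : ℂ => theta c σ) τ := fun c =>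
    (differentiableAt_theta c hτ).comp (f := fun σ : ℂ => (c, σ)) τ (by fun_prop)
  exact ((key (3 / 8)).pow 2).div ((key (1 / 8)).pow 2) (pow_ne_zero 2 h)

theorem isHolomorphic_uniformisation : IsHolomorphic uniformisation := by
  intro p
  refine ⟨fun q => hauptmodul q.1, fun q => cubicVec q.2 q.1, Eventually.of_forall fun q => ?_⟩
  refine ⟨(differentiableAt_hauptmodul q.1.im_pos).comp (f := Prod.fst) ((q.1 : ℂ), q.2)
    differentiableAt_fst, ?_, cubicVec_ne_zero q.2 q.1, rfl⟩
  rw [differentiableAt_pi]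
  exact fun i => (contDiffAt_cubicVec_apply i (q := ((q.1 : ℂ), q.2)) q.1.im_pos).differentiableAt
    one_ne_zero

theorem uniformisation_zero (τ : ℍ) : (uniformisation (τ, 0)).2 = zeroPoint := by
  rw [uniformisation, zeroPoint]
  dsimp only
  rw [Projectivization.mk_eq_mk_iff']
  refine ⟨cubicVec 0 τ 1, ?_⟩
  funext i
  fin_cases i <;> simp [cubicVec]

/-- Two parameters give the same point of a fibre if and only if they differ by a period. -/
theorem mk_cubicVec_eq_iff (τ : ℍ) (z w : ℂ) :
    Projectivization.mk ℂ (cubicVec z τ) (cubicVec_ne_zero z τ) =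
      Projectivization.mk ℂ (cubicVec w τ) (cubicVec_ne_zero w τ) ↔
    z - w ∈ periodLattice (τ : ℂ) := by
  rw [Projectivization.mk_eq_mk_iff']
  constructor
  · rintro ⟨c, hc⟩
    have hc0 : c ≠ 0 := by
      rintro rfl
      exact cubicVec_ne_zero z τ (by rw [← hc, zero_smul])
    by_cases hw : w ∈ periodLattice (τ : ℂ)
    · have h2 := congrFun hc 2
      have h3 : cubicVec w τ 2 = 0 := by
        simp [cubicVec, (theta_eq_zero_iff τ w).mpr hw]
      rw [Pi.smul_apply, h3, smul_zero] at h2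
      have h4 : theta z τ ^ 3 = 0 := h2.symm
      exact sub_mem ((theta_eq_zero_iff τ z).mp (eq_zero_of_pow_eq_zero h4)) hw
    · have hw' := (theta_ne_zero_iff τ w).mpr hw
      have hz' : theta z τ ≠ 0 := by
        intro h0
        have h2 := congrFun hc 2
        have h3 : cubicVec z τ 2 = 0 := by simp [cubicVec, h0]
        rw [h3, Pi.smul_apply, smul_eq_mul] at h2
        exact (mul_ne_zero hc0 (pow_ne_zero 3 hw')) h2
      refine sub_mem_of_coord_eq ((theta_ne_zero_iff τ z).mp hz') hw ?_ ?_
      · rw [uCoord_eq_div hz', uCoord_eq_div hw', ← hc]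
        simp [mul_div_mul_left, hc0]
      · rw [vCoord_eq_div, vCoord_eq_div, ← hc]
        simp [mul_div_mul_left, hc0]
  · intro h
    obtain ⟨c, hc, h1⟩ := cubicVec_add_mem h w
    rw [add_sub_cancel] at h1
    exact ⟨c, h1.symm⟩

theorem fibre_equation_iff (τ : ℍ) (P : Fin 3 → ℂ) :
    (fibre E (hauptmodul τ)).toProjective.Equation P ↔
      P 1 ^ 2 * P 2 + kappa τ ^ 2 * P 0 * P 1 * P 2 = P 0 * (P 0 - P 2) ^ 2 := by
  rw [WeierstrassCurve.Projective.equation_iff, fibre_E (hauptmodul_ne_zero τ), kappa_sq]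
  constructor <;> intro h <;> linear_combination h

theorem exists_smul_rep_eq (v : Fin 3 → ℂ) (hv : v ≠ 0) :
    ∃ c : ℂ, c ≠ 0 ∧ (Projectivization.mk ℂ v hv).rep = c • v := by
  have h := Projectivization.mk_rep (Projectivization.mk ℂ v hv)
  rw [Projectivization.mk_eq_mk_iff'] at h
  obtain ⟨c, hc⟩ := h
  refine ⟨c, ?_, hc.symm⟩
  rintro rfl
  exact Projectivization.rep_nonzero (Projectivization.mk ℂ v hv) (by rw [← hc, zero_smul])

theorem uniformisation_mem_smoothPart (q : ℍ × ℂ) : uniformisation q ∈ smoothPart E := by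
  refine ⟨hauptmodul_mem_smoothLocus q.1, ?_⟩
  change (fibre E (hauptmodul q.1)).toProjective.Equation
    (Projectivization.mk ℂ (cubicVec q.2 q.1) (cubicVec_ne_zero q.2 q.1)).rep
  obtain ⟨c, hc, h⟩ := exists_smul_rep_eq (cubicVec q.2 q.1) (cubicVec_ne_zero q.2 q.1)
  rw [h, fibre_equation_iff]
  have := cubicVec_equation q.2 q.1
  simp only [Pi.smul_apply, smul_eq_mul]
  linear_combination c ^ 3 * this

/-- The uniformisation maps onto every fibre over a value of the Hauptmodul. -/
theorem exists_uniformisation_eq (τ : ℍ) {P : Fin 3 → ℂ} (hP : P ≠ 0)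
    (h : P 1 ^ 2 * P 2 + kappa τ ^ 2 * P 0 * P 1 * P 2 = P 0 * (P 0 - P 2) ^ 2) :
    ∃ z, Projectivization.mk ℂ (cubicVec z τ) (cubicVec_ne_zero z τ) = Projectivization.mk ℂ P hP := by
  by_cases h2 : P 2 = 0
  · have h0 : P 0 = 0 := by
      rw [h2] at h
      have : P 0 ^ 3 = 0 := by linear_combination -h
      exact eq_zero_of_pow_eq_zero this
    have h1 : P 1 ≠ 0 := by
      intro h1
      apply hP
      funext i
      fin_cases i
      exacts [h0, h1, h2]
    refine ⟨0, ?_⟩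
    rw [Projectivization.mk_eq_mk_iff']
    refine ⟨cubicVec 0 τ 1 / P 1, ?_⟩
    funext i
    fin_cases i
    · simp [h0, cubicVec]
    · simp [h1]
    · simp [h2, cubicVec]
  · obtain ⟨z, hz, hu, hv⟩ := exists_coord_eq τ (U := P 0 / P 2) (V := P 1 / P 2) (by
      field_simp
      linear_combination h)
    refine ⟨z, ?_⟩
    have hz' := (theta_ne_zero_iff τ z).mpr hz
    have h3 : cubicVec z τ 2 ≠ 0 := pow_ne_zero 3 hz'
    rw [uCoord_eq_div hz', div_eq_div_iff h3 h2] at hu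
    rw [vCoord_eq_div, div_eq_div_iff h3 h2] at hv
    rw [Projectivization.mk_eq_mk_iff']
    refine ⟨cubicVec z τ 2 / P 2, ?_⟩
    funext i
    rw [Pi.smul_apply, smul_eq_mul, div_mul_eq_mul_div, div_eq_iff h2]
    fin_cases i
    · simp only [Fin.zero_eta]; linear_combination -hu
    · simp only [Fin.mk_one]; linear_combination -hv
    · rfl

/-! ### Invariance under `Γ₁(8)` -/

/-- The lower row of a matrix in `Γ₁(8)`. -/
theorem gamma1_entries {γ : SL(2, ℤ)} (hγ : γ ∈ CongruenceSubgroup.Gamma1 8) :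
    ∃ c d : ℤ, γ 1 0 = 8 * c ∧ γ 1 1 = 8 * d + 1 := by
  rw [CongruenceSubgroup.Gamma1_mem] at hγ
  obtain ⟨-, h1, h0⟩ := hγ
  obtain ⟨c, hc⟩ := (ZMod.intCast_zmod_eq_zero_iff_dvd _ 8).mp h0
  have h2 : ((γ 1 1 - 1 : ℤ) : ZMod 8) = 0 := by push_cast; rw [h1]; ring
  obtain ⟨d, hd⟩ := (ZMod.intCast_zmod_eq_zero_iff_dvd _ 8).mp h2
  exact ⟨c, d, by exact_mod_cast hc, by push_cast at hd; linarith⟩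

/-- The transformation of theta, translated by quarter periods, under `Γ₁(8)`: all translates by
quarter periods acquire the same factor, up to a constant independent of the parameter. -/
theorem theta_smul_add {γ : SL(2, ℤ)} (hγ : γ ∈ CongruenceSubgroup.Gamma1 8) (τ : ℍ) :
    ∃ ε : ℂ, ε ≠ 0 ∧ ∀ z : ℂ, ∃ K : ℂ, K ≠ 0 ∧
      theta (z / autFactor γ τ) (γ • τ : ℍ) = K * theta z τ ∧
      theta (z / autFactor γ τ + 1 / 2) (γ • τ : ℍ) = K * theta (z + 1 / 2) τ ∧
      theta (z / autFactor γ τ - 1 / 4) (γ • τ : ℍ) = K * ε * theta (z - 1 / 4) τ ∧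
      theta (z / autFactor γ τ + 1 / 4) (γ • τ : ℍ) = K * ε * theta (z + 1 / 4) τ := by
  obtain ⟨c, d, hc, hd⟩ := gamma1_entries hγ
  obtain ⟨C, hC, h⟩ := theta_smul γ τ
  have hj := autFactor_ne_zero γ τ
  have hjj : autFactor γ τ = 8 * c * τ + (8 * d + 1) := by
    rw [autFactor, hc, hd]; push_cast; ring
  -- the translate by `k / 4` is governed by the period `2 k (c τ + d)`
  have key : ∀ (k : ℤ) (z : ℂ), theta (z / autFactor γ τ + k / 4) (γ • τ : ℍ) =
      C * cexp (Real.pi * I * (8 * c) * z ^ 2 / autFactor γ τ) *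
        cexp (Real.pi * I * (c * (8 * d - 1) * k ^ 2 / 2)) * theta (z + k / 4) τ := by
    intro k z
    have e1 := h (z + k / 4 * autFactor γ τ)
    rw [add_div, mul_div_cancel_right₀ _ hj] at e1
    rw [e1, show z + k / 4 * autFactor γ τ =
      z + k / 4 + ((2 * (k * c) : ℤ) * (τ : ℂ) + (2 * (k * d) : ℤ)) by
        rw [hjj]; push_cast; ring, theta_add_lattice, hc,
      show 2 * (k * c) + 2 * (k * d) = 2 * (k * c + k * d) by ring, zpow_mul]
    norm_num
    have : cexp (Real.pi * I * (8 * c) * (z + k / 4 + (2 * (k * c) * (τ : ℂ) + 2 * (k * d))) ^ 2 /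
        autFactor γ τ) * cexp (-(2 * Real.pi * I * (2 * (k * c)) * (z + k / 4)) -
          Real.pi * I * (2 * (k * c)) ^ 2 * τ) =
        cexp (Real.pi * I * (8 * c) * z ^ 2 / autFactor γ τ) *
        cexp (Real.pi * I * (c * (8 * d - 1) * k ^ 2 / 2)) := by
      rw [← Complex.exp_add, ← Complex.exp_add]
      congr 1
      have e : z + k / 4 + (2 * (k * c) * (τ : ℂ) + 2 * (k * d)) =
        z + k / 4 * autFactor γ τ := by rw [hjj]; ring
      rw [e]
      generalize hJ : autFactor γ τ = J at *
      field_simp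
      rw [hjj]
      ring
    linear_combination (C * theta (z + k / 4) τ) * this
  have e2 : cexp (Real.pi * I * (c * (8 * d - 1) * (2 : ℂ) ^ 2 / 2)) = 1 := by
    rw [Complex.exp_eq_one_iff]
    exact ⟨c * (8 * d - 1), by push_cast; ring⟩
  refine ⟨cexp (Real.pi * I * (c * (8 * d - 1) / 2)), Complex.exp_ne_zero _, fun z =>
    ⟨C * cexp (Real.pi * I * (8 * c) * z ^ 2 / autFactor γ τ),
      mul_ne_zero hC (Complex.exp_ne_zero _), ?_, ?_, ?_, ?_⟩⟩
  · have := key 0 z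
    simpa using this
  · have := key 2 z
    push_cast at this
    rw [e2, mul_one, show (2 / 4 : ℂ) = 1 / 2 by norm_num] at this
    exact this
  · have := key (-1) z
    push_cast at this
    rw [neg_div, ← sub_eq_add_neg, ← sub_eq_add_neg] at this
    rw [this]
    congr 4
    ring
  · have := key 1 z
    push_cast at this
    rw [this]
    congr 4
    ring

theorem cubicVec_smul {γ : SL(2, ℤ)} (hγ : γ ∈ CongruenceSubgroup.Gamma1 8) (τ : ℍ) (z : ℂ) :
    ∃ K : ℂ, K ≠ 0 ∧ cubicVec (z / autFactor γ τ) (γ • τ : ℍ) = K • cubicVec z τ := by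
  obtain ⟨ε, hε, h⟩ := theta_smul_add hγ τ
  obtain ⟨K, hK, h0, h1, h2, -⟩ := h z
  obtain ⟨L, hL, -, g1, -, g3⟩ := h 0
  simp only [zero_div, zero_add] at g1 g3
  have hκ : kappa (γ • τ : ℍ) * ε ^ 2 = kappa τ := by
    rw [kappa, kappa, g1, g3]
    have := theta_quarter_ne_zero τ
    field_simp
  refine ⟨K ^ 3, pow_ne_zero 3 hK, ?_⟩
  simp only [cubicVec, h0, h1, h2, Matrix.smul_cons, smul_eq_mul, Matrix.smul_empty]
  congr 1
  · ring
  · congr 1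
    · linear_combination (K ^ 3 * theta (z - 1 / 4) τ ^ 2 * theta (z + 1 / 2) τ) * hκ
    · congr 1
      ring

theorem uCoord_smul {γ : SL(2, ℤ)} (hγ : γ ∈ CongruenceSubgroup.Gamma1 8) (τ : ℍ) (z : ℂ) :
    uCoord (z / autFactor γ τ) (γ • τ : ℍ) = uCoord z τ := by
  obtain ⟨ε, hε, h⟩ := theta_smul_add hγ τ
  obtain ⟨K, hK, h0, h1, -, -⟩ := h z
  rw [uCoord, uCoord, h0, h1, mul_pow, mul_pow, mul_div_mul_left _ _ (pow_ne_zero 2 hK)]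

theorem uCoord_eighth (τ : ℂ) : uCoord (1 / 8) τ = hauptmodul τ := by
  rw [uCoord, hauptmodul, show (1 / 8 + 1 / 2 : ℂ) = 1 / 2 - (-1 / 8) by norm_num, theta_half_sub,
    show (-1 / 8 + 1 / 2 : ℂ) = 3 / 8 by norm_num]

theorem hauptmodul_smul {γ : SL(2, ℤ)} (hγ : γ ∈ CongruenceSubgroup.Gamma1 8) (τ : ℍ) :
    hauptmodul (γ • τ : ℍ) = hauptmodul τ := by
  obtain ⟨c, d, hc, hd⟩ := gamma1_entries hγ
  have hj := autFactor_ne_zero γ τ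
  have h := uCoord_smul hγ τ (autFactor γ τ / 8)
  rw [div_right_comm, div_self hj, uCoord_eighth] at h
  have hl : (c : ℂ) * τ + d ∈ periodLattice (τ : ℂ) := ⟨c, d, rfl⟩
  rw [h, ← uCoord_eighth, ← uCoord_add_mem hl (1 / 8), autFactor, hc, hd]
  congr 1
  push_cast
  ring

theorem uniformisation_smul {γ : SL(2, ℤ)} (hγ : γ ∈ CongruenceSubgroup.Gamma1 8) (τ : ℍ)
    (z : ℂ) : uniformisation (γ • τ, z / autFactor γ τ) = uniformisation (τ, z) := by
  obtain ⟨K, hK, h⟩ := cubicVec_smul hγ τ z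
  rw [uniformisation, uniformisation]
  dsimp only
  rw [hauptmodul_smul hγ]
  congr 1
  rw [Projectivization.mk_eq_mk_iff']
  exact ⟨K, h.symm⟩

end ModularFibration

namespace ModularFibration

open Complex Filter

/-! ### Local lifts through the uniformisation -/

/-- The products `θ(x + y) θ(x - y)` satisfy the Plücker relation of `2 × 2` minors. -/
theorem theta_plucker (x y a b : ℂ) {τ : ℂ} (hτ : 0 < τ.im) :
    theta (x + a) τ * theta (x - a) τ * (theta (y + b) τ * theta (y - b) τ) -
      theta (x + b) τ * theta (x - b) τ * (theta (y + a) τ * theta (y - a) τ) =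
    theta (x + y) τ * theta (x - y) τ * (theta (a + b) τ * theta (a - b) τ) := by
  simp only [theta_mul_theta _ _ hτ]
  ring

/-- The minor of the linear forms `U`, `W` (lines through the point `(0 : 1 : 0)`). -/
theorem cubicVec_minor_zero_two (z w : ℂ) (τ : ℍ) :
    cubicVec z τ 0 * cubicVec w τ 2 - cubicVec z τ 2 * cubicVec w τ 0 =
      -theta (1 / 2) τ ^ 2 * (theta (z + 0) τ * theta (w + 0) τ) *
        (theta (z - w) τ * theta (z + w + 0) τ) := by
  have h := theta_three_term z w τ.im_pos
  simp only [cubicVec, Matrix.cons_val_zero, Matrix.cons_val, add_zero]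
  linear_combination theta z τ * theta w τ * h

/-- The minor of the linear forms `U - W`, `V` (lines through the point `(1 : 0 : 1)`), which serves
where the other pencil of lines is tangent to the fibre or has its centre. -/
theorem cubicVec_minor_sub_one (z w : ℂ) (τ : ℍ) :
    (cubicVec z τ 0 - cubicVec z τ 2) * cubicVec w τ 1 -
        cubicVec z τ 1 * (cubicVec w τ 0 - cubicVec w τ 2) =
      kappa τ ^ 2 * theta (1 / 2) τ * theta (1 / 4) τ *
        (theta (z + -1 / 4) τ * theta (w + -1 / 4) τ) *
        (theta (z - w) τ * theta (z + w + 1 / 4) τ) := by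
  have h := theta_plucker (z + 1 / 8) (w + 1 / 8) (1 / 8) (3 / 8) τ.im_pos
  have h1 := theta_sq_sub_theta_sq z τ
  have h2 := theta_sq_sub_theta_sq w τ
  simp only [show ∀ x : ℂ, x + 1 / 8 + 1 / 8 = x + 1 / 4 from fun x => by ring,
    show ∀ x : ℂ, x + 1 / 8 + 3 / 8 = x + 1 / 2 from fun x => by ring,
    show ∀ x : ℂ, x + 1 / 8 - 3 / 8 = x - 1 / 4 from fun x => by ring,
    add_sub_cancel_right, add_sub_add_right_eq_sub,
    show z + 1 / 8 + (w + 1 / 8) = z + w + 1 / 4 by ring,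
    show (1 / 8 + 3 / 8 : ℂ) = 1 / 2 by norm_num,
    show (1 / 8 - 3 / 8 : ℂ) = -(1 / 4) by norm_num, theta_neg] at h
  simp only [cubicVec, Matrix.cons_val_zero, Matrix.cons_val_one, Matrix.cons_val, neg_div,
    ← sub_eq_add_neg]
  linear_combination (-kappa τ ^ 2 * theta (z - 1 / 4) τ * theta (w - 1 / 4) τ) * h +
    (kappa τ * theta z τ * theta (w - 1 / 4) τ ^ 2 * theta (w + 1 / 2) τ) * h1 -
    (kappa τ * theta w τ * theta (z - 1 / 4) τ ^ 2 * theta (z + 1 / 2) τ) * h2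

/-- Being a multiple of a given nonzero vector is a closed condition. -/
theorem eventually_ne_smul {P Q : ℂ → Fin 3 → ℂ} {w₀ : ℂ} (hP : ContinuousAt P w₀)
    (hQ : ContinuousAt Q w₀) (hQ0 : Q w₀ ≠ 0) (h : ∀ c : ℂ, P w₀ ≠ c • Q w₀) :
    ∀ᶠ w in 𝓝 w₀, ∀ c : ℂ, P w ≠ c • Q w := by
  obtain ⟨i, hi⟩ := Function.ne_iff.mp hQ0
  obtain ⟨j, hj⟩ := Function.ne_iff.mp (h (P w₀ i / Q w₀ i))
  rw [Pi.smul_apply, smul_eq_mul, div_mul_eq_mul_div, Ne, eq_div_iff hi] at hj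
  have hc : ∀ k, ContinuousAt (fun w => P w k) w₀ := fun k => (continuousAt_pi.mp hP) k
  have hd : ∀ k, ContinuousAt (fun w => Q w k) w₀ := fun k => (continuousAt_pi.mp hQ) k
  have hs := (((hc j).mul (hd i)).sub ((hc i).mul (hd j))).eventually_ne (sub_ne_zero.mpr hj)
  filter_upwards [hs] with w hw c hc
  apply hw
  change P w j * Q w i - P w i * Q w j = 0
  rw [hc, Pi.smul_apply, Pi.smul_apply, smul_eq_mul, smul_eq_mul]
  ring

theorem exists_smul_eq_of_mk_eq {v w : Fin 3 → ℂ} {hv : v ≠ 0} {hw : w ≠ 0}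
    (h : Projectivization.mk ℂ v hv = Projectivization.mk ℂ w hw) :
    ∃ c : ℂ, c ≠ 0 ∧ w = c • v := by
  obtain ⟨c, hc⟩ := (Projectivization.mk_eq_mk_iff' ℂ w v hw hv).mp h.symm
  refine ⟨c, ?_, hc.symm⟩
  rintro rfl
  exact hw (by rw [← hc, zero_smul])

theorem sub_mem_of_cubicVec_eq_smul {τ : ℍ} {z w : ℂ} (c : ℂ)
    (h : cubicVec z τ = c • cubicVec w τ) : z - w ∈ periodLattice (τ : ℂ) := by
  rw [← mk_cubicVec_eq_iff τ, Projectivization.mk_eq_mk_iff']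
  exact ⟨c, h.symm⟩

theorem contDiffAt_cubicVec_comp {T g : ℂ → ℂ} {w : ℂ} (hT : ContDiffAt ℂ 1 T w)
    (hg : ContDiffAt ℂ 1 g w) (him : 0 < (T w).im) :
    ContDiffAt ℂ 1 (fun w => cubicVec (g w) (T w)) w :=
  contDiffAt_pi.mpr fun i => ContDiffAt.comp (f := fun w => (T w, g w)) w
    (contDiffAt_cubicVec_apply i (q := (T w, g w)) him) (hT.prodMk hg)

/-- Lifting a family of points of the fibres, with the help of two linear forms whose `2 × 2`
minor on the parametrised curve factors into theta functions. The pencil of lines spanned by the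
forms identifies `z` with `-e - z`, and has its centre at `-r` on the curve. -/
theorem exists_local_lift_of_minor {L₁ L₂ : (Fin 3 → ℂ) →L[ℂ] ℂ} {c : ℍ → ℂ} {r e : ℂ}
    (hc : ∀ τ, c τ ≠ 0)
    (hL : ∀ (τ : ℍ) (z w : ℂ), L₁ (cubicVec z τ) * L₂ (cubicVec w τ) -
      L₂ (cubicVec z τ) * L₁ (cubicVec w τ) =
        c τ * (theta (z + r) τ * theta (w + r) τ) * (theta (z - w) τ * theta (z + w + e) τ))
    {T : ℂ → ℂ} {P : ℂ → Fin 3 → ℂ} {w₀ z₀ : ℂ} (hT : ContDiffAt ℂ 1 T w₀)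
    (him : 0 < (T w₀).im) (hP : ContDiffAt ℂ 1 P w₀)
    (heq : ∀ᶠ w in 𝓝 w₀, P w 1 ^ 2 * P w 2 + kappa (T w) ^ 2 * P w 0 * P w 1 * P w 2 =
      P w 0 * (P w 0 - P w 2) ^ 2)
    {k : ℂ} (hk : k ≠ 0) (h0 : P w₀ = k • cubicVec z₀ (T w₀))
    (hr : z₀ + r ∉ periodLattice (T w₀)) (he : z₀ + z₀ + e ∉ periodLattice (T w₀)) :
    ∃ f : ℂ → ℂ, ContDiffAt ℂ 1 f w₀ ∧ f w₀ = z₀ ∧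
      ∀ᶠ w in 𝓝 w₀, ∃ c : ℂ, c ≠ 0 ∧ P w = c • cubicVec (f w) (T w) := by
  set τ₀ : ℍ := ⟨T w₀, him⟩ with hτ₀
  have hτc : T w₀ = (τ₀ : ℂ) := rfl
  rw [hτc] at h0 hr he
  have hr' := (theta_ne_zero_iff τ₀ _).mpr hr
  have he' := (theta_ne_zero_iff τ₀ _).mpr he
  set H : ℂ × ℂ → ℂ := fun q => L₁ (P q.1) * L₂ (cubicVec q.2 (T q.1)) -
    L₂ (P q.1) * L₁ (cubicVec q.2 (T q.1)) with hH
  have hHd : ContDiffAt ℂ 1 H (w₀, z₀) := by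
    have h1 : ContDiffAt ℂ 1 (fun q : ℂ × ℂ => P q.1) (w₀, z₀) :=
      ContDiffAt.comp (f := Prod.fst) (w₀, z₀) hP contDiffAt_fst
    have h2 : ContDiffAt ℂ 1 (fun q : ℂ × ℂ => T q.1) (w₀, z₀) :=
      ContDiffAt.comp (f := Prod.fst) (w₀, z₀) hT contDiffAt_fst
    have h3 : ContDiffAt ℂ 1 (fun q : ℂ × ℂ => cubicVec q.2 (T q.1)) (w₀, z₀) :=
      contDiffAt_pi.mpr fun i => ContDiffAt.comp (f := fun q : ℂ × ℂ => (T q.1, q.2)) (w₀, z₀)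
        (contDiffAt_cubicVec_apply i (q := (T w₀, z₀)) him) (h2.prodMk contDiffAt_snd)
    exact ((L₁.contDiff.contDiffAt.comp _ h1).mul (L₂.contDiff.contDiffAt.comp _ h3)).sub
      ((L₂.contDiff.contDiffAt.comp _ h1).mul (L₁.contDiff.contDiffAt.comp _ h3))
  have hHz : ∀ z, H (w₀, z) = k * (c τ₀ * (theta (z₀ + r) τ₀ * theta (z + r) τ₀) *
      (theta (z₀ - z) τ₀ * theta (z₀ + z + e) τ₀)) := by
    intro z
    rw [← hL τ₀ z₀ z]
    simp only [hH, h0, hτc, map_smul, smul_eq_mul]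
    ring
  have hderiv : HasDerivAt (fun z => H (w₀, z)) (k * (c τ₀ *
      (theta (z₀ + r) τ₀ * theta (z₀ + r) τ₀) *
        (-deriv (theta · τ₀) 0 * theta (z₀ + z₀ + e) τ₀))) z₀ := by
    have hθ := differentiable_theta τ₀.im_pos
    have d1 : HasDerivAt (fun z => theta (z₀ - z) τ₀) (-deriv (theta · τ₀) 0) z₀ := by
      have h1 : HasDerivAt (theta · (τ₀ : ℂ)) (deriv (theta · τ₀) 0) (z₀ - z₀) := by
        rw [sub_self]
        exact (hθ 0).hasDerivAt
      exact (h1.comp z₀ ((hasDerivAt_id z₀).const_sub z₀)).congr_deriv (by ring)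
    have d2 : DifferentiableAt ℂ (fun z => theta (z + r) τ₀) z₀ := by
      exact (hθ _).comp z₀ (by fun_prop)
    have d3 : DifferentiableAt ℂ (fun z => theta (z₀ + z + e) τ₀) z₀ := by
      exact (hθ _).comp z₀ (by fun_prop)
    have d := (((d2.hasDerivAt.const_mul (theta (z₀ + r) τ₀)).const_mul (c τ₀)).mul
      (d1.mul d3.hasDerivAt)).const_mul k
    refine (d.congr_deriv ?_).congr_of_eventuallyEq (Eventually.of_forall hHz)
    simp
  have hinv : (fderiv ℂ H (w₀, z₀) ∘L ContinuousLinearMap.inr ℂ ℂ ℂ).IsInvertible := by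
    set d := k * (c τ₀ * (theta (z₀ + r) τ₀ * theta (z₀ + r) τ₀) *
        (-deriv (theta · τ₀) 0 * theta (z₀ + z₀ + e) τ₀)) with hd
    have hd0 : d ≠ 0 := mul_ne_zero hk (mul_ne_zero (mul_ne_zero (hc _) (mul_ne_zero hr' hr'))
      (mul_ne_zero (neg_ne_zero.mpr (deriv_theta_zero_ne_zero τ₀)) he'))
    refine ⟨ContinuousLinearEquiv.unitsEquivAut ℂ (Units.mk0 d hd0), ?_⟩
    ext
    have h1 : HasDerivAt (fun z => H (w₀, z)) (fderiv ℂ H (w₀, z₀) (0, 1)) z₀ :=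
      (hHd.differentiableAt one_ne_zero).hasFDerivAt.comp_hasDerivAt z₀
        ((hasDerivAt_const z₀ w₀).prodMk (hasDerivAt_id z₀))
    simpa using hderiv.unique h1
  have hf0 := hHd.implicitFunction_apply_self one_ne_zero hinv
  have hfe := hHd.eventually_apply_implicitFunction one_ne_zero hinv
  have hfd := hHd.contDiffAt_implicitFunction one_ne_zero hinv
  set f := hHd.implicitFunction one_ne_zero hinv
  dsimp only at hf0 hfd hfe
  refine ⟨f, hfd, hf0, ?_⟩
  have hCf := contDiffAt_cubicVec_comp hT hfd him
  have hC1 := contDiffAt_cubicVec_comp hT (contDiffAt_const (c := -r)) him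
  have hC2 := contDiffAt_cubicVec_comp hT (hfd.neg.sub (contDiffAt_const (c := e))) him
  have hk' : ∀ b z : ℂ, k • cubicVec z₀ (τ₀ : ℂ) = b • cubicVec z τ₀ →
      z₀ - z ∈ periodLattice (τ₀ : ℂ) := fun b z hb =>
    sub_mem_of_cubicVec_eq_smul (k⁻¹ * b) (by rw [mul_smul, ← hb, smul_smul, inv_mul_cancel₀ hk,
      one_smul])
  -- near `w₀` the points avoid the centre of the pencil and the second point on the line
  have hE1 := eventually_ne_smul hP.continuousAt hC1.continuousAt (cubicVec_ne_zero _ τ₀) (by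
    intro b hb
    rw [h0] at hb
    exact hr (by simpa using hk' b _ hb))
  have hE2 := eventually_ne_smul hP.continuousAt hC2.continuousAt (cubicVec_ne_zero _ τ₀) (by
    intro b hb
    rw [h0, hf0] at hb
    exact he (by convert hk' b _ hb using 1; ring))
  have hE3 := eventually_ne_smul hCf.continuousAt hC1.continuousAt (cubicVec_ne_zero _ τ₀) (by
    intro b hb
    rw [hf0] at hb
    exact hr (by simpa using sub_mem_of_cubicVec_eq_smul (τ := τ₀) b hb))
  have hPne : ∀ᶠ w in 𝓝 w₀, P w ≠ 0 := hP.continuousAt.eventually_ne (by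
    rw [h0]
    exact smul_ne_zero hk (cubicVec_ne_zero _ τ₀))
  have hIm : ∀ᶠ w in 𝓝 w₀, 0 < (T w).im :=
    (Complex.continuous_im.continuousAt.comp hT.continuousAt).eventually (lt_mem_nhds him)
  have hHw0 : H (w₀, z₀) = 0 := by
    rw [hHz, sub_self, theta_zero]
    ring
  filter_upwards [heq, hfe, hE1, hE2, hE3, hPne, hIm] with w hw1 hw2 hw3 hw4 hw5 hw6 hw7
  obtain ⟨z, hz⟩ := exists_uniformisation_eq ⟨T w, hw7⟩ hw6 hw1
  obtain ⟨b, hb, hPb⟩ := exists_smul_eq_of_mk_eq hz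
  change P w = b • cubicVec z (T w) at hPb
  have hprod := hL ⟨T w, hw7⟩ z (f w)
  have htr : ∀ x : ℂ, z - x ∈ periodLattice (T w) →
      ∃ a : ℂ, a ≠ 0 ∧ P w = a • cubicVec x (T w) := by
    intro x hx
    obtain ⟨a, ha, h⟩ := cubicVec_add_mem hx x
    rw [add_sub_cancel] at h
    exact ⟨b * a, mul_ne_zero hb ha, by rw [hPb, h, smul_smul]⟩
  have hzero : c ⟨T w, hw7⟩ * (theta (z + r) (T w) * theta (f w + r) (T w)) *
      (theta (z - f w) (T w) * theta (z + f w + e) (T w)) = 0 := by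
    refine Eq.trans hprod.symm ?_
    apply mul_left_cancel₀ hb
    rw [mul_zero, ← hHw0, ← hw2]
    simp only [hH, hPb, map_smul, smul_eq_mul]
    ring
  have hth : ∀ x : ℂ, theta x (T w) = 0 → x ∈ periodLattice (T w) := fun x hx =>
    (theta_eq_zero_iff ⟨T w, hw7⟩ x).mp hx
  rcases mul_eq_zero.mp hzero with h | h
  · rcases mul_eq_zero.mp ((mul_eq_zero.mp h).resolve_left (hc _)) with h | h
    · obtain ⟨a, -, ha⟩ := htr (-r) (by simpa using hth _ h)
      exact absurd ha (hw3 a)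
    · obtain ⟨a, -, ha⟩ := cubicVec_add_mem (hth _ h) (-r)
      rw [show -r + (f w + r) = f w by ring] at ha
      exact absurd ha (hw5 a)
  · rcases mul_eq_zero.mp h with h | h
    · exact htr _ (hth _ h)
    · obtain ⟨a, -, ha⟩ := htr (-f w - e) (by convert hth _ h using 1; ring)
      exact absurd ha (hw4 a)

/-- A family of points on the fibres over `κ(T w)²` lifts locally through the theta
parametrisation. -/
theorem exists_local_lift {T : ℂ → ℂ} {P : ℂ → Fin 3 → ℂ} {w₀ z₀ : ℂ}
    (hT : ContDiffAt ℂ 1 T w₀) (him : 0 < (T w₀).im) (hP : ContDiffAt ℂ 1 P w₀)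
    (heq : ∀ᶠ w in 𝓝 w₀, P w 1 ^ 2 * P w 2 + kappa (T w) ^ 2 * P w 0 * P w 1 * P w 2 =
      P w 0 * (P w 0 - P w 2) ^ 2)
    {k : ℂ} (hk : k ≠ 0) (h0 : P w₀ = k • cubicVec z₀ (T w₀)) :
    ∃ f : ℂ → ℂ, ContDiffAt ℂ 1 f w₀ ∧ f w₀ = z₀ ∧
      ∀ᶠ w in 𝓝 w₀, ∃ c : ℂ, c ≠ 0 ∧ P w = c • cubicVec (f w) (T w) := by
  set p : Fin 3 → (Fin 3 → ℂ) →L[ℂ] ℂ := fun i => ContinuousLinearMap.proj i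
  set τ₀ : ℍ := ⟨T w₀, him⟩
  -- the projection `U` is a local coordinate on the fibre except at the points of order two
  by_cases h2 : z₀ + z₀ ∈ periodLattice (T w₀)
  · refine exists_local_lift_of_minor (L₁ := p 0 - p 2) (L₂ := p 1) (r := -1 / 4) (e := 1 / 4)
      (c := fun τ => kappa τ ^ 2 * theta (1 / 2) τ * theta (1 / 4) τ)
      (fun τ => mul_ne_zero (mul_ne_zero (pow_ne_zero _ (kappa_ne_zero τ)) (theta_half_ne_zero τ))
        (theta_quarter_ne_zero τ)) (fun τ z w => cubicVec_minor_sub_one z w τ)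
      hT him hP heq hk h0 ?_ ?_
    · intro h
      apply half_not_mem τ₀
      convert sub_mem h2 (add_mem h h) using 1
      ring
    · intro h
      apply quarter_not_mem τ₀
      convert sub_mem h h2 using 1
      ring
  · refine exists_local_lift_of_minor (L₁ := p 0) (L₂ := p 2) (r := 0) (e := 0)
      (c := fun τ => -theta (1 / 2) τ ^ 2)
      (fun τ => neg_ne_zero.mpr (pow_ne_zero _ (theta_half_ne_zero τ)))
      (fun τ z w => cubicVec_minor_zero_two z w τ) hT him hP heq hk h0 ?_ ?_
    · rw [add_zero]
      exact fun h => h2 (add_mem h h)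
    · rwa [add_zero]

end ModularFibration

namespace ModularFibration

open Complex Filter

/-! ### The Hauptmodul separates the orbits of `Γ₁(8)` -/

/-- A continuous function with values in the period lattices has locally constant coefficients. -/
theorem exists_eventually_eq_lattice {T d : ℂ → ℂ} {w₀ : ℂ} (hT : ContinuousAt T w₀)
    (hd : ContinuousAt d w₀) (him : 0 < (T w₀).im) (h : ∀ᶠ w in 𝓝 w₀, d w ∈ periodLattice (T w)) :
    ∃ m n : ℤ, ∀ᶠ w in 𝓝 w₀, d w = m * T w + n := by
  obtain ⟨m, n, hmn⟩ := h.self_of_nhds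
  refine ⟨m, n, ?_⟩
  have h0 : ContinuousAt (fun w => ‖d w - (m * T w + n)‖) w₀ :=
    (hd.sub ((hT.const_mul _).add continuousAt_const)).norm
  have hz : ‖d w₀ - (m * T w₀ + n)‖ = 0 := by rw [hmn, sub_self, norm_zero]
  have h1 : ∀ᶠ w in 𝓝 w₀, ‖d w - (m * T w + n)‖ < 1 := h0.eventually_lt_const (by simp [hz])
  have h2 : ∀ᶠ w in 𝓝 w₀, ‖d w - (m * T w + n)‖ < (T w).im :=
    h0.eventually_lt (Complex.continuous_im.continuousAt.comp hT) (by rw [hz]; exact him)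
  filter_upwards [h, h1, h2] with w hw hw1 hw2
  obtain ⟨m', n', hw⟩ := hw
  have e : d w - (m * T w + n) = ((m' - m : ℤ) : ℂ) * T w + ((n' - n : ℤ) : ℂ) := by
    rw [hw]; push_cast; ring
  have hi : 0 < (T w).im := (norm_nonneg _).trans_lt hw2
  have e1 : m' - m = 0 := by
    have h3 := (Complex.abs_im_le_norm _).trans_lt hw2
    rw [e] at h3
    simp only [add_im, mul_im, intCast_re, intCast_im, zero_mul, add_zero, abs_mul,
      abs_of_pos hi] at h3
    have h4 : |((m' - m : ℤ) : ℝ)| < 1 := by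
      by_contra! h5
      exact absurd h3 (not_lt.mpr (le_mul_of_one_le_left hi.le h5))
    exact Int.abs_lt_one_iff.mp (by exact_mod_cast h4)
  rw [e, e1, Int.cast_zero, zero_mul, zero_add, Complex.norm_intCast] at hw1
  have e2 : n' - n = 0 := Int.abs_lt_one_iff.mp (by exact_mod_cast hw1)
  rw [e1, e2] at e
  simpa [sub_eq_zero] using e

theorem exists_smul_of_minor_eq_zero {v w : Fin 3 → ℂ} (hv : v ≠ 0) (hw : w ≠ 0)
    (h : ∀ i j, v i * w j = v j * w i) : ∃ c : ℂ, c ≠ 0 ∧ v = c • w := by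
  obtain ⟨i, hi⟩ := Function.ne_iff.mp hw
  have e : v = (v i / w i) • w := by
    funext j
    rw [Pi.smul_apply, smul_eq_mul, div_mul_eq_mul_div, eq_div_iff hi, h]
  refine ⟨v i / w i, fun h0 => hv ?_, e⟩
  rw [e, h0, zero_smul]

theorem cubicVec_zero (τ : ℂ) : cubicVec 0 τ = ![0, cubicVec 0 τ 1, 0] := by
  funext i
  fin_cases i <;> simp [cubicVec]

theorem cubicVec_zero_one_ne_zero (τ : ℍ) : cubicVec 0 τ 1 ≠ 0 := by
  intro h
  have h1 := cubicVec_zero τ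
  rw [h] at h1
  apply cubicVec_ne_zero 0 τ
  rw [h1]
  simp

/-- `f` lifts the theta parametrisation of the fibre of `τ` to that of `τ'`, near `w`. -/
def IsLiftAt (τ τ' : ℂ) (w : ℂ) (f : ℂ → ℂ) : Prop :=
  ContDiffAt ℂ 1 f w ∧ ∀ᶠ u in 𝓝 w, ∃ c : ℂ, c ≠ 0 ∧ cubicVec u τ = c • cubicVec (f u) τ'

theorem IsLiftAt.eventually {τ τ' w : ℂ} {f : ℂ → ℂ} (h : IsLiftAt τ τ' w f) :
    ∀ᶠ u in 𝓝 w, IsLiftAt τ τ' u f :=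
  (h.1.eventually (by simp)).and h.2.eventually_nhds

theorem IsLiftAt.deriv_eq {τ τ' : ℍ} {w : ℂ} {f g : ℂ → ℂ} (hf : IsLiftAt τ τ' w f)
    (hg : IsLiftAt τ τ' w g) : deriv f w = deriv g w := by
  obtain ⟨m, n, h⟩ := exists_eventually_eq_lattice (T := fun _ => (τ' : ℂ)) (d := fun u => f u - g u)
    continuousAt_const (hf.1.continuousAt.sub hg.1.continuousAt) τ'.im_pos (by
      filter_upwards [hf.2, hg.2] with u ⟨a, ha, h1⟩ ⟨b, hb, h2⟩
      refine sub_mem_of_cubicVec_eq_smul (a⁻¹ * b) ?_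
      rw [mul_smul, ← h2, h1, smul_smul, inv_mul_cancel₀ ha, one_smul])
  have h1 : f =ᶠ[𝓝 w] fun u => g u + (m * τ' + n) := by
    filter_upwards [h] with u hu
    rw [← hu]
    ring
  rw [h1.deriv_eq, deriv_add_const]

theorem analyticAt_of_contDiffAt_one {f : ℂ → ℂ} {w : ℂ} (h : ContDiffAt ℂ 1 f w) :
    AnalyticAt ℂ f w := by
  rw [Complex.analyticAt_iff_eventually_differentiableAt]
  filter_upwards [h.eventually (by simp)] with u hu using hu.differentiableAt one_ne_zero

/-- Equal fibres have homothetic theta parametrisations: the derivatives of local lifts from one to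
the other agree and form an entire doubly periodic function, which is constant. -/
theorem exists_homothety {τ τ' : ℍ} (h : kappa τ ^ 2 = kappa τ' ^ 2) :
    ∃ l : ℂ, ∀ u, ∃ c : ℂ, c ≠ 0 ∧ cubicVec u τ = c • cubicVec (l * u) τ' := by
  have hC : ∀ w, ContDiffAt ℂ 1 (fun u => cubicVec u (τ : ℂ)) w := fun w =>
    contDiffAt_cubicVec_comp contDiffAt_const contDiffAt_id τ.im_pos
  have heq : ∀ u, cubicVec u τ 1 ^ 2 * cubicVec u τ 2 +
      kappa τ' ^ 2 * cubicVec u τ 0 * cubicVec u τ 1 * cubicVec u τ 2 =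
      cubicVec u τ 0 * (cubicVec u τ 0 - cubicVec u τ 2) ^ 2 := fun u =>
    h ▸ cubicVec_equation u τ
  have hex : ∀ w, ∃ f, IsLiftAt τ τ' w f := by
    intro w
    obtain ⟨z, hz⟩ := exists_uniformisation_eq τ' (cubicVec_ne_zero w τ) (heq w)
    obtain ⟨k, hk, hz⟩ := exists_smul_eq_of_mk_eq hz
    obtain ⟨f, hf, -, hf'⟩ := exists_local_lift (T := fun _ => (τ' : ℂ))
      (P := fun u => cubicVec u τ) contDiffAt_const τ'.im_pos (hC w)
      (Eventually.of_forall heq) hk hz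
    exact ⟨f, hf, hf'⟩
  choose F hF using hex
  set g : ℂ → ℂ := fun w => deriv (F w) w with hg
  have hgf : ∀ {w f}, IsLiftAt τ τ' w f → g =ᶠ[𝓝 w] deriv f := by
    intro w f hf
    filter_upwards [hf.eventually] with u hu using (hF u).deriv_eq hu
  have hgd : Differentiable ℂ g := by
    intro w
    refine DifferentiableAt.congr_of_eventuallyEq ?_ (hgf (hF w))
    exact (analyticAt_of_contDiffAt_one (hF w).1).deriv.differentiableAt
  have hgp : ∀ l ∈ periodLattice (τ : ℂ), ∀ z, g (z + l) = g z := by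
    intro l hl z
    have hlift : IsLiftAt τ τ' z (fun u => F (z + l) (u + l)) := by
      refine ⟨ContDiffAt.comp (f := fun u => u + l) z (hF (z + l)).1
        (contDiffAt_id.add contDiffAt_const), ?_⟩
      have ht : Tendsto (fun u => u + l) (𝓝 z) (𝓝 (z + l)) :=
        (continuous_id.add continuous_const).tendsto z
      filter_upwards [ht.eventually (hF (z + l)).2] with u ⟨a, ha, hu⟩
      obtain ⟨b, hb, hb'⟩ := cubicVec_add_mem hl u
      refine ⟨b⁻¹ * a, mul_ne_zero (inv_ne_zero hb) ha, ?_⟩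
      rw [mul_smul, ← hu, hb', smul_smul, inv_mul_cancel₀ hb, one_smul]
    simp only [hg]
    rw [(hF z).deriv_eq hlift, deriv_comp_add_const]
  have hgc := eq_const_of_doublyPeriodic τ.im_pos hgd hgp
  obtain ⟨f, hf, hf0, hf'⟩ := exists_local_lift (T := fun _ => (τ' : ℂ)) (w₀ := 0) (z₀ := 0)
      (P := fun u => cubicVec u τ) contDiffAt_const τ'.im_pos (hC 0)
      (Eventually.of_forall heq) (k := cubicVec 0 τ 1 / cubicVec 0 τ' 1)
      (div_ne_zero (cubicVec_zero_one_ne_zero τ) (cubicVec_zero_one_ne_zero τ')) (by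
        have := cubicVec_zero_one_ne_zero τ'
        rw [cubicVec_zero, cubicVec_zero (τ' : ℂ)]
        funext i
        fin_cases i <;> simp [this])
  have hlift : IsLiftAt τ τ' 0 f := ⟨hf, hf'⟩
  refine ⟨g 0, ?_⟩
  have hlin : ∀ᶠ u in 𝓝 (0 : ℂ), f u = g 0 * u := by
    have h1 : ∀ᶠ u in 𝓝 (0 : ℂ), HasDerivAt (fun u => f u - g 0 * u) 0 u := by
      filter_upwards [hgf hlift, hlift.eventually] with u hu hu'
      have h2 := (hu'.1.differentiableAt one_ne_zero).hasDerivAt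
      rw [← hu, hgc u 0] at h2
      exact (h2.sub ((hasDerivAt_id u).const_mul (g 0))).congr_deriv (by simp)
    obtain ⟨ε, hε, hball⟩ := Metric.eventually_nhds_iff_ball.mp h1
    filter_upwards [Metric.ball_mem_nhds 0 hε] with u hu
    have := Metric.isOpen_ball.is_const_of_deriv_eq_zero (convex_ball (0 : ℂ) ε).isPreconnected
      (fun v hv => (hball v hv).differentiableAt.differentiableWithinAt)
      (fun v hv => (hball v hv).deriv) hu (Metric.mem_ball_self hε)
    simpa [hf0, sub_eq_zero] using this
  intro u
  refine exists_smul_of_minor_eq_zero (cubicVec_ne_zero u τ) (cubicVec_ne_zero _ τ') fun i j => ?_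
  have hd : ∀ i, Differentiable ℂ fun u => cubicVec u τ i := fun i w =>
    (differentiableAt_pi.mp ((hC w).differentiableAt one_ne_zero)) i
  have hd' : ∀ i, Differentiable ℂ fun u => cubicVec (g 0 * u) τ' i := fun i w =>
    (differentiableAt_pi.mp ((contDiffAt_cubicVec_comp (T := fun _ => (τ' : ℂ)) contDiffAt_const
      (contDiffAt_const.mul contDiffAt_id) τ'.im_pos).differentiableAt one_ne_zero)) i
  have h1 : AnalyticOnNhd ℂ (fun u => cubicVec u τ i * cubicVec (g 0 * u) τ' j) Set.univ :=
    fun w _ => ((hd i).mul (hd' j)).analyticAt w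
  have h2 : AnalyticOnNhd ℂ (fun u => cubicVec u τ j * cubicVec (g 0 * u) τ' i) Set.univ :=
    fun w _ => ((hd j).mul (hd' i)).analyticAt w
  refine congrFun (h1.eq_of_eventuallyEq h2 (z₀ := 0) ?_) u
  filter_upwards [hlin, hf'] with v hv ⟨c, hc, hv'⟩
  rw [hv', hv]
  simp only [Pi.smul_apply, smul_eq_mul]
  ring

theorem cubicVec_two_eq_zero_iff (z : ℂ) (τ : ℍ) :
    cubicVec z τ 2 = 0 ↔ z ∈ periodLattice (τ : ℂ) := by
  rw [← theta_eq_zero_iff]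
  exact pow_eq_zero_iff (n := 3) (by norm_num)

theorem vCoord_eighth (τ : ℍ) : vCoord (1 / 8) τ = hauptmodul τ - 1 := by
  have h := theta_eighth_ne_zero τ
  rw [hauptmodul_sub_one, vCoord, show (1 / 8 - 1 / 4 : ℂ) = -(1 / 8) by norm_num, theta_neg,
    show (1 / 8 + 1 / 2 : ℂ) = 1 / 2 - (-1 / 8) by norm_num, theta_half_sub,
    show (-1 / 8 + 1 / 2 : ℂ) = 3 / 8 by norm_num]
  field_simp

/-- An integral basis of a homothetic lattice gives a unimodular matrix. -/
theorem exists_smul_of_homothetic {τ τ' : ℍ} {l : ℂ}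
    (h : ∀ u, u ∈ periodLattice (τ : ℂ) ↔ l * u ∈ periodLattice (τ' : ℂ)) :
    ∃ γ : SL(2, ℤ), γ • τ' = τ ∧ l = autFactor γ τ' := by
  have hl : l ≠ 0 := by
    rintro rfl
    exact half_not_mem τ ((h _).mpr (by rw [zero_mul]; exact zero_mem _))
  obtain ⟨c, d, h1⟩ := (h 1).mp (one_mem_periodLattice _)
  obtain ⟨a, b, h2⟩ := (h τ).mp (tau_mem_periodLattice _)
  obtain ⟨m, n, h3⟩ := (h l⁻¹).mpr (by rw [mul_inv_cancel₀ hl]; exact one_mem_periodLattice _)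
  obtain ⟨m', n', h4⟩ := (h (l⁻¹ * τ')).mpr (by
    rw [mul_inv_cancel_left₀ hl]; exact tau_mem_periodLattice _)
  rw [mul_one] at h1
  have e1 : ((m * a + n * c : ℤ) : ℝ) * (τ' : ℂ) + ((m * b + n * d : ℤ) : ℝ) =
      (0 : ℝ) * τ' + (1 : ℝ) := by
    have : l * l⁻¹ = m * (l * τ) + n * l := by rw [h3]; ring
    rw [mul_inv_cancel₀ hl, h2, h1] at this
    push_cast
    linear_combination -this
  have e2 : ((m' * a + n' * c : ℤ) : ℝ) * (τ' : ℂ) + ((m' * b + n' * d : ℤ) : ℝ) =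
      (1 : ℝ) * τ' + (0 : ℝ) := by
    have : l * (l⁻¹ * τ') = m' * (l * τ) + n' * l := by rw [h4]; ring
    rw [mul_inv_cancel_left₀ hl, h2, h1] at this
    push_cast
    linear_combination -this
  obtain ⟨f1, f2⟩ := lattice_coeff_ext τ'.im_pos e1
  obtain ⟨f3, f4⟩ := lattice_coeff_ext τ'.im_pos e2
  norm_cast at f1 f2 f3 f4
  have hdet : (a * d - b * c) * (m' * n - n' * m) = 1 := by
    linear_combination (m' * b + n' * d) * f1 * (-1) + f2 * (m' * a + n' * c) + f3
  have him : 0 < ((a * d - b * c : ℤ) : ℝ) * τ'.im := by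
    have h5 : (τ : ℂ) = (a * τ' + b) * (starRingEnd ℂ) l / (normSq l : ℂ) := by
      rw [← h2, Complex.normSq_eq_conj_mul_self]
      field_simp [(map_ne_zero (starRingEnd ℂ)).mpr hl]
    have h6 := τ.im_pos
    rw [← UpperHalfPlane.coe_im, h5, Complex.div_ofReal_im] at h6
    have h7 := (div_pos_iff_of_pos_right (Complex.normSq_pos.mpr hl)).mp h6
    rw [h1] at h7
    simp [Complex.mul_im] at h7
    push_cast
    linarith
  have hpos : 0 < a * d - b * c := by
    have := (pos_iff_pos_of_mul_pos him).mpr τ'.im_pos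
    exact_mod_cast this
  have hdet1 : a * d - b * c = 1 :=
    Int.eq_one_of_mul_eq_one_right hpos.le hdet
  refine ⟨⟨!![a, b; c, d], by rw [Matrix.det_fin_two_of, hdet1]⟩, ?_, ?_⟩
  · apply UpperHalfPlane.ext
    have h8 := smul_mul_autFactor ⟨!![a, b; c, d], by rw [Matrix.det_fin_two_of, hdet1]⟩ τ'
    have h9 : autFactor ⟨!![a, b; c, d], by rw [Matrix.det_fin_two_of, hdet1]⟩ τ' = l := by
      rw [h1]
      rfl
    rw [h9] at h8
    apply mul_right_cancel₀ hl
    rw [h8, mul_comm (τ : ℂ) l, h2]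
    rfl
  · rw [h1]
    rfl

/-- The homothety between the period lattices of two fibres with equal Hauptmodul preserves the point
`(s, s - 1)` with parameter `1/8`, so that the matrix relating the lattices lies in `Γ₁(8)`. -/
theorem exists_gamma1_smul_of_hauptmodul_eq {τ τ' : ℍ} (h : hauptmodul τ = hauptmodul τ') :
    ∃ γ ∈ CongruenceSubgroup.Gamma1 8, γ • τ' = τ := by
  obtain ⟨l, hl⟩ := exists_homothety (τ := τ) (τ' := τ') (by rw [kappa_sq, kappa_sq, h])
  have hmem : ∀ u, u ∈ periodLattice (τ : ℂ) ↔ l * u ∈ periodLattice (τ' : ℂ) := by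
    intro u
    obtain ⟨c, hc, hu⟩ := hl u
    rw [← cubicVec_two_eq_zero_iff, ← cubicVec_two_eq_zero_iff, hu, Pi.smul_apply, smul_eq_mul,
      mul_eq_zero, or_iff_right hc]
  -- the point `1/8` has the coordinates `(s, s - 1)` for both parametrisations
  have h8 : l * (1 / 8) - 1 / 8 ∈ periodLattice (τ' : ℂ) := by
    obtain ⟨c, hc, hu⟩ := hl (1 / 8)
    have h0 : l * (1 / 8) ∉ periodLattice (τ' : ℂ) := fun h0 => eighth_not_mem τ ((hmem _).mpr h0)
    have h1 := (theta_ne_zero_iff τ' _).mpr h0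
    refine sub_mem_of_coord_eq h0 (eighth_not_mem τ') ?_ ?_
    · rw [uCoord_eighth, ← h, ← uCoord_eighth, uCoord_eq_div h1,
        uCoord_eq_div (theta_eighth_ne_zero τ), hu]
      simp [mul_div_mul_left, hc]
    · rw [vCoord_eighth, ← h, ← vCoord_eighth, vCoord_eq_div, vCoord_eq_div, hu]
      simp [mul_div_mul_left, hc]
  obtain ⟨γ, hγ, hlγ⟩ := exists_smul_of_homothetic hmem
  refine ⟨γ, ?_, hγ⟩
  obtain ⟨m, n, hmn⟩ := h8
  have e : ((γ 1 0 : ℤ) : ℝ) * (τ' : ℂ) + ((γ 1 1 : ℤ) : ℝ) =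
      ((8 * m : ℤ) : ℝ) * τ' + ((8 * n + 1 : ℤ) : ℝ) := by
    have : l = (γ 1 0 : ℤ) * (τ' : ℂ) + (γ 1 1 : ℤ) := hlγ
    push_cast
    linear_combination 8 * hmn - this
  obtain ⟨e1, e2⟩ := lattice_coeff_ext τ'.im_pos e
  norm_cast at e1 e2
  have hdet := det_eq_one γ
  have z8 : (8 : ZMod 8) = 0 := rfl
  have z1 : ((γ 1 0 : ℤ) : ZMod 8) = 0 := by
    rw [e1]; push_cast; rw [z8, zero_mul]
  have z2 : ((γ 1 1 : ℤ) : ZMod 8) = 1 := by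
    rw [e2]; push_cast; rw [z8, zero_mul, zero_add]
  rw [CongruenceSubgroup.Gamma1_mem]
  refine ⟨?_, z2, z1⟩
  have := congrArg (Int.cast : ℤ → ZMod 8) hdet
  push_cast at this
  rw [z1, z2] at this
  simpa using this

theorem hauptmodul_eq_of_uniformisation_eq {τ τ' : ℍ} {z z' : ℂ}
    (h : uniformisation (τ, z) = uniformisation (τ', z')) : hauptmodul τ = hauptmodul τ' := by
  rw [uniformisation, uniformisation, Prod.mk.injEq] at h
  exact h.1

theorem uniformisation_eq_iff_sub_mem (τ : ℍ) (z z' : ℂ) :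
    uniformisation (τ, z') = uniformisation (τ, z) ↔ z' - z ∈ periodLattice (τ : ℂ) := by
  rw [← mk_cubicVec_eq_iff, uniformisation, uniformisation, Prod.mk.injEq]
  exact and_iff_right rfl

/-- The fibres of the uniformisation are the orbits of `Γ₁(8) ⋉ ℤ²`. -/
theorem uniformisation_eq_iff (τ τ' : ℍ) (z z' : ℂ) :
    uniformisation (τ', z') = uniformisation (τ, z) ↔
      ∃ γ ∈ CongruenceSubgroup.Gamma1 8, ∃ m n : ℤ, τ' = γ • τ ∧
        z' = (z + m * (τ : ℂ) + n) / ((γ 1 0 : ℤ) * (τ : ℂ) + (γ 1 1 : ℤ)) := by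
  constructor
  · intro h
    have h0 : hauptmodul τ' = hauptmodul τ := hauptmodul_eq_of_uniformisation_eq h
    obtain ⟨γ, hγ, rfl⟩ := exists_gamma1_smul_of_hauptmodul_eq h0
    rw [← uniformisation_smul hγ τ z, uniformisation_eq_iff_sub_mem] at h
    have hj := autFactor_ne_zero γ τ
    obtain ⟨m, n, hmn⟩ := (div_autFactor_mem_iff γ τ (z' * autFactor γ τ - z)).mp (by
      rwa [sub_div, mul_div_cancel_right₀ _ hj])
    refine ⟨γ, hγ, m, n, rfl, ?_⟩
    change z' = _ / autFactor γ τ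
    rw [eq_div_iff hj]
    linear_combination hmn
  · rintro ⟨γ, hγ, m, n, rfl, rfl⟩
    change uniformisation (γ • τ, _ / autFactor γ τ) = _
    rw [uniformisation_smul hγ, uniformisation_eq_iff_sub_mem]
    exact ⟨m, n, by ring⟩

end ModularFibration

namespace ModularFibration

open Complex Filter

/-! ### The invariant theta norm and the discriminant near the cusps -/

/-- The absolute value of theta, normalised so that it is invariant under translation of `z` by
periods. -/
noncomputable def thetaNorm (z τ : ℂ) : ℝ :=
  ‖theta z τ‖ * Real.exp (-(Real.pi * z.im ^ 2 / τ.im))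

theorem thetaNorm_nonneg (z τ : ℂ) : 0 ≤ thetaNorm z τ :=
  mul_nonneg (norm_nonneg _) (Real.exp_pos _).le

theorem thetaNorm_add_mem {τ l : ℂ} (hτ : 0 < τ.im) (hl : l ∈ periodLattice τ) (z : ℂ) :
    thetaNorm (z + l) τ = thetaNorm z τ := by
  obtain ⟨m, n, rfl⟩ := hl
  have hs : ‖((-1 : ℂ) ^ (m + n))‖ = 1 := by rw [norm_zpow, norm_neg, norm_one, one_zpow]
  rw [thetaNorm, thetaNorm, theta_add_lattice, norm_mul, norm_mul, hs, one_mul, Complex.norm_exp,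
    mul_comm (Real.exp _) ‖_‖, mul_assoc, ← Real.exp_add]
  congr 2
  have h1 : (z + (m * τ + n)).im = z.im + m * τ.im := by simp
  have h2 : (-(2 * Real.pi * I * m * z) - Real.pi * I * m ^ 2 * τ).re =
      2 * Real.pi * m * z.im + Real.pi * m ^ 2 * τ.im := by
    rw [show -(2 * Real.pi * I * m * z) - Real.pi * I * m ^ 2 * τ =
      -(((2 * Real.pi * m : ℝ) : ℂ) * (I * z)) - ((Real.pi * m ^ 2 : ℝ) : ℂ) * (I * τ) by
        push_cast; ring]
    rw [Complex.sub_re, Complex.neg_re, Complex.re_ofReal_mul, Complex.re_ofReal_mul,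
      Complex.I_mul_re, Complex.I_mul_re]
    ring
  rw [h1, h2]
  field_simp
  ring

theorem thetaNorm_smul (γ : SL(2, ℤ)) (τ : ℍ) :
    ∃ C : ℝ, 0 < C ∧ ∀ z, thetaNorm (z / autFactor γ τ) (γ • τ : ℍ) = C * thetaNorm z τ := by
  obtain ⟨C, hC, h⟩ := theta_smul γ τ
  refine ⟨‖C‖, norm_pos_iff.mpr hC, fun z => ?_⟩
  have hj := autFactor_ne_zero γ τ
  have hy := τ.im_pos
  have hn := Complex.normSq_pos.mpr hj
  rw [thetaNorm, thetaNorm, h, norm_mul, norm_mul, Complex.norm_exp, UpperHalfPlane.coe_im,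
    UpperHalfPlane.coe_im, ModularGroup.im_smul_eq_div_normSq, ← autFactor_eq_denom]
  rw [show ∀ a b c d : ℝ, a * b * c * d = a * (c * (b * d)) from fun a b c d => by ring,
    ← Real.exp_add]
  congr 3
  set J := autFactor γ τ with hJ
  have hJi : J.im = (γ 1 0 : ℤ) * τ.im := by rw [hJ, autFactor]; simp
  have e1 : (Real.pi * I * (γ 1 0 : ℤ) * z ^ 2 / J).re =
      -(Real.pi * (γ 1 0 : ℤ)) * (2 * z.re * z.im * J.re - (z.re ^ 2 - z.im ^ 2) * J.im) /
        normSq J := by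
    rw [show Real.pi * I * (γ 1 0 : ℤ) * z ^ 2 / J =
      ((Real.pi * (γ 1 0 : ℤ) : ℝ) : ℂ) * (I * (z ^ 2 / J)) by push_cast; ring,
      Complex.re_ofReal_mul, Complex.I_mul_re, Complex.div_im, sq z, Complex.mul_im,
      Complex.mul_re]
    field_simp
    ring
  have e2 : (z / J).im = (z.im * J.re - z.re * J.im) / normSq J := by
    rw [Complex.div_im]
    ring
  rw [e1, e2]
  have hns : normSq J = J.re ^ 2 + J.im ^ 2 := by rw [normSq_apply]; ring
  have e3 : ((γ 1 0 : ℤ) : ℝ) = J.im / τ.im := by rw [hJi]; field_simp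
  rw [e3]
  field_simp
  rw [hns]
  ring

theorem thetaNorm_half {τ : ℂ} (hτ : 0 < τ.im) (hτ' : 3 ≤ 4 * τ.im ^ 2) :
    Real.exp (-(Real.pi * (1 / 4) * τ.im)) ≤ thetaNorm (1 / 2) τ ∧
      thetaNorm (1 / 2) τ ≤ 3 * Real.exp (-(Real.pi * (1 / 4) * τ.im)) := by
  have hz : |(1 / 2 : ℂ).im| ≤ τ.im / 2 := by simpa using (half_pos hτ).le
  have h1 := le_norm_theta hτ hτ' hz
  have h2 := norm_theta_le hτ hτ' hz
  have hs : Complex.sin (Real.pi * (1 / 2)) = 1 := by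
    rw [show (Real.pi * (1 / 2) : ℂ) = Real.pi / 2 by ring, Complex.sin_pi_div_two]
  have hN : thetaNorm (1 / 2) τ = ‖theta (1 / 2) τ‖ := by
    rw [thetaNorm]
    simp
  rw [hs, norm_one, mul_one] at h1 h2
  rw [hN]
  exact ⟨h1, h2⟩

/-- The bounds for a parameter on the boundary of the strip `|Im z| ≤ Im τ / 2`. -/
theorem thetaNorm_of_im_eq {z τ : ℂ} (hτ : 0 < τ.im) (hτ' : 3 ≤ 4 * τ.im ^ 2)
    (hz : z.im = τ.im / 2) : 1 / 4 ≤ thetaNorm z τ ∧ thetaNorm z τ ≤ 3 := by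
  have hz' : |z.im| ≤ τ.im / 2 := by rw [hz, abs_of_pos (by linarith)]
  have h1 := le_norm_theta hτ hτ' hz'
  have h2 := norm_theta_le hτ hτ' hz'
  set x := Real.exp (Real.pi * (τ.im / 2)) with hx
  have hx0 : 0 < x := Real.exp_pos _
  have hx2 : 2 ≤ x ^ 2 := by
    have h9 := nine_le_exp_pi_mul hτ' hτ
    have : x ^ 2 = Real.exp (Real.pi * τ.im) := by
      rw [hx, ← Real.exp_nat_mul]
      congr 1
      push_cast
      ring
    rw [this]
    linarith
  have e1 : ‖cexp (-(Real.pi * z) * I)‖ = x := by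
    rw [Complex.norm_exp, hx, ← hz]
    congr 1
    simp [Complex.mul_re, Complex.mul_im]
  have e2 : ‖cexp (Real.pi * z * I)‖ = x⁻¹ := by
    rw [Complex.norm_exp, hx, ← hz, ← Real.exp_neg]
    congr 1
    simp [Complex.mul_re, Complex.mul_im]
  have hsin : ‖Complex.sin (Real.pi * z)‖ =
      ‖cexp (-(Real.pi * z) * I) - cexp (Real.pi * z * I)‖ / 2 := by
    rw [Complex.sin, norm_div, norm_mul, Complex.norm_I, mul_one, Complex.norm_two]
  have hs1 := norm_sub_norm_le (cexp (-(Real.pi * z) * I)) (cexp (Real.pi * z * I))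
  have hs2 := norm_sub_le (cexp (-(Real.pi * z) * I)) (cexp (Real.pi * z * I))
  rw [e1, e2] at hs1 hs2
  have hxi : x⁻¹ ≤ x / 2 := by
    rw [inv_le_iff_one_le_mul₀ hx0]
    nlinarith
  have hE : Real.exp (-(Real.pi * z.im ^ 2 / τ.im)) * Real.exp (-(Real.pi * (1 / 4) * τ.im)) =
      x⁻¹ := by
    rw [← Real.exp_add, hx, ← Real.exp_neg, hz]
    congr 1
    field_simp
    ring
  set A := Real.exp (-(Real.pi * z.im ^ 2 / τ.im))
  set B := Real.exp (-(Real.pi * (1 / 4) * τ.im))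
  have hA : 0 < A := Real.exp_pos _
  have hxx : x⁻¹ * x = 1 := inv_mul_cancel₀ hx0.ne'
  have hxi0 : 0 < x⁻¹ := inv_pos.mpr hx0
  rw [thetaNorm]
  constructor
  · calc (1 / 4 : ℝ) = x⁻¹ * (x / 4) := by linear_combination -(1 / 4) * hxx
      _ ≤ x⁻¹ * ‖Complex.sin (Real.pi * z)‖ := by
        apply mul_le_mul_of_nonneg_left _ hxi0.le
        rw [hsin]
        linarith
      _ = (B * ‖Complex.sin (Real.pi * z)‖) * A := by rw [← hE]; ring
      _ ≤ ‖theta z τ‖ * A := mul_le_mul_of_nonneg_right h1 hA.le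
  · calc ‖theta z τ‖ * A ≤ 3 * (B * ‖Complex.sin (Real.pi * z)‖) * A :=
        mul_le_mul_of_nonneg_right h2 hA.le
      _ = 3 * (x⁻¹ * ‖Complex.sin (Real.pi * z)‖) := by rw [← hE]; ring
      _ ≤ 3 * (x⁻¹ * x) := by
        apply mul_le_mul_of_nonneg_left _ (by norm_num)
        apply mul_le_mul_of_nonneg_left _ hxi0.le
        rw [hsin]
        linarith
      _ = 3 := by rw [hxx, mul_one]

theorem thetaNorm_halfPeriod_even {τ : ℂ} (hτ : 0 < τ.im) (hτ' : 3 ≤ 4 * τ.im ^ 2) {m n : ℤ}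
    (hm : Even m) (hn : Odd n) :
    Real.exp (-(Real.pi * (1 / 4) * τ.im)) ≤ thetaNorm ((m * τ + n) / 2) τ ∧
      thetaNorm ((m * τ + n) / 2) τ ≤ 3 * Real.exp (-(Real.pi * (1 / 4) * τ.im)) := by
  obtain ⟨a, rfl⟩ := hm
  obtain ⟨b, rfl⟩ := hn
  rw [show (((a + a : ℤ) : ℂ) * τ + ((2 * b + 1 : ℤ) : ℂ)) / 2 = 1 / 2 + (a * τ + b) by
    push_cast; ring, thetaNorm_add_mem hτ ⟨a, b, rfl⟩]
  exact thetaNorm_half hτ hτ'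

theorem thetaNorm_halfPeriod_odd {τ : ℂ} (hτ : 0 < τ.im) (hτ' : 3 ≤ 4 * τ.im ^ 2) {m n : ℤ}
    (hm : Odd m) : 1 / 4 ≤ thetaNorm ((m * τ + n) / 2) τ ∧ thetaNorm ((m * τ + n) / 2) τ ≤ 3 := by
  obtain ⟨a, rfl⟩ := hm
  rw [show (((2 * a + 1 : ℤ) : ℂ) * τ + n) / 2 = (τ / 2 + n / 2) + (a * τ + (0 : ℤ)) by
    push_cast; ring, thetaNorm_add_mem hτ ⟨a, 0, rfl⟩]
  apply thetaNorm_of_im_eq hτ hτ'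
  simp

/-- The discriminant of the fibre over `a`. -/
noncomputable def fibreDisc (a : ℂ) : ℂ := (a + 1 / a - 2) ^ 2 * ((a + 1 / a - 2) ^ 2 - 16)

theorem fibreDisc_hauptmodul (τ : ℍ) : fibreDisc (hauptmodul τ) =
    16 * (uCoord (τ / 2) τ - uCoord (τ / 2 + 1 / 2) τ) ^ 2 := by
  have h1 := quadratic_tau_half τ
  have h2 := quadratic_tau_half_add_half τ
  have h3 := uCoord_tau_half_ne τ
  rw [fibreDisc, ← kappa_sq]
  set x := uCoord (τ / 2) τ
  set y := uCoord (τ / 2 + 1 / 2) τ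
  have h4 : 4 * (x + y) = 8 - kappa τ ^ 4 := by
    apply mul_left_cancel₀ (sub_ne_zero.mpr h3)
    linear_combination h1 - h2
  -- the discriminant of the quadratic equation with roots `x` and `y`
  have h5 : 4 * (x * y) = 4 := by linear_combination -h1 + x * h4
  linear_combination (-4 * (x + y) - 8 + kappa τ ^ 4) * h4 + 16 * h5

/-- The discriminant in terms of the values of theta at the three half periods. -/
theorem norm_fibreDisc_mul (τ : ℍ) : ‖fibreDisc (hauptmodul τ)‖ *
    (thetaNorm (τ / 2) τ ^ 4 * thetaNorm (τ / 2 + 1 / 2) τ ^ 4) =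
      16 * thetaNorm (1 / 2) τ ^ 8 := by
  have h1 := (theta_ne_zero_iff τ _).mpr (tau_half_not_mem τ)
  have h2 := (theta_ne_zero_iff τ _).mpr (tau_half_add_half_not_mem τ)
  have e : ‖uCoord (τ / 2) τ - uCoord (τ / 2 + 1 / 2) τ‖ * (‖theta (τ / 2) τ‖ ^ 2 *
      ‖theta (τ / 2 + 1 / 2) τ‖ ^ 2) =
      ‖theta (1 / 2) τ‖ ^ 4 * ‖cexp (-(2 * Real.pi * I * (1 / 2)) - Real.pi * I * τ)‖ := by
    rw [uCoord_sub_uCoord (tau_half_not_mem τ) (tau_half_add_half_not_mem τ), norm_div, norm_neg,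
      norm_mul, norm_mul, norm_mul, norm_pow, norm_pow, norm_pow,
      div_mul_cancel₀ _ (by positivity),
      show (τ / 2 - (τ / 2 + 1 / 2) : ℂ) = -(1 / 2) by ring, theta_neg, norm_neg,
      show (τ / 2 + (τ / 2 + 1 / 2) : ℂ) = 1 / 2 + ((1 : ℤ) * τ + (0 : ℤ)) by push_cast; ring,
      theta_add_lattice]
    simp only [add_zero, zpow_one, Int.cast_one, mul_one, one_pow, norm_mul, norm_neg, norm_one,
      one_mul]
    ring
  have e2 : ‖cexp (-(2 * Real.pi * I * (1 / 2)) - Real.pi * I * τ)‖ =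
      Real.exp (Real.pi * (τ : ℂ).im) := by
    rw [Complex.norm_exp]
    congr 1
    simp [Complex.mul_re, Complex.mul_im]
  rw [e2] at e
  rw [fibreDisc_hauptmodul, norm_mul, norm_pow, thetaNorm, thetaNorm, thetaNorm]
  have hi1 : (τ / 2 : ℂ).im = (τ : ℂ).im / 2 := by simp
  have hi2 : (τ / 2 + 1 / 2 : ℂ).im = (τ : ℂ).im / 2 := by simp
  have hi3 : (1 / 2 : ℂ).im = 0 := by simp
  have hy : 0 < (τ : ℂ).im := τ.im_pos
  rw [hi1, hi2, hi3]
  have e3 : Real.exp (-(Real.pi * ((τ : ℂ).im / 2) ^ 2 / (τ : ℂ).im)) ^ 4 *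
      Real.exp (Real.pi * (τ : ℂ).im) = 1 := by
    rw [← Real.exp_nat_mul, ← Real.exp_add, Real.exp_eq_one_iff]
    field_simp
    push_cast
    ring
  generalize Real.exp (-(Real.pi * ((τ : ℂ).im / 2) ^ 2 / (τ : ℂ).im)) = A at *
  generalize Real.exp (Real.pi * (τ : ℂ).im) = B at *
  norm_num
  generalize ‖uCoord (τ / 2) τ - uCoord (τ / 2 + 1 / 2) τ‖ = D at *
  generalize ‖theta (1 / 2) τ‖ = t at *
  calc _ = 16 * (D * (‖theta (τ / 2) τ‖ ^ 2 * ‖theta (τ / 2 + 1 / 2) τ‖ ^ 2)) ^ 2 * A ^ 8 := by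
        ring
    _ = 16 * (t ^ 4) ^ 2 * (A ^ 4 * B) ^ 2 := by rw [e]; ring
    _ = _ := by rw [e3]; ring

/-- The discriminant at a translate of `σ`, in terms of the half periods of `σ`. -/
theorem norm_fibreDisc_smul (δ : SL(2, ℤ)) (σ : ℍ) : ‖fibreDisc (hauptmodul (δ • σ : ℍ))‖ *
    (thetaNorm (((δ 0 0 : ℤ) * σ + (δ 0 1 : ℤ)) / 2) σ ^ 4 *
      thetaNorm (((δ 0 0 + δ 1 0 : ℤ) * σ + (δ 0 1 + δ 1 1 : ℤ)) / 2) σ ^ 4) =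
      16 * thetaNorm (((δ 1 0 : ℤ) * σ + (δ 1 1 : ℤ)) / 2) σ ^ 8 := by
  obtain ⟨C, hC, h⟩ := thetaNorm_smul δ σ
  have hj := autFactor_ne_zero δ σ
  have hm := norm_fibreDisc_mul (δ • σ)
  have hjj : autFactor δ σ = (δ 1 0 : ℤ) * (σ : ℂ) + (δ 1 1 : ℤ) := rfl
  have e1 := h (((δ 1 0 : ℤ) * σ + (δ 1 1 : ℤ)) / 2)
  have e2 := h (((δ 0 0 : ℤ) * σ + (δ 0 1 : ℤ)) / 2)
  have e3 := h (((δ 0 0 + δ 1 0 : ℤ) * σ + (δ 0 1 + δ 1 1 : ℤ)) / 2)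
  rw [← hjj, div_right_comm, div_self hj, hjj] at e1
  rw [div_right_comm, ← coe_smul_eq] at e2
  rw [show (((δ 0 0 + δ 1 0 : ℤ) : ℂ) * σ + ((δ 0 1 + δ 1 1 : ℤ) : ℂ)) / 2 / autFactor δ σ =
    ((δ • σ : ℍ) : ℂ) / 2 + 1 / 2 by
      rw [coe_smul_eq]
      field_simp
      rw [hjj]
      push_cast
      ring] at e3
  rw [e1, e2, e3] at hm
  apply mul_left_cancel₀ (pow_ne_zero 8 hC.ne')
  linear_combination hm

/-- Near the cusps the discriminant tends to `0` or to `∞`, uniformly and at most exponentially. -/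
theorem fibreDisc_smul_bounds (δ : SL(2, ℤ)) {σ : ℍ} (hσ : 3 ≤ 4 * σ.im ^ 2) :
    Real.exp (Real.pi * σ.im) ≤ 12 ^ 10 * (‖fibreDisc (hauptmodul (δ • σ : ℍ))‖ +
        ‖fibreDisc (hauptmodul (δ • σ : ℍ))‖⁻¹) ∧
      ‖fibreDisc (hauptmodul (δ • σ : ℍ))‖ + ‖fibreDisc (hauptmodul (δ • σ : ℍ))‖⁻¹ ≤
        12 ^ 10 * Real.exp (2 * Real.pi * σ.im) := by
  have h := norm_fibreDisc_smul δ σ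
  have hdet := det_eq_one δ
  have hev := fun {m n : ℤ} (hm : Even m) (hn : Odd n) =>
    thetaNorm_halfPeriod_even (τ := σ) σ.im_pos hσ hm hn
  have hod := fun {m n : ℤ} (hm : Odd m) =>
    thetaNorm_halfPeriod_odd (τ := σ) (n := n) σ.im_pos hσ hm
  set x := Real.exp (-(Real.pi * (1 / 4) * (σ : ℂ).im)) with hx
  have hx0 : 0 < x := Real.exp_pos _
  have hx1 : x ≤ 1 := by
    rw [hx, Real.exp_le_one_iff, neg_nonpos]
    have := σ.im_pos
    have := Real.pi_pos
    rw [UpperHalfPlane.coe_im]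
    positivity
  have e1 : Real.exp (Real.pi * σ.im) = (x ^ 4)⁻¹ := by
    rw [hx, ← Real.exp_nat_mul, ← Real.exp_neg]
    congr 1
    rw [UpperHalfPlane.coe_im]
    push_cast
    ring
  have e2 : Real.exp (2 * Real.pi * σ.im) = (x ^ 8)⁻¹ := by
    rw [hx, ← Real.exp_nat_mul, ← Real.exp_neg]
    congr 1
    rw [UpperHalfPlane.coe_im]
    push_cast
    ring
  rw [e1, e2]
  set D := ‖fibreDisc (hauptmodul (δ • σ : ℍ))‖ with hD
  have hD0 : 0 ≤ D := norm_nonneg _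
  have hx4 : x ^ 4 ≤ 1 := pow_le_one₀ hx0.le hx1
  have hx8 : x ^ 8 ≤ x ^ 4 := pow_le_pow_of_le_one hx0.le hx1 (by norm_num)
  have hx80 : 0 < x ^ 8 := by positivity
  have hx40 : 0 < x ^ 4 := by positivity
  by_cases hc : Even (δ 1 0)
  · have hd : Odd (δ 1 1) := by
      rcases Int.even_or_odd (δ 1 1) with hd | hd
      · have : Even (1 : ℤ) := by
          rw [← hdet]
          exact (hd.mul_left _).sub (hc.mul_left _)
        exact absurd this (by decide)
      · exact hd
    have ha : Odd (δ 0 0) := by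
      rcases Int.even_or_odd (δ 0 0) with ha | ha
      · have : Even (1 : ℤ) := by
          rw [← hdet]
          exact (ha.mul_right _).sub (hc.mul_left _)
        exact absurd this (by decide)
      · exact ha
    obtain ⟨p1, p2⟩ := hev hc hd
    obtain ⟨q1, q2⟩ := hod (n := δ 0 1) ha
    obtain ⟨r1, r2⟩ := hod (n := δ 0 1 + δ 1 1) (ha.add_even hc)
    set A := thetaNorm (((δ 1 0 : ℤ) * σ + (δ 1 1 : ℤ)) / 2) σ
    set B := thetaNorm (((δ 0 0 : ℤ) * σ + (δ 0 1 : ℤ)) / 2) σ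
    set C := thetaNorm (((δ 0 0 + δ 1 0 : ℤ) * σ + (δ 0 1 + δ 1 1 : ℤ)) / 2) σ
    have hA8 : x ^ 8 ≤ A ^ 8 := pow_le_pow_left₀ hx0.le p1 8
    have hA8' : A ^ 8 ≤ 3 ^ 8 * x ^ 8 := by
      rw [← mul_pow]; exact pow_le_pow_left₀ (hx0.le.trans p1) p2 8
    have hBC : (1 / 4) ^ 4 * (1 / 4) ^ 4 ≤ B ^ 4 * C ^ 4 :=
      mul_le_mul (pow_le_pow_left₀ (by norm_num) q1 4) (pow_le_pow_left₀ (by norm_num) r1 4)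
        (by norm_num) (by positivity)
    have hBC' : B ^ 4 * C ^ 4 ≤ 3 ^ 4 * 3 ^ 4 :=
      mul_le_mul (pow_le_pow_left₀ (by linarith) q2 4) (pow_le_pow_left₀ (by linarith) r2 4)
        (by positivity) (by norm_num)
    have hDpos : 0 < D := by
      refine hD0.lt_of_ne fun h0 => ?_
      rw [← h0, zero_mul] at h
      linarith
    have hDu : D ≤ 16 * 12 ^ 8 * x ^ 8 := by
      have : D * ((1 / 4) ^ 4 * (1 / 4) ^ 4) ≤ 16 * (3 ^ 8 * x ^ 8) := by
        calc _ ≤ D * (B ^ 4 * C ^ 4) := mul_le_mul_of_nonneg_left hBC hD0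
          _ = 16 * A ^ 8 := h
          _ ≤ _ := by linarith
      linarith
    have hDl : 16 * x ^ 8 ≤ 3 ^ 8 * D := by
      have : 16 * A ^ 8 ≤ D * (3 ^ 4 * 3 ^ 4) := by
        rw [← h]; exact mul_le_mul_of_nonneg_left hBC' hD0
      linarith
    constructor
    · have : (16 * 12 ^ 8 * x ^ 4)⁻¹ ≤ D⁻¹ :=
        inv_anti₀ hDpos (hDu.trans (mul_le_mul_of_nonneg_left hx8 (by norm_num)))
      rw [mul_inv] at this
      have h4 : 0 < (x ^ 4)⁻¹ := inv_pos.mpr hx40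
      linarith
    · have h1 : D⁻¹ ≤ 3 ^ 8 * (x ^ 8)⁻¹ := by
        rw [inv_le_iff_one_le_mul₀ hDpos, mul_assoc, mul_comm _ D, ← mul_assoc,
          ← div_eq_mul_inv, one_le_div hx80]
        linarith
      have h2 : 1 ≤ (x ^ 8)⁻¹ := (one_le_inv₀ hx80).mpr (hx8.trans hx4)
      linarith
  · have hc' := Int.not_even_iff_odd.mp hc
    obtain ⟨p1, p2⟩ := hod (n := δ 1 1) hc'
    set A := thetaNorm (((δ 1 0 : ℤ) * σ + (δ 1 1 : ℤ)) / 2) σ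
    set B := thetaNorm (((δ 0 0 : ℤ) * σ + (δ 0 1 : ℤ)) / 2) σ with hB
    set C := thetaNorm (((δ 0 0 + δ 1 0 : ℤ) * σ + (δ 0 1 + δ 1 1 : ℤ)) / 2) σ with hC
    have hA8 : (1 / 4) ^ 8 ≤ A ^ 8 := pow_le_pow_left₀ (by norm_num) p1 8
    have hA8' : A ^ 8 ≤ 3 ^ 8 := pow_le_pow_left₀ (by linarith) p2 8
    -- exactly one of the other two half periods is congruent to `1 / 2`
    have hBC : x ^ 4 * (1 / 4) ^ 4 ≤ B ^ 4 * C ^ 4 ∧ B ^ 4 * C ^ 4 ≤ (3 * x) ^ 4 * 3 ^ 4 := by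
      have hcomb : ∀ b c : ℝ, x ≤ b ∧ b ≤ 3 * x → 1 / 4 ≤ c ∧ c ≤ 3 →
          x ^ 4 * (1 / 4) ^ 4 ≤ b ^ 4 * c ^ 4 ∧ b ^ 4 * c ^ 4 ≤ (3 * x) ^ 4 * 3 ^ 4 := by
        rintro b c ⟨b1, b2⟩ ⟨c1, c2⟩
        exact ⟨mul_le_mul (pow_le_pow_left₀ hx0.le b1 4) (pow_le_pow_left₀ (by norm_num) c1 4)
          (by norm_num) (by positivity),
          mul_le_mul (pow_le_pow_left₀ (hx0.le.trans b1) b2 4)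
            (pow_le_pow_left₀ (by linarith) c2 4) (by positivity) (by positivity)⟩
      by_cases ha : Even (δ 0 0)
      · have hb : Odd (δ 0 1) := by
          rcases Int.even_or_odd (δ 0 1) with hb | hb
          · have : Even (1 : ℤ) := by
              rw [← hdet]
              exact (ha.mul_right _).sub (hb.mul_right _)
            exact absurd this (by decide)
          · exact hb
        exact hcomb B C (hev ha hb) (hod (ha.add_odd hc'))
      · have ha' := Int.not_even_iff_odd.mp ha
        have hbd : Odd (δ 0 1 + δ 1 1) := by
          rcases Int.even_or_odd (δ 0 1 + δ 1 1) with hb | hb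
          · have : Even (1 : ℤ) := by
              rw [← hdet, show δ 0 0 * δ 1 1 - δ 0 1 * δ 1 0 =
                δ 0 0 * (δ 0 1 + δ 1 1) - δ 0 1 * (δ 0 0 + δ 1 0) by ring]
              exact (hb.mul_left _).sub ((ha'.add_odd hc').mul_left _)
            exact absurd this (by decide)
          · exact hb
        rw [mul_comm (B ^ 4)]
        exact hcomb C B (hev (ha'.add_odd hc') hbd) (hod ha')
    obtain ⟨hBC1, hBC2⟩ := hBC
    have hDpos : 0 < D := by
      refine hD0.lt_of_ne fun h0 => ?_
      rw [← h0, zero_mul] at h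
      linarith
    have hDu : D * x ^ 4 ≤ 16 * 12 ^ 8 := by
      have : D * (x ^ 4 * (1 / 4) ^ 4) ≤ 16 * 3 ^ 8 := by
        calc _ ≤ D * (B ^ 4 * C ^ 4) := mul_le_mul_of_nonneg_left hBC1 hD0
          _ = 16 * A ^ 8 := h
          _ ≤ _ := by linarith
      linarith
    have hDl : 16 ≤ 12 ^ 8 * (D * x ^ 4) := by
      have : 16 * A ^ 8 ≤ D * ((3 * x) ^ 4 * 3 ^ 4) := by
        rw [← h]; exact mul_le_mul_of_nonneg_left hBC2 hD0
      linarith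
    constructor
    · have h1 : (x ^ 4)⁻¹ ≤ 12 ^ 8 * D := by
        rw [inv_le_iff_one_le_mul₀ hx40]
        linarith
      have h2 : 0 < D⁻¹ := inv_pos.mpr hDpos
      linarith
    · have h1 : D ≤ 16 * 12 ^ 8 * (x ^ 4)⁻¹ := by
        rw [← div_eq_mul_inv, le_div_iff₀ hx40]
        exact hDu
      have h2 : D⁻¹ ≤ 12 ^ 8 := by
        rw [inv_le_iff_one_le_mul₀ hDpos]
        have : D * x ^ 4 ≤ D := mul_le_of_le_one_right hD0 hx4
        linarith
      have h3 : (x ^ 4)⁻¹ ≤ (x ^ 8)⁻¹ := inv_anti₀ hx80 hx8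
      have h4 : 1 ≤ (x ^ 8)⁻¹ := (one_le_inv₀ hx80).mpr (hx8.trans hx4)
      linarith

end ModularFibration

namespace ModularFibration

open Complex Filter

/-! ### The Hauptmodul maps onto the smooth locus -/

theorem fibreDisc_mul (a : ℂ) (ha : a ≠ 0) : fibreDisc a * a ^ 4 =
    (a - 1) ^ 4 * (a + 1) ^ 2 *
      ((a - (3 + 2 * (Real.sqrt 2 : ℂ))) * (a - (3 - 2 * (Real.sqrt 2 : ℂ)))) := by
  have h2 : (Real.sqrt 2 : ℂ) ^ 2 = 2 := by
    rw [← Complex.ofReal_pow, Real.sq_sqrt (by norm_num)]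
    norm_num
  have h3 : (a - (3 + 2 * (Real.sqrt 2 : ℂ))) * (a - (3 - 2 * (Real.sqrt 2 : ℂ))) =
      a ^ 2 - 6 * a + 1 := by linear_combination -4 * h2
  rw [h3, fibreDisc]
  field_simp
  ring

theorem mem_smoothLocus_E_iff_fibreDisc {a : ℂ} :
    a ∈ smoothLocus E ↔ a ≠ 0 ∧ fibreDisc a ≠ 0 := mem_smoothLocus_E_iff a

theorem mem_smoothLocus_E_iff_ne {a : ℂ} : a ∈ smoothLocus E ↔
    a ≠ 0 ∧ a ≠ 1 ∧ a ≠ -1 ∧ a ≠ 3 + 2 * (Real.sqrt 2 : ℂ) ∧ a ≠ 3 - 2 * (Real.sqrt 2 : ℂ) := by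
  rw [mem_smoothLocus_E_iff_fibreDisc]
  refine and_congr_right fun ha => ?_
  have h := fibreDisc_mul a ha
  have h1 : fibreDisc a = 0 ↔ fibreDisc a * a ^ 4 = 0 := by
    rw [mul_eq_zero, or_iff_left (pow_ne_zero 4 ha)]
  rw [Ne, h1, h]
  simp only [mul_eq_zero, pow_eq_zero_iff, ne_eq, OfNat.ofNat_ne_zero, not_false_eq_true,
    sub_eq_zero, add_eq_zero_iff_eq_neg]
  tauto

theorem smoothLocus_E_eq : smoothLocus E =
    ({0, 1, -1, 3 + 2 * (Real.sqrt 2 : ℂ), 3 - 2 * (Real.sqrt 2 : ℂ)} : Set ℂ)ᶜ := by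
  ext a
  rw [mem_smoothLocus_E_iff_ne]
  simp only [Set.mem_compl_iff, Set.mem_insert_iff, Set.mem_singleton_iff]
  tauto

theorem isPreconnected_smoothLocus_E : IsPreconnected (smoothLocus E) := by
  rw [smoothLocus_E_eq]
  refine (Set.Countable.isConnected_compl_of_one_lt_rank (by simp) ?_).isPreconnected
  exact (Set.toFinite _).countable

/-- Finitely many translates of the fundamental domain of `SL(2, ℤ)` cover `ℍ` modulo a subgroup
of finite index. -/
theorem exists_finite_translates (Γ : Subgroup SL(2, ℤ)) [Γ.FiniteIndex] :
    ∃ S : Set SL(2, ℤ), S.Finite ∧ ∀ τ : ℍ, ∃ γ ∈ Γ, ∃ δ ∈ S, ∃ σ ∈ ModularGroup.fd,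
      γ • τ = δ • σ := by
  have : Finite (SL(2, ℤ) ⧸ Γ) := Subgroup.finite_quotient_of_finiteIndex
  refine ⟨Set.range fun q : SL(2, ℤ) ⧸ Γ => (Quotient.out q)⁻¹, Set.finite_range _, fun τ => ?_⟩
  obtain ⟨g, hg⟩ := ModularGroup.exists_smul_mem_fd τ
  set δ := Quotient.out (g : SL(2, ℤ) ⧸ Γ) with hδ
  have hmem : δ⁻¹ * g ∈ Γ := by
    rw [← QuotientGroup.eq]
    exact QuotientGroup.out_eq' _
  exact ⟨δ⁻¹ * g, hmem, δ⁻¹, ⟨_, rfl⟩, g • τ, hg, by rw [mul_smul]⟩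

theorem continuous_smul_coe (δ : SL(2, ℤ)) : Continuous fun σ : ℍ => δ • σ := by
  simp only [ModularGroup.sl_moeb]
  exact continuous_const_smul _

theorem continuous_hauptmodul : Continuous fun τ : ℍ => hauptmodul τ :=
  continuous_iff_continuousAt.mpr fun τ =>
    ContinuousAt.comp (f := ((↑) : ℍ → ℂ)) (g := hauptmodul)
      (differentiableAt_hauptmodul τ.im_pos).continuousAt
      UpperHalfPlane.continuous_coe.continuousAt

theorem continuousAt_fibreDisc {a : ℂ} (ha : a ≠ 0) : ContinuousAt fibreDisc a := by
  unfold fibreDisc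
  fun_prop (disch := assumption)

/-- Open mapping theorem; the Hauptmodul is not constant because the discriminant of its fibre tends
to `0` or to `∞` at a cusp. -/
theorem isOpen_range_hauptmodul : IsOpen (Set.range fun τ : ℍ => hauptmodul τ) := by
  have hU : IsOpen {z : ℂ | 0 < z.im} := isOpen_lt continuous_const Complex.continuous_im
  have hr : (Set.range fun τ : ℍ => hauptmodul τ) = hauptmodul '' {z : ℂ | 0 < z.im} := by
    ext a
    constructor
    · rintro ⟨τ, rfl⟩
      exact ⟨τ, τ.im_pos, rfl⟩
    · rintro ⟨z, hz, rfl⟩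
      exact ⟨⟨z, hz⟩, rfl⟩
  have ha : AnalyticOnNhd ℂ hauptmodul {z : ℂ | 0 < z.im} :=
    DifferentiableOn.analyticOnNhd
      (fun z hz => (differentiableAt_hauptmodul hz).differentiableWithinAt) hU
  have hc : IsPreconnected {z : ℂ | 0 < z.im} := (convex_halfSpace_im_gt 0).isPreconnected
  rw [hr]
  rcases ha.is_constant_or_isOpen hc with ⟨w, hw⟩ | h
  · -- a constant Hauptmodul would contradict the behaviour of the discriminant at the cusp
    exfalso
    set M := 12 ^ 10 * (‖fibreDisc w‖ + ‖fibreDisc w‖⁻¹) with hM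
    have hb : ∀ y : ℝ, 1 ≤ y → Real.exp (Real.pi * y) ≤ M := by
      intro y hy
      have hy0 : 0 < y := by linarith
      set σ : ℍ := ⟨y * I, by simpa using hy0⟩
      have hσ : σ.im = y := by
        change ((y : ℂ) * I).im = y
        simp
      have h1 := (fibreDisc_smul_bounds 1 (σ := σ) (by rw [hσ]; nlinarith)).1
      rwa [one_smul, hw σ σ.im_pos, hσ] at h1
    have h1 := hb (max 1 M) (le_max_left _ _)
    have h2 := Real.add_one_le_exp (Real.pi * max 1 M)
    have h3 := Real.pi_gt_three
    nlinarith [le_max_left 1 M, le_max_right 1 M]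
  · exact h _ subset_rfl hU

/-- The image of the Hauptmodul is closed in the smooth locus: near a point of the smooth locus the
discriminant is bounded above and below, which confines the parameters to a compact set modulo
`Γ₁(8)`. -/
theorem closure_range_hauptmodul_inter :
    closure (Set.range fun τ : ℍ => hauptmodul τ) ∩ smoothLocus E ⊆
      Set.range fun τ : ℍ => hauptmodul τ := by
  rintro a ⟨hcl, ha⟩
  obtain ⟨ha0, haD⟩ := mem_smoothLocus_E_iff_fibreDisc.mp ha
  set Q : ℂ → ℝ := fun a => ‖fibreDisc a‖ + ‖fibreDisc a‖⁻¹ with hQ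
  have hQc : ContinuousAt Q a :=
    (continuousAt_fibreDisc ha0).norm.add
      ((continuousAt_fibreDisc ha0).norm.inv₀ (norm_ne_zero_iff.mpr haD))
  set B := Q a + 1 with hB
  have hnhds : ∀ᶠ b in 𝓝 a, Q b < B := hQc.eventually_lt_const (by linarith)
  -- near `a` only a compact part of each translate of the fundamental domain contributes
  obtain ⟨S, hS, hcov⟩ := exists_finite_translates (CongruenceSubgroup.Gamma1 8)
  set K : Set ℂ := ⋃ δ ∈ S, (fun σ : ℍ => hauptmodul (δ • σ : ℍ)) ''
    ModularGroup.truncatedFundamentalDomain (12 ^ 10 * B) with hK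
  have hKc : IsCompact K := hS.isCompact_biUnion fun δ _ =>
    (ModularGroup.isCompact_truncatedFundamentalDomain _).image
      (continuous_hauptmodul.comp (continuous_smul_coe δ))
  have haK : a ∈ closure K := by
    rw [mem_closure_iff_nhds] at hcl ⊢
    intro t ht
    obtain ⟨b, ⟨hbt, hb⟩, τ, rfl⟩ := hcl _ (inter_mem ht hnhds)
    refine ⟨_, hbt, ?_⟩
    obtain ⟨γ, hγ, δ, hδ, σ, hσ, h⟩ := hcov τ
    have h1 : hauptmodul τ = hauptmodul (δ • σ : ℍ) := by rw [← h, hauptmodul_smul hγ]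
    refine Set.mem_biUnion hδ ⟨σ, ⟨hσ, ?_⟩, h1.symm⟩
    have h2 := (fibreDisc_smul_bounds δ
      (ModularGroup.three_le_four_mul_im_sq_of_mem_fd hσ)).1
    have h3 : Q (hauptmodul (δ • σ : ℍ)) < B := h1 ▸ hb
    have h4 := Real.add_one_le_exp (Real.pi * σ.im)
    have h5 := Real.pi_gt_three
    have h6 := σ.im_pos
    have h7 : (12 : ℝ) ^ 10 * Q (hauptmodul (δ • σ : ℍ)) < 12 ^ 10 * B :=
      mul_lt_mul_of_pos_left h3 (by norm_num)
    nlinarith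
  rw [hKc.isClosed.closure_eq] at haK
  obtain ⟨δ, -, σ, -, h⟩ := Set.mem_iUnion₂.mp haK
  exact ⟨δ • σ, h⟩

/-- The image is open and closed in the smooth locus, which is connected. -/
theorem range_hauptmodul : (Set.range fun τ : ℍ => hauptmodul τ) = smoothLocus E := by
  refine Set.Subset.antisymm ?_ ?_
  · rintro _ ⟨τ, rfl⟩
    exact hauptmodul_mem_smoothLocus τ
  · refine isPreconnected_smoothLocus_E.subset_of_closure_inter_subset isOpen_range_hauptmodul
      ⟨hauptmodul UpperHalfPlane.I, hauptmodul_mem_smoothLocus _, ⟨_, rfl⟩⟩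
      closure_range_hauptmodul_inter

theorem range_uniformisation : Set.range uniformisation = smoothPart E := by
  refine Set.Subset.antisymm ?_ ?_
  · rintro _ ⟨q, rfl⟩
    exact uniformisation_mem_smoothPart q
  · rintro ⟨a, P⟩ ⟨ha, hP⟩
    have ha' : a ∈ smoothLocus E := ha
    rw [← range_hauptmodul] at ha'
    obtain ⟨τ, rfl⟩ := ha'
    obtain ⟨z, hz⟩ := exists_uniformisation_eq τ P.rep_nonzero
      ((fibre_equation_iff τ P.rep).mp hP)
    refine ⟨(τ, z), ?_⟩
    rw [uniformisation]
    refine Prod.ext rfl ?_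
    rw [Projectivization.mk_rep] at hz
    exact hz

end ModularFibration

namespace ModularFibration

open Complex Filter

/-! ### Global lifts of sections -/

theorem isOpen_halfPlane : IsOpen {z : ℂ | 0 < z.im} :=
  isOpen_lt continuous_const Complex.continuous_im

theorem isPreconnected_halfPlane : IsPreconnected {z : ℂ | 0 < z.im} :=
  (convex_halfSpace_im_gt 0).isPreconnected

/-- A holomorphic function on the upper half plane has a primitive; the Cayley transform reduces
this to the unit disc. -/
theorem exists_primitive_halfPlane {g : ℂ → ℂ} (hg : DifferentiableOn ℂ g {z : ℂ | 0 < z.im}) :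
    ∃ F : ℂ → ℂ, ∀ z : ℂ, 0 < z.im → HasDerivAt F (g z) z := by
  have hne : ∀ w ∈ Metric.ball (0 : ℂ) 1, 1 - w ≠ 0 := by
    intro w hw h
    rw [mem_ball_zero_iff, ← sub_eq_zero.mp h, norm_one] at hw
    exact lt_irrefl _ hw
  have him : ∀ w ∈ Metric.ball (0 : ℂ) 1, 0 < (I * (1 + w) / (1 - w)).im := by
    intro w hw
    have h1 := hne w hw
    rw [mem_ball_zero_iff] at hw
    have h2 : normSq w < 1 := by
      rw [Complex.normSq_eq_norm_sq]
      nlinarith [norm_nonneg w]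
    have h3 : (I * (1 + w) / (1 - w)).im = (1 - normSq w) / normSq (1 - w) := by
      rw [Complex.div_im]
      simp [Complex.normSq_apply, Complex.mul_re, Complex.mul_im]
      ring
    rw [h3]
    exact div_pos (by linarith) (Complex.normSq_pos.mpr h1)
  have hG : DifferentiableOn ℂ (fun w => g (I * (1 + w) / (1 - w)) * (2 * I / (1 - w) ^ 2))
      (Metric.ball 0 1) := by
    have h1 : DifferentiableOn ℂ (fun w : ℂ => I * (1 + w) / (1 - w)) (Metric.ball 0 1) :=
      DifferentiableOn.div (by fun_prop) (by fun_prop) hne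
    refine (hg.comp h1 him).mul (DifferentiableOn.div (by fun_prop) (by fun_prop) ?_)
    exact fun w hw => pow_ne_zero 2 (hne w hw)
  obtain ⟨G, hG⟩ := hG.isExactOn_ball
  refine ⟨fun z => G ((z - I) / (z + I)), fun z hz => ?_⟩
  have hzI : z + I ≠ 0 := by
    intro h
    have := congrArg Complex.im h
    simp at this
    linarith
  have hmem : (z - I) / (z + I) ∈ Metric.ball (0 : ℂ) 1 := by
    rw [mem_ball_zero_iff, norm_div, div_lt_one (norm_pos_iff.mpr hzI),
      ← sq_lt_sq₀ (norm_nonneg _) (norm_nonneg _), ← Complex.normSq_eq_norm_sq,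
      ← Complex.normSq_eq_norm_sq]
    simp [Complex.normSq_apply]
    nlinarith
  have h1 : HasDerivAt (fun z : ℂ => (z - I) / (z + I)) (2 * I / (z + I) ^ 2) z := by
    refine (((hasDerivAt_id z).sub_const I).div ((hasDerivAt_id z).add_const I) hzI).congr_deriv ?_
    simp only [id]
    field_simp
    ring
  refine ((hG _ hmem).comp z h1).congr_deriv ?_
  have e1 : 1 - (z - I) / (z + I) = 2 * I / (z + I) := by
    field_simp
    ring
  have e2 : I * (1 + (z - I) / (z + I)) / (1 - (z - I) / (z + I)) = z := by
    rw [e1]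
    field_simp
    ring
  dsimp only
  rw [e2, e1]
  field_simp

theorem eventuallyEq_of_eventually_hasDerivAt {f g f' : ℂ → ℂ} {w : ℂ}
    (hf : ∀ᶠ u in 𝓝 w, HasDerivAt f (f' u) u) (hg : ∀ᶠ u in 𝓝 w, HasDerivAt g (f' u) u)
    (h : f w = g w) : f =ᶠ[𝓝 w] g := by
  have h1 : ∀ᶠ u in 𝓝 w, HasDerivAt (fun u => f u - g u) 0 u := by
    filter_upwards [hf, hg] with u hu hu'
    exact (hu.sub hu').congr_deriv (sub_self _)
  obtain ⟨ε, hε, hball⟩ := Metric.eventually_nhds_iff_ball.mp h1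
  filter_upwards [Metric.ball_mem_nhds w hε] with u hu
  have := Metric.isOpen_ball.is_const_of_deriv_eq_zero (convex_ball w ε).isPreconnected
    (fun v hv => (hball v hv).differentiableAt.differentiableWithinAt)
    (fun v hv => (hball v hv).deriv) hu (Metric.mem_ball_self hε)
  simpa [h, sub_eq_zero] using this

/-- `f` is, near `w`, a lift of the family of points `P` through the theta parametrisation. -/
def IsSectionLiftAt (P : ℂ → Fin 3 → ℂ) (w : ℂ) (f : ℂ → ℂ) : Prop :=
  ContDiffAt ℂ 1 f w ∧ ∀ᶠ u in 𝓝 w, ∃ c : ℂ, c ≠ 0 ∧ P u = c • cubicVec (f u) u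

theorem IsSectionLiftAt.eventually {P : ℂ → Fin 3 → ℂ} {w : ℂ} {f : ℂ → ℂ}
    (h : IsSectionLiftAt P w f) : ∀ᶠ u in 𝓝 w, IsSectionLiftAt P u f :=
  (h.1.eventually (by simp)).and h.2.eventually_nhds

theorem IsSectionLiftAt.exists_eventually_eq {P : ℂ → Fin 3 → ℂ} {w : ℂ} {f g : ℂ → ℂ}
    (hw : 0 < w.im) (hf : IsSectionLiftAt P w f) (hg : IsSectionLiftAt P w g) :
    ∃ m n : ℤ, ∀ᶠ u in 𝓝 w, f u = g u + (m * u + n) := by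
  obtain ⟨m, n, h⟩ := exists_eventually_eq_lattice (T := fun u => u) (d := fun u => f u - g u)
    continuousAt_id (hf.1.continuousAt.sub hg.1.continuousAt) hw (by
      filter_upwards [hf.2, hg.2, isOpen_halfPlane.mem_nhds hw] with u ⟨a, ha, h1⟩ ⟨b, hb, h2⟩ hu
      refine sub_mem_of_cubicVec_eq_smul (τ := ⟨u, hu⟩) (a⁻¹ * b) ?_
      change cubicVec (f u) u = (a⁻¹ * b) • cubicVec (g u) u
      rw [mul_smul, ← h2, h1, smul_smul, inv_mul_cancel₀ ha, one_smul])
  refine ⟨m, n, ?_⟩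
  filter_upwards [h] with u hu
  rw [← hu]
  ring

theorem IsSectionLiftAt.deriv_deriv_eq {P : ℂ → Fin 3 → ℂ} {w : ℂ} {f g : ℂ → ℂ}
    (hw : 0 < w.im) (hf : IsSectionLiftAt P w f) (hg : IsSectionLiftAt P w g) :
    deriv (deriv f) w = deriv (deriv g) w := by
  obtain ⟨m, n, h⟩ := hf.exists_eventually_eq hw hg
  have h1 : deriv f =ᶠ[𝓝 w] fun u => deriv g u + m := by
    filter_upwards [h.eventually_nhds, hg.eventually] with u hu hgu
    rw [EventuallyEq.deriv_eq (f₁ := f) (f := fun u => g u + (m * u + n)) hu]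
    have h2 := (hgu.1.differentiableAt one_ne_zero).hasDerivAt.add
      (((hasDerivAt_id u).const_mul (m : ℂ)).add_const (n : ℂ))
    exact (h2.congr_deriv (by simp)).deriv
  rw [h1.deriv_eq, deriv_add_const]

/-- Over the upper half plane a section lifts globally through the theta parametrisation. Second
derivatives of local lifts agree, and integrating them twice gives the lift. -/
theorem exists_global_lift {P : ℂ → Fin 3 → ℂ}
    (hP : ∀ w : ℂ, 0 < w.im → ContDiffAt ℂ 1 P w) (hP0 : ∀ w : ℂ, 0 < w.im → P w ≠ 0)
    (heq : ∀ w : ℂ, 0 < w.im → P w 1 ^ 2 * P w 2 + kappa w ^ 2 * P w 0 * P w 1 * P w 2 =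
      P w 0 * (P w 0 - P w 2) ^ 2) :
    ∃ f : ℂ → ℂ, DifferentiableOn ℂ f {z : ℂ | 0 < z.im} ∧
      ∀ w : ℂ, 0 < w.im → ∃ c : ℂ, c ≠ 0 ∧ P w = c • cubicVec (f w) w := by
  have hex : ∀ w : ℂ, ∃ f, 0 < w.im → IsSectionLiftAt P w f := by
    intro w
    by_cases hw : 0 < w.im
    · obtain ⟨z, hz⟩ := exists_uniformisation_eq ⟨w, hw⟩ (hP0 w hw) (heq w hw)
      obtain ⟨k, hk, hz⟩ := exists_smul_eq_of_mk_eq hz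
      obtain ⟨f, hf, -, hf'⟩ := exists_local_lift (T := fun u => u) (P := P) contDiffAt_id hw
        (hP w hw) (by
          filter_upwards [isOpen_halfPlane.mem_nhds hw] with u hu using heq u hu) hk hz
      exact ⟨f, fun _ => ⟨hf, hf'⟩⟩
    · exact ⟨0, fun h => absurd h hw⟩
  choose F hF using hex
  have hgf : ∀ {w f}, 0 < w.im → IsSectionLiftAt P w f →
      (fun u => deriv (deriv (F u)) u) =ᶠ[𝓝 w] deriv (deriv f) := by
    intro w f hw hf
    filter_upwards [hf.eventually, isOpen_halfPlane.mem_nhds hw] with u hu hu'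
      using (hF u hu').deriv_deriv_eq hu' hu
  have hgd : DifferentiableOn ℂ (fun u => deriv (deriv (F u)) u) {z : ℂ | 0 < z.im} := by
    intro w hw
    refine (DifferentiableAt.congr_of_eventuallyEq ?_
      (hgf hw (hF w hw))).differentiableWithinAt
    exact (analyticAt_of_contDiffAt_one (hF w hw).1).deriv.deriv.differentiableAt
  have hI : 0 < Complex.I.im := by simp
  set f₀ := F I
  have hf₀ := hF I hI
  obtain ⟨G, hG⟩ := exists_primitive_halfPlane hgd
  set G₁ : ℂ → ℂ := fun z => G z + (deriv f₀ I - G I) with hG₁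
  have hG₁d : ∀ z : ℂ, 0 < z.im → HasDerivAt G₁ (deriv (deriv (F z)) z) z := fun z hz =>
    (hG z hz).add_const _
  obtain ⟨H, hH⟩ := exists_primitive_halfPlane (g := G₁)
    (fun z hz => (hG₁d z hz).differentiableAt.differentiableWithinAt)
  set f : ℂ → ℂ := fun z => H z + (f₀ I - H I) with hf
  have hfd : ∀ z : ℂ, 0 < z.im → HasDerivAt f (G₁ z) z := fun z hz => (hH z hz).add_const _
  have hmemI := isOpen_halfPlane.mem_nhds hI
  have e1 : G₁ =ᶠ[𝓝 I] deriv f₀ := by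
    refine eventuallyEq_of_eventually_hasDerivAt (f' := deriv (deriv f₀)) ?_ ?_ (by simp [hG₁])
    · filter_upwards [hmemI, hgf hI hf₀] with u hu hu'
      rw [← hu']
      exact hG₁d u hu
    · filter_upwards [hf₀.eventually] with u hu
      exact (analyticAt_of_contDiffAt_one hu.1).deriv.differentiableAt.hasDerivAt
  have e2 : f =ᶠ[𝓝 I] f₀ := by
    refine eventuallyEq_of_eventually_hasDerivAt (f' := deriv f₀) ?_ ?_ (by simp [hf])
    · filter_upwards [hmemI, e1] with u hu hu'
      rw [← hu']
      exact hfd u hu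
    · filter_upwards [hf₀.eventually] with u hu
      exact (hu.1.differentiableAt one_ne_zero).hasDerivAt
  have hfdiff : DifferentiableOn ℂ f {z : ℂ | 0 < z.im} := fun z hz =>
    (hfd z hz).differentiableAt.differentiableWithinAt
  refine ⟨f, hfdiff, fun w hw => ?_⟩
  refine exists_smul_of_minor_eq_zero (hP0 w hw) (cubicVec_ne_zero _ ⟨w, hw⟩) fun i j => ?_
  have hPd : ∀ i, DifferentiableOn ℂ (fun u => P u i) {z : ℂ | 0 < z.im} := fun i u hu =>
    ((differentiableAt_pi.mp ((hP u hu).differentiableAt one_ne_zero)) i).differentiableWithinAt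
  have hCd : ∀ i, DifferentiableOn ℂ (fun u => cubicVec (f u) u i) {z : ℂ | 0 < z.im} :=
    fun i u hu => ((differentiableAt_pi.mp ((contDiffAt_cubicVec_comp (T := fun u => u)
      contDiffAt_id ((hfdiff.analyticOnNhd isOpen_halfPlane u hu).contDiffAt)
        hu).differentiableAt one_ne_zero)) i).differentiableWithinAt
  have a1 := ((hPd i).mul (hCd j)).analyticOnNhd isOpen_halfPlane
  have a2 := ((hPd j).mul (hCd i)).analyticOnNhd isOpen_halfPlane
  refine a1.eqOn_of_preconnected_of_eventuallyEq a2 isPreconnected_halfPlane hI ?_ hw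
  filter_upwards [e2, hf₀.2] with u hu ⟨c, hc0, hc⟩
  change P u i * cubicVec (f u) u j = P u j * cubicVec (f u) u i
  rw [hc, hu, Pi.smul_apply, Pi.smul_apply, smul_eq_mul, smul_eq_mul]
  ring

end ModularFibration

namespace ModularFibration

open Complex Filter

/-! ### Sections of the fibration and their lifts -/

/-- Polynomials without common zero are homogeneous coordinates of a point of `E` over `ℂ(s)`. -/
def IsHomogeneousModel : E.toAffine.Point → (Fin 3 → Polynomial ℂ) → Prop
  | .zero, v => v = ![0, 1, 0]
  | .some x y _, v => v 2 ≠ 0 ∧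
      x * algebraMap (Polynomial ℂ) (RatFunc ℂ) (v 2) = algebraMap _ _ (v 0) ∧
      y * algebraMap (Polynomial ℂ) (RatFunc ℂ) (v 2) = algebraMap _ _ (v 1) ∧
      ∀ a : ℂ, ∃ i, (v i).eval a ≠ 0

theorem exists_isHomogeneousModel (P : E.toAffine.Point) : ∃ v, IsHomogeneousModel P v := by
  rcases P with _ | ⟨x, y, h⟩
  · exact ⟨_, rfl⟩
  set φ := algebraMap (Polynomial ℂ) (RatFunc ℂ)
  set S : Set (Fin 3 → Polynomial ℂ) :=
    {v | v 2 ≠ 0 ∧ x * φ (v 2) = φ (v 0) ∧ y * φ (v 2) = φ (v 1)} with hS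
  have hne : S.Nonempty := by
    refine ⟨![x.num * y.denom, y.num * x.denom, x.denom * y.denom],
      mul_ne_zero x.denom_ne_zero y.denom_ne_zero, ?_, ?_⟩
    · have h1 := RatFunc.num_div_denom x
      have h2 : φ x.denom ≠ 0 := RatFunc.algebraMap_ne_zero x.denom_ne_zero
      rw [div_eq_iff h2] at h1
      simp only [Matrix.cons_val_zero, Matrix.cons_val, map_mul]
      rw [h1]
      ring
    · have h1 := RatFunc.num_div_denom y
      have h2 : φ y.denom ≠ 0 := RatFunc.algebraMap_ne_zero y.denom_ne_zero
      rw [div_eq_iff h2] at h1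
      simp only [Matrix.cons_val_one, Matrix.cons_val, map_mul]
      rw [h1]
      ring
  -- a triple with last entry of minimal degree has no common zero
  set v := Function.argminOn (fun v => (v 2).natDegree) S hne with hv
  obtain ⟨hv2, hx, hy⟩ : v ∈ S := Function.argminOn_mem _ S hne
  refine ⟨v, hv2, hx, hy, fun a => ?_⟩
  by_contra! hroot
  have hdvd : ∀ i, ∃ w, v i = (Polynomial.X - Polynomial.C a) * w := fun i =>
    Polynomial.dvd_iff_isRoot.mpr (hroot i)
  choose w hw using hdvd
  have hXa : φ (Polynomial.X - Polynomial.C a) ≠ 0 :=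
    RatFunc.algebraMap_ne_zero (Polynomial.X_sub_C_ne_zero a)
  have hw2 : w 2 ≠ 0 := by
    intro h0
    rw [hw, h0, mul_zero] at hv2
    exact hv2 rfl
  have hwS : w ∈ S := by
    refine ⟨hw2, ?_, ?_⟩
    · apply mul_left_cancel₀ hXa
      rw [hw 2, hw 0, map_mul, map_mul] at hx
      linear_combination hx
    · apply mul_left_cancel₀ hXa
      rw [hw 2, hw 1, map_mul, map_mul] at hy
      linear_combination hy
  have hle : (v 2).natDegree ≤ (w 2).natDegree := Function.argminOn_le (fun v => (v 2).natDegree) S hwS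
  rw [hw 2, Polynomial.natDegree_mul (Polynomial.X_sub_C_ne_zero a) hw2,
    Polynomial.natDegree_X_sub_C] at hle
  omega

theorem IsHomogeneousModel.exists_eval_ne_zero {P : E.toAffine.Point} {v : Fin 3 → Polynomial ℂ}
    (h : IsHomogeneousModel P v) (a : ℂ) : (fun i => (v i).eval a) ≠ 0 := by
  rw [Function.ne_iff]
  rcases P with _ | ⟨x, y, hP⟩
  · obtain rfl : v = ![0, 1, 0] := h
    exact ⟨1, by simp⟩
  · exact h.2.2.2 a

theorem IsHomogeneousModel.equation {P : E.toAffine.Point} {v : Fin 3 → Polynomial ℂ}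
    (h : IsHomogeneousModel P v) : v 1 ^ 2 * v 2 * Polynomial.X +
      (Polynomial.X - 1) ^ 2 * (v 0 * v 1 * v 2) = Polynomial.X * (v 0 * (v 0 - v 2) ^ 2) := by
  rcases P with _ | ⟨x, y, hP⟩
  · obtain rfl : v = ![0, 1, 0] := h
    simp
  · obtain ⟨-, hx, hy, -⟩ := h
    apply RatFunc.algebraMap_injective ℂ
    have ha := E_a₁_mul
    have he := (WeierstrassCurve.Affine.equation_iff' x y).mp hP.1
    simp only [WeierstrassCurve.toAffine] at he
    have h2 : E.a₂ = -2 := rfl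
    have h3 : E.a₃ = 0 := rfl
    have h4 : E.a₄ = 1 := rfl
    have h6 : E.a₆ = 0 := rfl
    rw [h2, h3, h4, h6] at he
    simp only [map_add, map_mul, map_pow, map_sub, map_one] at ha ⊢
    rw [← hx, ← hy]
    generalize algebraMap (Polynomial ℂ) (RatFunc ℂ) (v 2) = w at *
    generalize algebraMap (Polynomial ℂ) (RatFunc ℂ) Polynomial.X = t at *
    linear_combination w ^ 3 * t * he - (x * y * w ^ 3) * ha

theorem IsHomogeneousModel.eval_equation {P : E.toAffine.Point} {v : Fin 3 → Polynomial ℂ}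
    (h : IsHomogeneousModel P v) {a : ℂ} (ha : a ≠ 0) :
    (v 1).eval a ^ 2 * (v 2).eval a +
      (a + 1 / a - 2) * (v 0).eval a * (v 1).eval a * (v 2).eval a =
        (v 0).eval a * ((v 0).eval a - (v 2).eval a) ^ 2 := by
  have h1 := congrArg (Polynomial.eval a) h.equation
  simp only [Polynomial.eval_add, Polynomial.eval_mul, Polynomial.eval_pow, Polynomial.eval_sub,
    Polynomial.eval_X, Polynomial.eval_one] at h1
  field_simp
  linear_combination h1

/-- A holomorphic function on the upper half plane that parametrises a section. -/
def IsLiftOf (v : Fin 3 → Polynomial ℂ) (f : ℂ → ℂ) : Prop :=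
  DifferentiableOn ℂ f {z : ℂ | 0 < z.im} ∧ ∀ τ : ℍ, ∃ c : ℂ, c ≠ 0 ∧
    (fun i => (v i).eval (hauptmodul τ)) = c • cubicVec (f τ) τ

theorem IsHomogeneousModel.exists_isLiftOf {P : E.toAffine.Point} {v : Fin 3 → Polynomial ℂ}
    (h : IsHomogeneousModel P v) : ∃ f, IsLiftOf v f := by
  obtain ⟨f, hf, hf'⟩ := exists_global_lift (P := fun w i => (v i).eval (hauptmodul w))
    (fun w hw => contDiffAt_pi.mpr fun i => by
      have ha : ContDiffAt ℂ 1 hauptmodul w :=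
        (DifferentiableOn.analyticOnNhd (fun z hz =>
          (differentiableAt_hauptmodul hz).differentiableWithinAt) isOpen_halfPlane w hw).contDiffAt
      exact ((v i).differentiable.contDiff.contDiffAt).comp w ha)
    (fun w _ => h.exists_eval_ne_zero _)
    (fun w hw => by
      have := h.eval_equation (hauptmodul_ne_zero ⟨w, hw⟩)
      have hk := kappa_sq ⟨w, hw⟩
      change kappa w ^ 2 = _ at hk
      rw [hk]
      exact this)
  exact ⟨f, hf, fun τ => hf' τ τ.im_pos⟩

/-- The action of a matrix on functions by which lifts of sections transform. -/
noncomputable def translate (δ : SL(2, ℤ)) (f : ℂ → ℂ) (z : ℂ) : ℂ :=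
  f (((δ 0 0 : ℤ) * z + (δ 0 1 : ℤ)) / ((δ 1 0 : ℤ) * z + (δ 1 1 : ℤ))) *
    ((δ 1 0 : ℤ) * z + (δ 1 1 : ℤ))

theorem translate_coe (δ : SL(2, ℤ)) (f : ℂ → ℂ) (σ : ℍ) :
    translate δ f σ = f (δ • σ : ℍ) * autFactor δ σ := by
  rw [coe_smul_eq]
  rfl

theorem translate_mul (γ δ : SL(2, ℤ)) (f : ℂ → ℂ) (σ : ℍ) :
    translate (γ * δ) f σ = translate γ f (δ • σ : ℍ) * autFactor δ σ := by
  rw [translate_coe, translate_coe, autFactor_mul, mul_smul, mul_assoc]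

theorem hasDerivAt_translate (δ : SL(2, ℤ)) {f : ℂ → ℂ}
    (hf : DifferentiableOn ℂ f {z : ℂ | 0 < z.im}) (σ : ℍ) :
    HasDerivAt (translate δ f)
      (deriv f (δ • σ : ℍ) / autFactor δ σ + f (δ • σ : ℍ) * (δ 1 0 : ℤ)) σ := by
  have hj : ((δ 1 0 : ℤ) : ℂ) * σ + (δ 1 1 : ℤ) ≠ 0 := autFactor_ne_zero δ σ
  have hs := coe_smul_eq δ σ
  have hd : DifferentiableAt ℂ f (δ • σ : ℍ) :=
    (hf _ (δ • σ : ℍ).im_pos).differentiableAt (isOpen_halfPlane.mem_nhds (δ • σ : ℍ).im_pos)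
  have hdet : (δ 0 0 : ℂ) * δ 1 1 - δ 0 1 * δ 1 0 = 1 := by exact_mod_cast det_eq_one δ
  have h1 : HasDerivAt (fun z : ℂ => ((δ 1 0 : ℤ) : ℂ) * z + (δ 1 1 : ℤ)) (δ 1 0 : ℤ) σ :=
    (((hasDerivAt_id (σ : ℂ)).const_mul _).add_const _).congr_deriv (mul_one _)
  have h2 : HasDerivAt (fun z : ℂ => ((δ 0 0 : ℤ) : ℂ) * z + (δ 0 1 : ℤ)) (δ 0 0 : ℤ) σ :=
    (((hasDerivAt_id (σ : ℂ)).const_mul _).add_const _).congr_deriv (mul_one _)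
  have h3 := h2.div h1 hj
  have hd' := hd.hasDerivAt
  rw [hs] at hd' ⊢
  refine ((hd'.comp (σ : ℂ) h3).mul h1).congr_deriv ?_
  rw [autFactor] at *
  simp only [Function.comp_apply, Pi.div_apply]
  generalize deriv f _ = D
  generalize f _ = D'
  field_simp
  linear_combination D * hdet

theorem differentiableOn_translate (δ : SL(2, ℤ)) {f : ℂ → ℂ}
    (hf : DifferentiableOn ℂ f {z : ℂ | 0 < z.im}) :
    DifferentiableOn ℂ (translate δ f) {z : ℂ | 0 < z.im} := fun z hz =>
  (hasDerivAt_translate δ hf ⟨z, hz⟩).differentiableAt.differentiableWithinAt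

theorem exists_eq_lattice {d : ℂ → ℂ} (hd : DifferentiableOn ℂ d {z : ℂ | 0 < z.im})
    (h : ∀ τ : ℍ, d τ ∈ periodLattice (τ : ℂ)) : ∃ m n : ℤ, ∀ τ : ℍ, d τ = m * τ + n := by
  have hI : 0 < Complex.I.im := by simp
  have hmem := isOpen_halfPlane.mem_nhds hI
  obtain ⟨m, n, hmn⟩ := exists_eventually_eq_lattice (T := fun u => u) continuousAt_id
    ((hd I hI).differentiableAt hmem).continuousAt hI (by
      filter_upwards [hmem] with u hu using h ⟨u, hu⟩)
  refine ⟨m, n, fun τ => ?_⟩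
  have h2 : DifferentiableOn ℂ (fun z : ℂ => (m : ℂ) * z + n) {z : ℂ | 0 < z.im} := by fun_prop
  exact (hd.analyticOnNhd isOpen_halfPlane).eqOn_of_preconnected_of_eventuallyEq
    (h2.analyticOnNhd isOpen_halfPlane) isPreconnected_halfPlane hI hmn τ.im_pos

/-- A lift of a section and its translate by `Γ₁(8)` lift the same section, hence differ by a period. -/
theorem IsLiftOf.translate_eq {v : Fin 3 → Polynomial ℂ} {f : ℂ → ℂ} (hf : IsLiftOf v f)
    {γ : SL(2, ℤ)} (hγ : γ ∈ CongruenceSubgroup.Gamma1 8) :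
    ∃ m n : ℤ, ∀ τ : ℍ, translate γ f τ = f τ + (m * τ + n) := by
  obtain ⟨m, n, h⟩ := exists_eq_lattice (d := fun z => translate γ f z - f z)
    ((differentiableOn_translate γ hf.1).sub hf.1) (fun τ => by
      obtain ⟨a, ha, h1⟩ := hf.2 τ
      obtain ⟨b, hb, h2⟩ := hf.2 (γ • τ)
      rw [hauptmodul_smul hγ] at h2
      obtain ⟨K, hK, h3⟩ := cubicVec_smul hγ τ (translate γ f τ)
      rw [translate_coe, mul_div_cancel_right₀ _ (autFactor_ne_zero γ τ), ← translate_coe] at h3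
      refine sub_mem_of_cubicVec_eq_smul ((b * K)⁻¹ * a) ?_
      rw [mul_smul, ← h1, h2, h3, smul_smul, smul_smul,
        mul_assoc, inv_mul_cancel₀ (mul_ne_zero hb hK), one_smul])
  refine ⟨m, n, fun τ => ?_⟩
  rw [← h]
  ring

theorem coe_T_pow_eight : ((ModularGroup.T ^ 8 : SL(2, ℤ)) : Matrix (Fin 2) (Fin 2) ℤ) =
    !![1, 8; 0, 1] := by
  have h := ModularGroup.coe_T_zpow 8
  exact_mod_cast h

theorem T_pow_conj_mem (δ : SL(2, ℤ)) : δ * ModularGroup.T ^ 8 * δ⁻¹ ∈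
    CongruenceSubgroup.Gamma1 8 := by
  have hT : ModularGroup.T ^ 8 ∈ CongruenceSubgroup.Gamma 8 := by
    rw [CongruenceSubgroup.Gamma_mem, coe_T_pow_eight]
    simp
    rfl
  have h := (CongruenceSubgroup.Gamma_normal 8).conj_mem _ hT δ
  rw [CongruenceSubgroup.Gamma_mem] at h
  rw [CongruenceSubgroup.Gamma1_mem]
  exact ⟨h.1, h.2.2.2, h.2.2.1⟩

/-- Along every cusp the lifts have period `8` up to periods of the lattice. -/
theorem IsLiftOf.translate_add_eight {v : Fin 3 → Polynomial ℂ} {f : ℂ → ℂ} (hf : IsLiftOf v f)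
    (δ : SL(2, ℤ)) : ∃ m n : ℤ, ∀ z : ℂ, 0 < z.im →
      translate δ f (z + 8) = translate δ f z + (m * z + n) := by
  obtain ⟨m, n, h⟩ := hf.translate_eq (T_pow_conj_mem δ)
  refine ⟨m * δ 0 0 + n * δ 1 0, m * δ 0 1 + n * δ 1 1, fun z hz => ?_⟩
  set σ : ℍ := ⟨z, hz⟩
  have h1 := translate_mul (δ * ModularGroup.T ^ 8 * δ⁻¹) δ f σ
  rw [inv_mul_cancel_right, h, add_mul, ← translate_coe, add_mul, mul_assoc,
    smul_mul_autFactor] at h1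
  have h2 := translate_mul δ (ModularGroup.T ^ 8) f σ
  have h3 : autFactor (ModularGroup.T ^ 8) σ = 1 := by
    rw [autFactor, coe_T_pow_eight]
    simp
  have h4 : ((ModularGroup.T ^ 8 • σ : ℍ) : ℂ) = z + 8 := by
    rw [coe_smul_eq, h3, coe_T_pow_eight]
    simp [σ]
  rw [h3, mul_one, h4, h1] at h2
  change translate δ f z + _ = _ at h2
  rw [← h2, autFactor]
  change _ + ((m : ℂ) * (_ * z + _) + n * (_ * z + _)) = _
  push_cast
  ring

/-- The derivative of a lift relative to the flat structure of the fibres: it vanishes for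
`f = ατ + β` with real `α` and `β`, that is, for sections of constant real coordinates. -/
noncomputable def flatDeriv (f : ℂ → ℂ) (z : ℂ) : ℂ := deriv f z - ((f z).im / z.im : ℝ)

theorem flatDeriv_translate (δ : SL(2, ℤ)) {f : ℂ → ℂ}
    (hf : DifferentiableOn ℂ f {z : ℂ | 0 < z.im}) (σ : ℍ) :
    flatDeriv (translate δ f) σ = flatDeriv f (δ • σ : ℍ) / autFactor δ σ := by
  have hj := autFactor_ne_zero δ σ
  have hs := smul_mul_autFactor δ σ
  have hjj : autFactor δ σ = (δ 1 0 : ℤ) * (σ : ℂ) + (δ 1 1 : ℤ) := rfl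
  have hdet : (δ 0 0 : ℂ) * δ 1 1 - δ 0 1 * δ 1 0 = 1 := by exact_mod_cast det_eq_one δ
  obtain ⟨x, y, hxy⟩ := exists_real_coeff (δ • σ : ℍ).im_pos (f (δ • σ : ℍ))
  have hw : ((δ • σ : ℍ) : ℂ).im ≠ 0 := (δ • σ : ℍ).im_pos.ne'
  have hσ : (σ : ℂ).im ≠ 0 := σ.im_pos.ne'
  have e1 : (f (δ • σ : ℍ)).im / ((δ • σ : ℍ) : ℂ).im = x := by
    rw [hxy, Complex.add_im, Complex.im_ofReal_mul, Complex.ofReal_im, add_zero,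
      mul_div_cancel_right₀ _ hw]
  have e2 : (translate δ f σ).im / (σ : ℂ).im = x * (δ 0 0 : ℤ) + y * (δ 1 0 : ℤ) := by
    have : translate δ f σ = ((x * (δ 0 0 : ℤ) + y * (δ 1 0 : ℤ) : ℝ) : ℂ) * σ +
        ((x * (δ 0 1 : ℤ) + y * (δ 1 1 : ℤ) : ℝ) : ℂ) := by
      rw [translate_coe, hxy, add_mul, mul_assoc, hs, hjj]
      push_cast
      ring
    rw [this, Complex.add_im, Complex.im_ofReal_mul, Complex.ofReal_im, add_zero,
      mul_div_cancel_right₀ _ hσ]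
  rw [flatDeriv, flatDeriv, (hasDerivAt_translate δ hf σ).deriv, e1, e2, hxy]
  rw [eq_div_iff hj, sub_mul, add_mul, div_mul_cancel₀ _ hj]
  push_cast
  linear_combination ((x : ℂ) * δ 1 0) * hs - x * hdet - (x * δ 0 0) * hjj

/-- The square norm of the flat derivative, for the invariant metric of the fibration. -/
noncomputable def flatNorm (f : ℂ → ℂ) (z : ℂ) : ℝ := ‖flatDeriv f z‖ ^ 2 * z.im

/-- The flat norm is invariant, also under matrices outside of `Γ₁(8)`. -/
theorem flatNorm_translate (δ : SL(2, ℤ)) {f : ℂ → ℂ}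
    (hf : DifferentiableOn ℂ f {z : ℂ | 0 < z.im}) (σ : ℍ) :
    flatNorm (translate δ f) σ = flatNorm f (δ • σ : ℍ) := by
  have hj := autFactor_ne_zero δ σ
  rw [flatNorm, flatNorm, flatDeriv_translate δ hf, norm_div, UpperHalfPlane.coe_im,
    UpperHalfPlane.coe_im, ModularGroup.im_smul_eq_div_normSq, ← autFactor_eq_denom,
    Complex.normSq_eq_norm_sq]
  ring

theorem flatDeriv_add_real {f g : ℂ → ℂ} {a b : ℝ} {z : ℂ} (hz : 0 < z.im)
    (hg : DifferentiableAt ℂ g z) (h : f =ᶠ[𝓝 z] fun u => g u + (a * u + b)) :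
    flatDeriv f z = flatDeriv g z := by
  have h1 : deriv f z = deriv g z + a := by
    rw [h.deriv_eq]
    have h2 := hg.hasDerivAt.add (((hasDerivAt_id z).const_mul (a : ℂ)).add_const (b : ℂ))
    exact (h2.congr_deriv (by simp)).deriv
  have h2 : (f z).im = (g z).im + a * z.im := by
    rw [h.self_of_nhds]
    simp
  rw [flatDeriv, flatDeriv, h1, h2, add_div, mul_div_cancel_right₀ _ hz.ne']
  push_cast
  ring

theorem IsLiftOf.flatNorm_smul {v : Fin 3 → Polynomial ℂ} {f : ℂ → ℂ} (hf : IsLiftOf v f)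
    {γ : SL(2, ℤ)} (hγ : γ ∈ CongruenceSubgroup.Gamma1 8) (τ : ℍ) :
    flatNorm f (γ • τ : ℍ) = flatNorm f τ := by
  obtain ⟨m, n, h⟩ := hf.translate_eq hγ
  have hmem := isOpen_halfPlane.mem_nhds τ.im_pos
  rw [← flatNorm_translate γ hf.1, flatNorm, flatNorm,
    flatDeriv_add_real (a := m) (b := n) τ.im_pos ((hf.1 _ τ.im_pos).differentiableAt hmem) (by
      filter_upwards [hmem] with u hu
      push_cast
      exact h ⟨u, hu⟩)]

end ModularFibration

namespace ModularFibration

open Complex Filter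

/-! ### A maximum principle -/

/-- The second derivative test, with the derivatives supplied explicitly. -/
theorem second_deriv_nonpos_of_isLocalMax {p p₁ : ℝ → ℝ} {p₂ x : ℝ}
    (h : ∀ᶠ y in 𝓝 x, HasDerivAt p (p₁ y) y) (h₁ : HasDerivAt p₁ p₂ x) (hmax : IsLocalMax p x) :
    p₂ ≤ 0 := by
  by_contra! hpos
  have hd : deriv p =ᶠ[𝓝 x] p₁ := h.mono fun y hy => hy.deriv
  have h2 : deriv (deriv p) x = p₂ := by rw [hd.deriv_eq, h₁.deriv]
  have hmin : IsLocalMin p x := isLocalMin_of_deriv_deriv_pos (by rw [h2]; exact hpos)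
    hmax.deriv_eq_zero h.self_of_nhds.continuousAt
  have hc : p =ᶠ[𝓝 x] fun _ => p x := by
    filter_upwards [hmin, hmax] with y hy hy'
    exact le_antisymm hy' hy
  have hd0 : deriv p =ᶠ[𝓝 x] fun _ => 0 := by
    filter_upwards [hc.eventually_nhds] with y hy
    rw [EventuallyEq.deriv_eq (f₁ := p) (f := fun _ => p x) hy, deriv_const]
  rw [hd0.deriv_eq, deriv_const] at h2
  exact hpos.ne h2

theorem hasDerivAt_comp_line {g : ℂ → ℂ} {g' z e : ℂ} {x : ℝ} (h : HasDerivAt g g' (z + x * e)) :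
    HasDerivAt (fun t : ℝ => (g (z + t * e)).re) (e * g').re x ∧
      HasDerivAt (fun t : ℝ => (g (z + t * e)).im) (e * g').im x := by
  have h1 : HasDerivAt (fun t : ℝ => z + (t : ℂ) * e) e x :=
    (((Complex.ofRealCLM.hasDerivAt (x := x)).mul_const e).const_add z).congr_deriv (by simp)
  have h2 : HasDerivAt (fun t : ℝ => g (z + t * e)) (e * g') x :=
    (HasDerivAt.comp x (h₂ := g) h h1).congr_deriv (mul_comm _ _)
  exact ⟨Complex.reCLM.hasFDerivAt.comp_hasDerivAt x h2,
    Complex.imCLM.hasFDerivAt.comp_hasDerivAt x h2⟩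

theorem flatNorm_eq {f : ℂ → ℂ} {z : ℂ} (hz : z.im ≠ 0) : flatNorm f z =
    ((deriv f z).re ^ 2 + (deriv f z).im ^ 2) * z.im - 2 * ((deriv f z).re * (f z).im) +
      (f z).im ^ 2 / z.im := by
  rw [flatNorm, flatDeriv, ← Complex.normSq_eq_norm_sq, Complex.normSq_apply, Complex.sub_re,
    Complex.sub_im, Complex.ofReal_re, Complex.ofReal_im]
  field_simp
  ring

/-- The second derivative of the flat norm along a line, at a local maximum where the function
vanishes. -/
theorem flatNorm_second_deriv {f : ℂ → ℂ} {z e : ℂ} (hz : 0 < z.im)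
    (hf : AnalyticAt ℂ f z) (h0 : f z = 0) (hmax : IsLocalMax (flatNorm f) z) :
    let a := deriv f z
    let b := deriv (deriv f) z
    let c := deriv (deriv (deriv f)) z
    2 * ((e * b).re ^ 2 + a.re * (e * (e * c)).re + ((e * b).im ^ 2 + a.im * (e * (e * c)).im)) *
        z.im + 4 * e.im * (a.re * (e * b).re + a.im * (e * b).im) -
      4 * ((e * b).re * (e * a).im) - 2 * (a.re * (e * (e * b)).im) +
        2 * (e * a).im ^ 2 / z.im ≤ 0 := by
  intro a b c
  have hline : Tendsto (fun t : ℝ => z + (t : ℂ) * e) (𝓝 0) (𝓝 z) := by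
    have : Continuous fun t : ℝ => z + (t : ℂ) * e := by fun_prop
    have h := this.tendsto 0
    simpa using h
  have him : ∀ t : ℝ, (z + (t : ℂ) * e).im = z.im + t * e.im := fun t => by simp
  set y : ℝ → ℝ := fun t => z.im + t * e.im with hy
  have hyd : ∀ t, HasDerivAt y e.im t := fun t =>
    (((hasDerivAt_id t).mul_const e.im).const_add z.im).congr_deriv (by simp)
  set A : ℝ → ℝ := fun t => (deriv f (z + t * e)).re with hA
  set B : ℝ → ℝ := fun t => (deriv f (z + t * e)).im with hB
  set C : ℝ → ℝ := fun t => (f (z + t * e)).im with hC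
  set A₁ : ℝ → ℝ := fun t => (e * deriv (deriv f) (z + t * e)).re with hA₁
  set B₁ : ℝ → ℝ := fun t => (e * deriv (deriv f) (z + t * e)).im with hB₁
  set C₁ : ℝ → ℝ := fun t => (e * deriv f (z + t * e)).im with hC₁
  have hpos : ∀ᶠ t : ℝ in 𝓝 0, 0 < y t := by
    have := (hyd 0).continuousAt.eventually_const_lt (u := 0) (by simpa [hy] using hz)
    exact this
  have han : ∀ᶠ t : ℝ in 𝓝 0, AnalyticAt ℂ f (z + t * e) :=
    hline.eventually hf.eventually_analyticAt
  set p₁ : ℝ → ℝ := fun t => 2 * (A t * A₁ t + B t * B₁ t) * y t + e.im * (A t ^ 2 + B t ^ 2) -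
    2 * (A₁ t * C t + A t * C₁ t) + (2 * C t * C₁ t / y t - e.im * C t ^ 2 / y t ^ 2) with hp₁
  have hψ : ∀ᶠ t : ℝ in 𝓝 0, HasDerivAt (fun t : ℝ => flatNorm f (z + t * e)) (p₁ t) t := by
    filter_upwards [han.eventually_nhds, hpos.eventually_nhds] with t ht hyt
    have e1 : (fun t : ℝ => flatNorm f (z + t * e)) =ᶠ[𝓝 t] fun t =>
        (A t ^ 2 + B t ^ 2) * y t - 2 * (A t * C t) + C t ^ 2 / y t := by
      filter_upwards [hyt] with u hu
      rw [flatNorm_eq (by rw [him]; exact hu.ne'), him]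
    refine HasDerivAt.congr_of_eventuallyEq ?_ e1
    have ht' := ht.self_of_nhds
    have hy0 := hyt.self_of_nhds.ne'
    obtain ⟨dA, dB⟩ := hasDerivAt_comp_line ht'.deriv.differentiableAt.hasDerivAt
    obtain ⟨-, dC⟩ := hasDerivAt_comp_line ht'.differentiableAt.hasDerivAt
    have d := ((((dA.pow 2).add (dB.pow 2)).mul (hyd t)).sub ((dA.mul dC).const_mul 2)).add
      ((dC.pow 2).div (hyd t) hy0)
    refine d.congr_deriv ?_
    simp only [hp₁, hA, hB, hC, hA₁, hB₁, hC₁, Pi.add_apply, Pi.pow_apply] at hy0 ⊢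
    field_simp
    ring
  have hz0 : z + ((0 : ℝ) : ℂ) * e = z := by simp
  have y0 : y 0 = z.im := by simp [hy]
  have hd2 : HasDerivAt (deriv (deriv f)) c (z + ((0 : ℝ) : ℂ) * e) := by
    rw [hz0]; exact hf.deriv.deriv.differentiableAt.hasDerivAt
  have hd1 : HasDerivAt (deriv f) b (z + ((0 : ℝ) : ℂ) * e) := by
    rw [hz0]; exact hf.deriv.differentiableAt.hasDerivAt
  have hd0 : HasDerivAt f a (z + ((0 : ℝ) : ℂ) * e) := by
    rw [hz0]; exact hf.differentiableAt.hasDerivAt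
  obtain ⟨dA₁, dB₁⟩ := hasDerivAt_comp_line (hd2.const_mul e)
  obtain ⟨dA, dB⟩ := hasDerivAt_comp_line hd1
  obtain ⟨-, dC₁⟩ := hasDerivAt_comp_line (hd1.const_mul e)
  obtain ⟨-, dC⟩ := hasDerivAt_comp_line hd0
  have hy0 : y 0 ≠ 0 := by rw [y0]; exact hz.ne'
  have d : HasDerivAt p₁ _ 0 := ((((((dA.mul dA₁).add (dB.mul dB₁)).const_mul 2).mul (hyd 0)).add
    (((dA.pow 2).add (dB.pow 2)).const_mul e.im)).sub
      (((dA₁.mul dC).add (dA.mul dC₁)).const_mul 2)).add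
        ((((dC.const_mul 2).mul dC₁).div (hyd 0) hy0).sub
          (((dC.pow 2).const_mul e.im).div ((hyd 0).pow 2) (pow_ne_zero 2 hy0)))
  have hmax' : IsLocalMax (fun t : ℝ => flatNorm f (z + t * e)) 0 := by
    have := hline.eventually hmax
    simpa [IsLocalMax, IsMaxFilter] using this
  have key := second_deriv_nonpos_of_isLocalMax hψ d hmax'
  refine le_of_eq_of_le ?_ key
  simp only [Pi.add_apply, Pi.mul_apply, Pi.pow_apply, y0, hz0]
  have hzi := hz.ne'
  field_simp
  simp only [h0, Complex.zero_im]
  ring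

/-- The flat norm of a holomorphic function has no positive local maximum. -/
theorem flatNorm_eq_zero_of_isLocalMax {f : ℂ → ℂ} {z : ℂ} (hz : 0 < z.im)
    (hf : DifferentiableOn ℂ f {z : ℂ | 0 < z.im}) (hmax : IsLocalMax (flatNorm f) z) :
    flatNorm f z = 0 := by
  obtain ⟨x, y, hxy⟩ := exists_real_coeff hz (f z)
  -- subtracting a flat section, the function may be assumed to vanish at `z`
  set g : ℂ → ℂ := fun u => f u - (x * u + y) with hg
  have hgd : DifferentiableOn ℂ g {z : ℂ | 0 < z.im} := by
    refine hf.sub ?_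
    fun_prop
  have hgz : g z = 0 := by simp [hg, hxy]
  have hmem := isOpen_halfPlane.mem_nhds hz
  have hfg : ∀ u : ℂ, 0 < u.im → flatNorm f u = flatNorm g u := by
    intro u hu
    rw [flatNorm, flatNorm, flatDeriv_add_real (g := g) (a := x) (b := y) hu
      ((hgd u hu).differentiableAt (isOpen_halfPlane.mem_nhds hu))
      (Eventually.of_forall fun v => by simp [hg])]
  have hmaxg : IsLocalMax (flatNorm g) z := by
    filter_upwards [hmax, hmem] with u hu hu'
    rwa [← hfg u hu', ← hfg z hz]
  have ha := hgd.analyticOnNhd isOpen_halfPlane z hz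
  have h1 := flatNorm_second_deriv (e := 1) hz ha hgz hmaxg
  have h2 := flatNorm_second_deriv (e := I) hz ha hgz hmaxg
  simp only [one_mul, Complex.one_im, Complex.I_im, Complex.mul_re, Complex.mul_im, Complex.I_re,
    zero_mul, zero_sub, zero_add, add_zero, mul_zero, one_mul, mul_one] at h1 h2
  set a := deriv g z
  set b := deriv (deriv g) z
  set c := deriv (deriv (deriv g)) z
  have h3 : 4 * (b.re ^ 2 + b.im ^ 2) * z.im + 2 * (a.re ^ 2 + a.im ^ 2) / z.im ≤ 0 := by
    have e : 4 * (b.re ^ 2 + b.im ^ 2) * z.im + 2 * (a.re ^ 2 + a.im ^ 2) / z.im =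
      2 * a.im ^ 2 / z.im + 2 * a.re ^ 2 / z.im + 4 * (b.re ^ 2 + b.im ^ 2) * z.im := by ring
    rw [e]
    linarith
  have h4 : 0 ≤ 4 * (b.re ^ 2 + b.im ^ 2) * z.im := by positivity
  have h5 : (a.re ^ 2 + a.im ^ 2) / z.im ≤ 0 := by
    rw [mul_div_assoc] at h3
    linarith
  have h6 : a.re ^ 2 + a.im ^ 2 ≤ 0 := by
    rwa [div_le_iff₀ hz, zero_mul] at h5
  have h7 : a.re = 0 := by nlinarith
  have h8 : a.im = 0 := by nlinarith
  rw [hfg z hz, flatNorm_eq hz.ne', hgz]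
  change (a.re ^ 2 + a.im ^ 2) * z.im - 2 * (a.re * (0 : ℂ).im) + (0 : ℂ).im ^ 2 / z.im = 0
  rw [h7, h8]
  simp

end ModularFibration

namespace ModularFibration

open Complex Filter

/-! ### Lower bounds for theta along a section near the cusps -/

theorem norm_sin_eq (w : ℂ) : ‖Complex.sin w‖ = ‖cexp (-w * I) - cexp (w * I)‖ / 2 := by
  rw [Complex.sin, norm_div, norm_mul, Complex.norm_I, mul_one, Complex.norm_two]

theorem norm_exp_mul_I' (w : ℂ) : ‖cexp (w * I)‖ = Real.exp (-w.im) := by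
  rw [Complex.norm_exp]
  simp

theorem norm_sin_le (w : ℂ) : ‖Complex.sin w‖ ≤ Real.exp |w.im| := by
  have h := norm_sub_le (cexp (-w * I)) (cexp (w * I))
  rw [norm_exp_mul_I', norm_exp_mul_I', Complex.neg_im, neg_neg] at h
  have h1 : Real.exp w.im ≤ Real.exp |w.im| := Real.exp_le_exp.mpr (le_abs_self _)
  have h2 : Real.exp (-w.im) ≤ Real.exp |w.im| := Real.exp_le_exp.mpr (neg_le_abs _)
  rw [norm_sin_eq]
  linarith

theorem abs_im_le_norm_sin (w : ℂ) : |w.im| ≤ ‖Complex.sin w‖ := by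
  have h := abs_norm_sub_norm_le (cexp (-w * I)) (cexp (w * I))
  rw [norm_exp_mul_I', norm_exp_mul_I', Complex.neg_im, neg_neg] at h
  have h1 : |w.im| ≤ |Real.sinh w.im| := by
    rw [Real.abs_sinh]
    exact Real.self_le_sinh_iff.mpr (abs_nonneg _)
  rw [Real.sinh_eq, abs_div, abs_two] at h1
  rw [norm_sin_eq]
  linarith

theorem pi_mul_im (z : ℂ) : ((Real.pi : ℂ) * z).im = Real.pi * z.im := Complex.im_ofReal_mul _ _

theorem exp_mul_norm_sin_le_thetaNorm {z τ : ℂ} (hτ : 0 < τ.im) (hτ' : 3 ≤ 4 * τ.im ^ 2)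
    (hz : |z.im| ≤ τ.im / 2) :
    Real.exp (-(Real.pi * τ.im / 2)) * ‖Complex.sin (Real.pi * z)‖ ≤ thetaNorm z τ := by
  have h1 := le_norm_theta hτ hτ' hz
  have h2 : Real.exp (-(Real.pi * τ.im / 4)) ≤ Real.exp (-(Real.pi * z.im ^ 2 / τ.im)) := by
    rw [Real.exp_le_exp, neg_le_neg_iff, div_le_iff₀ hτ]
    have h3 : z.im ^ 2 ≤ (τ.im / 2) ^ 2 := sq_le_sq' (by linarith [abs_le.mp hz]) (abs_le.mp hz).2
    have := mul_le_mul_of_nonneg_left h3 Real.pi_pos.le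
    linarith
  have h3 : Real.exp (-(Real.pi * τ.im / 2)) =
      Real.exp (-(Real.pi * (1 / 4) * τ.im)) * Real.exp (-(Real.pi * τ.im / 4)) := by
    rw [← Real.exp_add]
    congr 1
    ring
  rw [thetaNorm, h3, mul_right_comm]
  exact mul_le_mul h1 h2 (Real.exp_pos _).le (norm_nonneg _)

theorem thetaNorm_le_three {τ : ℂ} (hτ : 0 < τ.im) (hτ' : 3 ≤ 4 * τ.im ^ 2) (z : ℂ) :
    thetaNorm z τ ≤ 3 := by
  obtain ⟨m, hm⟩ := exists_sub_mem_strip hτ z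
  have hl : (-m : ℤ) * τ + (0 : ℤ) ∈ periodLattice τ := ⟨-m, 0, rfl⟩
  rw [← thetaNorm_add_mem hτ hl z, show z + ((-m : ℤ) * τ + (0 : ℤ)) = z - m * τ by push_cast; ring]
  generalize z - m * τ = w at *
  have h1 := norm_theta_le hτ hτ' hm
  have h2 := norm_sin_le (Real.pi * w)
  rw [pi_mul_im, abs_mul, abs_of_pos Real.pi_pos] at h2
  calc thetaNorm w τ ≤ 3 * (Real.exp (-(Real.pi * (1 / 4) * τ.im)) *
        Real.exp (Real.pi * |w.im|)) * Real.exp (-(Real.pi * w.im ^ 2 / τ.im)) := by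
        refine mul_le_mul_of_nonneg_right (h1.trans ?_) (Real.exp_pos _).le
        gcongr
    _ = 3 * Real.exp (-(Real.pi * (|w.im| - τ.im / 2) ^ 2 / τ.im)) := by
        rw [mul_assoc, ← Real.exp_add, ← Real.exp_add, ← sq_abs w.im]
        congr 2
        field_simp
        ring
    _ ≤ 3 * 1 := by
        gcongr
        rw [Real.exp_le_one_iff, neg_nonpos]
        have := Real.pi_pos
        positivity
    _ = 3 := mul_one 3

/-- Theta cannot be small both at `z` and at a translate of `z` by a half period. -/
theorem thetaNorm_or_halfPeriod {τ : ℂ} (hτ : 0 < τ.im) (hτ' : 3 ≤ 4 * τ.im ^ 2) {m n : ℤ}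
    (hmn : Odd m ∨ Odd n) (z : ℂ) :
    1 / 2 * Real.exp (-(Real.pi * τ.im / 2)) ≤ thetaNorm z τ ∨
      1 / 2 * Real.exp (-(Real.pi * τ.im / 2)) ≤ thetaNorm (z + (m * τ + n) / 2) τ := by
  have he := Real.exp_pos (-(Real.pi * τ.im / 2))
  obtain ⟨k, hk⟩ := exists_sub_mem_strip hτ z
  have hl : (-k : ℤ) * τ + (0 : ℤ) ∈ periodLattice τ := ⟨-k, 0, rfl⟩
  rw [← thetaNorm_add_mem hτ hl z, ← thetaNorm_add_mem hτ hl (z + (m * τ + n) / 2),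
    show z + ((-k : ℤ) * τ + (0 : ℤ)) = z - k * τ by push_cast; ring,
    show z + (m * τ + n) / 2 + ((-k : ℤ) * τ + (0 : ℤ)) = z - k * τ + (m * τ + n) / 2 by
      push_cast; ring]
  generalize z - k * τ = w at *
  by_cases hs : 1 / 2 ≤ ‖Complex.sin (Real.pi * w)‖
  · left
    have := exp_mul_norm_sin_le_thetaNorm hτ hτ' hk
    nlinarith
  right
  push Not at hs
  have main : ∀ w' : ℂ, |w'.im| ≤ τ.im / 2 → 1 / 2 ≤ ‖Complex.sin (Real.pi * w')‖ →
      w + (m * τ + n) / 2 - w' ∈ periodLattice τ →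
      1 / 2 * Real.exp (-(Real.pi * τ.im / 2)) ≤ thetaNorm (w + (m * τ + n) / 2) τ := by
    intro w' h1 h2 h3
    rw [show w + (m * τ + n) / 2 = w' + (w + (m * τ + n) / 2 - w') by ring,
      thetaNorm_add_mem hτ h3]
    have := exp_mul_norm_sin_le_thetaNorm hτ hτ' h1
    nlinarith
  rcases Int.even_or_odd m with ⟨a, rfl⟩ | ⟨a, rfl⟩
  · obtain ⟨b, rfl⟩ := hmn.resolve_left (by simp)
    refine main (w + 1 / 2) (by simpa using hk) ?_ ⟨a, b, by push_cast; ring⟩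
    have h1 := Complex.sin_sq_add_cos_sq (Real.pi * w)
    have h2 : Complex.sin (Real.pi * (w + 1 / 2)) = Complex.cos (Real.pi * w) := by
      rw [← Complex.sin_add_pi_div_two]
      congr 1
      ring
    rw [h2]
    have h3 := norm_add_le (Complex.sin (Real.pi * w) ^ 2) (Complex.cos (Real.pi * w) ^ 2)
    rw [h1, norm_one, norm_pow, norm_pow] at h3
    nlinarith [norm_nonneg (Complex.sin (Real.pi * w)), norm_nonneg (Complex.cos (Real.pi * w))]
  · -- `w` is close to the real axis, hence its translate by half a period is not
    have h1 := abs_im_le_norm_sin (Real.pi * w)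
    rw [pi_mul_im, abs_mul, abs_of_pos Real.pi_pos] at h1
    have hpi := Real.pi_gt_three
    have hy : 4 / 5 ≤ τ.im := by nlinarith
    have main' : ∀ w' : ℂ, |w'.im| = τ.im / 2 - |w.im| →
        w + ((2 * a + 1 : ℤ) * τ + n) / 2 - w' ∈ periodLattice τ →
        1 / 2 * Real.exp (-(Real.pi * τ.im / 2)) ≤
          thetaNorm (w + ((2 * a + 1 : ℤ) * τ + n) / 2) τ := by
      intro w' h2 h3
      refine main w' (by rw [h2]; linarith [abs_nonneg w.im]) ?_ h3
      have h4 := abs_im_le_norm_sin (Real.pi * w')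
      rw [pi_mul_im, abs_mul, abs_of_pos Real.pi_pos, h2] at h4
      nlinarith
    rcases le_total w.im 0 with hw | hw
    · refine main' (w + τ / 2 + n / 2) ?_ ⟨a, 0, by push_cast; ring⟩
      rw [abs_of_nonpos hw] at hk ⊢
      rw [abs_of_nonneg]
      · simp
        ring
      · simp
        linarith
    · refine main' (w - τ / 2 + n / 2) ?_ ⟨a + 1, 0, by push_cast; ring⟩
      rw [abs_of_nonneg hw] at hk ⊢
      rw [abs_of_nonpos]
      · simp
      · simp
        linarith

/-- A size function on the base, which tends to infinity at the singular fibres. -/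
noncomputable def cuspSize (a : ℂ) : ℝ := ‖fibreDisc a‖ + ‖fibreDisc a‖⁻¹

theorem two_le_cuspSize {a : ℂ} (ha : fibreDisc a ≠ 0) : 2 ≤ cuspSize a := by
  have h := norm_pos_iff.mpr ha
  have h1 : ‖fibreDisc a‖ * ‖fibreDisc a‖⁻¹ = 1 := mul_inv_cancel₀ h.ne'
  have h2 := inv_pos.mpr h
  rw [cuspSize]
  nlinarith [sq_nonneg (‖fibreDisc a‖ - ‖fibreDisc a‖⁻¹)]

theorem fibreDisc_inv (a : ℂ) : fibreDisc a⁻¹ = fibreDisc a := by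
  rw [fibreDisc, fibreDisc, one_div, one_div, inv_inv, add_comm a⁻¹]

theorem norm_le_cuspSize {a : ℂ} (ha : a ≠ 0) (hD : fibreDisc a ≠ 0) :
    ‖a‖ ≤ 256 * cuspSize a := by
  have h2 := two_le_cuspSize hD
  by_cases h : ‖a‖ ≤ 10
  · linarith
  push Not at h
  have h1 : ‖a‖ / 2 ≤ ‖a - 1‖ := by
    have := norm_sub_norm_le a 1
    rw [norm_one] at this
    linarith
  have h3 : ‖a‖ / 2 ≤ ‖a + 1‖ := by
    have := norm_sub_norm_le a (-1)
    rw [norm_neg, norm_one, sub_neg_eq_add] at this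
    linarith
  have h4 : ‖a‖ ^ 2 / 4 ≤ ‖a ^ 2 - 6 * a + 1‖ := by
    have h5 := norm_sub_norm_le (a ^ 2) (6 * a - 1)
    have h6 := norm_sub_le (6 * a) 1
    rw [norm_mul, norm_one] at h6
    rw [norm_pow, show a ^ 2 - (6 * a - 1) = a ^ 2 - 6 * a + 1 by ring] at h5
    have h7 : ‖(6 : ℂ)‖ = 6 := by simp
    rw [h7] at h6
    nlinarith
  have h5 : ‖fibreDisc a‖ * ‖a‖ ^ 4 = ‖a - 1‖ ^ 4 * ‖a + 1‖ ^ 2 * ‖a ^ 2 - 6 * a + 1‖ := by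
    rw [← norm_pow, ← norm_pow, ← norm_pow, ← norm_mul, ← norm_mul, ← norm_mul, fibreDisc]
    congr 1
    field_simp
    ring
  have h6 : (‖a‖ / 2) ^ 4 * (‖a‖ / 2) ^ 2 * (‖a‖ ^ 2 / 4) ≤ ‖fibreDisc a‖ * ‖a‖ ^ 4 := by
    rw [h5]
    gcongr
  have hpos : 0 < ‖a‖ := by linarith
  have h7 : ‖a‖ ^ 4 ≤ 256 * ‖fibreDisc a‖ := by
    have : ‖a‖ ^ 4 * ‖a‖ ^ 4 ≤ (256 * ‖fibreDisc a‖) * ‖a‖ ^ 4 := by nlinarith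
    exact le_of_mul_le_mul_right this (by positivity)
  have h8 : ‖a‖ ≤ ‖a‖ ^ 4 := le_self_pow₀ (by linarith) (by norm_num)
  have h9 : 0 ≤ ‖fibreDisc a‖⁻¹ := inv_nonneg.mpr (norm_nonneg _)
  rw [cuspSize]
  linarith

theorem one_le_cuspSize_mul_norm {a : ℂ} (ha : a ≠ 0) (hD : fibreDisc a ≠ 0) :
    1 ≤ 256 * cuspSize a * ‖a‖ := by
  have h := norm_le_cuspSize (inv_ne_zero ha) (by rwa [fibreDisc_inv])
  rw [cuspSize, fibreDisc_inv, ← cuspSize, norm_inv] at h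
  rwa [inv_le_iff_one_le_mul₀ (norm_pos_iff.mpr ha)] at h

/-- Polynomials are bounded by powers of the cusp size. -/
theorem exists_norm_eval_le (p : Polynomial ℂ) : ∃ (M : ℝ) (k : ℕ), 0 ≤ M ∧
    ∀ a : ℂ, a ≠ 0 → fibreDisc a ≠ 0 → ‖p.eval a‖ ≤ M * cuspSize a ^ k := by
  induction p using Polynomial.induction_on' with
  | add p q hp hq =>
    obtain ⟨M, k, hM, h⟩ := hp
    obtain ⟨N, l, hN, h'⟩ := hq
    refine ⟨M + N, k + l, by positivity, fun a ha hD => ?_⟩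
    have h1 : 1 ≤ cuspSize a := by linarith [two_le_cuspSize hD]
    rw [Polynomial.eval_add, add_mul]
    refine (norm_add_le _ _).trans (add_le_add ((h a ha hD).trans ?_) ((h' a ha hD).trans ?_))
    · exact mul_le_mul_of_nonneg_left (pow_le_pow_right₀ h1 (by omega)) hM
    · exact mul_le_mul_of_nonneg_left (pow_le_pow_right₀ h1 (by omega)) hN
  | monomial n c =>
    refine ⟨‖c‖ * 256 ^ n, n, by positivity, fun a ha hD => ?_⟩
    rw [Polynomial.eval_monomial, norm_mul, norm_pow, mul_assoc, ← mul_pow]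
    gcongr
    exact norm_le_cuspSize ha hD

/-- Near the cusps, linear factors are bounded below by powers of the cusp size. -/
theorem exists_one_le_norm_sub (r : ℂ) : ∃ (M : ℝ) (k : ℕ) (B : ℝ), 0 ≤ M ∧
    ∀ a : ℂ, a ≠ 0 → fibreDisc a ≠ 0 → B ≤ cuspSize a → 1 ≤ M * cuspSize a ^ k * ‖a - r‖ := by
  by_cases hr : r = 0
  · refine ⟨256, 1, 0, by norm_num, fun a ha hD _ => ?_⟩
    rw [hr, sub_zero, pow_one]
    exact one_le_cuspSize_mul_norm ha hD
  by_cases hrD : fibreDisc r = 0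
  · set n : Polynomial ℂ := (Polynomial.X - 1) ^ 4 * (Polynomial.X + 1) ^ 2 *
      (Polynomial.X ^ 2 - 6 * Polynomial.X + 1) with hn
    have hna : ∀ a : ℂ, a ≠ 0 → fibreDisc a * a ^ 4 = n.eval a := by
      intro a ha
      simp only [hn, fibreDisc, Polynomial.eval_mul, Polynomial.eval_pow, Polynomial.eval_sub,
        Polynomial.eval_add, Polynomial.eval_X, Polynomial.eval_one, Polynomial.eval_ofNat]
      field_simp
      ring
    have hroot : n.IsRoot r := by
      rw [Polynomial.IsRoot, ← hna r hr, hrD, zero_mul]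
    obtain ⟨q, hq⟩ := Polynomial.dvd_iff_isRoot.mpr hroot
    obtain ⟨M, k, hM, h⟩ := exists_norm_eval_le q
    refine ⟨256 ^ 4 * M, k + 5, 0, by positivity, fun a ha hD _ => ?_⟩
    have h1 := hna a ha
    rw [hq, Polynomial.eval_mul, Polynomial.eval_sub, Polynomial.eval_X, Polynomial.eval_C] at h1
    have h2 := one_le_cuspSize_mul_norm ha hD
    have h3 : 1 ≤ cuspSize a * ‖fibreDisc a‖ := by
      have h4 := norm_pos_iff.mpr hD
      rw [cuspSize, add_mul, inv_mul_cancel₀ h4.ne']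
      nlinarith
    have h0 : 0 ≤ cuspSize a := by linarith [two_le_cuspSize hD]
    have h5 : ‖fibreDisc a‖ * ‖a‖ ^ 4 = ‖a - r‖ * ‖q.eval a‖ := by
      rw [← norm_pow, ← norm_mul, h1, norm_mul]
    calc (1 : ℝ) ≤ (cuspSize a * ‖fibreDisc a‖) * (256 * cuspSize a * ‖a‖) ^ 4 :=
          one_le_mul_of_one_le_of_one_le h3 (one_le_pow₀ h2)
      _ = 256 ^ 4 * cuspSize a ^ 5 * (‖a - r‖ * ‖q.eval a‖) := by rw [← h5]; ring
      _ ≤ 256 ^ 4 * cuspSize a ^ 5 * (‖a - r‖ * (M * cuspSize a ^ k)) := by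
          gcongr
          exact h a ha hD
      _ = 256 ^ 4 * M * cuspSize a ^ (k + 5) * ‖a - r‖ := by ring
  · have hc : ContinuousAt cuspSize r := (continuousAt_fibreDisc hr).norm.add
      ((continuousAt_fibreDisc hr).norm.inv₀ (norm_ne_zero_iff.mpr hrD))
    have hev : ∀ᶠ a in 𝓝 r, cuspSize a < cuspSize r + 1 := hc.eventually_lt_const (by linarith)
    obtain ⟨ε, hε, hball⟩ := Metric.eventually_nhds_iff_ball.mp hev
    refine ⟨ε⁻¹, 0, cuspSize r + 1, (inv_pos.mpr hε).le, fun a ha hD hB => ?_⟩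
    have h1 : ε ≤ ‖a - r‖ := by
      by_contra! h2
      exact absurd (hball a (by rwa [Metric.mem_ball, dist_eq_norm])) (not_lt.mpr hB)
    rw [pow_zero, mul_one, ← inv_mul_cancel₀ hε.ne']
    exact mul_le_mul_of_nonneg_left h1 (inv_pos.mpr hε).le

theorem exists_one_le_norm_eval (p : Polynomial ℂ) (hp : p ≠ 0) :
    ∃ (M : ℝ) (k : ℕ) (B : ℝ), 0 ≤ M ∧ ∀ a : ℂ, a ≠ 0 → fibreDisc a ≠ 0 → B ≤ cuspSize a →
      1 ≤ M * cuspSize a ^ k * ‖p.eval a‖ := by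
  induction hn : p.natDegree using Nat.strong_induction_on generalizing p with
  | _ n ih =>
  rcases Nat.eq_zero_or_pos n with h0 | hpos
  · obtain ⟨c, rfl⟩ := Polynomial.natDegree_eq_zero.mp (hn.trans h0)
    have hc : c ≠ 0 := by simpa using hp
    refine ⟨‖c‖⁻¹, 0, 0, by positivity, fun a _ _ _ => ?_⟩
    rw [Polynomial.eval_C, pow_zero, mul_one, inv_mul_cancel₀ (norm_ne_zero_iff.mpr hc)]
  · obtain ⟨r, hr⟩ := IsAlgClosed.exists_root p (by
      rw [Polynomial.degree_eq_natDegree hp, hn]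
      exact_mod_cast hpos.ne')
    obtain ⟨q, hq⟩ := Polynomial.dvd_iff_isRoot.mpr hr
    have hq0 : q ≠ 0 := by
      rintro rfl
      exact hp (by rw [hq, mul_zero])
    have hdeg : q.natDegree < n := by
      rw [← hn, hq, Polynomial.natDegree_mul (Polynomial.X_sub_C_ne_zero r) hq0,
        Polynomial.natDegree_X_sub_C]
      omega
    obtain ⟨M, k, B, hM, h⟩ := ih _ hdeg q hq0 rfl
    obtain ⟨N, l, B', hN, h'⟩ := exists_one_le_norm_sub r
    refine ⟨N * M, l + k, max B B', by positivity, fun a ha hD hB => ?_⟩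
    have h1 := h a ha hD ((le_max_left _ _).trans hB)
    have h2 := h' a ha hD ((le_max_right _ _).trans hB)
    rw [hq, Polynomial.eval_mul, Polynomial.eval_sub, Polynomial.eval_X, Polynomial.eval_C,
      norm_mul]
    calc (1 : ℝ) ≤ (N * cuspSize a ^ l * ‖a - r‖) * (M * cuspSize a ^ k * ‖q.eval a‖) :=
          one_le_mul_of_one_le_of_one_le h2 h1
      _ = _ := by ring

/-- Near the cusps a quotient of polynomials in the Hauptmodul grows at most exponentially. -/
theorem exists_norm_eval_le_exp (p q : Polynomial ℂ) (hq : q ≠ 0) :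
    ∃ C Y : ℝ, 0 ≤ C ∧ 1 ≤ Y ∧ ∀ (δ : SL(2, ℤ)) (σ : ℍ), Y ≤ σ.im →
      q.eval (hauptmodul (δ • σ : ℍ)) ≠ 0 ∧ ‖p.eval (hauptmodul (δ • σ : ℍ))‖ ≤
        Real.exp (C * σ.im) * ‖q.eval (hauptmodul (δ • σ : ℍ))‖ := by
  obtain ⟨M, k, hM, h⟩ := exists_norm_eval_le p
  obtain ⟨N, l, B, hN, h'⟩ := exists_one_le_norm_eval q hq
  set A := M * N * (12 ^ 10) ^ (k + l) with hA
  have hA0 : 0 ≤ A := by positivity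
  refine ⟨A + 2 * Real.pi * (k + l), max 1 (12 ^ 10 * B), by positivity, le_max_left _ _,
    fun δ σ hσ => ?_⟩
  have hσ1 : 1 ≤ σ.im := (le_max_left _ _).trans hσ
  obtain ⟨b1, b2⟩ := fibreDisc_smul_bounds δ (σ := σ) (by nlinarith)
  obtain ⟨ha, hD⟩ := mem_smoothLocus_E_iff_fibreDisc.mp (hauptmodul_mem_smoothLocus (δ • σ))
  set a := hauptmodul (δ • σ : ℍ)
  rw [← cuspSize] at b1 b2
  have hB : B ≤ cuspSize a := by
    have h1 := Real.add_one_le_exp (Real.pi * σ.im)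
    have h2 := (le_max_right _ _).trans hσ
    have h3 := Real.pi_gt_three
    nlinarith
  have h1 := h a ha hD
  have h2 := h' a ha hD hB
  have hQ : 0 ≤ cuspSize a := by linarith [two_le_cuspSize hD]
  constructor
  · intro h0
    rw [h0, norm_zero, mul_zero] at h2
    linarith
  · calc ‖p.eval a‖ ≤ M * cuspSize a ^ k * 1 := by rw [mul_one]; exact h1
      _ ≤ M * cuspSize a ^ k * (N * cuspSize a ^ l * ‖q.eval a‖) := by gcongr
      _ = M * N * cuspSize a ^ (k + l) * ‖q.eval a‖ := by ring
      _ ≤ M * N * (12 ^ 10 * Real.exp (2 * Real.pi * σ.im)) ^ (k + l) * ‖q.eval a‖ := by gcongr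
      _ = A * Real.exp (2 * Real.pi * (k + l) * σ.im) * ‖q.eval a‖ := by
          rw [mul_pow, ← Real.exp_nat_mul, hA, show ((k + l : ℕ) : ℝ) * (2 * Real.pi * σ.im) =
            2 * Real.pi * (k + l) * σ.im by push_cast; ring]
          ring
      _ ≤ Real.exp (A * σ.im) * Real.exp (2 * Real.pi * (k + l) * σ.im) * ‖q.eval a‖ := by
          gcongr
          have h3 := Real.add_one_le_exp (A * σ.im)
          nlinarith
      _ = _ := by rw [← Real.exp_add, ← add_mul]

/-- The ratio `U : W` along a section, in terms of theta norms at a translate. -/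
theorem IsLiftOf.norm_eval_mul {v : Fin 3 → Polynomial ℂ} {f : ℂ → ℂ} (hf : IsLiftOf v f)
    (δ : SL(2, ℤ)) (σ : ℍ) : ‖(v 0).eval (hauptmodul (δ • σ : ℍ))‖ *
      thetaNorm (translate δ f σ) σ ^ 2 = ‖(v 2).eval (hauptmodul (δ • σ : ℍ))‖ *
      thetaNorm (translate δ f σ + ((δ 1 0 : ℤ) * σ + (δ 1 1 : ℤ)) / 2) σ ^ 2 := by
  obtain ⟨c, hc, h⟩ := hf.2 (δ • σ)
  obtain ⟨K, hK, hN⟩ := thetaNorm_smul δ σ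
  have hj := autFactor_ne_zero δ σ
  have h0 := congrFun h 0
  have h2 := congrFun h 2
  simp only [cubicVec, Pi.smul_apply, smul_eq_mul, Matrix.cons_val_zero, Matrix.cons_val] at h0 h2
  have e1 := hN (translate δ f σ)
  have e2 := hN (translate δ f σ + autFactor δ σ / 2)
  rw [translate_coe, mul_div_cancel_right₀ _ hj] at e1
  rw [translate_coe, add_div, mul_div_cancel_right₀ _ hj, div_right_comm, div_self hj] at e2
  change _ * thetaNorm (translate δ f σ) σ ^ 2 = _ * thetaNorm (translate δ f σ +
    autFactor δ σ / 2) σ ^ 2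
  rw [translate_coe]
  apply mul_left_cancel₀ (pow_ne_zero 2 hK.ne')
  calc _ = ‖(v 0).eval (hauptmodul (δ • σ : ℍ))‖ * (K * thetaNorm (f (δ • σ : ℍ) *
        autFactor δ σ) σ) ^ 2 := by ring
    _ = ‖(v 2).eval (hauptmodul (δ • σ : ℍ))‖ * (K * thetaNorm (f (δ • σ : ℍ) *
        autFactor δ σ + autFactor δ σ / 2) σ) ^ 2 := by
      rw [← e1, ← e2, h0, h2, thetaNorm, thetaNorm]
      simp only [norm_mul, norm_pow]
      have him : (f (δ • σ : ℍ) + 1 / 2).im = (f (δ • σ : ℍ)).im := by simp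
      rw [him]
      ring
    _ = _ := by ring

/-- Along a section other than the zero section, theta decreases at most exponentially. -/
theorem IsLiftOf.exists_exp_le_thetaNorm {v : Fin 3 → Polynomial ℂ} {f : ℂ → ℂ}
    (hf : IsLiftOf v f) (hv : v 2 ≠ 0) : ∃ C Y : ℝ, 0 ≤ C ∧ 1 ≤ Y ∧
      ∀ (δ : SL(2, ℤ)) (σ : ℍ), Y ≤ σ.im →
        Real.exp (-(C * σ.im)) ≤ thetaNorm (translate δ f σ) σ := by
  obtain ⟨C, Y, hC, hY, h⟩ := exists_norm_eval_le_exp (v 0) (v 2) hv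
  refine ⟨Real.pi / 2 + C + 1, Y, by positivity, hY, fun δ σ hσ => ?_⟩
  obtain ⟨h1, h2⟩ := h δ σ hσ
  have hσ1 : 1 ≤ σ.im := hY.trans hσ
  have h3 := hf.norm_eval_mul δ σ
  have hdet := det_eq_one δ
  have hodd : Odd (δ 1 0) ∨ Odd (δ 1 1) := by
    by_contra! hcon
    rw [Int.not_odd_iff_even, Int.not_odd_iff_even] at hcon
    have : Even (1 : ℤ) := by
      rw [← hdet]
      exact (hcon.2.mul_left _).sub (hcon.1.mul_left _)
    exact absurd this (by decide)
  have h4 := thetaNorm_or_halfPeriod (τ := σ) σ.im_pos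
    (by rw [UpperHalfPlane.coe_im]; nlinarith) hodd (translate δ f σ)
  rw [UpperHalfPlane.coe_im] at h4
  set x := thetaNorm (translate δ f σ) σ with hx
  set y := thetaNorm (translate δ f σ + ((δ 1 0 : ℤ) * σ + (δ 1 1 : ℤ)) / 2) σ
  have hx0 : 0 ≤ x := thetaNorm_nonneg _ _
  have hpos := norm_pos_iff.mpr h1
  have h5 : y ^ 2 ≤ (Real.exp (C * σ.im) * x) ^ 2 := by
    have h6 : ‖(v 2).eval (hauptmodul (δ • σ : ℍ))‖ * y ^ 2 ≤
        ‖(v 2).eval (hauptmodul (δ • σ : ℍ))‖ * (Real.exp (C * σ.im) * x ^ 2) := by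
      rw [← h3]
      calc _ ≤ Real.exp (C * σ.im) * ‖(v 2).eval (hauptmodul (δ • σ : ℍ))‖ * x ^ 2 := by
            gcongr
        _ = _ := by ring
    have h7 := le_of_mul_le_mul_left h6 hpos
    have h8 : 1 ≤ Real.exp (C * σ.im) := Real.one_le_exp (by positivity)
    nlinarith [sq_nonneg x]
  have h6 : y ≤ Real.exp (C * σ.im) * x := by
    exact abs_le_of_sq_le_sq' h5 (by positivity) |>.2
  have h7 : 1 ≤ Real.exp (C * σ.im) := Real.one_le_exp (by positivity)
  have h8 : 1 / 2 * Real.exp (-(Real.pi * σ.im / 2)) ≤ Real.exp (C * σ.im) * x := by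
    rcases h4 with h4 | h4
    · nlinarith
    · linarith
  have h9 : Real.exp (-σ.im) ≤ 1 / 2 := by
    rw [Real.exp_neg, inv_le_comm₀ (Real.exp_pos _) (by norm_num)]
    have := Real.add_one_le_exp σ.im
    linarith
  have e : Real.exp (-((Real.pi / 2 + C + 1) * σ.im)) =
      Real.exp (-(C * σ.im)) * (Real.exp (-σ.im) * Real.exp (-(Real.pi * σ.im / 2))) := by
    rw [← Real.exp_add, ← Real.exp_add]
    congr 1
    ring
  calc _ = Real.exp (-(C * σ.im)) * (Real.exp (-σ.im) * Real.exp (-(Real.pi * σ.im / 2))) := e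
    _ ≤ Real.exp (-(C * σ.im)) * (Real.exp (C * σ.im) * x) := by
        refine mul_le_mul_of_nonneg_left (le_trans ?_ h8) (Real.exp_pos _).le
        gcongr
    _ = x := by rw [← mul_assoc, ← Real.exp_add, neg_add_cancel, Real.exp_zero, one_mul]

end ModularFibration

namespace ModularFibration

open Complex Filter

/-! ### Decay of the flat norm at the cusps -/

/-- A form of the Borel-Carathéodory inequality. -/
theorem norm_sub_le_of_re_ge {L : ℂ → ℂ} {c : ℂ} {R M : ℝ} (hM : 0 < M)
    (hL : DifferentiableOn ℂ L (Metric.ball c R))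
    (h : ∀ w ∈ Metric.ball c R, (L c).re - M ≤ (L w).re) {w : ℂ}
    (hw : w ∈ Metric.ball c (R / 2)) : ‖L w - L c‖ ≤ 2 * M := by
  have hwR : ‖w - c‖ < R / 2 := by rwa [mem_ball_iff_norm] at hw
  have hR : 0 < R := by linarith [norm_nonneg (w - c)]
  have hmaps : ∀ u ∈ Metric.ball (0 : ℂ) R, c + u ∈ Metric.ball c R := by
    intro u hu
    simpa using hu
  have key := Complex.borelCaratheodory_zero (f := fun u => L c - L (c + u)) (z := w - c) hM
    (by
      refine (differentiableOn_const _).sub (hL.comp ?_ hmaps)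
      fun_prop)
    (fun u hu => by
      have := h _ (hmaps u hu)
      simp only [Set.mem_ofPred_eq, Complex.sub_re]
      linarith)
    hR (by rw [mem_ball_zero_iff]; linarith) (by simp)
  rw [add_sub_cancel, norm_sub_rev] at key
  refine key.trans ?_
  rw [div_le_iff₀ (by linarith)]
  have := norm_nonneg (w - c)
  nlinarith

theorem exists_exp_eq {G : ℂ → ℂ} {c : ℂ} {R : ℝ} (hG : DifferentiableOn ℂ G (Metric.ball c R))
    (h0 : ∀ w ∈ Metric.ball c R, G w ≠ 0) : ∃ L : ℂ → ℂ,
      DifferentiableOn ℂ L (Metric.ball c R) ∧ ∀ w ∈ Metric.ball c R, cexp (L w) = G w := by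
  rcases le_or_gt R 0 with hR | hR
  · rw [Metric.ball_eq_empty.mpr hR]
    exact ⟨0, by simp, by simp⟩
  have hc := Metric.mem_ball_self (x := c) hR
  have hdiff : ∀ w ∈ Metric.ball c R, DifferentiableAt ℂ G w := fun w hw =>
    (hG w hw).differentiableAt (Metric.isOpen_ball.mem_nhds hw)
  have hd : DifferentiableOn ℂ (fun w => deriv G w / G w) (Metric.ball c R) :=
    (hG.deriv Metric.isOpen_ball).div hG h0
  obtain ⟨L, hL⟩ := hd.isExactOn_ball
  have h1 : ∀ w ∈ Metric.ball c R, HasDerivAt (fun u => G u * cexp (-L u)) 0 w := by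
    intro w hw
    refine ((hdiff w hw).hasDerivAt.mul (hL w hw).neg.cexp).congr_deriv ?_
    have := h0 w hw
    field_simp
    ring
  obtain ⟨b, hb⟩ : ∃ b, cexp b = G c * cexp (-L c) :=
    ⟨_, Complex.exp_log (mul_ne_zero (h0 c hc) (Complex.exp_ne_zero _))⟩
  refine ⟨fun w => L w + b, fun w hw =>
    ((hL w hw).differentiableAt.add_const b).differentiableWithinAt, fun w hw => ?_⟩
  have h2 := Metric.isOpen_ball.is_const_of_deriv_eq_zero (convex_ball c R).isPreconnected
    (fun v hv => (h1 v hv).differentiableAt.differentiableWithinAt)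
    (fun v hv => (h1 v hv).deriv) hw hc
  rw [Complex.exp_add, hb, ← h2, mul_left_comm, ← Complex.exp_add, add_neg_cancel,
    Complex.exp_zero, mul_one]

theorem norm_theta_eq (z τ : ℂ) :
    ‖theta z τ‖ = thetaNorm z τ * Real.exp (Real.pi * z.im ^ 2 / τ.im) := by
  rw [thetaNorm, mul_assoc, ← Real.exp_add, neg_add_cancel, Real.exp_zero, mul_one]

theorem im_mem_of_mem_ball {z w : ℂ} {r : ℝ} (hw : w ∈ Metric.ball z r) :
    z.im - r < w.im ∧ w.im < z.im + r := by
  rw [mem_ball_iff_norm] at hw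
  have h := (Complex.abs_im_le_norm (w - z)).trans_lt hw
  rw [Complex.sub_im, abs_lt] at h
  constructor <;> linarith

/-- If theta is not too small along `f`, the imaginary part of `f` is controlled by its value at
one point: the logarithm of theta along `f` is bounded below, hence bounded. -/
theorem abs_im_le_of_exp_le_thetaNorm {f : ℂ → ℂ} {z : ℂ} {C : ℝ} (hC : 0 ≤ C) (hz : 2 ≤ z.im)
    (hf : DifferentiableOn ℂ f (Metric.ball z (z.im / 2)))
    (hN : ∀ w ∈ Metric.ball z (z.im / 2), Real.exp (-(C * w.im)) ≤ thetaNorm (f w) w)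
    (h0 : |(f z).im| ≤ z.im / 2) {w : ℂ} (hw : w ∈ Metric.ball z (z.im / 2 / 2)) :
    |(f w).im| ≤ (3 * C + 3) * z.im := by
  set y := z.im with hy
  have hpi := Real.pi_gt_three
  have hpi' := Real.pi_lt_four
  have hzb : z ∈ Metric.ball z (y / 2) := Metric.mem_ball_self (by linarith)
  have hpos : ∀ u ∈ Metric.ball z (y / 2), 0 < u.im := fun u hu => by
    have := (im_mem_of_mem_ball hu).1
    linarith
  have hG : DifferentiableOn ℂ (fun u => theta (f u) u) (Metric.ball z (y / 2)) := fun u hu =>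
    ((differentiableAt_theta (f u) (hpos u hu)).comp u (f := fun u => (f u, u))
      (((hf u hu).differentiableAt (Metric.isOpen_ball.mem_nhds hu)).prodMk
        differentiableAt_id)).differentiableWithinAt
  have hG0 : ∀ u ∈ Metric.ball z (y / 2), theta (f u) u ≠ 0 := by
    intro u hu h
    have := hN u hu
    rw [thetaNorm, h, norm_zero, zero_mul] at this
    exact absurd this (Real.exp_pos _).not_ge
  obtain ⟨L, hL, hLG⟩ := exists_exp_eq hG hG0
  have hre : ∀ u ∈ Metric.ball z (y / 2),
      Real.exp (L u).re = thetaNorm (f u) u * Real.exp (Real.pi * (f u).im ^ 2 / u.im) := by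
    intro u hu
    rw [← Complex.norm_exp, hLG u hu, norm_theta_eq]
  have hlow : ∀ u ∈ Metric.ball z (y / 2),
      -(C * u.im) + Real.pi * (f u).im ^ 2 / u.im ≤ (L u).re := by
    intro u hu
    rw [← Real.exp_le_exp, hre u hu, Real.exp_add]
    exact mul_le_mul_of_nonneg_right (hN u hu) (Real.exp_pos _).le
  have hup : (L z).re ≤ 2 * y := by
    have h3 := thetaNorm_le_three (τ := z) (by linarith) (by nlinarith) (f z)
    have h4 : Real.pi * (f z).im ^ 2 / y ≤ y := by
      rw [div_le_iff₀ (by linarith)]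
      have := sq_le_sq' (by linarith [abs_le.mp h0]) (abs_le.mp h0).2
      nlinarith
    rw [← Real.exp_le_exp, hre z hzb, two_mul, Real.exp_add]
    refine mul_le_mul (h3.trans ?_) (Real.exp_le_exp.mpr h4) (Real.exp_pos _).le
      (Real.exp_pos _).le
    have := Real.add_one_le_exp y
    linarith
  have hM : 0 < (3 / 2 * C + 2) * y := by positivity
  have key := norm_sub_le_of_re_ge hM hL (fun u hu => by
    have h1 := hlow u hu
    have h2 := hpos u hu
    have h3 := (im_mem_of_mem_ball hu).2
    have h4 : 0 ≤ Real.pi * (f u).im ^ 2 / u.im := by positivity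
    nlinarith) hw
  have hwb : w ∈ Metric.ball z (y / 2) := Metric.ball_subset_ball (by linarith) hw
  have h1 := (Complex.re_le_norm _).trans key
  rw [Complex.sub_re] at h1
  have h2 := hlow w hwb
  have h3 := hpos w hwb
  have h4 := (im_mem_of_mem_ball hwb).2
  have h5 : Real.pi * (f w).im ^ 2 / w.im ≤ (9 / 2 * C + 6) * y := by nlinarith
  rw [div_le_iff₀ h3] at h5
  have h6 : (f w).im ^ 2 ≤ (3 * C + 3) * y ^ 2 := by
    have h7 : (9 / 2 * C + 6) * y * w.im ≤ (9 / 2 * C + 6) * y * (3 / 2 * y) :=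
      mul_le_mul_of_nonneg_left (by linarith) (by positivity)
    nlinarith [sq_nonneg (f w).im, sq_nonneg y, mul_nonneg hC (sq_nonneg y)]
  apply abs_le_of_sq_le_sq _ (by positivity)
  rw [mul_pow]
  nlinarith [mul_nonneg hC (sq_nonneg y), mul_nonneg (mul_nonneg hC hC) (sq_nonneg y), sq_nonneg y]

/-- The second derivative decays when theta is not too small along `f`. -/
theorem norm_deriv_deriv_le_of_exp_le_thetaNorm {f : ℂ → ℂ} {z : ℂ} {C : ℝ} (hC : 0 ≤ C)
    (hz : 2 ≤ z.im) (hf : DifferentiableOn ℂ f (Metric.ball z (z.im / 2)))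
    (hN : ∀ w ∈ Metric.ball z (z.im / 2), Real.exp (-(C * w.im)) ≤ thetaNorm (f w) w) :
    ‖deriv (deriv f) z‖ ≤ 1024 * (3 * C + 4) / z.im := by
  obtain ⟨m, hm⟩ := exists_sub_mem_strip (τ := z) (by linarith) (f z)
  -- subtracting a period changes neither the hypotheses nor the second derivative
  set g : ℂ → ℂ := fun u => f u - m * u with hg
  have hgd : DifferentiableOn ℂ g (Metric.ball z (z.im / 2)) := hf.sub (by fun_prop)
  have him : ∀ w ∈ Metric.ball z (z.im / 2 / 2), |(g w).im| ≤ (3 * C + 3) * z.im := by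
    intro w hw
    refine abs_im_le_of_exp_le_thetaNorm hC hz hgd (fun u hu => ?_) hm hw
    have hu0 : 0 < u.im := by
      have := (im_mem_of_mem_ball hu).1
      linarith
    have hl : (-m : ℤ) * u + (0 : ℤ) ∈ periodLattice u := ⟨-m, 0, rfl⟩
    have e : g u = f u + ((-m : ℤ) * u + (0 : ℤ)) := by
      simp only [hg]
      push_cast
      ring
    rw [e, thetaNorm_add_mem hu0 hl]
    exact hN u hu
  have hsub : Metric.ball z (z.im / 2 / 2) ⊆ Metric.ball z (z.im / 2) :=
    Metric.ball_subset_ball (by linarith)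
  have hM : 0 < (3 * C + 4) * z.im := by positivity
  have hbd : ∀ w ∈ Metric.ball z (z.im / 2 / 2 / 2), ‖g w - g z‖ ≤ 2 * ((3 * C + 4) * z.im) := by
    intro w hw
    have := norm_sub_le_of_re_ge (L := fun u => -I * g u) (c := z) (R := z.im / 2 / 2) hM
      ((hgd.mono hsub).const_mul _) (fun u hu => by
        have h1 := abs_le.mp (him u hu)
        have h2 := abs_le.mp hm
        have e : ∀ a : ℂ, (-I * a).re = a.im := fun a => by simp
        rw [e, e]
        have : (g z).im = (f z - m * z).im := rfl
        linarith) hw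
    rwa [← mul_sub, norm_mul, norm_neg, Complex.norm_I, one_mul] at this
  have hR : 0 < z.im / 16 := by linarith
  have hcl : Metric.closedBall z (z.im / 16) ⊆ Metric.ball z (z.im / 2 / 2 / 2) :=
    Metric.closedBall_subset_ball (by linarith)
  have hd : DifferentiableOn ℂ (fun u => g u - g z) (Metric.closedBall z (z.im / 16)) :=
    (hgd.sub_const _).mono (hcl.trans (Metric.ball_subset_ball (by linarith)))
  have key := Complex.norm_iteratedDeriv_le_of_forall_mem_sphere_norm_le 2 hR
    (hd.diffContOnCl_ball subset_rfl) (fun w hw => hbd w (hcl (Metric.sphere_subset_closedBall hw)))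
  have e : iteratedDeriv 2 (fun u => g u - g z) z = deriv (deriv f) z := by
    rw [iteratedDeriv_succ, iteratedDeriv_one]
    have h1 : deriv (fun u => g u - g z) =ᶠ[𝓝 z] fun u => deriv f u - m := by
      filter_upwards [Metric.isOpen_ball.mem_nhds (Metric.mem_ball_self (x := z)
        (ε := z.im / 2) (by linarith))] with u hu
      have h2 := ((hf u hu).differentiableAt (Metric.isOpen_ball.mem_nhds hu)).hasDerivAt
      exact (((h2.sub ((hasDerivAt_id u).const_mul (m : ℂ))).sub_const (g z)).congr_deriv
        (by simp)).deriv
    rw [h1.deriv_eq, deriv_sub_const]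
  rw [e] at key
  refine key.trans (le_of_eq ?_)
  have : z.im ≠ 0 := by linarith
  field_simp
  norm_num [Nat.factorial]

end ModularFibration

namespace ModularFibration

open Complex Filter

/-- The decay of the second derivative forces `m = 0` and lets the derivative tend to `n / 8`. -/
theorem exists_norm_deriv_sub_le {F : ℂ → ℂ} (hF : DifferentiableOn ℂ F {z : ℂ | 0 < z.im})
    {C Y : ℝ} (hC : 0 ≤ C) (hY : 1 ≤ Y) (h2 : ∀ z : ℂ, Y ≤ z.im → ‖deriv (deriv F) z‖ ≤ C / z.im)
    {m n : ℤ} (hper : ∀ z : ℂ, 0 < z.im → F (z + 8) = F z + (m * z + n)) :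
    ∀ z : ℂ, Y ≤ z.im → ‖deriv F z - n / 8‖ ≤ 8 * C / z.im := by
  have hd : ∀ z : ℂ, 0 < z.im → DifferentiableAt ℂ F z := fun z hz =>
    (hF z hz).differentiableAt (isOpen_halfPlane.mem_nhds hz)
  have hdd : ∀ z : ℂ, 0 < z.im → DifferentiableAt ℂ (deriv F) z := fun z hz =>
    (hF.deriv isOpen_halfPlane z hz).differentiableAt (isOpen_halfPlane.mem_nhds hz)
  have hdl : ∀ z w : ℂ, Y ≤ z.im → z.im ≤ w.im →
      ‖deriv F w - deriv F z‖ ≤ C / z.im * ‖w - z‖ := by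
    intro z w hz hw
    refine Convex.norm_image_sub_le_of_norm_deriv_le (s := {u : ℂ | z.im ≤ u.im})
      (fun u hu => hdd u ?_) (fun u hu => (h2 u (hz.trans hu)).trans ?_)
      (convex_halfSpace_im_ge _) (le_refl z.im) hw
    · have : z.im ≤ u.im := hu
      linarith
    · exact div_le_div_of_nonneg_left hC (by linarith) hu
  have h8 : ∀ z : ℂ, (z + 8).im = z.im := fun z => by simp
  have hm : m = 0 := by
    set y : ℝ := max Y (8 * C + 1) with hy
    have hyY : Y ≤ y := le_max_left _ _
    have hyC : 8 * C + 1 ≤ y := le_max_right _ _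
    set z : ℂ := y * I with hz
    have hzi : z.im = y := by simp [hz]
    have h3 : deriv F (z + 8) = deriv F z + m := by
      have e : (fun u => F (u + 8)) =ᶠ[𝓝 z] fun u => F u + (m * u + n) := by
        filter_upwards [isOpen_halfPlane.mem_nhds (show 0 < z.im by linarith)] with u hu
          using hper u hu
      have e2 := e.deriv_eq
      rw [deriv_comp_add_const] at e2
      rw [e2]
      have h4 := (hd z (by linarith)).hasDerivAt.add
        (((hasDerivAt_id z).const_mul (m : ℂ)).add_const (n : ℂ))
      exact (h4.congr_deriv (by simp)).deriv
    have h4 := hdl z (z + 8) (by linarith) (h8 z).ge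
    rw [h3, add_sub_cancel_left, add_sub_cancel_left, hzi, Complex.norm_intCast] at h4
    have h5 : C / y * ‖(8 : ℂ)‖ < 1 := by
      rw [div_mul_eq_mul_div, div_lt_one (by linarith)]
      norm_num
      linarith
    have h6 := h4.trans_lt h5
    exact Int.abs_lt_one_iff.mp (by exact_mod_cast h6)
  intro z hz
  have h3 : ‖(fun u => F u - deriv F z * u) (z + 8) - (fun u => F u - deriv F z * u) z‖ ≤
      C / z.im * 8 * ‖z + 8 - z‖ := by
    refine Convex.norm_image_sub_le_of_norm_hasDerivWithin_le
      (f := fun u => F u - deriv F z * u) (C := C / z.im * 8) (f' := fun u => deriv F u - deriv F z)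
      (s := {u : ℂ | z.im ≤ u.im} ∩ Metric.closedBall z 8) (fun u hu => ?_) (fun u hu => ?_)
      ((convex_halfSpace_im_ge _).inter (convex_closedBall _ _)) ⟨le_refl z.im, by simp⟩
      ⟨(h8 z).ge, by simp⟩
    · have : z.im ≤ u.im := hu.1
      exact ((hd u (by linarith)).hasDerivAt.sub
        (((hasDerivAt_id u).const_mul (deriv F z)).congr_deriv (mul_one _))).hasDerivWithinAt
    · refine (hdl z u hz hu.1).trans ?_
      have h4 : ‖u - z‖ ≤ 8 := by simpa [dist_eq_norm] using hu.2
      exact mul_le_mul_of_nonneg_left h4 (div_nonneg hC (by linarith))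
  have e : (fun u => F u - deriv F z * u) (z + 8) - (fun u => F u - deriv F z * u) z =
      -(8 * (deriv F z - n / 8)) := by
    simp only [hper z (by linarith), hm]
    push_cast
    ring
  rw [e, norm_neg, norm_mul, add_sub_cancel_left] at h3
  have e8 : ‖(8 : ℂ)‖ = 8 := by norm_num
  rw [e8] at h3
  have e9 : 8 * C / z.im = C / z.im * 8 := by ring
  rw [e9]
  linarith

/-- The flat norm tends to zero at the cusp `∞` for a function with small second derivative which
has period `8` up to periods of the lattice. -/
theorem exists_flatNorm_le {F : ℂ → ℂ} (hF : DifferentiableOn ℂ F {z : ℂ | 0 < z.im})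
    {C Y : ℝ} (hC : 0 ≤ C) (hY : 1 ≤ Y) (h2 : ∀ z : ℂ, Y ≤ z.im → ‖deriv (deriv F) z‖ ≤ C / z.im)
    {m n : ℤ} (hper : ∀ z : ℂ, 0 < z.im → F (z + 8) = F z + (m * z + n)) {ε : ℝ} (hε : 0 < ε) :
    ∃ Y', ∀ z : ℂ, |z.re| ≤ 1 / 2 → Y' ≤ z.im → flatNorm F z ≤ ε := by
  have h1 := exists_norm_deriv_sub_le hF hC hY h2 hper
  set H : ℂ → ℂ := fun z => F z - n / 8 * z with hH
  have hHd : ∀ z : ℂ, 0 < z.im → HasDerivAt H (deriv F z - n / 8) z := fun z hz =>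
    ((hF z hz).differentiableAt (isOpen_halfPlane.mem_nhds hz)).hasDerivAt.sub
      (((hasDerivAt_id z).const_mul ((n : ℂ) / 8)).congr_deriv (mul_one _))
  obtain ⟨A, hA⟩ : ∃ A, ∀ x ∈ Set.Icc (-(1 / 2) : ℝ) (1 / 2), ‖H (x + Y * I)‖ ≤ A := by
    refine isCompact_Icc.exists_bound_of_continuousOn fun x _ => ?_
    have h3 : ContinuousAt H (x + Y * I) := (hHd _ (by simp; linarith)).continuousAt
    exact (ContinuousAt.comp (g := H) (f := fun x : ℝ => (x : ℂ) + Y * I) h3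
      (by fun_prop)).continuousWithinAt
  have hA0 : 0 ≤ A := (norm_nonneg _).trans (hA 0 (by constructor <;> norm_num))
  have hlog : ∀ z : ℂ, |z.re| ≤ 1 / 2 → Y ≤ z.im → ‖H z‖ ≤ A + 8 * C * Real.log z.im := by
    intro z hx hz
    have hline : ∀ t : ℝ, Y ≤ t → HasDerivAt (fun t : ℝ => H (z.re + t * I))
        ((deriv F (z.re + t * I) - n / 8) * I) t := by
      intro t ht
      have h3 : HasDerivAt (fun t : ℝ => (z.re : ℂ) + t * I) I t :=
        (((Complex.ofRealCLM.hasDerivAt (x := t)).mul_const I).const_add _).congr_deriv (by simp)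
      exact HasDerivAt.comp t (h₂ := H) (hHd _ (by simp; linarith)) h3
    have key := image_norm_le_of_norm_deriv_right_le_deriv_boundary' (a := Y) (b := z.im)
      (f := fun t : ℝ => H (z.re + t * I)) (B := fun t => A + 8 * C * Real.log t)
      (B' := fun t => 8 * C * t⁻¹)
      (fun t ht => (hline t ht.1).continuousAt.continuousWithinAt)
      (fun t ht => (hline t ht.1).hasDerivWithinAt)
      (by
        have := hA z.re ⟨by linarith [abs_le.mp hx], by linarith [abs_le.mp hx]⟩
        have h4 : 0 ≤ 8 * C * Real.log Y := mul_nonneg (by linarith) (Real.log_nonneg hY)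
        linarith)
      (fun t ht => ((continuousAt_const.add (continuousAt_const.mul
        (Real.continuousAt_log (by linarith [ht.1]))))).continuousWithinAt)
      (fun t ht => (((Real.hasDerivAt_log (by linarith [ht.1])).const_mul
        (8 * C)).const_add A).hasDerivWithinAt)
      (fun t ht => by
        have h3 := h1 (z.re + t * I) (by simpa using ht.1)
        have h4 : ((z.re : ℂ) + t * I).im = t := by simp
        rw [norm_mul, Complex.norm_I, mul_one, ← div_eq_mul_inv]
        rwa [h4] at h3)
      (Set.right_mem_Icc.mpr hz)
    simpa only [Complex.re_add_im] using key
  have ho : (fun y : ℝ => 8 * C + A + 8 * C * Real.log y) =o[atTop] fun y => y ^ (1 / 2 : ℝ) := by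
    refine Asymptotics.IsLittleO.add (Asymptotics.isLittleO_const_left.mpr (Or.inr ?_))
      ((isLittleO_log_rpow_atTop (by norm_num)).const_mul_left _)
    exact tendsto_norm_atTop_atTop.comp (tendsto_rpow_atTop (by norm_num))
  obtain ⟨Y₁, hY₁⟩ := eventually_atTop.mp (ho.bound (Real.sqrt_pos.mpr hε))
  refine ⟨max Y Y₁, fun z hx hz => ?_⟩
  have hzY : Y ≤ z.im := (le_max_left _ _).trans hz
  have hz0 : 0 < z.im := by linarith
  have h3 := hY₁ z.im ((le_max_right _ _).trans hz)
  have h4 := hlog z hx hzY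
  have h5 := h1 z hzY
  have e1 : flatDeriv F z = flatDeriv H z := by
    refine flatDeriv_add_real (a := n / 8) (b := 0) hz0 (hHd z hz0).differentiableAt
      (Eventually.of_forall fun u => ?_)
    simp only [hH]
    push_cast
    ring
  have h6 : ‖flatDeriv H z‖ ≤ (8 * C + A + 8 * C * Real.log z.im) / z.im := by
    rw [flatDeriv, (hHd z hz0).deriv]
    refine (norm_sub_le _ _).trans ?_
    rw [Complex.norm_real, Real.norm_eq_abs, abs_div, abs_of_pos hz0]
    have h7 := (Complex.abs_im_le_norm (H z)).trans h4
    have h8 : |(H z).im| / z.im ≤ (A + 8 * C * Real.log z.im) / z.im :=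
      div_le_div_of_nonneg_right h7 hz0.le
    have e : (8 * C + A + 8 * C * Real.log z.im) / z.im =
      8 * C / z.im + (A + 8 * C * Real.log z.im) / z.im := by ring
    rw [e]
    linarith
  have hlog0 : 0 ≤ Real.log z.im := Real.log_nonneg (by linarith)
  have hnn : 0 ≤ 8 * C + A + 8 * C * Real.log z.im := by positivity
  rw [Real.norm_of_nonneg hnn, Real.norm_of_nonneg (Real.rpow_nonneg hz0.le _),
    ← Real.sqrt_eq_rpow, ← Real.sqrt_mul hε.le] at h3
  have h7 : (8 * C + A + 8 * C * Real.log z.im) ^ 2 ≤ ε * z.im :=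
    (Real.le_sqrt hnn (by positivity)).mp h3
  rw [flatNorm, e1]
  calc ‖flatDeriv H z‖ ^ 2 * z.im
      ≤ ((8 * C + A + 8 * C * Real.log z.im) / z.im) ^ 2 * z.im := by gcongr
    _ = (8 * C + A + 8 * C * Real.log z.im) ^ 2 / z.im := by
      field_simp
    _ ≤ ε := by rwa [div_le_iff₀ hz0]

/-- The flat norm of a section other than the zero section tends to zero at every cusp. -/
theorem IsLiftOf.exists_flatNorm_translate_le {v : Fin 3 → Polynomial ℂ} {f : ℂ → ℂ}
    (hf : IsLiftOf v f) (hv : v 2 ≠ 0) (δ : SL(2, ℤ)) {ε : ℝ} (hε : 0 < ε) :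
    ∃ Y, ∀ σ : ℍ, |σ.re| ≤ 1 / 2 → Y ≤ σ.im → flatNorm (translate δ f) σ ≤ ε := by
  obtain ⟨C, Y, hC, hY, hN⟩ := hf.exists_exp_le_thetaNorm hv
  obtain ⟨m, n, hper⟩ := hf.translate_add_eight δ
  have hF := differentiableOn_translate δ hf.1
  obtain ⟨Y', hY'⟩ := exists_flatNorm_le hF (C := 1024 * (3 * C + 4)) (Y := 2 * Y) (by positivity)
    (by linarith) (fun z hz => by
      have hpos : ∀ w ∈ Metric.ball z (z.im / 2), Y ≤ w.im := fun w hw => by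
        have := (im_mem_of_mem_ball hw).1
        linarith
      exact norm_deriv_deriv_le_of_exp_le_thetaNorm hC (by linarith)
        (hF.mono fun w hw => by
          have := hpos w hw
          show 0 < w.im
          linarith)
        (fun w hw => hN δ ⟨w, by linarith [hpos w hw]⟩ (hpos w hw))) hper hε
  exact ⟨Y', fun σ h1 h2 => hY' σ h1 h2⟩

end ModularFibration

namespace ModularFibration

open Complex Filter

/-! ### Sections are torsion -/

theorem flatNorm_nonneg (f : ℂ → ℂ) (τ : ℍ) : 0 ≤ flatNorm f τ :=
  mul_nonneg (sq_nonneg _) τ.im_pos.le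

theorem continuous_flatNorm {f : ℂ → ℂ} (hf : DifferentiableOn ℂ f {z : ℂ | 0 < z.im}) :
    Continuous fun τ : ℍ => flatNorm f τ := by
  have h1 : Continuous fun τ : ℍ => f τ := by
    rw [continuous_iff_continuousAt]
    intro τ
    exact ContinuousAt.comp (g := f) (f := ((↑) : ℍ → ℂ))
      ((hf τ τ.im_pos).differentiableAt (isOpen_halfPlane.mem_nhds τ.im_pos)).continuousAt
      UpperHalfPlane.continuous_coe.continuousAt
  have h2 : Continuous fun τ : ℍ => deriv f τ := by
    rw [continuous_iff_continuousAt]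
    intro τ
    exact ContinuousAt.comp (g := deriv f) (f := ((↑) : ℍ → ℂ))
      ((hf.deriv isOpen_halfPlane τ τ.im_pos).differentiableAt
        (isOpen_halfPlane.mem_nhds τ.im_pos)).continuousAt
      UpperHalfPlane.continuous_coe.continuousAt
  have h3 : Continuous fun τ : ℍ => (f τ).im / (τ : ℂ).im :=
    (Complex.continuous_im.comp h1).div (Complex.continuous_im.comp UpperHalfPlane.continuous_coe)
      fun τ => τ.im_pos.ne'
  exact ((h2.sub (Complex.continuous_ofReal.comp h3)).norm.pow 2).mul
    (Complex.continuous_im.comp UpperHalfPlane.continuous_coe)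

/-- The flat norm of a section vanishes: it is invariant and tends to zero at the cusps, hence has a
maximum, which can only be zero. -/
theorem IsLiftOf.flatNorm_eq_zero {v : Fin 3 → Polynomial ℂ} {f : ℂ → ℂ} (hf : IsLiftOf v f)
    (hv : v 2 ≠ 0) (τ : ℍ) : flatNorm f τ = 0 := by
  by_contra hne
  have hpos : 0 < flatNorm f τ := lt_of_le_of_ne (flatNorm_nonneg f τ) (Ne.symm hne)
  obtain ⟨S, hS, hcov⟩ := exists_finite_translates (CongruenceSubgroup.Gamma1 8)
  choose Y hY using fun δ => hf.exists_flatNorm_translate_le hv δ (half_pos hpos)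
  obtain ⟨B, hB⟩ := (hS.image Y).bddAbove
  set K : Set ℍ := ⋃ δ ∈ S, (fun σ : ℍ => δ • σ) '' ModularGroup.truncatedFundamentalDomain B
    with hK
  have hKc : IsCompact K := hS.isCompact_biUnion fun δ _ =>
    (ModularGroup.isCompact_truncatedFundamentalDomain _).image (continuous_smul_coe δ)
  have hred : ∀ τ' : ℍ, flatNorm f τ ≤ flatNorm f τ' → ∃ σ ∈ K, flatNorm f τ' = flatNorm f σ := by
    intro τ' hle
    obtain ⟨γ, hγ, δ, hδ, σ, hσ, h⟩ := hcov τ'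
    have h1 : flatNorm f τ' = flatNorm f (δ • σ : ℍ) := by rw [← h, hf.flatNorm_smul hγ]
    refine ⟨δ • σ, Set.mem_biUnion hδ ⟨σ, ⟨hσ, ?_⟩, rfl⟩, h1⟩
    by_contra! hlt
    have h2 := hY δ σ hσ.2 ((hB ⟨δ, hδ, rfl⟩).trans hlt.le)
    rw [flatNorm_translate δ hf.1, ← h1] at h2
    linarith
  obtain ⟨σ₀, hσ₀, h0⟩ := hred τ le_rfl
  obtain ⟨σ₁, hσ₁, hmax⟩ := hKc.exists_isMaxOn ⟨σ₀, hσ₀⟩ (continuous_flatNorm hf.1).continuousOn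
  have h1 : flatNorm f τ ≤ flatNorm f σ₁ := h0.trans_le (hmax hσ₀)
  have hloc : IsLocalMax (flatNorm f) (σ₁ : ℂ) := by
    filter_upwards [isOpen_halfPlane.mem_nhds σ₁.im_pos] with u hu
    rcases le_total (flatNorm f τ) (flatNorm f u) with hle | hle
    · obtain ⟨σ, hσ, h⟩ := hred ⟨u, hu⟩ hle
      change flatNorm f u = _ at h
      rw [h]
      exact hmax hσ
    · exact hle.trans h1
  rw [flatNorm_eq_zero_of_isLocalMax σ₁.im_pos hf.1 hloc] at h1
  linarith

/-- If the flat derivative vanishes, `f'` is holomorphic and real-valued, hence constant. -/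
theorem exists_real_of_flatNorm_eq_zero {f : ℂ → ℂ}
    (hf : DifferentiableOn ℂ f {z : ℂ | 0 < z.im}) (h : ∀ τ : ℍ, flatNorm f τ = 0) :
    ∃ a b : ℝ, ∀ τ : ℍ, f τ = a * τ + b := by
  have h1 : ∀ z : ℂ, 0 < z.im → deriv f z = ((f z).im / z.im : ℝ) := by
    intro z hz
    have h2 := h ⟨z, hz⟩
    rw [flatNorm, mul_eq_zero, or_iff_left (show ((⟨z, hz⟩ : ℍ) : ℂ).im ≠ 0 from hz.ne'),
      sq_eq_zero_iff, norm_eq_zero, flatDeriv] at h2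
    exact sub_eq_zero.mp h2
  have hI : 0 < Complex.I.im := by simp
  obtain ⟨c, hc⟩ := ((hf.deriv isOpen_halfPlane).analyticOnNhd
    isOpen_halfPlane).eq_const_of_im_eq_const (c₀ := 0)
      (fun z hz => by rw [h1 z hz, Complex.ofReal_im]) isOpen_halfPlane
      ⟨⟨I, hI⟩, isPreconnected_halfPlane⟩
  set a : ℝ := (f I).im / I.im with ha
  have hca : c = a := by rw [← hc I hI, h1 I hI]
  have hconst : ∀ z : ℂ, 0 < z.im → f z - a * z = f I - a * I := by
    intro z hz
    have hd : ∀ u : ℂ, 0 < u.im → HasDerivAt (fun u => f u - a * u) 0 u := fun u hu =>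
      (((hf u hu).differentiableAt (isOpen_halfPlane.mem_nhds hu)).hasDerivAt.sub
        ((hasDerivAt_id u).const_mul (a : ℂ))).congr_deriv (by rw [hc u hu, hca]; simp)
    exact isOpen_halfPlane.is_const_of_deriv_eq_zero isPreconnected_halfPlane
      (f := fun u => f u - a * u)
      (fun u hu => (hd u hu).differentiableAt.differentiableWithinAt)
      (fun u hu => (hd u hu).deriv) hz hI
  refine ⟨a, (f I - a * I).re, fun τ => ?_⟩
  have him : (f I - a * I).im = 0 := by
    rw [Complex.sub_im, Complex.im_ofReal_mul, ha, div_mul_cancel₀ _ hI.ne', sub_self]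
  have h3 : (((f I - a * I).re : ℝ) : ℂ) = f I - a * I := Complex.ext (by simp) (by simp [him])
  rw [h3, ← hconst τ τ.im_pos]
  ring

theorem real_coeff_ext {τ : ℍ} {a b c d : ℝ} (h : (a : ℂ) * τ + b = c * τ + d) : a = c ∧ b = d := by
  have h1 := congrArg Complex.im h
  rw [Complex.add_im, Complex.add_im, Complex.im_ofReal_mul, Complex.im_ofReal_mul,
    Complex.ofReal_im, Complex.ofReal_im, add_zero, add_zero] at h1
  have h2 := mul_right_cancel₀ τ.im_pos.ne' h1
  subst h2
  exact ⟨rfl, by simpa using h⟩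

/-- The real coefficients are fixed by comparing the lift with its translates by `τ ↦ τ + 1` and
`τ ↦ τ / (8τ + 1)`, generators of the stabilisers of two cusps in `Γ₁(8)`. -/
theorem IsLiftOf.exists_eq {v : Fin 3 → Polynomial ℂ} {f : ℂ → ℂ} (hf : IsLiftOf v f)
    (hv : v 2 ≠ 0) : ∃ m k : ℤ, ∀ τ : ℍ, f τ = m * τ + k / 8 := by
  obtain ⟨a, b, hab⟩ := exists_real_of_flatNorm_eq_zero hf.1 (hf.flatNorm_eq_zero hv)
  set γ : SL(2, ℤ) := ⟨!![1, 0; 8, 1], by simp [Matrix.det_fin_two]⟩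
  have hT : ModularGroup.T ∈ CongruenceSubgroup.Gamma1 8 := by
    rw [CongruenceSubgroup.Gamma1_mem, ModularGroup.coe_T]
    simp
  have hγ : γ ∈ CongruenceSubgroup.Gamma1 8 := by
    rw [CongruenceSubgroup.Gamma1_mem]
    simp [γ]
    rfl
  obtain ⟨m₁, n₁, h₁⟩ := hf.translate_eq hT
  obtain ⟨m₂, n₂, h₂⟩ := hf.translate_eq hγ
  have e₁ := h₁ UpperHalfPlane.I
  have e₂ := h₂ UpperHalfPlane.I
  rw [translate_coe, hab, hab, add_mul, mul_assoc, smul_mul_autFactor] at e₁ e₂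
  rw [autFactor, ModularGroup.coe_T] at e₁
  simp only [autFactor, γ, Matrix.of_apply, Matrix.cons_val', Matrix.cons_val_zero,
    Matrix.cons_val_one, Matrix.cons_val_fin_one, Int.cast_one, Int.cast_zero, one_mul, zero_mul,
    zero_add, mul_one, add_zero, Int.cast_ofNat] at e₁ e₂
  generalize UpperHalfPlane.I = τ at *
  obtain ⟨-, ha⟩ := real_coeff_ext (τ := τ) (a := a) (b := a + b) (c := a + m₁) (d := b + n₁)
    (by push_cast; linear_combination e₁)
  obtain ⟨hb, -⟩ := real_coeff_ext (τ := τ) (a := a + 8 * b) (b := b) (c := a + m₂) (d := b + n₂)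
    (by push_cast; linear_combination e₂)
  refine ⟨n₁, m₂, fun τ' => ?_⟩
  have ha' : a = n₁ := by linarith
  have hb' : b = m₂ / 8 := by linarith
  rw [hab, ha', hb']
  push_cast
  ring

/-- Every section is given by an eighth period. -/
theorem exists_eighthPeriod (P : E.toAffine.Point) : ∃ (k : ℤ) (v : Fin 3 → Polynomial ℂ),
    IsHomogeneousModel P v ∧ ∀ τ : ℍ, ∃ c : ℂ, c ≠ 0 ∧
      (fun i => (v i).eval (hauptmodul τ)) = c • cubicVec (k / 8) τ := by
  obtain ⟨v, hv⟩ := exists_isHomogeneousModel P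
  by_cases hv2 : v 2 = 0
  · have : v = ![0, 1, 0] := by
      rcases P with _ | ⟨x, y, hP⟩
      · exact hv
      · exact absurd hv2 hv.1
    subst this
    refine ⟨0, _, hv, fun τ => ⟨(cubicVec 0 τ 1)⁻¹, inv_ne_zero (cubicVec_zero_one_ne_zero τ), ?_⟩⟩
    rw [Int.cast_zero, zero_div]
    nth_rw 2 [cubicVec_zero]
    have := cubicVec_zero_one_ne_zero τ
    funext i
    fin_cases i <;> simp [this]
  obtain ⟨f, hf⟩ := hv.exists_isLiftOf
  obtain ⟨m, k, hmk⟩ := hf.exists_eq hv2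
  refine ⟨k, v, hv, fun τ => ?_⟩
  obtain ⟨c, hc, h⟩ := hf.2 τ
  obtain ⟨d, hd, h'⟩ := cubicVec_add_mem (τ := τ) (l := m * τ + (0 : ℤ)) ⟨m, 0, rfl⟩ (k / 8)
  refine ⟨c * d, mul_ne_zero hc hd, ?_⟩
  rw [h, mul_smul, ← h', hmk]
  congr 2
  push_cast
  ring

theorem infinite_range_hauptmodul : (Set.range fun τ : ℍ => hauptmodul τ).Infinite := by
  rw [range_hauptmodul, smoothLocus_E_eq]
  exact (Set.toFinite _).infinite_compl

theorem IsHomogeneousModel.eq_of_mul_eq {P Q : E.toAffine.Point} {v w : Fin 3 → Polynomial ℂ}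
    (hv : IsHomogeneousModel P v) (hw : IsHomogeneousModel Q w)
    (h : ∀ i j, v i * w j = v j * w i) : P = Q := by
  rcases P with _ | ⟨x, y, hP⟩ <;> rcases Q with _ | ⟨x', y', hQ⟩
  · rfl
  · obtain rfl : v = ![0, 1, 0] := hv
    have := h 1 2
    simp at this
    exact absurd this hw.1
  · obtain rfl : w = ![0, 1, 0] := hw
    have := h 1 2
    simp at this
    exact absurd this.symm hv.1
  · obtain ⟨hv2, hx, hy, -⟩ := hv
    obtain ⟨hw2, hx', hy', -⟩ := hw
    have a2 : algebraMap (Polynomial ℂ) (RatFunc ℂ) (v 2) ≠ 0 := RatFunc.algebraMap_ne_zero hv2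
    have b2 : algebraMap (Polynomial ℂ) (RatFunc ℂ) (w 2) ≠ 0 := RatFunc.algebraMap_ne_zero hw2
    have h0 := congrArg (algebraMap (Polynomial ℂ) (RatFunc ℂ)) (h 0 2)
    have h1 := congrArg (algebraMap (Polynomial ℂ) (RatFunc ℂ)) (h 1 2)
    rw [map_mul, map_mul] at h0 h1
    rw [← hx, ← hx'] at h0
    rw [← hy, ← hy'] at h1
    have ex : x = x' := by
      apply mul_right_cancel₀ (mul_ne_zero a2 b2)
      linear_combination h0
    have ey : y = y' := by
      apply mul_right_cancel₀ (mul_ne_zero a2 b2)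
      linear_combination h1
    subst ex ey
    rfl

/-- A section is determined by its eighth period, so there are at most eight sections. -/
theorem exists_injective_zmod : ∃ k : E.toAffine.Point → ZMod 8, Function.Injective k := by
  choose k v hv hk using exists_eighthPeriod
  refine ⟨fun P => (k P : ZMod 8), fun P Q h => ?_⟩
  obtain ⟨m, hm⟩ := (ZMod.intCast_eq_intCast_iff_dvd_sub _ _ 8).mp h
  refine (hv P).eq_of_mul_eq (hv Q) fun i j =>
    Polynomial.eq_of_infinite_eval_eq _ _ (infinite_range_hauptmodul.mono ?_)
  rintro _ ⟨τ, rfl⟩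
  obtain ⟨a, -, h1⟩ := hk P τ
  obtain ⟨b, -, h2⟩ := hk Q τ
  obtain ⟨c, -, h3⟩ := cubicVec_add_mem (τ := τ) (l := (0 : ℤ) * τ + m) ⟨0, m, rfl⟩ (k P / 8)
  have e : (k P : ℂ) / 8 + ((0 : ℤ) * τ + m) = k Q / 8 := by
    have : (k Q : ℂ) - k P = 8 * m := by exact_mod_cast hm
    push_cast
    linear_combination -this / 8
  rw [e] at h3
  rw [h3, smul_smul] at h2
  have p1 := fun i => congrFun h1 i
  have p2 := fun i => congrFun h2 i
  simp only [Pi.smul_apply, smul_eq_mul] at p1 p2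
  simp only [Set.mem_ofPred_eq, Polynomial.eval_mul]
  rw [p1, p1, p2, p2]
  ring

end ModularFibration

namespace ModularFibration

open Complex Filter

/-! ### The Mordell-Weil group -/

theorem s_ne_zero : s ≠ 0 := RatFunc.X_ne_zero

theorem s_sub_C_ne_zero (c : ℂ) : s - RatFunc.C c ≠ 0 := by
  have h : s - RatFunc.C c = algebraMap (Polynomial ℂ) (RatFunc ℂ)
    (Polynomial.X - Polynomial.C c) := by simp [s]
  rw [h]
  exact RatFunc.algebraMap_ne_zero (Polynomial.X_sub_C_ne_zero c)

theorem s_sub_one_ne_zero : s - 1 ≠ 0 := by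
  have := s_sub_C_ne_zero 1
  rwa [map_one] at this

theorem s_add_one_ne_zero : s + 1 ≠ 0 := by
  have := s_sub_C_ne_zero (-1)
  rwa [map_neg, map_one, sub_neg_eq_add] at this

theorem E_a₁ : E.a₁ = (s - 1) ^ 2 / s := by
  have h := s_ne_zero
  change s + 1 / s - 2 = _
  field_simp
  ring

theorem E_a₁_ne_zero : E.a₁ ≠ 0 := by
  rw [E_a₁]
  exact div_ne_zero (pow_ne_zero 2 s_sub_one_ne_zero) s_ne_zero

theorem nonsingular_torsionPoint : E.toAffine.Nonsingular s (s - 1) := by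
  have h := s_ne_zero
  rw [WeierstrassCurve.Affine.nonsingular_iff]
  refine ⟨?_, Or.inr ?_⟩
  · rw [WeierstrassCurve.Affine.equation_iff]
    change _ + E.a₁ * _ * _ + 0 * _ = _ + (-2) * _ + 1 * _ + 0
    rw [E_a₁]
    field_simp
    ring
  · change s - 1 ≠ -(s - 1) - E.a₁ * s - 0
    rw [E_a₁]
    field_simp
    intro h1
    have h2 : (s - 1) * (s + 1) = 0 := by linear_combination h1
    exact mul_ne_zero s_sub_one_ne_zero s_add_one_ne_zero h2

theorem nonsingular_one_zero : E.toAffine.Nonsingular 1 0 := by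
  rw [WeierstrassCurve.Affine.nonsingular_iff]
  refine ⟨?_, Or.inr ?_⟩
  · rw [WeierstrassCurve.Affine.equation_iff]
    change _ + E.a₁ * _ * _ + 0 * _ = _ + (-2) * _ + 1 * _ + 0
    ring
  · change 0 ≠ -0 - E.a₁ * 1 - 0
    simpa using E_a₁_ne_zero

theorem nonsingular_zero_zero : E.toAffine.Nonsingular 0 0 := by
  rw [WeierstrassCurve.Affine.nonsingular_iff]
  refine ⟨?_, Or.inl ?_⟩
  · rw [WeierstrassCurve.Affine.equation_iff]
    change _ + E.a₁ * _ * _ + 0 * _ = _ + (-2) * _ + 1 * _ + 0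
    ring
  · change E.a₁ * 0 ≠ 3 * 0 ^ 2 + 2 * (-2) * 0 + 1
    simp

variable [DecidableEq (RatFunc ℂ)]

/-- Doubling `A = (s, s - 1)` gives `(1, 0)`. -/
theorem two_nsmul_torsionPoint : 2 • WeierstrassCurve.Affine.Point.some _ _ nonsingular_torsionPoint =
    WeierstrassCurve.Affine.Point.some _ _ nonsingular_one_zero := by
  have h := s_ne_zero
  have h1 := s_sub_one_ne_zero
  have h2 := s_add_one_ne_zero
  have hne : s - 1 ≠ E.toAffine.negY s (s - 1) := by
    change s - 1 ≠ -(s - 1) - E.a₁ * s - 0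
    rw [E_a₁]
    field_simp
    intro h3
    have h4 : (s - 1) * (s + 1) = 0 := by linear_combination h3
    exact mul_ne_zero h1 h2 h4
  have hsl : E.toAffine.slope s s (s - 1) (s - 1) = (2 * s - 1) / s := by
    rw [WeierstrassCurve.Affine.slope_of_Y_ne rfl hne, div_eq_div_iff (sub_ne_zero.mpr hne) h]
    change (3 * s ^ 2 + 2 * (-2) * s + 1 - E.a₁ * (s - 1)) * s =
      (2 * s - 1) * (s - 1 - (-(s - 1) - E.a₁ * s - 0))
    rw [E_a₁]
    field_simp
    ring
  rw [two_nsmul, WeierstrassCurve.Affine.Point.add_self_of_Y_ne hne,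
    WeierstrassCurve.Affine.Point.some.injEq]
  have hx : E.toAffine.addX s s ((2 * s - 1) / s) = 1 := by
    change _ ^ 2 + E.a₁ * _ - (-2) - s - s = 1
    rw [E_a₁]
    field_simp
    ring
  rw [hsl, hx]
  refine ⟨rfl, ?_⟩
  rw [WeierstrassCurve.Affine.addY, WeierstrassCurve.Affine.negAddY, hx]
  change -(_ * (1 - s) + (s - 1)) - E.a₁ * 1 - 0 = 0
  rw [E_a₁]
  field_simp
  ring

/-- Doubling `(1, 0)` gives the point `(0, 0)` of order two. -/
theorem two_nsmul_one_zero : 2 • WeierstrassCurve.Affine.Point.some _ _ nonsingular_one_zero =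
    WeierstrassCurve.Affine.Point.some _ _ nonsingular_zero_zero := by
  have hne : (0 : RatFunc ℂ) ≠ E.toAffine.negY 1 0 := by
    change 0 ≠ -0 - E.a₁ * 1 - 0
    simpa using E_a₁_ne_zero
  have hsl : E.toAffine.slope 1 1 0 0 = 0 := by
    rw [WeierstrassCurve.Affine.slope_of_Y_ne rfl hne, div_eq_zero_iff]
    left
    change 3 * 1 ^ 2 + 2 * (-2) * 1 + 1 - E.a₁ * 0 = 0
    ring
  rw [two_nsmul, WeierstrassCurve.Affine.Point.add_self_of_Y_ne hne,
    WeierstrassCurve.Affine.Point.some.injEq]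
  have hx : E.toAffine.addX 1 1 0 = 0 := by
    change _ ^ 2 + E.a₁ * _ - (-2) - 1 - 1 = (0 : RatFunc ℂ)
    ring
  rw [hsl, hx]
  refine ⟨rfl, ?_⟩
  rw [WeierstrassCurve.Affine.addY, WeierstrassCurve.Affine.negAddY, hx]
  change -(_ * (0 - 1) + 0) - E.a₁ * 0 - 0 = 0
  ring

theorem two_nsmul_zero_zero :
    2 • WeierstrassCurve.Affine.Point.some _ _ nonsingular_zero_zero = 0 := by
  rw [two_nsmul, WeierstrassCurve.Affine.Point.add_self_of_Y_eq]
  change 0 = -0 - E.a₁ * 0 - 0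
  ring

theorem addOrderOf_torsionPoint :
    addOrderOf (WeierstrassCurve.Affine.Point.some _ _ nonsingular_torsionPoint) = 8 := by
  have h4 : 2 ^ 2 • WeierstrassCurve.Affine.Point.some _ _ nonsingular_torsionPoint =
      WeierstrassCurve.Affine.Point.some _ _ nonsingular_zero_zero := by
    rw [pow_two, mul_nsmul, two_nsmul_torsionPoint, two_nsmul_one_zero]
  refine addOrderOf_eq_prime_pow (p := 2) (n := 2) ?_ ?_
  · rw [h4]
    exact WeierstrassCurve.Affine.Point.some_ne_zero _
  · rw [pow_succ, mul_nsmul, h4, two_nsmul_zero_zero]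

/-- There are at most eight points, and one of them has order eight. -/
theorem nonempty_addEquiv_zmod : Nonempty (E.toAffine.Point ≃+ ZMod 8) := by
  obtain ⟨k, hk⟩ := exists_injective_zmod
  have hfin : Finite E.toAffine.Point := Finite.of_injective k hk
  have hle : Nat.card E.toAffine.Point ≤ 8 := by
    have := Nat.card_le_card_of_injective k hk
    rwa [Nat.card_zmod] at this
  have hcard : addOrderOf (WeierstrassCurve.Affine.Point.some _ _ nonsingular_torsionPoint) =
      Nat.card E.toAffine.Point := by
    refine le_antisymm (Nat.le_of_dvd Nat.card_pos (addOrderOf_dvd_natCard _)) ?_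
    rwa [addOrderOf_torsionPoint]
  have e := zmodAddCyclicAddEquiv (isAddCyclic_of_addOrderOf_eq_card _ hcard)
  rw [← hcard, addOrderOf_torsionPoint] at e
  exact ⟨e.symm⟩

end ModularFibration

namespace ModularFibration

open Complex Filter

/-! ### Singular fibres -/

open IsDedekindDomain.HeightOneSpectrum in
/-- The valuation that the reduction theory of Weierstrass curves attaches to the local ring of
`ℙ¹` at a point. -/
noncomputable abbrev localValuation (p : OnePoint ℂ) : Valuation (RatFunc ℂ) ℤᵐ⁰ :=
  valuation (RatFunc ℂ) (IsDiscreteValuationRing.maximalIdeal (placeRing p))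

/-- The two valuations have the same valuation ring. -/
theorem localValuation_isEquiv (p : OnePoint ℂ) : (localValuation p).IsEquiv (placeValuation p) := by
  refine Valuation.isEquiv_iff_val_le_one.mpr fun {x} => ⟨fun h => ?_, fun h => ?_⟩
  · by_contra! hlt
    have hx0 : x ≠ 0 := by
      rintro rfl
      rw [map_zero] at hlt
      exact absurd hlt (by simp)
    have hinv : placeValuation p x⁻¹ < 1 := by
      rw [map_inv₀]
      exact inv_lt_one_of_one_lt₀ hlt
    have hmem : (⟨x⁻¹, hinv.le⟩ : placeRing p) ∈ IsLocalRing.maximalIdeal (placeRing p) := by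
      rw [IsLocalRing.mem_maximalIdeal, mem_nonunits_iff]
      intro hu
      have hu' := (Valuation.Integers.isUnit_iff_valuation_eq_one
        (Valuation.valuationSubring.integers (placeValuation p))).mp hu
      exact hinv.ne hu'
    have h1 := (IsDedekindDomain.HeightOneSpectrum.valuation_lt_one_iff_mem (K := RatFunc ℂ)
      (IsDiscreteValuationRing.maximalIdeal (placeRing p)) ⟨x⁻¹, hinv.le⟩).mpr hmem
    change localValuation p x⁻¹ < 1 at h1
    rw [map_inv₀] at h1
    exact absurd h1 (not_lt.mpr (one_le_inv₀ (zero_lt_iff.mpr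
      ((Valuation.ne_zero_iff _).mpr hx0)) |>.mpr h))
  · exact IsDedekindDomain.HeightOneSpectrum.valuation_le_one (K := RatFunc ℂ)
      (IsDiscreteValuationRing.maximalIdeal (placeRing p)) ⟨x, h⟩

theorem isIntegral_of_placeValuation_le_one {p : OnePoint ℂ} {W : WeierstrassCurve (RatFunc ℂ)}
    (h₁ : placeValuation p W.a₁ ≤ 1) (h₂ : placeValuation p W.a₂ ≤ 1)
    (h₃ : placeValuation p W.a₃ ≤ 1) (h₄ : placeValuation p W.a₄ ≤ 1)
    (h₆ : placeValuation p W.a₆ ≤ 1) : W.IsIntegral (placeRing p) :=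
  WeierstrassCurve.isIntegral_of_exists_lift _ ⟨⟨_, h₁⟩, rfl⟩ ⟨⟨_, h₂⟩, rfl⟩ ⟨⟨_, h₃⟩, rfl⟩
    ⟨⟨_, h₄⟩, rfl⟩ ⟨⟨_, h₆⟩, rfl⟩

/-- Minimality in terms of the valuations of the discriminants of all integral equations of the curve. -/
theorem isMinimal_of_forall_le {p : OnePoint ℂ} {W : WeierstrassCurve (RatFunc ℂ)}
    (hW : W.IsIntegral (placeRing p))
    (h : ∀ C : WeierstrassCurve.VariableChange (RatFunc ℂ), (C • W).IsIntegral (placeRing p) →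
      localValuation p (C • W).Δ ≤ localValuation p W.Δ) : W.IsMinimal (placeRing p) := by
  refine ⟨⟨by simpa using hW, fun C hC _ => ?_⟩⟩
  have hC' : (C • W).IsIntegral (placeRing p) := hC
  change WeierstrassCurve.valuation_Δ_aux (placeRing p) (C • W) ≤
    WeierstrassCurve.valuation_Δ_aux (placeRing p) ((1 : WeierstrassCurve.VariableChange _) • W)
  rw [one_smul, ← Subtype.coe_le_coe, WeierstrassCurve.valuation_Δ_aux_eq_of_isIntegral,
    WeierstrassCurve.valuation_Δ_aux_eq_of_isIntegral]
  exact h C hC'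

theorem hasGoodReduction_of_valuation_eq_one {p : OnePoint ℂ} {W : WeierstrassCurve (RatFunc ℂ)}
    (hW : W.IsIntegral (placeRing p)) (h : placeValuation p W.Δ = 1) :
    W.HasGoodReduction (placeRing p) := by
  have h1 : localValuation p W.Δ = 1 :=
    (Valuation.isEquiv_iff_val_eq_one.mp (localValuation_isEquiv p)).mpr h
  refine { toIsMinimal := isMinimal_of_forall_le hW fun C hC => ?_, goodReduction := h1 }
  obtain ⟨r, hr⟩ := WeierstrassCurve.Δ_integral_of_isIntegral (placeRing p) (C • W)
  rw [h1, ← hr]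
  exact IsDedekindDomain.HeightOneSpectrum.valuation_le_one _ r

/-- An integral equation with `c₄` a unit and `Δ` not a unit is minimal, and the reduction is
multiplicative. -/
theorem hasMultiplicativeReduction_of_valuation_eq_one {p : OnePoint ℂ}
    {W : WeierstrassCurve (RatFunc ℂ)} (hW : W.IsIntegral (placeRing p))
    (h : placeValuation p W.Δ < 1) (h' : placeValuation p W.c₄ = 1) :
    W.HasMultiplicativeReduction (placeRing p) := by
  have h1 : localValuation p W.Δ < 1 :=
    (Valuation.isEquiv_iff_val_lt_one.mp (localValuation_isEquiv p)).mpr h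
  have h2 : localValuation p W.c₄ = 1 :=
    (Valuation.isEquiv_iff_val_eq_one.mp (localValuation_isEquiv p)).mpr h'
  refine { toIsMinimal := isMinimal_of_forall_le hW fun C hC => ?_, badReduction := h1,
           multiplicativeReduction := h2 }
  -- a change of variables with integral result has integral `1 / u`, as `c₄` is a unit
  have h3 : localValuation p (C • W).c₄ ≤ 1 := by
    rw [← WeierstrassCurve.integralModel_c₄_eq (placeRing p) (C • W)]
    exact IsDedekindDomain.HeightOneSpectrum.valuation_le_one _ _
  rw [WeierstrassCurve.variableChange_c₄, map_mul, map_pow, h2, mul_one] at h3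
  rw [WeierstrassCurve.variableChange_Δ, map_mul, map_pow]
  have h4 : localValuation p ↑C.u⁻¹ ≤ 1 := by
    by_contra! hlt
    exact absurd h3 (not_le.mpr (one_lt_pow₀ hlt (by norm_num)))
  calc _ ≤ 1 * localValuation p W.Δ := by
        gcongr
        exact pow_le_one₀ zero_le h4
    _ = _ := one_mul _

theorem placeValuation_algebraMap_le_one (a : ℂ) (q : Polynomial ℂ) :
    placeValuation (a : OnePoint ℂ) (algebraMap _ _ q) ≤ 1 :=
  IsDedekindDomain.HeightOneSpectrum.valuation_le_one _ q

theorem placeValuation_algebraMap_eq_one {a : ℂ} {q : Polynomial ℂ} (h : q.eval a ≠ 0) :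
    placeValuation (a : OnePoint ℂ) (algebraMap _ _ q) = 1 := by
  refine (IsDedekindDomain.HeightOneSpectrum.valuation_eq_one_iff_notMem _).mpr fun hq => h ?_
  rw [Ideal.mem_span_singleton] at hq
  exact Polynomial.dvd_iff_isRoot.mp hq

theorem placeValuation_s_sub_C_self (a : ℂ) :
    placeValuation (a : OnePoint ℂ) (s - RatFunc.C a) = WithZero.exp (-1) := by
  have h : s - RatFunc.C a = algebraMap (Polynomial ℂ) (RatFunc ℂ)
    (Polynomial.X - Polynomial.C a) := by simp [s]
  rw [h]
  refine (IsDedekindDomain.HeightOneSpectrum.valuation_of_algebraMap _ _).trans ?_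
  exact IsDedekindDomain.HeightOneSpectrum.intValuation_singleton _
    (Polynomial.X_sub_C_ne_zero a) rfl

theorem placeValuation_s_sub_C {a b : ℂ} (hab : a ≠ b) :
    placeValuation (a : OnePoint ℂ) (s - RatFunc.C b) = 1 := by
  have h : s - RatFunc.C b = algebraMap (Polynomial ℂ) (RatFunc ℂ)
    (Polynomial.X - Polynomial.C b) := by simp [s]
  rw [h]
  exact placeValuation_algebraMap_eq_one (by simpa using sub_ne_zero.mpr hab)

theorem placeValuation_infty_algebraMap {q : Polynomial ℂ} (hq : q ≠ 0) :
    placeValuation OnePoint.infty (algebraMap _ _ q) = WithZero.exp (q.natDegree : ℤ) := by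
  classical
  exact RatFunc.inftyValuation.polynomial ℂ hq

theorem placeValuation_infty_s_sub_C (b : ℂ) :
    placeValuation OnePoint.infty (s - RatFunc.C b) = WithZero.exp 1 := by
  have h : s - RatFunc.C b = algebraMap (Polynomial ℂ) (RatFunc ℂ)
    (Polynomial.X - Polynomial.C b) := by simp [s]
  rw [h, placeValuation_infty_algebraMap (Polynomial.X_sub_C_ne_zero b),
    Polynomial.natDegree_X_sub_C, Nat.cast_one]

theorem placeValuation_C (p : OnePoint ℂ) {c : ℂ} (hc : c ≠ 0) :
    placeValuation p (RatFunc.C c) = 1 := by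
  rw [← RatFunc.algebraMap_C]
  induction p using OnePoint.rec with
  | infty => rw [placeValuation_infty_algebraMap (by simpa), Polynomial.natDegree_C]; rfl
  | coe a => exact placeValuation_algebraMap_eq_one (by simpa)

theorem E_Δ_eq : E.Δ = E.a₁ ^ 2 * (E.a₁ ^ 2 - 16) := by
  simp only [WeierstrassCurve.Δ, WeierstrassCurve.b₂, WeierstrassCurve.b₄, WeierstrassCurve.b₆,
    WeierstrassCurve.b₈]
  rw [show E.a₂ = -2 from rfl, show E.a₃ = 0 from rfl, show E.a₄ = 1 from rfl,
    show E.a₆ = 0 from rfl]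
  ring

theorem E_c₄_eq : E.c₄ = E.Δ + 16 := by
  rw [E_Δ_eq]
  simp only [WeierstrassCurve.c₄, WeierstrassCurve.b₂, WeierstrassCurve.b₄]
  rw [show E.a₂ = -2 from rfl, show E.a₃ = 0 from rfl, show E.a₄ = 1 from rfl]
  ring

theorem E_Δ_mul {α β : ℂ} (hadd : α + β = 6) (hmul : α * β = 1) :
    E.Δ * (s - RatFunc.C 0) ^ 4 = (s - RatFunc.C 1) ^ 4 * (s - RatFunc.C (-1)) ^ 2 *
      ((s - RatFunc.C α) * (s - RatFunc.C β)) := by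
  have h := s_ne_zero
  have h1 : RatFunc.C α + RatFunc.C β = 6 := by
    rw [← map_add, hadd, map_ofNat]
  have h2 : RatFunc.C α * RatFunc.C β = 1 := by rw [← map_mul, hmul, map_one]
  have h3 : (s - RatFunc.C α) * (s - RatFunc.C β) = s ^ 2 - 6 * s + 1 := by
    linear_combination -s * h1 + h2
  rw [h3, E_Δ_eq, E_a₁, map_zero, map_neg, map_one]
  field_simp
  ring

theorem placeValuation_neg_two (p : OnePoint ℂ) : placeValuation p (-2) = 1 := by
  rw [neg_two_eq_C]
  exact placeValuation_C p (by norm_num)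

theorem placeValuation_sixteen (p : OnePoint ℂ) : placeValuation p 16 = 1 := by
  rw [show (16 : RatFunc ℂ) = (-2) ^ 4 by norm_num, map_pow, placeValuation_neg_two, one_pow]

theorem placeValuation_s {a : ℂ} (ha : a ≠ 0) : placeValuation (a : OnePoint ℂ) s = 1 := by
  have := placeValuation_s_sub_C ha
  rwa [map_zero, sub_zero] at this

theorem isIntegral_E {a : ℂ} (ha : a ≠ 0) : E.IsIntegral (placeRing (a : OnePoint ℂ)) := by
  refine isIntegral_of_placeValuation_le_one ?_ (placeValuation_neg_two _).le ?_ (map_one _).le ?_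
  · rw [E_a₁, map_div₀, placeValuation_s ha, div_one, map_pow]
    refine pow_le_one₀ zero_le ?_
    have h : s - 1 = algebraMap (Polynomial ℂ) (RatFunc ℂ) (Polynomial.X - 1) := by simp [s]
    rw [h]
    exact placeValuation_algebraMap_le_one _ _
  · exact (map_zero _).trans_le zero_le
  · exact (map_zero _).trans_le zero_le

theorem placeValuation_Δ {α β a : ℂ} (hadd : α + β = 6) (hmul : α * β = 1) (ha : a ≠ 0) :
    placeValuation (a : OnePoint ℂ) E.Δ = placeValuation a (s - RatFunc.C 1) ^ 4 *
      placeValuation a (s - RatFunc.C (-1)) ^ 2 * (placeValuation a (s - RatFunc.C α) *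
        placeValuation a (s - RatFunc.C β)) := by
  have h := congrArg (placeValuation (a : OnePoint ℂ)) (E_Δ_mul hadd hmul)
  simpa only [map_mul, map_pow, placeValuation_s_sub_C ha, one_pow, mul_one] using h

theorem hasFibreTypeI_succ {a : ℂ} (ha : a ≠ 0) {n : ℕ}
    (h : placeValuation (a : OnePoint ℂ) E.Δ = WithZero.exp (-((n : ℤ) + 1))) :
    HasFibreTypeI E a (n + 1) := by
  have hlt : placeValuation (a : OnePoint ℂ) E.Δ < 1 := by
    rw [h, ← WithZero.exp_zero, WithZero.exp_lt_exp]
    omega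
  refine ⟨1, ?_, by rwa [one_smul]⟩
  rw [one_smul]
  refine hasMultiplicativeReduction_of_valuation_eq_one (isIntegral_E ha) hlt ?_
  have h16 := placeValuation_sixteen (a : OnePoint ℂ)
  rw [E_c₄_eq, Valuation.map_add_eq_of_lt_right _ (by rwa [h16]), h16]

theorem hasFibreTypeI_zero {a : ℂ} (ha : a ≠ 0)
    (h : placeValuation (a : OnePoint ℂ) E.Δ = 1) : HasFibreTypeI E a 0 :=
  ⟨1, by rw [one_smul]; exact hasGoodReduction_of_valuation_eq_one (isIntegral_E ha) h⟩

theorem placeValuation_Δ_of_pole {p : OnePoint ℂ} (h : placeValuation p E.a₁ = WithZero.exp 1) :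
    placeValuation p E.Δ = WithZero.exp 4 := by
  have h2 : placeValuation p (E.a₁ ^ 2) = WithZero.exp 2 := by
    rw [map_pow, h, ← WithZero.exp_nsmul]
    rfl
  have h3 : placeValuation p (E.a₁ ^ 2 - 16) = WithZero.exp 2 := by
    rw [Valuation.map_sub_eq_of_lt_left, h2]
    rw [h2, placeValuation_sixteen, ← WithZero.exp_zero, WithZero.exp_lt_exp]
    norm_num
  rw [E_Δ_eq, map_mul, h2, h3, ← WithZero.exp_add]
  rfl

/-- Where `a₁` has a simple pole, scaling by a uniformiser gives a minimal equation. -/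
theorem hasFibreTypeI_eight {p : OnePoint ℂ} {ϖ : RatFunc ℂ}
    (hϖ : placeValuation p ϖ = WithZero.exp (-1))
    (h : placeValuation p E.a₁ = WithZero.exp 1) : HasFibreTypeI E p 8 := by
  have hϖ0 : ϖ ≠ 0 := by
    rintro rfl
    rw [map_zero] at hϖ
    exact WithZero.exp_ne_zero hϖ.symm
  have hle : placeValuation p ϖ ≤ 1 := by
    rw [hϖ, ← WithZero.exp_zero, WithZero.exp_le_exp]
    norm_num
  set C : WeierstrassCurve.VariableChange (RatFunc ℂ) := ⟨(Units.mk0 ϖ hϖ0)⁻¹, 0, 0, 0⟩ with hC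
  have hu : ((C.u⁻¹ : (RatFunc ℂ)ˣ) : RatFunc ℂ) = ϖ := by simp [hC]
  have hΔ : placeValuation p (C • E).Δ = WithZero.exp (-8) := by
    rw [WeierstrassCurve.variableChange_Δ, hu, map_mul, map_pow, hϖ, placeValuation_Δ_of_pole h,
      ← WithZero.exp_nsmul, ← WithZero.exp_add]
    rfl
  refine ⟨C, hasMultiplicativeReduction_of_valuation_eq_one ?_ ?_ ?_, hΔ⟩
  · refine isIntegral_of_placeValuation_le_one ?_ ?_ ?_ ?_ ?_
    · rw [WeierstrassCurve.variableChange_a₁, hu]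
      simp only [hC, mul_zero, add_zero, map_mul, h, hϖ, ← WithZero.exp_add]
      rfl
    · rw [WeierstrassCurve.variableChange_a₂, hu]
      simp only [hC, zero_mul, mul_zero, sub_zero, add_zero, zero_pow two_ne_zero, map_mul, map_pow]
      rw [show E.a₂ = -2 from rfl, placeValuation_neg_two, mul_one]
      exact pow_le_one₀ zero_le hle
    · rw [WeierstrassCurve.variableChange_a₃, hu, show E.a₃ = 0 from rfl]
      simp [hC]
    · rw [WeierstrassCurve.variableChange_a₄, hu, show E.a₃ = 0 from rfl, show E.a₄ = 1 from rfl]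
      simp only [hC, zero_mul, mul_zero, sub_zero, add_zero, zero_pow two_ne_zero, map_pow,
        mul_one]
      exact pow_le_one₀ zero_le hle
    · rw [WeierstrassCurve.variableChange_a₆, hu, show E.a₃ = 0 from rfl, show E.a₆ = 0 from rfl]
      simp [hC]
  · rw [hΔ, ← WithZero.exp_zero, WithZero.exp_lt_exp]
    norm_num
  · rw [WeierstrassCurve.variableChange_c₄, hu, map_mul, map_pow, hϖ, E_c₄_eq,
      Valuation.map_add_eq_of_lt_left, placeValuation_Δ_of_pole h, ← WithZero.exp_nsmul,
      ← WithZero.exp_add]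
    · rfl
    · rw [placeValuation_Δ_of_pole h, placeValuation_sixteen, ← WithZero.exp_zero,
        WithZero.exp_lt_exp]
      norm_num

theorem placeValuation_zero_a₁ :
    placeValuation ((0 : ℂ) : OnePoint ℂ) E.a₁ = WithZero.exp 1 := by
  have h := placeValuation_s_sub_C_self 0
  have h1 := placeValuation_s_sub_C (zero_ne_one (α := ℂ))
  rw [map_zero, sub_zero] at h
  rw [map_one] at h1
  rw [E_a₁, map_div₀, map_pow, h, h1, one_pow, ← WithZero.exp_zero, ← WithZero.exp_sub]
  rfl

theorem placeValuation_infty_a₁ : placeValuation OnePoint.infty E.a₁ = WithZero.exp 1 := by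
  have h := placeValuation_infty_s_sub_C 0
  have h1 := placeValuation_infty_s_sub_C 1
  rw [map_zero, sub_zero] at h
  rw [map_one] at h1
  rw [E_a₁, map_div₀, map_pow, h, h1, ← WithZero.exp_nsmul, ← WithZero.exp_sub]
  rfl

theorem hasFibreTypeI_E_zero : HasFibreTypeI E ((0 : ℂ) : OnePoint ℂ) 8 := by
  have h := placeValuation_s_sub_C_self 0
  exact hasFibreTypeI_eight h placeValuation_zero_a₁

theorem hasFibreTypeI_E_infty : HasFibreTypeI E OnePoint.infty 8 := by
  refine hasFibreTypeI_eight (ϖ := (s - RatFunc.C 0)⁻¹) ?_ placeValuation_infty_a₁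
  rw [map_inv₀, placeValuation_infty_s_sub_C, ← WithZero.exp_neg]

theorem ne_of_add_of_mul {α β : ℂ} (hadd : α + β = 6) (hmul : α * β = 1) :
    α ≠ 0 ∧ α ≠ 1 ∧ α ≠ -1 ∧ α ≠ β := by
  refine ⟨?_, ?_, ?_, ?_⟩
  · rintro rfl
    simp at hmul
  · rintro rfl
    rw [one_mul] at hmul
    subst hmul
    norm_num at hadd
  · rintro rfl
    have : β = -1 := by linear_combination -hmul
    subst this
    norm_num at hadd
  · rintro rfl
    have h3 : α = 3 := by linear_combination hadd / 2
    subst h3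
    norm_num at hmul

theorem sqrt_two_add : (3 + 2 * (Real.sqrt 2 : ℂ)) + (3 - 2 * (Real.sqrt 2 : ℂ)) = 6 := by ring

theorem sqrt_two_mul : (3 + 2 * (Real.sqrt 2 : ℂ)) * (3 - 2 * (Real.sqrt 2 : ℂ)) = 1 := by
  have h : (Real.sqrt 2 : ℂ) ^ 2 = 2 := by
    rw [← Complex.ofReal_pow, Real.sq_sqrt (by norm_num)]
    norm_num
  linear_combination -4 * h

theorem placeValuation_Δ_one :
    placeValuation ((1 : ℂ) : OnePoint ℂ) E.Δ = WithZero.exp (-4) := by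
  have h := ne_of_add_of_mul sqrt_two_add sqrt_two_mul
  have h' := ne_of_add_of_mul (add_comm _ _ |>.trans sqrt_two_add)
    (mul_comm _ _ |>.trans sqrt_two_mul)
  rw [placeValuation_Δ sqrt_two_add sqrt_two_mul one_ne_zero, placeValuation_s_sub_C_self,
    placeValuation_s_sub_C (by norm_num), placeValuation_s_sub_C h.2.1.symm,
    placeValuation_s_sub_C h'.2.1.symm, one_pow, mul_one, mul_one, mul_one,
    ← WithZero.exp_nsmul]
  rfl

theorem placeValuation_Δ_neg_one :
    placeValuation ((-1 : ℂ) : OnePoint ℂ) E.Δ = WithZero.exp (-2) := by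
  have h := ne_of_add_of_mul sqrt_two_add sqrt_two_mul
  have h' := ne_of_add_of_mul (add_comm _ _ |>.trans sqrt_two_add)
    (mul_comm _ _ |>.trans sqrt_two_mul)
  rw [placeValuation_Δ sqrt_two_add sqrt_two_mul (by norm_num), placeValuation_s_sub_C_self,
    placeValuation_s_sub_C (by norm_num), placeValuation_s_sub_C h.2.2.1.symm,
    placeValuation_s_sub_C h'.2.2.1.symm, one_pow, mul_one, mul_one, one_mul,
    ← WithZero.exp_nsmul]
  rfl

theorem placeValuation_Δ_root {α β : ℂ} (hadd : α + β = 6) (hmul : α * β = 1) :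
    placeValuation (α : OnePoint ℂ) E.Δ = WithZero.exp (-1) := by
  have h := ne_of_add_of_mul hadd hmul
  rw [placeValuation_Δ hadd hmul h.1, placeValuation_s_sub_C_self, placeValuation_s_sub_C h.2.1,
    placeValuation_s_sub_C h.2.2.1, placeValuation_s_sub_C h.2.2.2, one_pow, one_pow, mul_one,
    mul_one, one_mul]

theorem hasFibreTypeI_E_one : HasFibreTypeI E ((1 : ℂ) : OnePoint ℂ) 4 :=
  hasFibreTypeI_succ one_ne_zero placeValuation_Δ_one

theorem hasFibreTypeI_E_neg_one : HasFibreTypeI E ((-1 : ℂ) : OnePoint ℂ) 2 :=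
  hasFibreTypeI_succ (by norm_num) placeValuation_Δ_neg_one

theorem hasFibreTypeI_E_root {α β : ℂ} (hadd : α + β = 6) (hmul : α * β = 1) :
    HasFibreTypeI E (α : OnePoint ℂ) 1 :=
  hasFibreTypeI_succ (ne_of_add_of_mul hadd hmul).1 (placeValuation_Δ_root hadd hmul)

theorem hasFibreTypeI_E_smooth {a : ℂ} (ha : a ∈ smoothLocus E) :
    HasFibreTypeI E (a : OnePoint ℂ) 0 := by
  obtain ⟨h0, h1, h2, h3, h4⟩ := mem_smoothLocus_E_iff_ne.mp ha
  refine hasFibreTypeI_zero h0 ?_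
  rw [placeValuation_Δ sqrt_two_add sqrt_two_mul h0, placeValuation_s_sub_C h1,
    placeValuation_s_sub_C h2, placeValuation_s_sub_C h3, placeValuation_s_sub_C h4]
  simp

/-- The order of the discriminant at a point of good reduction is a multiple of twelve. -/
theorem HasFibreTypeI.exists_placeValuation_Δ {p : OnePoint ℂ} (h : HasFibreTypeI E p 0) :
    ∃ k : ℤ, placeValuation p E.Δ = WithZero.exp (12 * k) := by
  obtain ⟨C, hC⟩ := h
  have h1 : placeValuation p (C • E).Δ = 1 :=
    (Valuation.isEquiv_iff_val_eq_one.mp (localValuation_isEquiv p)).mp hC.goodReduction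
  rw [WeierstrassCurve.variableChange_Δ, map_mul, map_pow] at h1
  have h2 : placeValuation p ((C.u⁻¹ : (RatFunc ℂ)ˣ) : RatFunc ℂ) ≠ 0 :=
    (Valuation.ne_zero_iff _).mpr (Units.ne_zero _)
  refine ⟨-WithZero.log (placeValuation p ((C.u⁻¹ : (RatFunc ℂ)ˣ) : RatFunc ℂ)), ?_⟩
  rw [← WithZero.exp_log h2, ← WithZero.exp_nsmul] at h1
  rw [eq_inv_of_mul_eq_one_right h1, ← WithZero.exp_neg]
  congr 1
  rw [nsmul_eq_mul]
  push_cast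
  ring

/-- The smooth fibres are those over the smooth locus. In particular the fibres over `0` and `∞`, where
the coefficients of `E` have poles, are singular also for the minimal equation. -/
theorem hasFibreTypeI_E_zero_iff (p : OnePoint ℂ) :
    HasFibreTypeI E p 0 ↔ ∃ a ∈ smoothLocus E, p = (a : OnePoint ℂ) := by
  constructor
  swap
  · rintro ⟨a, ha, rfl⟩
    exact hasFibreTypeI_E_smooth ha
  intro h
  obtain ⟨k, hk⟩ := h.exists_placeValuation_Δ
  -- at the singular fibres the order of the discriminant is not a multiple of twelve
  have hne : ∀ j : ℤ, ¬ (12 : ℤ) ∣ j → placeValuation p E.Δ ≠ WithZero.exp j := by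
    intro j hj h1
    rw [hk, WithZero.exp_inj] at h1
    exact hj ⟨k, h1.symm⟩
  induction p using OnePoint.rec with
  | infty =>
    exact absurd (placeValuation_Δ_of_pole placeValuation_infty_a₁) (hne 4 (by decide))
  | coe a =>
    refine ⟨a, mem_smoothLocus_E_iff_ne.mpr ⟨?_, ?_, ?_, ?_, ?_⟩, rfl⟩
    · rintro rfl
      exact hne 4 (by decide) (placeValuation_Δ_of_pole placeValuation_zero_a₁)
    · rintro rfl
      exact hne (-4) (by decide) placeValuation_Δ_one
    · rintro rfl
      exact hne (-2) (by decide) placeValuation_Δ_neg_one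
    · rintro rfl
      exact hne (-1) (by decide) (placeValuation_Δ_root sqrt_two_add sqrt_two_mul)
    · rintro rfl
      exact hne (-1) (by decide) (placeValuation_Δ_root (add_comm _ _ |>.trans sqrt_two_add)
        (mul_comm _ _ |>.trans sqrt_two_mul))

/-! ### The modular surface -/

theorem isEllipticModularSurface_E :
    IsEllipticModularSurface (CongruenceSubgroup.Gamma1 8) E :=
  ⟨hasFibreTypeI_E_zero_iff, fun τ => hauptmodul τ, uniformisation, isHolomorphic_uniformisation,
    range_uniformisation, fun _ _ => rfl, uniformisation_zero, uniformisation_eq_iff⟩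

end ModularFibration

namespace ModularFibration

open Complex Filter

/-! ### The surface is irreducible -/

/-- A primitive quadratic polynomial over a domain is irreducible if its discriminant is not a square. -/
theorem irreducible_quadratic {R : Type*} [CommRing R] [IsDomain R] {a b c : R} (ha : a ≠ 0)
    (hu : ∀ r, r ∣ a → r ∣ b → r ∣ c → IsUnit r) (hsq : ¬ IsSquare (b ^ 2 - 4 * a * c)) :
    Irreducible (Polynomial.C a * Polynomial.X ^ 2 + Polynomial.C b * Polynomial.X +
      Polynomial.C c) := by
  set f := Polynomial.C a * Polynomial.X ^ 2 + Polynomial.C b * Polynomial.X + Polynomial.C c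
  have hdeg : f.natDegree = 2 := Polynomial.natDegree_quadratic ha
  have hf0 : f ≠ 0 := by
    intro h
    rw [h] at hdeg
    simp at hdeg
  have hc2 : f.coeff 2 = a := by simp [f]
  have hc1 : f.coeff 1 = b := by simp [f]
  have hc0 : f.coeff 0 = c := by simp [f]
  have hconst : ∀ r : R, Polynomial.C r ∣ f → IsUnit (Polynomial.C r) := by
    intro r hr
    rw [Polynomial.C_dvd_iff_dvd_coeff] at hr
    exact (hu r (hc2 ▸ hr 2) (hc1 ▸ hr 1) (hc0 ▸ hr 0)).map Polynomial.C
  refine ⟨fun h => ?_, fun p q hpq => ?_⟩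
  · rw [Polynomial.natDegree_eq_zero_of_isUnit h] at hdeg
    exact absurd hdeg (by norm_num)
  have hp0 : p ≠ 0 := by rintro rfl; exact hf0 (by rw [hpq, zero_mul])
  have hq0 : q ≠ 0 := by rintro rfl; exact hf0 (by rw [hpq, mul_zero])
  have hadd : p.natDegree + q.natDegree = 2 := by
    rw [← Polynomial.natDegree_mul hp0 hq0, ← hpq, hdeg]
  rcases Nat.eq_zero_or_pos p.natDegree with hp | hp
  · left
    rw [Polynomial.eq_C_of_natDegree_eq_zero hp]
    refine hconst _ ?_
    rw [← Polynomial.eq_C_of_natDegree_eq_zero hp]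
    exact ⟨q, hpq⟩
  rcases Nat.eq_zero_or_pos q.natDegree with hq | hq
  · right
    rw [Polynomial.eq_C_of_natDegree_eq_zero hq]
    refine hconst _ ?_
    rw [← Polynomial.eq_C_of_natDegree_eq_zero hq]
    exact ⟨p, by rw [hpq, mul_comm]⟩
  refine absurd ?_ hsq
  -- a product of two linear factors has square discriminant
  obtain ⟨p₁, p₀, rfl⟩ := Polynomial.exists_eq_X_add_C_of_natDegree_le_one
    (show p.natDegree ≤ 1 by omega)
  obtain ⟨q₁, q₀, rfl⟩ := Polynomial.exists_eq_X_add_C_of_natDegree_le_one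
    (show q.natDegree ≤ 1 by omega)
  have hpq' : f = Polynomial.C (p₁ * q₁) * Polynomial.X ^ 2 +
      Polynomial.C (p₁ * q₀ + p₀ * q₁) * Polynomial.X + Polynomial.C (p₀ * q₀) := by
    rw [hpq]
    simp only [map_mul, map_add]
    ring
  rw [← hc2, ← hc1, ← hc0, hpq']
  simp only [Polynomial.coeff_add, Polynomial.coeff_C_mul, Polynomial.coeff_X_pow,
    Polynomial.coeff_X, Polynomial.coeff_C]
  norm_num
  exact ⟨p₁ * q₀ - p₀ * q₁, by ring⟩

/-- The linear coefficient of the equation of `Y₂` as a quadratic polynomial in `X`; the variables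
`0`, `1` stand for `Y`, `Z`. -/
noncomputable def yTwoMiddle : MvPolynomial (Fin 2) ℂ :=
  MvPolynomial.X 0 ^ 2 * MvPolynomial.X 1 + MvPolynomial.X 1 +
    MvPolynomial.X 0 * MvPolynomial.X 1 ^ 2 + MvPolynomial.X 0 -
      2 * MvPolynomial.X 0 * MvPolynomial.X 1

theorem finSuccEquiv_yTwoEquation : MvPolynomial.finSuccEquiv ℂ 2 yTwoEquation =
    Polynomial.C (MvPolynomial.X 0 * MvPolynomial.X 1) * Polynomial.X ^ 2 +
      Polynomial.C yTwoMiddle * Polynomial.X +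
        Polynomial.C (MvPolynomial.X 0 * MvPolynomial.X 1) := by
  have h1 : MvPolynomial.finSuccEquiv ℂ 2 (MvPolynomial.X 1) =
    Polynomial.C (MvPolynomial.X 0) := MvPolynomial.finSuccEquiv_X_succ (j := 0)
  have h2 : MvPolynomial.finSuccEquiv ℂ 2 (MvPolynomial.X 2) =
    Polynomial.C (MvPolynomial.X 1) := MvPolynomial.finSuccEquiv_X_succ (j := 1)
  simp only [yTwoEquation, yTwoMiddle, map_add, map_sub, map_mul, map_pow,
    MvPolynomial.finSuccEquiv_X_zero, h1, h2, map_ofNat]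
  ring

theorem isUnit_of_dvd_X_mul_X {b r : MvPolynomial (Fin 2) ℂ}
    (h0 : ¬ MvPolynomial.X 0 ∣ b) (h1 : ¬ MvPolynomial.X 1 ∣ b)
    (hr : r ∣ MvPolynomial.X 0 * MvPolynomial.X 1) (hrb : r ∣ b) : IsUnit r := by
  have hp : ∀ i : Fin 2, Irreducible (MvPolynomial.X i : MvPolynomial (Fin 2) ℂ) := fun i =>
    MvPolynomial.X_prime.irreducible
  have hrel := IsRelPrime.mul_left ((hp 0).isRelPrime_iff_not_dvd.mpr h0)
    ((hp 1).isRelPrime_iff_not_dvd.mpr h1)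
  exact hrel hr hrb

theorem not_isSquare_disc : ¬ IsSquare (yTwoMiddle ^ 2 -
    4 * (MvPolynomial.X 0 * MvPolynomial.X 1) * (MvPolynomial.X 0 * MvPolynomial.X 1)) := by
  rintro ⟨g, hg⟩
  -- on the line `Z = 2` the discriminant has a simple zero at `Y = -2`
  set e : MvPolynomial (Fin 2) ℂ →ₐ[ℂ] Polynomial ℂ :=
    MvPolynomial.aeval ![Polynomial.X, Polynomial.C 2]
  have h := congrArg e hg
  rw [map_mul e g g] at h
  generalize e g = G at h
  simp only [yTwoMiddle, map_add, map_sub, map_mul, map_pow, map_ofNat, e,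
    MvPolynomial.aeval_X, Matrix.cons_val_zero, Matrix.cons_val_one] at h
  have h' : (2 * Polynomial.X ^ 2 + Polynomial.X + 2) ^ 2 - 16 * Polynomial.X ^ 2 = G * G := by
    rw [← h]
    ring
  have h1 := congrArg (Polynomial.eval (-2)) h'
  have h2 := congrArg (fun q => Polynomial.eval (-2) (Polynomial.derivative q)) h'
  simp only [Polynomial.derivative_sub, Polynomial.derivative_mul, Polynomial.derivative_pow,
    Polynomial.derivative_add, Polynomial.derivative_X, Polynomial.derivative_ofNat,
    Polynomial.eval_add, Polynomial.eval_sub, Polynomial.eval_mul, Polynomial.eval_pow,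
    Polynomial.eval_X, Polynomial.eval_ofNat, Polynomial.eval_C, Polynomial.eval_one,
    Polynomial.eval_zero] at h1 h2
  norm_num at h1 h2
  rw [h1] at h2
  norm_num at h2

theorem irreducible_yTwoEquation : Irreducible yTwoEquation := by
  rw [← MulEquiv.irreducible_iff (MvPolynomial.finSuccEquiv ℂ 2), finSuccEquiv_yTwoEquation]
  refine irreducible_quadratic (mul_ne_zero (MvPolynomial.X_ne_zero _) (MvPolynomial.X_ne_zero _))
    (fun r h1 h2 _ => isUnit_of_dvd_X_mul_X ?_ ?_ h1 h2) not_isSquare_disc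
  · rintro ⟨g, hg⟩
    have := congrArg (MvPolynomial.eval ![(0 : ℂ), 1]) hg
    simp [yTwoMiddle] at this
  · rintro ⟨g, hg⟩
    have := congrArg (MvPolynomial.eval ![(1 : ℂ), 0]) hg
    simp [yTwoMiddle] at this

instance isDomain_yTwoRing : IsDomain YTwoRing := by
  have hp : Prime yTwoEquation := irreducible_yTwoEquation.prime
  have : (Ideal.span {yTwoEquation}).IsPrime :=
    (Ideal.span_singleton_prime hp.ne_zero).mpr hp
  exact Ideal.Quotient.isDomain _

end ModularFibration

namespace ModularFibration

open Complex Filter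

/-! ### The function field -/

/-- The map `(-XY, Z)` from `Y₂` to the plane is dominant: given the product of `X` and `Y`, the
equation prescribes their sum. -/
theorem exists_point_of_product {u z : ℂ} (hu : u ≠ 0) (hu' : u ≠ 1) (hz : z ≠ 0) :
    ∃ x y : ℂ, -(x * y) = u ∧ MvPolynomial.eval ![x, y, z] yTwoEquation = 0 := by
  have hu1 : u - 1 ≠ 0 := sub_ne_zero.mpr hu'
  -- the equation determines the sum of `x` and `y` from their product
  set t := -((z + 1 / z - 2) * u / (u - 1)) with ht
  obtain ⟨r, hr⟩ := IsAlgClosed.exists_pow_nat_eq (t ^ 2 + 4 * u) (two_pos)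
  refine ⟨(t + r) / 2, (t - r) / 2, by linear_combination hr / 4, ?_⟩
  have hp : (t + r) / 2 * ((t - r) / 2) = -u := by linear_combination -hr / 4
  have hs : (t + r) / 2 + (t - r) / 2 = t := by ring
  generalize (t + r) / 2 = x at *
  generalize (t - r) / 2 = y at *
  have ht' : t * (u - 1) * z = -((z ^ 2 + 1 - 2 * z) * u) := by
    rw [ht]
    field_simp
  simp only [yTwoEquation, map_add, map_sub, map_mul, map_pow, MvPolynomial.eval_X,
    Matrix.cons_val_zero, Matrix.cons_val_one, Matrix.cons_val, map_ofNat]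
  have e : x ^ 2 * y * z + y * z + x * y ^ 2 * z + x * z + x * y * z ^ 2 + x * y -
      2 * x * y * z = (x * y + 1) * (x + y) * z + x * y * (z ^ 2 + 1 - 2 * z) := by ring
  rw [e, hp, hs]
  linear_combination -ht'

/-- The homomorphism from polynomials to rational functions on `Y₂`. -/
noncomputable def toYTwo : MvPolynomial (Fin 3) ℂ →+* YTwoFunctionField :=
  (algebraMap YTwoRing YTwoFunctionField).comp (Ideal.Quotient.mk _)

theorem toYTwo_eq_zero_iff (q : MvPolynomial (Fin 3) ℂ) : toYTwo q = 0 ↔ yTwoEquation ∣ q := by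
  rw [toYTwo, RingHom.comp_apply,
    map_eq_zero_iff _ (IsFractionRing.injective YTwoRing YTwoFunctionField),
    Ideal.Quotient.eq_zero_iff_mem, Ideal.mem_span_singleton]

/-- A polynomial in `Z`, as a polynomial in `X, Y, Z`. -/
noncomputable def polyZ : Polynomial ℂ →+* MvPolynomial (Fin 3) ℂ :=
  (Polynomial.aeval (MvPolynomial.X 2)).toRingHom

/-- The polynomial `-XY`, which becomes the coordinate `U`. -/
noncomputable def polyU : MvPolynomial (Fin 3) ℂ := -(MvPolynomial.X 0 * MvPolynomial.X 1)

/-- The polynomial `-Y (XY + 1)`, which becomes the coordinate `V`. -/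
noncomputable def polyV : MvPolynomial (Fin 3) ℂ :=
  -(MvPolynomial.X 1 * (MvPolynomial.X 0 * MvPolynomial.X 1 + 1))

/-- The functions `Z` and `-XY` on `Y₂` are algebraically independent. -/
theorem eq_zero_of_eval₂_eq_zero {q : Polynomial (Polynomial ℂ)}
    (h : q.eval₂ (toYTwo.comp polyZ) (toYTwo polyU) = 0) : q = 0 := by
  rw [← Polynomial.hom_eval₂, toYTwo_eq_zero_iff] at h
  obtain ⟨w, hw⟩ := h
  have hev : ∀ u z : ℂ, u ≠ 0 → u ≠ 1 → z ≠ 0 →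
      (q.map (Polynomial.evalRingHom z)).eval u = 0 := by
    intro u z hu hu' hz
    obtain ⟨x, y, hxy, h0⟩ := exists_point_of_product hu hu' hz
    have h1 := congrArg (MvPolynomial.eval ![x, y, z]) hw
    rw [map_mul, h0, zero_mul, Polynomial.hom_eval₂] at h1
    have e1 : (MvPolynomial.eval ![x, y, z]).comp polyZ = Polynomial.evalRingHom z := by
      refine Polynomial.ringHom_ext (fun a => ?_) ?_
      · simp [polyZ]
      · simp [polyZ]
    have e2 : MvPolynomial.eval ![x, y, z] polyU = u := by
      rw [← hxy]
      simp [polyU]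
    rwa [e1, e2, ← Polynomial.eval_map] at h1
  ext1 i
  rw [Polynomial.coeff_zero]
  have hinf : ∀ t : Set ℂ, t.Finite → tᶜ.Infinite := fun t ht => ht.infinite_compl
  refine Polynomial.eq_zero_of_infinite_isRoot _
    ((hinf {0} (Set.toFinite _)).mono fun z hz => ?_)
  have h2 : q.map (Polynomial.evalRingHom z) = 0 := by
    refine Polynomial.eq_zero_of_infinite_isRoot _
      ((hinf {0, 1} (Set.toFinite _)).mono fun u hu => ?_)
    rw [Set.mem_compl_iff, Set.mem_insert_iff, Set.mem_singleton_iff, not_or] at hu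
    exact hev u z hu.1 hu.2 hz
  have h3 := congrArg (fun r => r.coeff i) h2
  simpa [Polynomial.coeff_map] using h3

theorem injective_toYTwo_polyZ : Function.Injective (toYTwo.comp polyZ) := by
  rw [injective_iff_map_eq_zero]
  intro r hr
  exact Polynomial.C_eq_zero.mp (eq_zero_of_eval₂_eq_zero (q := Polynomial.C r)
    (by rwa [Polynomial.eval₂_C]))

/-- The inclusion of the function field `ℂ(s)` of the base, along `Z`. -/
noncomputable def baseToYTwo : RatFunc ℂ →+* YTwoFunctionField :=
  IsFractionRing.lift injective_toYTwo_polyZ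

theorem baseToYTwo_algebraMap (r : Polynomial ℂ) :
    baseToYTwo (algebraMap _ _ r) = toYTwo (polyZ r) :=
  IsFractionRing.lift_algebraMap injective_toYTwo_polyZ r

theorem baseToYTwo_s : baseToYTwo s = yTwoCoord 2 := by
  rw [s, ← RatFunc.algebraMap_X, baseToYTwo_algebraMap, polyZ]
  simp [toYTwo, yTwoCoord]

theorem baseToYTwo_C (c : ℂ) : baseToYTwo (RatFunc.C c) = yTwoConst c := by
  rw [← RatFunc.algebraMap_C, baseToYTwo_algebraMap, polyZ]
  simp [toYTwo, yTwoConst, MvPolynomial.algebraMap_eq]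

theorem injective_eval₂_baseToYTwo :
    Function.Injective (Polynomial.eval₂RingHom baseToYTwo (toYTwo polyU)) := by
  rw [injective_iff_map_eq_zero]
  intro q hq
  have h1 := IsLocalization.integerNormalization_eval₂_eq_zero
    (nonZeroDivisors (Polynomial ℂ)) baseToYTwo q hq
  have e : baseToYTwo.comp (algebraMap (Polynomial ℂ) (RatFunc ℂ)) = toYTwo.comp polyZ :=
    RingHom.ext baseToYTwo_algebraMap
  rw [e] at h1
  exact (IsLocalization.integerNormalization_eq_zero_iff le_rfl q).mp
    (eq_zero_of_eval₂_eq_zero h1)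

theorem toYTwo_polyU : toYTwo polyU = -(yTwoCoord 0 * yTwoCoord 1) := by
  simp [toYTwo, polyU, yTwoCoord]

theorem toYTwo_polyV :
    toYTwo polyV = -(yTwoCoord 1 * (yTwoCoord 0 * yTwoCoord 1 + 1)) := by
  simp [toYTwo, polyV, yTwoCoord]

theorem toYTwo_polyU_ne_zero : toYTwo polyU ≠ 0 := by
  intro h
  have := eq_zero_of_eval₂_eq_zero (q := Polynomial.X) (by rw [Polynomial.eval₂_X, h])
  exact Polynomial.X_ne_zero this

theorem toYTwo_polyU_ne_one : toYTwo polyU ≠ 1 := by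
  intro h
  have := eq_zero_of_eval₂_eq_zero (q := Polynomial.X - Polynomial.C 1)
    (by rw [Polynomial.eval₂_sub, Polynomial.eval₂_X, Polynomial.eval₂_C, map_one, h, sub_self])
  exact Polynomial.X_sub_C_ne_zero _ this

theorem weierstrass_equation_toYTwo :
    toYTwo polyV ^ 2 + baseToYTwo E.a₁ * toYTwo polyU * toYTwo polyV =
      toYTwo polyU * (toYTwo polyU - 1) ^ 2 := by
  have hz : yTwoCoord 2 ≠ 0 := by
    rw [← baseToYTwo_s]
    exact (map_ne_zero _).mpr s_ne_zero
  have ha : baseToYTwo E.a₁ * yTwoCoord 2 = (yTwoCoord 2 - 1) ^ 2 := by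
    rw [E_a₁, map_div₀, map_pow, map_sub, map_one, baseToYTwo_s, div_mul_cancel₀ _ hz]
  have hF : toYTwo yTwoEquation = 0 := (toYTwo_eq_zero_iff _).mpr dvd_rfl
  have hX : ∀ i, toYTwo (MvPolynomial.X i) = yTwoCoord i := fun i => rfl
  simp only [yTwoEquation, map_add, map_sub, map_mul, map_pow, map_ofNat, hX] at hF
  rw [toYTwo_polyU, toYTwo_polyV]
  apply mul_right_cancel₀ hz
  generalize yTwoCoord 0 = x at *
  generalize yTwoCoord 1 = y at *
  generalize yTwoCoord 2 = z at *
  linear_combination (x * y * (y * (x * y + 1))) * ha + (y * (x * y + 1)) * hF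

/-- The homomorphism from the coordinate ring of `E` given by `U = -XY`, `V = -Y (XY + 1)`,
`s = Z`. -/
noncomputable def coordinateRingToYTwo : E.toAffine.CoordinateRing →+* YTwoFunctionField :=
  AdjoinRoot.lift (Polynomial.eval₂RingHom baseToYTwo (toYTwo polyU)) (toYTwo polyV) (by
    rw [WeierstrassCurve.Affine.polynomial]
    have h := weierstrass_equation_toYTwo
    simp only [WeierstrassCurve.toAffine]
    rw [show E.a₂ = -2 from rfl, show E.a₃ = 0 from rfl, show E.a₄ = 1 from rfl,
      show E.a₆ = 0 from rfl]
    simp only [Polynomial.eval₂_add, Polynomial.eval₂_sub, Polynomial.eval₂_mul,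
      Polynomial.eval₂_pow, Polynomial.eval₂_X, Polynomial.eval₂_C, Polynomial.coe_eval₂RingHom]
    simp only [map_zero, map_one, map_neg, map_ofNat]
    linear_combination h)

/-- The coordinate ring is integral over `ℂ(s)[U]`, on which the homomorphism is injective because `Z`
and `-XY` are algebraically independent. -/
theorem injective_coordinateRingToYTwo : Function.Injective coordinateRingToYTwo := by
  have : Module.Finite (Polynomial (RatFunc ℂ)) E.toAffine.CoordinateRing :=
    WeierstrassCurve.Affine.monic_polynomial.finite_adjoinRoot
  have hint : Algebra.IsIntegral (Polynomial (RatFunc ℂ)) E.toAffine.CoordinateRing :=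
    Algebra.IsIntegral.of_finite _ _
  rw [RingHom.injective_iff_ker_eq_bot]
  refine Ideal.eq_bot_of_comap_eq_bot (R := Polynomial (RatFunc ℂ)) ?_
  rw [eq_bot_iff]
  intro q hq
  rw [Ideal.mem_comap, RingHom.mem_ker] at hq
  refine (injective_iff_map_eq_zero _).mp injective_eval₂_baseToYTwo q ?_
  rw [← hq]
  exact (AdjoinRoot.lift_of _).symm

/-- The homomorphism of function fields given by `U = -XY`, `V = -Y (XY + 1)`, `s = Z`. -/
noncomputable def functionFieldToYTwo : E.toAffine.FunctionField →+* YTwoFunctionField :=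
  IsFractionRing.lift (K := E.toAffine.FunctionField) injective_coordinateRingToYTwo

theorem functionFieldToYTwo_curveConst (f : RatFunc ℂ) :
    functionFieldToYTwo (curveConst f) = baseToYTwo f := by
  refine (IsFractionRing.lift_algebraMap (K := E.toAffine.FunctionField)
    injective_coordinateRingToYTwo _).trans ?_
  refine (AdjoinRoot.lift_of _).trans ?_
  simp

theorem functionFieldToYTwo_curveU : functionFieldToYTwo curveU = toYTwo polyU := by
  refine (IsFractionRing.lift_algebraMap (K := E.toAffine.FunctionField)
    injective_coordinateRingToYTwo _).trans ?_
  refine (AdjoinRoot.lift_of _).trans ?_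
  simp

theorem functionFieldToYTwo_curveV : functionFieldToYTwo curveV = toYTwo polyV := by
  refine (IsFractionRing.lift_algebraMap (K := E.toAffine.FunctionField)
    injective_coordinateRingToYTwo _).trans ?_
  exact AdjoinRoot.lift_root _

/-- The inverse substitution is `Y = V / (U - 1)`, `X = -U / Y`. -/
theorem surjective_functionFieldToYTwo : Function.Surjective functionFieldToYTwo := by
  set S := RingHom.fieldRange (K := E.toAffine.FunctionField) functionFieldToYTwo with hS
  have hU : toYTwo polyU ∈ S := ⟨curveU, functionFieldToYTwo_curveU⟩
  have hV : toYTwo polyV ∈ S := ⟨curveV, functionFieldToYTwo_curveV⟩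
  have hx : ∀ c, baseToYTwo c ∈ S := fun c => ⟨curveConst c, functionFieldToYTwo_curveConst c⟩
  have hne : toYTwo polyU - 1 ≠ 0 := sub_ne_zero.mpr toYTwo_polyU_ne_one
  have hy0 : yTwoCoord 1 ≠ 0 := by
    intro h
    apply toYTwo_polyU_ne_zero
    rw [toYTwo_polyU, h, mul_zero, neg_zero]
  have h1 : yTwoCoord 1 ∈ S := by
    have e : yTwoCoord 1 = toYTwo polyV / (toYTwo polyU - 1) := by
      rw [eq_div_iff hne, toYTwo_polyV, toYTwo_polyU]
      ring
    rw [e]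
    exact div_mem hV (sub_mem hU (one_mem _))
  have h0 : yTwoCoord 0 ∈ S := by
    have e : yTwoCoord 0 = -(toYTwo polyU / yTwoCoord 1) := by
      rw [toYTwo_polyU]
      field_simp
    rw [e]
    exact neg_mem (div_mem hU h1)
  have h2 : yTwoCoord 2 ∈ S := by
    rw [← baseToYTwo_s]
    exact hx _
  have hall : ∀ q, toYTwo q ∈ S := by
    intro q
    induction q using MvPolynomial.induction_on with
    | C c =>
      have : toYTwo (MvPolynomial.C c) = yTwoConst c := rfl
      rw [this, ← baseToYTwo_C]
      exact hx _
    | add p q hp hq => rw [map_add]; exact add_mem hp hq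
    | mul_X p i hp =>
      rw [map_mul]
      refine mul_mem hp ?_
      change yTwoCoord i ∈ S
      fin_cases i
      exacts [h0, h1, h2]
  intro f
  obtain ⟨a, b, -, rfl⟩ := IsFractionRing.div_surjective YTwoRing f
  obtain ⟨p, rfl⟩ := Ideal.Quotient.mk_surjective a
  obtain ⟨q, rfl⟩ := Ideal.Quotient.mk_surjective b
  exact div_mem (hall p) (hall q)

theorem exists_functionField_equiv : ∃ φ : YTwoFunctionField ≃+* E.toAffine.FunctionField,
    (∀ c : ℂ, φ (yTwoConst c) = curveConst (RatFunc.C c)) ∧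
    φ (yTwoCoord 2) = curveConst s ∧ φ (-(yTwoCoord 0 * yTwoCoord 1)) = curveU ∧
    φ (-(yTwoCoord 1 * (yTwoCoord 0 * yTwoCoord 1 + 1))) = curveV := by
  have : IsSimpleRing E.toAffine.FunctionField :=
    DivisionRing.isSimpleRing E.toAffine.FunctionField
  set ψ := RingEquiv.ofBijective functionFieldToYTwo
    ⟨functionFieldToYTwo.injective, surjective_functionFieldToYTwo⟩ with hψ
  refine ⟨ψ.symm, fun c => ?_, ?_, ?_, ?_⟩ <;> rw [RingEquiv.symm_apply_eq]
  · rw [← baseToYTwo_C]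
    exact (functionFieldToYTwo_curveConst _).symm
  · rw [← baseToYTwo_s]
    exact (functionFieldToYTwo_curveConst _).symm
  · rw [← toYTwo_polyU]
    exact functionFieldToYTwo_curveU.symm
  · rw [← toYTwo_polyV]
    exact functionFieldToYTwo_curveV.symm

end ModularFibration

theorem mainTheorem3 [DecidableEq (RatFunc ℂ)] :
    -- `Y₂` is irreducible; in the fibration `Z = s` it has the Weierstrass model `E`,
    -- through `U = -XY`, `V = -Y(XY + 1)`
    (IsDomain ModularFibration.YTwoRing ∧
      ∃ φ : ModularFibration.YTwoFunctionField ≃+*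
          ModularFibration.E.toAffine.FunctionField,
        (∀ c : ℂ, φ (ModularFibration.yTwoConst c) =
          ModularFibration.curveConst (RatFunc.C c)) ∧
        φ (ModularFibration.yTwoCoord 2) = ModularFibration.curveConst ModularFibration.s ∧
        φ (-(ModularFibration.yTwoCoord 0 * ModularFibration.yTwoCoord 1)) =
          ModularFibration.curveU ∧
        φ (-(ModularFibration.yTwoCoord 1 *
          (ModularFibration.yTwoCoord 0 * ModularFibration.yTwoCoord 1 + 1))) =
          ModularFibration.curveV) ∧
    -- the section `A = (s, s - 1)` has order `8`
    (∃ h : ModularFibration.E.toAffine.Nonsingular ModularFibration.s (ModularFibration.s - 1),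
      addOrderOf (WeierstrassCurve.Affine.Point.some _ _ h) = 8) ∧
    -- the singular fibres are `2 I₈, I₄, I₂, 2 I₁`
    (ModularFibration.HasFibreTypeI ModularFibration.E ((0 : ℂ) : OnePoint ℂ) 8 ∧
      ModularFibration.HasFibreTypeI ModularFibration.E OnePoint.infty 8 ∧
      ModularFibration.HasFibreTypeI ModularFibration.E ((1 : ℂ) : OnePoint ℂ) 4 ∧
      ModularFibration.HasFibreTypeI ModularFibration.E ((-1 : ℂ) : OnePoint ℂ) 2 ∧
      ModularFibration.HasFibreTypeI ModularFibration.E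
        ((3 + 2 * (Real.sqrt 2 : ℂ) : ℂ) : OnePoint ℂ) 1 ∧
      ModularFibration.HasFibreTypeI ModularFibration.E
        ((3 - 2 * (Real.sqrt 2 : ℂ) : ℂ) : OnePoint ℂ) 1 ∧
      ∀ a : ℂ, a ≠ 0 → a ≠ 1 → a ≠ -1 → a ≠ 3 + 2 * (Real.sqrt 2 : ℂ) →
        a ≠ 3 - 2 * (Real.sqrt 2 : ℂ) →
        ModularFibration.HasFibreTypeI ModularFibration.E (a : OnePoint ℂ) 0) ∧
    -- it is the elliptic modular surface attached to `Γ₁(8)`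
    ModularFibration.IsEllipticModularSurface (CongruenceSubgroup.Gamma1 8) ModularFibration.E ∧
    -- the Mordell-Weil group is cyclic of order `8`
    Nonempty (ModularFibration.E.toAffine.Point ≃+ ZMod 8) := by
  refine ⟨⟨ModularFibration.isDomain_yTwoRing, ModularFibration.exists_functionField_equiv⟩,
    ⟨ModularFibration.nonsingular_torsionPoint, ModularFibration.addOrderOf_torsionPoint⟩,
    ⟨ModularFibration.hasFibreTypeI_E_zero, ModularFibration.hasFibreTypeI_E_infty,
      ModularFibration.hasFibreTypeI_E_one, ModularFibration.hasFibreTypeI_E_neg_one,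
      ModularFibration.hasFibreTypeI_E_root ModularFibration.sqrt_two_add
        ModularFibration.sqrt_two_mul,
      ModularFibration.hasFibreTypeI_E_root
        ((add_comm _ _).trans ModularFibration.sqrt_two_add)
        ((mul_comm _ _).trans ModularFibration.sqrt_two_mul),
      fun a h0 h1 h2 h3 h4 => ModularFibration.hasFibreTypeI_E_smooth
        (ModularFibration.mem_smoothLocus_E_iff_ne.mpr ⟨h0, h1, h2, h3, h4⟩)⟩,
    ModularFibration.isEllipticModularSurface_E, ModularFibration.nonempty_addEquiv_zmod⟩
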